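/- \textbf{Setting.} Let $p$ be a prime, $G$ a compact $p$-adic Lie group, and $H$ a closed normal subgroup with $\Gamma:=G/H\cong\mathbb Z_p$; fix a topological generator $\gamma$ of $\Gamma$. For $g\in G$ write $\bar g=\gamma^{\theta(g)}$ for its image in $\Gamma$, so $\theta:G\to\mathbb Z_p$ is a continuous homomorphism. Let $\Lambda(G)$, $\Lambda(H)$ be the Iwasawa algebras over $\mathbb Z_p$. Let $L$ be a finite extension of $\mathbb Q_p$ with valuation ring $\mathcal O$, identify $\Lambda_{\mathcal O}(\Gamma)=\mathcal O[[T]]$ by $\gamma=1+T$, and let $Q_{\mathcal O}(\Gamma)$ be its quotient field. Each $F\in Q_{\mathcal O}(\Gamma)^\times$ is $F=T^{r(F)}F_0$ with $r(F)\in\mathbb Z$, $F_0(0)\in L^\times$; put $F^*(0):=F_0(0)$. Let $\rho:G\to \mathrm{GL}_n(\mathcal O)$ be a continuous representation. Let $S$ be the set of $\lambda\in\Lambda(G)$ such that $\Lambda(G)/\Lambda(G)\lambda$ is a finitely generated $\Lambda(H)$-module, and $S^*=\bigcup_{i\ge0}p^iS$ (a left and right denominator set). Let $C^p(R)$ be the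 category of bounded complexes of finitely generated projective left $R$-modules. $\Sigma_{S^*}$ consists of the $C\in C^p(\Lambda(G))$ for which $\Lambda(G)_{S^*}\otimes_{\Lambda(G)}C$ is acyclic. For $C\in C^p(\Lambda(G))$ regard $\mathcal O^n$ as a right $\Lambda(G)$-module by $o\cdot g=\rho(g)^{t}o$, and put $\mathbb H_i(G,C(\rho^*))=H^{-i}(\mathcal O^n\otimes_{\Lambda(G)}C)$. Let $\mathfrak B_i:\mathbb H_i(G,C(\rho^*))\to\mathbb H_{i-1}(G,C(\rho^*))$ be the Bockstein map, i.e. the connecting homomorphism of $0\to C\to C\otimes_{\mathbb Z_p}E_\theta\to C\to0$ after applying $\mathcal O^n\otimes_{\Lambda(G)}-$, where $E_\theta=\mathbb Z_pe_1\oplus\mathbb Z_pe_2$ with $ge_1=e_1$, $ge_2=e_2+\theta(g)e_1$. $\Sigma_{ss-\rho}$ consists of the $C$ for which the complex $(\mathbb H_\bullet(G,C(\rho^*)),\mathfrak B_\bullet)$ has $\mathbb Z_p$-torsion cohomology in each degree. Put $$r_G(C)(\rho)=\sum_i(-1)^{i+1}\dim_L\bigl(\mathbb H_i(H,C(\rho^*))^\Gamma\otimes_{\mathcal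 O}L\bigr),\qquad r_\Gamma(C_\rho)=\sum_i(-1)^{i+1}\dim_L\bigl(H^i(C_\rho)^\Gamma\otimes_{\mathcal O}L\bigr),$$ where $\mathbb H_i(H,C(\rho^*))=H^{-i}(\mathcal O^n\otimes_{\Lambda(H)}C)$ with $g\in G$ acting by $g(o\otimes c)=\rho^*(g)o\otimes gc$ ($\rho^*$ the contragredient of $\rho$), and $C_\rho=(\Lambda_{\mathcal O}(\Gamma)\otimes_{\mathcal O}\mathcal O^n)\otimes_{\Lambda(G)}C$ for the right action $(\tau\otimes o)g=\tau\bar g\otimes\rho(g)^{t}o$. For a full subcategory $\Sigma$ of $C^p(R)$, $K_1(R,\Sigma)$ is the abelian group generated by the symbols $[C,a]$, with $C\in\Sigma$ and $a:\mathbf 1_R\to\mathbf d_R(C)$ a morphism in the category of virtual objects (Fukaya--Kato determinants) of $R$, subject to: $[0,\mathrm{id}]=1$; $[D,\mathbf d_R(f)\circ a]=[C,a]$ for each quasi-isomorphism $f:C\to D$; and $[C,a]=[C',a'][C'',a'']$ for each short exact sequence $0\to C'\to C\to C''\to0$ in $\Sigma$, where $a$ corresponds to $a'\cdot a''$ under $\mathbf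 d_R(C)\cong\mathbf d_R(C')\mathbf d_R(C'')$. For $A\in\Sigma_{S^*}\cap\Sigma_{ss-\rho}$ let $\Sigma_A$ be the smallest full subcategory of $C^p(\Lambda(G))$ that contains $A$ and $0$ and is closed under shifts, quasi-isomorphisms and finite direct sums; it is contained in $\Sigma_{S^*}\cap\Sigma_{ss-\rho}$. Let * $\mathrm{ch}_{G,A}:K_1(\Lambda(G),\Sigma_A)\to K_1(\Lambda(G)_{S^*})$ be the homomorphism sending $[C,a]$ to the automorphism $\mathbf 1\to\mathbf d(\Lambda(G)_{S^*}\otimes C)\to\mathbf 1$, whose first map is induced by $a$ and whose second is given by the acyclicity of $\Lambda(G)_{S^*}\otimes C$; * $\rho_*:K_1(\Lambda(G)_{S^*})\to K_1(M_n(Q_{\mathcal O}(\Gamma)))\cong Q_{\mathcal O}(\Gamma)^\times$ be induced by the unique ring homomorphism $\Lambda(G)_{S^*}\to M_n(Q_{\mathcal O}(\Gamma))$ that extends the homomorphism $\Lambda(G)\to M_n(\Lambda_{\mathcal O}(\Gamma))$, $g\mapsto\rho(g)\bar g$; * $(-)^*(\rho):K_1(\Lambda(G),\Sigma_A)\to L^\times$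 be the homomorphism sending $[C,a]$ to $(-1)^{r_G(C)(\rho)}$ times the composite $$\mathbf 1_L\xrightarrow{L^n\otimes a}\mathbf d_L(L^n\otimes_{\Lambda(G)}C)\cong\mathbf d_L\bigl((\mathbb H_\bullet(G,C(\rho^*))_L,0)\bigr)=\mathbf d_L\bigl((\mathbb H_\bullet(G,C(\rho^*))_L,\mathfrak B_\bullet)\bigr)\cong\mathbf 1_L ,$$ where the first $\cong$ passes to cohomology and the last is given by the acyclicity of the complex $(\mathbb H_\bullet(G,C(\rho^*))_L,\mathfrak B_\bullet)$. \textbf{Proposition.} Let $A$ be in $\Sigma_{S^*}\cap\Sigma_{ss-\rho}$. Then the maps $\mathrm{ch}_{G,A}$, $\rho_*$ and $(-)^*(\rho)$ are well defined, and: (i) $r_G(A)(\rho)=r_\Gamma(A_\rho)=r\bigl(\rho_*(\mathrm{ch}_{G,A}([A,a]))\bigr)$ for every trivialization $a:\mathbf 1\to\mathbf d_{\Lambda(G)}(A)$ (the first equality holding also if there is none). (ii) $x^*(\rho)=\bigl(\rho_*(\mathrm{ch}_{G,A}(x))\bigr)^*(0)$ in $L^\times$ for every $x\in K_1(\Lambda(G),\Sigma_A)$.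 -/

import Mathlib

open scoped TensorProduct

noncomputable section

set_option linter.unusedSectionVars false

namespace LeadingTerm

universe u v w

/-! ### Iwasawa algebras -/

section Iwasawa

variable (p : ℕ) [Fact p.Prime]
variable (G : Type u) [Group G] [TopologicalSpace G] [IsTopologicalGroup G] [CompactSpace G]

/-- The Iwasawa algebra `Λ(G)` of a profinite group `G`, realised as the convolution algebra of
`ℤ_p`-valued measures on `G`, i.e. as the dual of the space of continuous functions `G → ℤ_p`.
(A measure `μ` corresponds to the element `(∑_x μ(1_x) x)_U` of `lim_U ℤ_p[G/U]`.) -/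
def Iwasawa : Type u := C(G, ℤ_[p]) →L[ℤ_[p]] ℤ_[p]

namespace Iwasawa

variable {p G}

instance : AddCommGroup (Iwasawa p G) :=
  inferInstanceAs (AddCommGroup (C(G, ℤ_[p]) →L[ℤ_[p]] ℤ_[p]))

instance : FunLike (Iwasawa p G) C(G, ℤ_[p]) ℤ_[p] :=
  inferInstanceAs (FunLike (C(G, ℤ_[p]) →L[ℤ_[p]] ℤ_[p]) C(G, ℤ_[p]) ℤ_[p])

instance : ContinuousSemilinearMapClass (Iwasawa p G) (RingHom.id ℤ_[p]) C(G, ℤ_[p]) ℤ_[p] :=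
  inferInstanceAs (ContinuousSemilinearMapClass (C(G, ℤ_[p]) →L[ℤ_[p]] ℤ_[p]) (RingHom.id ℤ_[p])
    C(G, ℤ_[p]) ℤ_[p])

@[ext] theorem ext {μ ν : Iwasawa p G} (h : ∀ f, μ f = ν f) : μ = ν := DFunLike.ext _ _ h

@[simp] theorem add_apply (μ ν : Iwasawa p G) (f : C(G, ℤ_[p])) : (μ + ν) f = μ f + ν f := rfl

@[simp] theorem zero_apply (f : C(G, ℤ_[p])) : (0 : Iwasawa p G) f = 0 := rfl

/-- The function `g ↦ ∫ f(gh) dν(h)`. -/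
def conv (ν : Iwasawa p G) : C(G, ℤ_[p]) →L[ℤ_[p]] C(G, ℤ_[p]) where
  toFun f := (⟨ν, map_continuous ν⟩ : C(C(G, ℤ_[p]), ℤ_[p])).comp
    (f.comp ⟨fun x : G × G => x.1 * x.2, continuous_mul⟩).curry
  map_add' f f' := by
    ext g
    exact map_add ν (f.comp ⟨fun h => g * h, by fun_prop⟩) (f'.comp ⟨fun h => g * h, by fun_prop⟩)
  map_smul' c f := by
    ext g
    exact map_smul ν c (f.comp ⟨fun h => g * h, by fun_prop⟩)
  cont := (ContinuousMap.continuous_postcomp _).comp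
    (ContinuousMap.continuous_curry.comp (ContinuousMap.continuous_precomp _))

/-- The function `h ↦ f(gh)`. -/
def shift (g : G) (f : C(G, ℤ_[p])) : C(G, ℤ_[p]) := f.comp ⟨fun h => g * h, by fun_prop⟩

theorem conv_apply (ν : Iwasawa p G) (f : C(G, ℤ_[p])) (g : G) : conv ν f g = ν (shift g f) := rfl

/-- Convolution: `∫ f d(μν) = ∫∫ f(gh) dν(h) dμ(g)`. -/
instance : Mul (Iwasawa p G) := ⟨fun μ ν => ContinuousLinearMap.comp (σ₁₂ := RingHom.id _) μ (conv ν)⟩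

theorem mul_apply (μ ν : Iwasawa p G) (f : C(G, ℤ_[p])) : (μ * ν) f = μ (conv ν f) := rfl

/-- The Dirac measure at `g`, i.e. the group element `g` as an element of `Λ(G)`. -/
def dirac (g : G) : Iwasawa p G where
  toFun f := f g
  map_add' _ _ := rfl
  map_smul' _ _ := rfl
  cont := continuous_eval_const g

@[simp] theorem dirac_apply (g : G) (f : C(G, ℤ_[p])) : (dirac g : Iwasawa p G) f = f g := rfl

instance : One (Iwasawa p G) := ⟨dirac 1⟩

theorem one_apply (f : C(G, ℤ_[p])) : (1 : Iwasawa p G) f = f 1 := rfl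

instance : Ring (Iwasawa p G) :=
  { (inferInstance : AddCommGroup (Iwasawa p G)) with
    mul := (· * ·)
    one := 1
    left_distrib := fun a b c => by
      ext f
      simp only [mul_apply, add_apply, ← map_add]
      rfl
    right_distrib := fun a b c => rfl
    zero_mul := fun a => rfl
    mul_zero := fun a => by
      ext f
      exact map_zero a
    mul_assoc := fun a b c => by
      ext f
      simp only [mul_apply]
      congr 1
      ext g
      simp only [conv_apply, mul_apply]
      congr 1
      ext h
      simp only [conv_apply, shift, ContinuousMap.comp_apply]
      congr 1
      ext k
      simp [mul_assoc]
    one_mul := fun a => by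
      ext f
      simp only [mul_apply, one_apply, conv_apply]
      congr 1
      ext h
      simp [shift]
    mul_one := fun a => by
      ext f
      simp only [mul_apply]
      congr 1
      ext h
      simp [conv_apply, one_apply, shift] }

instance (H : ClosedSubgroup G) : CompactSpace H.toSubgroup :=
  isCompact_iff_compactSpace.mp (IsClosed.isCompact H.isClosed')

/-- The ring homomorphism `Λ(H) → Λ(G)` for a closed subgroup `H` of `G`. -/
def ofSubgroup (H : ClosedSubgroup G) : Iwasawa p H.toSubgroup →+* Iwasawa p G where
  toFun μ :=
    { toFun := fun f => μ (f.comp ⟨fun h : H.toSubgroup => (h : G), continuous_subtype_val⟩)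
      map_add' := fun f f' => map_add μ (f.comp ⟨fun h : H.toSubgroup => (h : G), continuous_subtype_val⟩)
        (f'.comp ⟨fun h : H.toSubgroup => (h : G), continuous_subtype_val⟩)
      map_smul' := fun c f => map_smul μ c (f.comp ⟨fun h : H.toSubgroup => (h : G), continuous_subtype_val⟩)
      cont := (map_continuous μ).comp (ContinuousMap.continuous_precomp _) }
  map_one' := rfl
  map_mul' _ _ := rfl
  map_zero' := rfl
  map_add' _ _ := rfl

/-- The derivation `g ↦ θ(g) g` of `Λ(G)` attached to a continuous homomorphism `θ : G → ℤ_p`,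
i.e. multiplication of measures by the function `θ`. -/
def mulFun (θ : C(G, ℤ_[p])) (μ : Iwasawa p G) : Iwasawa p G where
  toFun f := μ (θ * f)
  map_add' f f' := by rw [mul_add, map_add]
  map_smul' c f := by rw [mul_smul_comm, map_smul]; rfl
  cont := (map_continuous μ).comp (continuous_const.mul continuous_id)

theorem mulFun_apply (θ : C(G, ℤ_[p])) (μ : Iwasawa p G) (f : C(G, ℤ_[p])) :
    mulFun θ μ f = μ (θ * f) := rfl

theorem mulFun_add (θ : C(G, ℤ_[p])) (μ ν : Iwasawa p G) :
    mulFun θ (μ + ν) = mulFun θ μ + mulFun θ ν := rfl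

theorem mulFun_zero (θ : C(G, ℤ_[p])) : mulFun θ (0 : Iwasawa p G) = 0 := rfl

theorem mulFun_one (θ : C(G, ℤ_[p])) (hθ : ∀ g h, θ (g * h) = θ g + θ h) :
    mulFun θ (1 : Iwasawa p G) = 0 := by
  ext f
  have h1 : θ 1 = 0 := by simpa using hθ 1 1
  simp [mulFun_apply, one_apply, h1]

theorem mulFun_mul (θ : C(G, ℤ_[p])) (hθ : ∀ g h, θ (g * h) = θ g + θ h) (μ ν : Iwasawa p G) :
    mulFun θ (μ * ν) = mulFun θ μ * ν + μ * mulFun θ ν := by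
  ext f
  simp only [mulFun_apply, mul_apply, add_apply, ← map_add]
  congr 1
  ext g
  simp only [ContinuousMap.add_apply, ContinuousMap.mul_apply, conv_apply, mulFun_apply]
  rw [← smul_eq_mul (θ g), ← map_smul, ← map_add]
  congr 1
  ext h
  simp [shift, hθ, add_mul]


variable {O : Type v} [CommRing O] [Algebra ℤ_[p] O] [Module.Finite ℤ_[p] O] [Module.Free ℤ_[p] O]
  [TopologicalSpace O] [IsModuleTopology ℤ_[p] O]

/-- The composite of a continuous function `f : G → O` with a (necessarily continuous) linear
form `ℓ : O → ℤ_p`. -/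
def compDual (ℓ : Module.Dual ℤ_[p] O) (f : C(G, O)) : C(G, ℤ_[p]) :=
  ⟨fun g => ℓ (f g), (IsModuleTopology.continuous_of_linearMap ℓ).comp f.continuous⟩

/-- The integral `∫ f dμ ∈ O` of a continuous function `f : G → O` with values in a finite free
`ℤ_p`-algebra. It is characterised by `ℓ(∫ f dμ) = ∫ ℓ(f) dμ` for all linear forms `ℓ` on `O`. -/
def integral (μ : Iwasawa p G) (f : C(G, O)) : O :=
  (Module.evalEquiv ℤ_[p] O).symm
    { toFun := fun ℓ => μ (compDual ℓ f)
      map_add' := fun ℓ ℓ' => map_add μ (compDual ℓ f) (compDual ℓ' f)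
      map_smul' := fun c ℓ => map_smul μ c (compDual ℓ f) }

theorem apply_integral (ℓ : Module.Dual ℤ_[p] O) (μ : Iwasawa p G) (f : C(G, O)) :
    ℓ (integral μ f) = μ (compDual ℓ f) :=
  Module.apply_evalEquiv_symm_apply (R := ℤ_[p]) (M := O) ℓ _

theorem dual_ext {x y : O} (h : ∀ ℓ : Module.Dual ℤ_[p] O, ℓ x = ℓ y) : x = y :=
  (Module.evalEquiv ℤ_[p] O).injective (LinearMap.ext h)

theorem integral_add_left (μ ν : Iwasawa p G) (f : C(G, O)) :
    integral (μ + ν) f = integral μ f + integral ν f :=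
  dual_ext (p := p) fun ℓ => by simp [apply_integral]

theorem integral_zero_left (f : C(G, O)) : integral (0 : Iwasawa p G) f = 0 :=
  dual_ext (p := p) fun ℓ => by simp [apply_integral]

theorem integral_dirac (g : G) (f : C(G, O)) : integral (dirac g : Iwasawa p G) f = f g :=
  dual_ext (p := p) fun ℓ => by simp [apply_integral, compDual]

/-- Integrals of functions with `f(gh) = ∑ a_k(g) b_k(h)` against a convolution. -/
theorem integral_mul {ι : Type*} (s : Finset ι) (μ ν : Iwasawa p G) (f : C(G, O))
    (a b : ι → C(G, O)) (h : ∀ x y, f (x * y) = ∑ k ∈ s, a k x * b k y) :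
    integral (μ * ν) f = ∑ k ∈ s, integral μ (a k) * integral ν (b k) := by
  refine dual_ext (p := p) fun ℓ => ?_
  have key : ∀ (c : O) (κ : Iwasawa p G) (F : C(G, O)),
      κ (compDual (ℓ.comp (LinearMap.mulLeft ℤ_[p] c)) F) = ℓ (c * integral κ F) := fun c κ F => by
    rw [← apply_integral]; rfl
  rw [map_sum, apply_integral, mul_apply]
  have h2 : conv ν (compDual ℓ f) = ∑ k ∈ s,
      compDual (ℓ.comp (LinearMap.mulLeft ℤ_[p] (integral ν (b k)))) (a k) := by
    ext x
    rw [conv_apply, ContinuousMap.sum_apply]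
    have h3 : shift x (compDual ℓ f) = ∑ k ∈ s,
        compDual (ℓ.comp (LinearMap.mulLeft ℤ_[p] (a k x))) (b k) := by
      ext y
      rw [ContinuousMap.sum_apply]
      simp [shift, compDual, h]
    rw [h3, map_sum]
    refine Finset.sum_congr rfl fun k _ => ?_
    rw [key]
    simp [compDual, mul_comm]
  rw [h2, map_sum]
  refine Finset.sum_congr rfl fun k _ => ?_
  rw [key, mul_comm]

end Iwasawa

variable {p G}
variable {O : Type v} [CommRing O] [Algebra ℤ_[p] O] [Module.Finite ℤ_[p] O] [Module.Free ℤ_[p] O]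
  [TopologicalSpace O] [IsModuleTopology ℤ_[p] O]

/-- The continuous function `g ↦ binom(θ(g), k) ρ(g)_{ij}`, i.e. the `(i,j)`-entry of the coefficient
at `T^k` of `ρ(g) (1+T)^{θ(g)}`. -/
def repCoeff {n : ℕ} (ρ : G →ₜ* GL (Fin n) O) (θ : G →ₜ* Multiplicative ℤ_[p]) (i j : Fin n)
    (k : ℕ) : C(G, O) where
  toFun g := Ring.choose (θ g).toAdd k • (ρ g : Matrix (Fin n) (Fin n) O) i j
  continuous_toFun :=
    ((PadicInt.continuous_choose k).comp (continuous_toAdd.comp θ.continuous_toFun)).smul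
      ((Units.continuous_val.comp ρ.continuous_toFun).matrix_elem i j)

theorem repCoeff_mul {n : ℕ} (ρ : G →ₜ* GL (Fin n) O) (θ : G →ₜ* Multiplicative ℤ_[p])
    (i j : Fin n) (k : ℕ) (g h : G) : repCoeff ρ θ i j k (g * h) =
      ∑ x ∈ Finset.univ ×ˢ Finset.HasAntidiagonal.antidiagonal k,
        repCoeff ρ θ i x.1 x.2.1 g * repCoeff ρ θ x.1 j x.2.2 h := by
  simp only [repCoeff, ContinuousMap.coe_mk, map_mul, toAdd_mul, Units.val_mul, Matrix.mul_apply,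
    Finset.sum_product]
  rw [Ring.add_choose_eq k (Commute.all _ _), Finset.smul_sum]
  refine Finset.sum_congr rfl fun l _ => ?_
  rw [Finset.sum_smul]
  refine Finset.sum_congr rfl fun x _ => ?_
  rw [smul_mul_smul_comm]

/-- The ring homomorphism `Λ(G) → M_n(Λ_O(Γ))` with `g ↦ ρ(g) ḡ`. Here `Λ_O(Γ)` is identified with
`O[[T]]` by `γ = 1 + T`, so that the image `ḡ = γ^{θ(g)}` of `g` in `Γ` is `(1 + T)^{θ(g)}`. -/
def repΓ {n : ℕ} (ρ : G →ₜ* GL (Fin n) O) (θ : G →ₜ* Multiplicative ℤ_[p]) :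
    Iwasawa p G →+* Matrix (Fin n) (Fin n) (PowerSeries O) where
  toFun μ := Matrix.of fun i j => PowerSeries.mk fun k => μ.integral (repCoeff ρ θ i j k)
  map_one' := by
    ext i j k
    have : (1 : Iwasawa p G) = Iwasawa.dirac 1 := rfl
    rw [Matrix.of_apply, PowerSeries.coeff_mk, this, Iwasawa.integral_dirac]
    rcases eq_or_ne i j with rfl | hij
    · rcases k with _ | k <;> simp [repCoeff, PowerSeries.coeff_one]
    · simp [repCoeff, hij]
  map_zero' := by
    ext i j k
    simp [Iwasawa.integral_zero_left]
  map_add' μ ν := by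
    ext i j k
    simp [Iwasawa.integral_add_left]
  map_mul' μ ν := by
    ext i j k
    have h := Iwasawa.integral_mul (Finset.univ ×ˢ Finset.HasAntidiagonal.antidiagonal k) μ ν
      (repCoeff ρ θ i j k) (fun x : Fin n × ℕ × ℕ => repCoeff ρ θ i x.1 x.2.1)
      (fun x : Fin n × ℕ × ℕ => repCoeff ρ θ x.1 j x.2.2) (repCoeff_mul ρ θ i j k)
    rw [Finset.sum_product] at h
    rw [Matrix.of_apply, PowerSeries.coeff_mk, h, Matrix.mul_apply, map_sum]
    refine Finset.sum_congr rfl fun l _ => ?_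
    simp [PowerSeries.coeff_mul]

/-- The ring homomorphism `Λ(G) → M_n(O)` extending `ρ`: the constant term of `repΓ`, i.e.
`μ ↦ (∫ ρ(g)_{ij} dμ(g))_{ij}`. -/
def repO {n : ℕ} (ρ : G →ₜ* GL (Fin n) O) (θ : G →ₜ* Multiplicative ℤ_[p]) :
    Iwasawa p G →+* Matrix (Fin n) (Fin n) O :=
  (PowerSeries.constantCoeff (R := O)).mapMatrix.comp (repΓ ρ θ)

end Iwasawa
/-! ### Tensor products over non-commutative rings -/

section Tensor

variable {R : Type u} [Ring R] {B : Type v} [Ring B] {Y : Type w} [AddCommGroup Y] [Module B Y]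

/-- The relations `y r ⊗ m = y ⊗ r m`, for `r` in a subring `R₀` of `R`, in `Y ⊗_ℤ M`. Here `Y` is a
`(B, R)`-bimodule, with right action given by `act`, and `M` is a left `R`-module. -/
def tensorRel (R₀ : Subring R) (act : Rᵐᵒᵖ →+* Module.End B Y) (M : Type*) [AddCommGroup M]
    [Module R M] : Submodule B (Y ⊗[ℤ] M) :=
  Submodule.span B {z | ∃ r ∈ R₀, ∃ (y : Y) (m : M),
    z = act (MulOpposite.op r) y ⊗ₜ[ℤ] m - y ⊗ₜ[ℤ] (r • m)}

/-- The tensor product `Y ⊗_{R₀} M`, a left `B`-module. -/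
abbrev BTensor (R₀ : Subring R) (act : Rᵐᵒᵖ →+* Module.End B Y) (M : Type*) [AddCommGroup M]
    [Module R M] : Type _ :=
  (Y ⊗[ℤ] M) ⧸ tensorRel R₀ act M

namespace BTensor

variable {M N P : Type*} [AddCommGroup M] [Module R M] [AddCommGroup N] [Module R N]
  [AddCommGroup P] [Module R P]

/-- The class of `y ⊗ m`. -/
def tmul (R₀ : Subring R) (act : Rᵐᵒᵖ →+* Module.End B Y) (y : Y) (m : M) : BTensor R₀ act M :=
  Submodule.Quotient.mk (y ⊗ₜ[ℤ] m)

variable (R₀ : Subring R) (act : Rᵐᵒᵖ →+* Module.End B Y)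

theorem act_tmul {r : R} (hr : r ∈ R₀) (y : Y) (m : M) :
    tmul R₀ act (act (MulOpposite.op r) y) m = tmul R₀ act y (r • m) :=
  (Submodule.Quotient.eq _).2 (Submodule.subset_span ⟨r, hr, y, m, rfl⟩)

theorem tmul_add (y : Y) (m m' : M) :
    tmul R₀ act y (m + m') = tmul R₀ act y m + tmul R₀ act y m' := by
  simp only [tmul, TensorProduct.tmul_add, Submodule.Quotient.mk_add]

theorem add_tmul (y y' : Y) (m : M) :
    tmul R₀ act (y + y') m = tmul R₀ act y m + tmul R₀ act y' m := by
  simp only [tmul, TensorProduct.add_tmul, Submodule.Quotient.mk_add]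

theorem smul_tmul (b : B) (y : Y) (m : M) :
    tmul R₀ act (b • y) m = b • tmul R₀ act y m := rfl

variable {R₀ act} in
theorem hom_ext {V : Type*} [AddCommGroup V] [Module B V] {f g : BTensor R₀ act M →ₗ[B] V}
    (h : ∀ y m, f (tmul R₀ act y m) = g (tmul R₀ act y m)) : f = g := by
  refine Submodule.linearMap_qext _ (LinearMap.ext fun z => ?_)
  induction z using TensorProduct.induction_on with
  | zero => simp
  | tmul y m => exact h y m
  | add a b ha hb => rw [map_add, map_add, ha, hb]

variable {R₀ act} in
/-- A `B`-linear map `a` of `Y` and an additive map `f : M → N` that respect the relations induce a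
map `Y ⊗ M → Y ⊗ N`. -/
def mapAdd (a : Y →ₗ[B] Y) (f : M →+ N)
    (h : ∀ r ∈ R₀, ∀ y m, tmul R₀ act (a (act (MulOpposite.op r) y)) (f m) =
      tmul R₀ act (a y) (f (r • m))) :
    BTensor R₀ act M →ₗ[B] BTensor R₀ act N :=
  Submodule.mapQ _ _ (TensorProduct.AlgebraTensorModule.map a f.toIntLinearMap) <| by
    refine Submodule.span_le.2 ?_
    rintro _ ⟨r, hr, y, m, rfl⟩
    rw [SetLike.mem_coe, Submodule.mem_comap, map_sub]
    exact (Submodule.Quotient.eq _).1 (h r hr y m)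

/-- Functoriality of `Y ⊗_{R₀} M` in the `R`-module `M`. -/
def map (f : M →ₗ[R] N) : BTensor R₀ act M →ₗ[B] BTensor R₀ act N :=
  mapAdd LinearMap.id f.toAddMonoidHom fun r hr y m => by
    simp only [LinearMap.id_apply, LinearMap.toAddMonoidHom_coe, map_smul]
    exact act_tmul R₀ act hr y (f m)

@[simp] theorem map_tmul (f : M →ₗ[R] N) (y : Y) (m : M) :
    map R₀ act f (tmul R₀ act y m) = tmul R₀ act y (f m) := rfl

theorem map_id : map R₀ act (LinearMap.id : M →ₗ[R] M) = LinearMap.id := hom_ext fun _ _ => rfl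

theorem map_comp (g : N →ₗ[R] P) (f : M →ₗ[R] N) :
    map R₀ act (g ∘ₗ f) = map R₀ act g ∘ₗ map R₀ act f := hom_ext fun _ _ => rfl

theorem map_add (f g : M →ₗ[R] N) : map R₀ act (f + g) = map R₀ act f + map R₀ act g :=
  hom_ext fun y m => by
    simp only [map_tmul, LinearMap.add_apply, tmul_add]

theorem map_zero : map R₀ act (0 : M →ₗ[R] N) = 0 := by
  have h := map_add R₀ act (0 : M →ₗ[R] N) 0
  rw [add_zero] at h
  exact left_eq_add.1 h

/-- The isomorphism induced by an isomorphism of modules. -/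
def congr (f : M ≃ₗ[R] N) : BTensor R₀ act M ≃ₗ[B] BTensor R₀ act N :=
  LinearEquiv.ofLinearMap (map R₀ act f.toLinearMap) (map R₀ act f.symm.toLinearMap)
    (by rw [← map_comp, LinearEquiv.comp_symm, map_id])
    (by rw [← map_comp, LinearEquiv.symm_comp, map_id])

/-- `Y ⊗ (M ⊕ N) = (Y ⊗ M) ⊕ (Y ⊗ N)`. -/
def prodEquiv (M N : Type*) [AddCommGroup M] [Module R M] [AddCommGroup N] [Module R N] :
    BTensor R₀ act (M × N) ≃ₗ[B] BTensor R₀ act M × BTensor R₀ act N :=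
  LinearEquiv.ofLinearMap
    ((map R₀ act (LinearMap.fst R M N)).prod (map R₀ act (LinearMap.snd R M N)))
    ((map R₀ act (LinearMap.inl R M N)).coprod (map R₀ act (LinearMap.inr R M N)))
    (by
      refine LinearMap.prod_ext (hom_ext fun y m => ?_) (hom_ext fun y m => ?_)
      · have : tmul R₀ act y (0 : N) = 0 := by simp [tmul]
        simp [this]
      · have : tmul R₀ act y (0 : M) = 0 := by simp [tmul]
        simp [this])
    (hom_ext fun y m => by
      simp [← tmul_add])

/-- The isomorphism `(Y ⊗ M) ⊕ (Y ⊗ P) ≅ (Y ⊗ N) ⊕ (Y ⊗ P)` induced by `M ⊕ P ≅ N ⊕ P`. -/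
def congrProd {M N P : Type*} [AddCommGroup M] [Module R M] [AddCommGroup N] [Module R N]
    [AddCommGroup P] [Module R P] (f : (M × P) ≃ₗ[R] (N × P)) :
    (BTensor R₀ act M × BTensor R₀ act P) ≃ₗ[B] (BTensor R₀ act N × BTensor R₀ act P) :=
  (prodEquiv R₀ act M P).symm.trans ((congr R₀ act f).trans (prodEquiv R₀ act N P))

theorem span_exists_surjective [Module.Finite R M] : ∃ (k : ℕ) (f : (Fin k → Y) →ₗ[B]
    BTensor ⊤ act M), Function.Surjective f := by
  obtain ⟨k, s, hs⟩ := Module.Finite.exists_fin (R := R) (M := M)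
  let f : (Fin k → Y) →ₗ[B] BTensor ⊤ act M :=
    { toFun := fun c => ∑ i, tmul ⊤ act (c i) (s i)
      map_add' := fun c c' => by simp [add_tmul, Finset.sum_add_distrib]
      map_smul' := fun b c => by simp [smul_tmul, Finset.smul_sum] }
  refine ⟨k, f, ?_⟩
  rw [← LinearMap.range_eq_top, eq_top_iff]
  rintro z -
  obtain ⟨z, rfl⟩ := Submodule.Quotient.mk_surjective _ z
  induction z using TensorProduct.induction_on with
  | zero => simp
  | tmul y m =>
    obtain ⟨c, rfl⟩ := (Submodule.mem_span_range_iff_exists_fun R).1 (hs ▸ Submodule.mem_top (x := m))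
    refine ⟨fun i => act (MulOpposite.op (c i)) y, ?_⟩
    change ∑ i, tmul ⊤ act (act (MulOpposite.op (c i)) y) (s i) = tmul ⊤ act y (∑ i, c i • s i)
    have h : ∀ t : Finset (Fin k), tmul ⊤ act y (∑ i ∈ t, c i • s i) =
        ∑ i ∈ t, tmul ⊤ act y (c i • s i) := fun t => by
      classical
      induction t using Finset.induction_on with
      | empty => simp [tmul]
      | insert a t ha ih => rw [Finset.sum_insert ha, Finset.sum_insert ha, tmul_add, ih]
    rw [h]
    exact Finset.sum_congr rfl fun i _ => act_tmul ⊤ act (Subring.mem_top _) y (s i)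
  | add a b ha hb => rw [Submodule.Quotient.mk_add]; exact Submodule.add_mem _ ha hb

instance [Module.Finite R M] [Module.Finite B Y] : Module.Finite B (BTensor ⊤ act M) := by
  obtain ⟨k, f, hf⟩ := span_exists_surjective act (M := M)
  exact Module.Finite.of_surjective f hf

end BTensor

/-- A ring `B` as a right module over `R` by a ring homomorphism `R → B`. -/
def actRing (φ : R →+* B) : Rᵐᵒᵖ →+* Module.End B B where
  toFun r := LinearMap.toSpanSingleton B B (φ r.unop)
  map_one' := by ext; simp
  map_mul' a b := by ext; simp
  map_zero' := by ext; simp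
  map_add' a b := by ext; simp

/-- Scalar extension along a ring homomorphism preserves finitely generated projective modules. -/
instance (φ : R →+* B) (M : Type*) [AddCommGroup M] [Module R M] [Module.Finite R M]
    [Module.Projective R M] : Module.Projective B (BTensor ⊤ (actRing φ) M) := by
  obtain ⟨k, f, g, -, -, hfg⟩ := Module.Finite.exists_comp_eq_id_of_projective R M
  let s₀ : B ⊗[ℤ] M →ₗ[B] (Fin k → B) := TensorProduct.AlgebraTensorModule.lift
    { toFun := fun b =>
        { toFun := fun m i => b * φ (g m i)
          map_add' := fun m m' => by ext i; simp [mul_add]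
          map_smul' := fun c m => by
            ext i
            simp only [map_zsmul, Pi.smul_apply, mul_smul_comm, eq_intCast, Int.cast_id] }
      map_add' := fun b b' => by ext m i; simp [add_mul]
      map_smul' := fun c b => by ext m i; simp [mul_assoc] }
  have hs₀ : ∀ b m, s₀ (b ⊗ₜ m) = fun i => b * φ (g m i) := fun b m => rfl
  let s : BTensor ⊤ (actRing φ) M →ₗ[B] (Fin k → B) := Submodule.liftQ _ s₀ <| by
    refine Submodule.span_le.2 ?_
    rintro _ ⟨r, -, y, m, rfl⟩
    rw [SetLike.mem_coe, LinearMap.mem_ker, map_sub, hs₀, hs₀, sub_eq_zero]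
    ext i
    simp [actRing, mul_assoc]
  let t : (Fin k → B) →ₗ[B] BTensor ⊤ (actRing φ) M :=
    { toFun := fun c => ∑ i, BTensor.tmul ⊤ (actRing φ) (c i) (f (Pi.single i 1))
      map_add' := fun c c' => by simp [BTensor.add_tmul, Finset.sum_add_distrib]
      map_smul' := fun b c => by
        simp only [Pi.smul_apply, BTensor.smul_tmul, Finset.smul_sum, RingHom.id_apply] }
  refine Module.Projective.of_split s t (BTensor.hom_ext fun y m => ?_)
  change ∑ i, BTensor.tmul ⊤ (actRing φ) (y * φ (g m i)) (f (Pi.single i 1)) = _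
  have h1 : ∀ i, BTensor.tmul ⊤ (actRing φ) (y * φ (g m i)) (f (Pi.single i 1)) =
      BTensor.tmul ⊤ (actRing φ) y (f (Pi.single i (g m i))) := fun i => by
    have := BTensor.act_tmul ⊤ (actRing φ) (Subring.mem_top (g m i)) y (f (Pi.single i 1))
    rw [← map_smul, ← Pi.single_smul, smul_eq_mul, mul_one] at this
    exact this
  have h2 : ∀ t : Finset (Fin k), ∑ i ∈ t, BTensor.tmul ⊤ (actRing φ) y (f (Pi.single i (g m i))) =
      BTensor.tmul ⊤ (actRing φ) y (∑ i ∈ t, f (Pi.single i (g m i))) := fun t => by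
    classical
    induction t using Finset.induction_on with
    | empty => simp [BTensor.tmul]
    | insert a t ha ih => rw [Finset.sum_insert ha, Finset.sum_insert ha, BTensor.tmul_add, ih]
  rw [Finset.sum_congr rfl fun i _ => h1 i, h2, ← map_sum, Finset.univ_sum_single]
  exact congrArg _ (LinearMap.congr_fun hfg m)

/-- The space `B^n` of row vectors as a right module over `R` by a ring homomorphism `R → M_n(B)`.
In terms of column vectors, `r` acts by the transpose of its image. -/
def actMatrix {B : Type v} [CommRing B] {n : ℕ} (φ : R →+* Matrix (Fin n) (Fin n) B) :
    Rᵐᵒᵖ →+* Module.End B (Fin n → B) where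
  toFun r := (φ r.unop).vecMulLinear
  map_one' := by ext; simp
  map_mul' a b := by
    refine LinearMap.ext fun v => ?_
    simp [Matrix.vecMul_vecMul]
  map_zero' := by ext; simp
  map_add' a b := by ext; simp

end Tensor

/-! ### The group `K₁` of a ring -/

section K1

/-- A finitely generated projective module together with an automorphism. -/
structure K1Gen (R : Type u) [Ring R] : Type (u + 1) where
  carrier : Type u
  [addCommGroup : AddCommGroup carrier]
  [module : Module R carrier]
  [finite : Module.Finite R carrier]
  [projective : Module.Projective R carrier]
  auto : carrier ≃ₗ[R] carrier

attribute [instance] K1Gen.addCommGroup K1Gen.module K1Gen.finite K1Gen.projective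

variable (R : Type u) [Ring R]

/-- The defining relations of `K₁(R)`: `[P, α ∘ β] = [P, α] [P, β]`,
`[P ⊕ Q, α ⊕ β] = [P, α] [Q, β]`, and `[P, α] = [Q, β]` for isomorphic pairs. -/
inductive K1Rel : FreeGroup (K1Gen R) → Prop
  | comp (P : Type u) [AddCommGroup P] [Module R P] [Module.Finite R P] [Module.Projective R P]
      (α β : P ≃ₗ[R] P) :
      K1Rel (FreeGroup.of ⟨P, β.trans α⟩ * (FreeGroup.of ⟨P, α⟩ * FreeGroup.of ⟨P, β⟩)⁻¹)
  | sum (P Q : Type u) [AddCommGroup P] [Module R P] [Module.Finite R P] [Module.Projective R P]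
      [AddCommGroup Q] [Module R Q] [Module.Finite R Q] [Module.Projective R Q]
      (α : P ≃ₗ[R] P) (β : Q ≃ₗ[R] Q) :
      K1Rel (FreeGroup.of ⟨P × Q, α.prodCongr β⟩ *
        (FreeGroup.of ⟨P, α⟩ * FreeGroup.of ⟨Q, β⟩)⁻¹)
  | iso (P Q : Type u) [AddCommGroup P] [Module R P] [Module.Finite R P] [Module.Projective R P]
      [AddCommGroup Q] [Module R Q] [Module.Finite R Q] [Module.Projective R Q]
      (α : P ≃ₗ[R] P) (e : P ≃ₗ[R] Q) :
      K1Rel (FreeGroup.of ⟨Q, (e.symm.trans α).trans e⟩ * (FreeGroup.of ⟨P, α⟩)⁻¹)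

/-- The (Bass–Whitehead) group `K₁(R)`. -/
def K1 : Type (u + 1) := Abelianization (PresentedGroup {x | K1Rel R x})

instance : CommGroup (K1 R) :=
  inferInstanceAs (CommGroup (Abelianization (PresentedGroup {x | K1Rel R x})))

variable {R}

/-- The class `[P, α]` in `K₁(R)` of an automorphism of a finitely generated projective module. -/
def K1.mk {P : Type u} [AddCommGroup P] [Module R P] [Module.Finite R P] [Module.Projective R P]
    (α : P ≃ₗ[R] P) : K1 R :=
  Abelianization.of (PresentedGroup.of (rels := {x | K1Rel R x}) ⟨P, α⟩)

/-- The homomorphism `K₁(R) → K^×`, `[P, α] ↦ det_K(Y ⊗_R α)`, for a field `K` and a `(K,R)`-bimodule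
`Y` of finite dimension over `K`. -/
def K1.det {K : Type v} [Field K] {Y : Type w} [AddCommGroup Y] [Module K Y] [Module.Finite K Y]
    (act : Rᵐᵒᵖ →+* Module.End K Y) : K1 R →* Kˣ :=
  Abelianization.lift <| PresentedGroup.toGroup
    (f := fun x : K1Gen R => LinearEquiv.det (BTensor.congr ⊤ act x.auto)) <| by
  rintro _ (⟨P, α, β⟩ | ⟨P, Q, α, β⟩ | ⟨P, Q, α, e⟩)
  · simp only [map_mul, map_inv, FreeGroup.lift_apply_of]
    rw [mul_inv_eq_one, ← map_mul]
    congr 1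
    exact LinearEquiv.toLinearMap_injective (BTensor.map_comp ⊤ act _ _)
  · simp only [map_mul, map_inv, FreeGroup.lift_apply_of]
    rw [mul_inv_eq_one]
    ext
    rw [Units.val_mul, LinearEquiv.coe_det, LinearEquiv.coe_det, LinearEquiv.coe_det,
      ← LinearMap.det_prodMap, ← LinearMap.det_conj _ (BTensor.prodEquiv ⊤ act P Q)]
    congr 1
    refine LinearMap.prod_ext (BTensor.hom_ext fun y m => ?_) (BTensor.hom_ext fun y m => ?_)
    · have h : BTensor.tmul ⊤ act y (0 : Q) = 0 := by simp [BTensor.tmul]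
      simp [BTensor.prodEquiv, BTensor.congr, h]
    · have h : BTensor.tmul ⊤ act y (0 : P) = 0 := by simp [BTensor.tmul]
      simp [BTensor.prodEquiv, BTensor.congr, h]
  · simp only [map_mul, map_inv, FreeGroup.lift_apply_of]
    rw [mul_inv_eq_one]
    ext
    rw [LinearEquiv.coe_det, LinearEquiv.coe_det, ← LinearMap.det_conj _ (BTensor.congr ⊤ act e)]
    congr 1
    exact BTensor.hom_ext fun _ _ => rfl

end K1

/-! ### Differential modules and determinants -/

section Det

/-- Two modules with maps in both directions. A bounded complex `C` gives such an object by taking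
the sums of all terms of even and of odd degree. Its determinant is the virtual object
`(C^{ev}, C^{od})`; the morphisms `(P, Q) → (P', Q')` of virtual objects are the classes of
isomorphisms `P ⊕ Q' ⊕ M ≅ P' ⊕ Q ⊕ M` modulo those that differ by automorphisms with trivial
class in `K₁`. -/
structure DiffMod (B : Type v) [Ring B] where
  ev : Type w
  od : Type w
  [acgEv : AddCommGroup ev]
  [acgOd : AddCommGroup od]
  [modEv : Module B ev]
  [modOd : Module B od]
  dEv : ev →ₗ[B] od
  dOd : od →ₗ[B] ev

attribute [instance] DiffMod.acgEv DiffMod.acgOd DiffMod.modEv DiffMod.modOd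

variable {B : Type v} [Ring B]

/-- A contraction of a differential module: `d² = 0`, `s² = 0` and `ds + sd = 1`. -/
structure Contraction (X : DiffMod.{v, w} B) where
  sEv : X.ev →ₗ[B] X.od
  sOd : X.od →ₗ[B] X.ev
  dd_ev : X.dOd ∘ₗ X.dEv = 0
  dd_od : X.dEv ∘ₗ X.dOd = 0
  ss_ev : sOd ∘ₗ sEv = 0
  ss_od : sEv ∘ₗ sOd = 0
  homotopy_ev : X.dOd ∘ₗ sEv + sOd ∘ₗ X.dEv = LinearMap.id
  homotopy_od : X.dEv ∘ₗ sOd + sEv ∘ₗ X.dOd = LinearMap.id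

/-- The canonical trivialisation of the determinant of an acyclic complex, as an isomorphism
`d + s : X^{od} ≅ X^{ev}`. -/
def Contraction.acyc {X : DiffMod.{v, w} B} (s : Contraction X) : X.od ≃ₗ[B] X.ev :=
  LinearEquiv.ofLinearMap (X.dOd + s.sOd) (X.dEv + s.sEv)
    (by rw [LinearMap.add_comp, LinearMap.comp_add, LinearMap.comp_add, s.dd_ev, s.ss_ev, zero_add,
      add_zero, s.homotopy_ev])
    (by rw [LinearMap.add_comp, LinearMap.comp_add, LinearMap.comp_add, s.dd_od, s.ss_od, zero_add,
      add_zero, s.homotopy_od])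

/-- The mapping cone of `f : X → X'`, with terms `X' ⊕ X[1]` and differential
`(x', x) ↦ (dx' + f x, -dx)`. -/
def cone (X X' : DiffMod.{v, w} B) (fEv : X.ev →ₗ[B] X'.ev) (fOd : X.od →ₗ[B] X'.od) :
    DiffMod.{v, w} B where
  ev := X'.ev × X.od
  od := X'.od × X.ev
  dEv := (X'.dEv ∘ₗ LinearMap.fst _ _ _ + fOd ∘ₗ LinearMap.snd _ _ _).prod
    (-(X.dOd ∘ₗ LinearMap.snd _ _ _))
  dOd := (X'.dOd ∘ₗ LinearMap.fst _ _ _ + fEv ∘ₗ LinearMap.snd _ _ _).prod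
    (-(X.dEv ∘ₗ LinearMap.snd _ _ _))

/-- The composite of a morphism `1 → (Ce, Co)`, given by `φ : Co ⊕ M ≅ Ce ⊕ M`, with a morphism
`(Ce, Co) → (De, Do)`, given by `τ : Do ⊕ Ce ≅ De ⊕ Co`. It is the isomorphism
`(x', x, m) ↦ (y', -y, m')` where `φ(x, m) = (z, m')` and `τ(x', z) = (y', y)`. The sign makes up for
the interchange of the two copies of `Co`: without it, composition with an identity morphism would
multiply by the class of `-1` on `Co`. -/
def compTriv {Ce Co De Do M : Type*} [AddCommGroup Ce] [Module B Ce] [AddCommGroup Co]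
    [Module B Co] [AddCommGroup De] [Module B De] [AddCommGroup Do] [Module B Do] [AddCommGroup M]
    [Module B M] (τ : (Do × Ce) ≃ₗ[B] (De × Co)) (φ : (Co × M) ≃ₗ[B] (Ce × M)) :
    (Do × (Co × M)) ≃ₗ[B] (De × (Co × M)) :=
  (((LinearEquiv.refl B Do).prodCongr φ).trans (LinearEquiv.prodAssoc B Do Ce M).symm).trans
    (((τ.trans ((LinearEquiv.refl B De).prodCongr (LinearEquiv.neg B))).prodCongr
      (LinearEquiv.refl B M)).trans (LinearEquiv.prodAssoc B De Co M))

/-- The interchange of the last two summands. -/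
def prodRightComm (P M N : Type*) [AddCommGroup P] [Module B P] [AddCommGroup M] [Module B M]
    [AddCommGroup N] [Module B N] : ((P × M) × N) ≃ₗ[B] ((P × N) × M) where
  toFun x := ((x.1.1, x.2), x.1.2)
  invFun x := ((x.1.1, x.2), x.1.2)
  map_add' _ _ := rfl
  map_smul' _ _ := rfl
  left_inv _ := rfl
  right_inv _ := rfl

/-- For `φ : P ⊕ M ≅ Q ⊕ M` and `ψ : P ⊕ N ≅ Q ⊕ N`, the automorphism `ψ⁻¹ ∘ φ` of `P ⊕ M ⊕ N`. -/
def compareTriv {P Q M N : Type*} [AddCommGroup P] [Module B P] [AddCommGroup Q] [Module B Q]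
    [AddCommGroup M] [Module B M] [AddCommGroup N] [Module B N] (φ : (P × M) ≃ₗ[B] (Q × M))
    (ψ : (P × N) ≃ₗ[B] (Q × N)) : ((P × M) × N) ≃ₗ[B] ((P × M) × N) :=
  ((φ.prodCongr (LinearEquiv.refl B N)).trans (prodRightComm Q M N)).trans
    ((ψ.symm.prodCongr (LinearEquiv.refl B M)).trans (prodRightComm P N M))

end Det

/-! ### Perfect complexes and localized `K₁`-groups -/

section Complexes

open CategoryTheory CategoryTheory.Limits

/-- An object of `C^p(R)`: a bounded (cohomological) complex of finitely generated projective
left `R`-modules. -/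
structure PerfCx (R : Type u) [Ring R] : Type (u + 1) where
  cx : CochainComplex (ModuleCat.{u} R) ℤ
  finite : ∀ i, Module.Finite R (cx.X i)
  projective : ∀ i, Module.Projective R (cx.X i)
  bounded : ∃ a b : ℤ, ∀ i, i < a ∨ b < i → Subsingleton (cx.X i)

attribute [instance] PerfCx.finite PerfCx.projective

variable {R : Type u} [Ring R]

namespace PerfCx

/-- The differential as a linear map. -/
def d (C : PerfCx R) (i j : ℤ) : C.cx.X i →ₗ[R] C.cx.X j := (C.cx.d i j).hom

theorem d_comp_d (C : PerfCx R) (i j k : ℤ) : C.d j k ∘ₗ C.d i j = 0 := by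
  have h := C.cx.d_comp_d i j k
  exact congrArg ModuleCat.Hom.hom h

/-- The sum of the terms of even degree. -/
abbrev ev (C : PerfCx R) : Type u := DirectSum {i : ℤ // Even i} fun i => C.cx.X i

/-- The sum of the terms of odd degree. -/
abbrev od (C : PerfCx R) : Type u := DirectSum {i : ℤ // Odd i} fun i => C.cx.X i

/-- The differential on the even part. -/
def dEv (C : PerfCx R) : C.ev →ₗ[R] C.od :=
  DirectSum.toModule R _ _ fun i =>
    DirectSum.lof R {i : ℤ // Odd i} (fun i => C.cx.X i) ⟨i.1 + 1, i.2.add_one⟩ ∘ₗ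
      C.d i.1 (i.1 + 1)

/-- The differential on the odd part. -/
def dOd (C : PerfCx R) : C.od →ₗ[R] C.ev :=
  DirectSum.toModule R _ _ fun i =>
    DirectSum.lof R {i : ℤ // Even i} (fun i => C.cx.X i) ⟨i.1 + 1, i.2.add_one⟩ ∘ₗ
      C.d i.1 (i.1 + 1)

theorem dOd_comp_dEv (C : PerfCx R) : C.dOd ∘ₗ C.dEv = 0 := by
  refine DirectSum.linearMap_ext R fun i => LinearMap.ext fun x => ?_
  have h : C.d (i.1 + 1) (i.1 + 1 + 1) (C.d i.1 (i.1 + 1) x) = 0 :=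
    LinearMap.congr_fun (C.d_comp_d i.1 (i.1 + 1) (i.1 + 1 + 1)) x
  simp [dOd, dEv, h]

theorem dEv_comp_dOd (C : PerfCx R) : C.dEv ∘ₗ C.dOd = 0 := by
  refine DirectSum.linearMap_ext R fun i => LinearMap.ext fun x => ?_
  have h : C.d (i.1 + 1) (i.1 + 1 + 1) (C.d i.1 (i.1 + 1) x) = 0 :=
    LinearMap.congr_fun (C.d_comp_d i.1 (i.1 + 1) (i.1 + 1 + 1)) x
  simp [dOd, dEv, h]

/-- The differential module attached to a complex. -/
abbrev fold (C : PerfCx R) : DiffMod.{u, u} R where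
  ev := C.ev
  od := C.od
  dEv := C.dEv
  dOd := C.dOd

theorem finite_directSum {ι : Type} [DecidableEq ι] (X : ι → Type u) [∀ i, AddCommGroup (X i)]
    [∀ i, Module R (X i)] [∀ i, Module.Finite R (X i)] (t : Finset ι)
    (ht : ∀ i, i ∉ t → Subsingleton (X i)) : Module.Finite R (DirectSum ι X) := by
  let f : (∀ i : t, X i) →ₗ[R] DirectSum ι X :=
    ∑ i : t, DirectSum.lof R ι X i ∘ₗ LinearMap.proj i
  refine Module.Finite.of_surjective f ?_
  rw [← LinearMap.range_eq_top, eq_top_iff]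
  rintro z -
  induction z using DirectSum.induction_on with
  | zero => exact Submodule.zero_mem _
  | of i x =>
    by_cases hi : i ∈ t
    · refine ⟨Pi.single (⟨i, hi⟩ : t) x, ?_⟩
      rw [LinearMap.sum_apply, Finset.sum_eq_single (⟨i, hi⟩ : t)]
      · simp [DirectSum.lof_eq_of]
      · intro j _ hj
        simp [Pi.single_eq_of_ne hj]
      · simp
    · have := ht i hi
      rw [Subsingleton.elim x 0, map_zero]
      exact Submodule.zero_mem _
  | add a b ha hb => exact Submodule.add_mem _ ha hb

theorem finite_of_parity (C : PerfCx R) (q : ℤ → Prop) :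
    Module.Finite R (DirectSum {i : ℤ // q i} fun i => C.cx.X i) := by
  classical
  obtain ⟨a, b, h⟩ := C.bounded
  refine finite_directSum _ ((Finset.Icc a b).subtype q) fun i hi => h i ?_
  simp only [Finset.mem_subtype, Finset.mem_Icc, not_and, not_le] at hi
  by_contra hc
  push Not at hc
  exact absurd (hi hc.1) (not_lt.2 hc.2)

instance (C : PerfCx R) : Module.Finite R C.ev := C.finite_of_parity _
instance (C : PerfCx R) : Module.Finite R C.od := C.finite_of_parity _
instance (C : PerfCx R) : Module.Projective R C.ev := by
  unfold ev DirectSum; infer_instance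
instance (C : PerfCx R) : Module.Projective R C.od := by
  unfold od DirectSum; infer_instance

/-- The map on even parts induced by a morphism of complexes. -/
def mapEv {C D : PerfCx R} (f : C.cx ⟶ D.cx) : C.ev →ₗ[R] D.ev :=
  DirectSum.lmap fun i => (f.f i.1).hom

/-- The map on odd parts induced by a morphism of complexes. -/
def mapOd {C D : PerfCx R} (f : C.cx ⟶ D.cx) : C.od →ₗ[R] D.od :=
  DirectSum.lmap fun i => (f.f i.1).hom

/-- A representative of a morphism `1_R → d_R(C)`, i.e. an isomorphism
`C^{od} ⊕ M ≅ C^{ev} ⊕ M` with `M` finitely generated projective. -/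
structure Triv (C : PerfCx R) : Type (u + 1) where
  stab : Type u
  [addCommGroup : AddCommGroup stab]
  [module : Module R stab]
  [finite : Module.Finite R stab]
  [projective : Module.Projective R stab]
  iso : (C.od × stab) ≃ₗ[R] (C.ev × stab)

attribute [instance] Triv.addCommGroup Triv.module Triv.finite Triv.projective

/-- `a' = d_R(f) ∘ a`, where `d_R(f) : d_R(C) → d_R(D)` for a quasi-isomorphism `f : C → D` is the
morphism given by the trivialisation of the determinant of the (acyclic) mapping cone of `f`. For
`f = id`, this says that `a` and `a'` represent the same morphism. -/
def IsPush {C D : PerfCx R} (f : C.cx ⟶ D.cx) (a : C.Triv) (a' : D.Triv) : Prop :=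
  ∃ s : Contraction (cone C.fold D.fold (mapEv f) (mapOd f)),
    K1.mk (compareTriv a'.iso (compTriv s.acyc a.iso)) = 1

/-- `a = a' · a''` under the isomorphism `d_R(C) ≅ d_R(C') d_R(C'')` of a short exact sequence
`0 → C' → C → C'' → 0`, which is given by splittings of the sequence of even and odd parts. -/
def IsProd {C' C C'' : PerfCx R} (f : C'.cx ⟶ C.cx) (g : C.cx ⟶ C''.cx) (a' : C'.Triv)
    (a : C.Triv) (a'' : C''.Triv) : Prop :=
  ∃ (eEv : (C'.ev × C''.ev) ≃ₗ[R] C.ev) (eOd : (C'.od × C''.od) ≃ₗ[R] C.od),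
    (∀ x, eEv (x, 0) = mapEv f x) ∧ (∀ x y, mapEv g (eEv (x, y)) = y) ∧
    (∀ x, eOd (x, 0) = mapOd f x) ∧ (∀ x y, mapOd g (eOd (x, y)) = y) ∧
    K1.mk (compareTriv a.iso
      (((eOd.symm.prodCongr (LinearEquiv.refl R (a'.stab × a''.stab))).trans
        ((LinearEquiv.prodProdProdComm R C'.od C''.od a'.stab a''.stab).trans
          ((a'.iso.prodCongr a''.iso).trans
            (LinearEquiv.prodProdProdComm R C'.ev a'.stab C''.ev a''.stab)))).trans
        (eEv.prodCongr (LinearEquiv.refl R (a'.stab × a''.stab))))) = 1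

/-- The identity trivialisation of a zero complex. -/
def zeroTriv (C : PerfCx R) [Subsingleton C.ev] [Subsingleton C.od] : C.Triv where
  stab := PUnit
  iso := 0

end PerfCx

/-- A generator `[C, a]` of the localized `K₁`-group of a full subcategory `Σ` of `C^p(R)`. -/
structure K1LocGen (S : PerfCx R → Prop) : Type (u + 1) where
  cx : PerfCx R
  mem : S cx
  triv : cx.Triv

/-- The defining relations of the localized `K₁`-group. The further relation
`[C[1], a⁻¹] = [C, a]⁻¹` is a consequence of these. -/
inductive K1LocRel (S : PerfCx R → Prop) : FreeGroup (K1LocGen S) → Prop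
  | zero (C : PerfCx R) (hC : S C) [Subsingleton C.ev] [Subsingleton C.od] :
      K1LocRel S (FreeGroup.of ⟨C, hC, C.zeroTriv⟩)
  | push (C D : PerfCx R) (hC : S C) (hD : S D) (f : C.cx ⟶ D.cx) (hf : QuasiIso f)
      (a : C.Triv) (a' : D.Triv) (h : PerfCx.IsPush f a a') :
      K1LocRel S (FreeGroup.of ⟨D, hD, a'⟩ * (FreeGroup.of ⟨C, hC, a⟩)⁻¹)
  | exact (C' C C'' : PerfCx R) (hC' : S C') (hC : S C) (hC'' : S C'')
      (f : C'.cx ⟶ C.cx) (g : C.cx ⟶ C''.cx) (hf : ∀ i, Function.Injective (f.f i).hom)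
      (hfg : ∀ i, Function.Exact (f.f i).hom (g.f i).hom)
      (hg : ∀ i, Function.Surjective (g.f i).hom) (a' : C'.Triv) (a : C.Triv) (a'' : C''.Triv)
      (h : PerfCx.IsProd f g a' a a'') :
      K1LocRel S (FreeGroup.of ⟨C, hC, a⟩ *
        (FreeGroup.of ⟨C', hC', a'⟩ * FreeGroup.of ⟨C'', hC'', a''⟩)⁻¹)

/-- The localized `K₁`-group `K₁(R, Σ)`. -/
def K1Loc (S : PerfCx R → Prop) : Type (u + 1) :=
  Abelianization (PresentedGroup {x | K1LocRel S x})

instance (S : PerfCx R → Prop) : CommGroup (K1Loc S) :=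
  inferInstanceAs (CommGroup (Abelianization (PresentedGroup {x | K1LocRel S x})))

/-- The class `[C, a]`. -/
def K1Loc.mk {S : PerfCx R → Prop} (C : PerfCx R) (hC : S C) (a : C.Triv) : K1Loc S :=
  Abelianization.of (PresentedGroup.of (rels := {x | K1LocRel S x}) ⟨C, hC, a⟩)

/-- The smallest full subcategory `Σ_A` of `C^p(R)` that contains `A` and the zero complex and is
closed under quasi-isomorphisms, shifts and direct sums. -/
inductive SigmaGen (A : PerfCx R) : PerfCx R → Prop
  | base : SigmaGen A A
  | zero (C : PerfCx R) (h : IsZero C.cx) : SigmaGen A C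
  | quasi (C D : PerfCx R) (f : C.cx ⟶ D.cx) (hf : QuasiIso f) (h : SigmaGen A C) : SigmaGen A D
  | quasi' (C D : PerfCx R) (f : C.cx ⟶ D.cx) (hf : QuasiIso f) (h : SigmaGen A D) : SigmaGen A C
  | shift (C D : PerfCx R) (n : ℤ) (e : D.cx ≅ C.cx⟦n⟧) (h : SigmaGen A C) : SigmaGen A D
  | sum (C D E : PerfCx R) (e : E.cx ≅ C.cx ⊞ D.cx) (hC : SigmaGen A C) (hD : SigmaGen A D) :
      SigmaGen A E

end Complexes

/-! ### Localization and characteristic elements -/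

section Localization

variable (R : Type u) [Ring R] (S : Set R)

/-- The defining relations of the localization: the generators `inl r` form a homomorphic image of
`R`, and `inr s` is a two-sided inverse of `inl s` for `s ∈ S`. -/
inductive LocRel : FreeAlgebra ℤ (R ⊕ S) → FreeAlgebra ℤ (R ⊕ S) → Prop
  | one : LocRel (FreeAlgebra.ι ℤ (Sum.inl 1)) 1
  | add (a b : R) : LocRel (FreeAlgebra.ι ℤ (Sum.inl (a + b)))
      (FreeAlgebra.ι ℤ (Sum.inl a) + FreeAlgebra.ι ℤ (Sum.inl b))
  | mul (a b : R) : LocRel (FreeAlgebra.ι ℤ (Sum.inl (a * b)))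
      (FreeAlgebra.ι ℤ (Sum.inl a) * FreeAlgebra.ι ℤ (Sum.inl b))
  | inv_mul (s : S) :
      LocRel (FreeAlgebra.ι ℤ (Sum.inr s) * FreeAlgebra.ι ℤ (Sum.inl (s : R))) 1
  | mul_inv (s : S) :
      LocRel (FreeAlgebra.ι ℤ (Sum.inl (s : R)) * FreeAlgebra.ι ℤ (Sum.inr s)) 1

/-- The localization `R_S`: the universal ring under `R` in which all elements of `S` become
invertible. If `S` is a denominator set, this is the ring of fractions `S⁻¹R`. -/
def Loc : Type u := RingQuot (LocRel R S)

instance : Ring (Loc R S) := inferInstanceAs (Ring (RingQuot (LocRel R S)))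

variable {R}

/-- The canonical homomorphism `R → R_S`. -/
def toLoc : R →+* Loc R S where
  toFun r := RingQuot.mkRingHom (LocRel R S) (FreeAlgebra.ι ℤ (Sum.inl r))
  map_one' := (RingQuot.mkRingHom_rel LocRel.one).trans (map_one _)
  map_mul' a b := (RingQuot.mkRingHom_rel (LocRel.mul a b)).trans (map_mul _ _ _)
  map_add' a b := (RingQuot.mkRingHom_rel (LocRel.add a b)).trans (map_add _ _ _)
  map_zero' := by
    have h : RingQuot.mkRingHom (LocRel R S) (FreeAlgebra.ι ℤ (Sum.inl (0 + 0))) =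
        RingQuot.mkRingHom (LocRel R S) (FreeAlgebra.ι ℤ (Sum.inl 0)) +
          RingQuot.mkRingHom (LocRel R S) (FreeAlgebra.ι ℤ (Sum.inl 0)) :=
      (RingQuot.mkRingHom_rel (LocRel.add 0 0)).trans (map_add _ _ _)
    rw [add_zero] at h
    exact left_eq_add.1 h

/-- The subcategory `Σ_S` of those `C` for which `R_S ⊗_R C` is acyclic. -/
def SigmaLoc (C : PerfCx R) : Prop :=
  ∀ i : ℤ, Function.Exact (BTensor.map ⊤ (actRing (toLoc S)) (C.d (i - 1) i))
    (BTensor.map ⊤ (actRing (toLoc S)) (C.d i (i + 1)))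

/-- The differential module `Y ⊗_R C`. -/
abbrev PerfCx.tensor {B : Type v} [Ring B] {Y : Type w} [AddCommGroup Y] [Module B Y]
    (act : Rᵐᵒᵖ →+* Module.End B Y) (C : PerfCx R) : DiffMod.{v, max w u} B where
  ev := BTensor ⊤ act C.ev
  od := BTensor ⊤ act C.od
  dEv := BTensor.map ⊤ act C.dEv
  dOd := BTensor.map ⊤ act C.dOd

/-- `x` is the element `θ_{C,a}` of `K₁(R_S)`: the composite of the trivialisation
`1 → d(R_S ⊗ C)` induced by `a` with the inverse of the one given by acyclicity of `R_S ⊗ C`. -/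
def IsCharElement (C : PerfCx R) (a : C.Triv) (x : K1 (Loc R S)) : Prop :=
  ∃ s : Contraction (C.tensor (actRing (toLoc S))),
    x = K1.mk ((BTensor.congrProd ⊤ (actRing (toLoc S)) a.iso).trans
      (s.acyc.prodCongr (LinearEquiv.refl _ (BTensor ⊤ (actRing (toLoc S)) a.stab))).symm)

end Localization

/-! ### Homology and Bockstein maps -/

section Homology

variable {B : Type v} [Ring B] {M N P M' N' P' : Type*} [AddCommGroup M] [Module B M]
  [AddCommGroup N] [Module B N] [AddCommGroup P] [Module B P] [AddCommGroup M'] [Module B M']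
  [AddCommGroup N'] [Module B N'] [AddCommGroup P'] [Module B P']

/-- The homology `ker g / im f` of `M → N → P`. -/
abbrev Hgy (f : M →ₗ[B] N) (g : N →ₗ[B] P) : Type _ :=
  LinearMap.ker g ⧸ (LinearMap.range f).submoduleOf (LinearMap.ker g)

/-- The map on homology induced by a map `b` that preserves cycles and boundaries. -/
def Hgy.map {f : M →ₗ[B] N} {g : N →ₗ[B] P} {f' : M' →ₗ[B] N'} {g' : N' →ₗ[B] P'} (b : N →ₗ[B] N')
    (hg : ∀ x, g x = 0 → g' (b x) = 0) (hf : ∀ x, ∃ y, b (f x) = f' y) :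
    Hgy f g →ₗ[B] Hgy f' g' :=
  Submodule.mapQ _ _ (b.restrict (p := LinearMap.ker g) (q := LinearMap.ker g') hg) <| by
    rintro ⟨x, hx⟩ ⟨y, hy⟩
    obtain ⟨z, hz⟩ := hf y
    exact ⟨z, by rw [← hz, hy]; rfl⟩

end Homology

section Bockstein

variable {p : ℕ} [Fact p.Prime] {G : Type u} [Group G] [TopologicalSpace G] [IsTopologicalGroup G]
  [CompactSpace G]

/-- A continuous homomorphism `θ : G → ℤ_p` as a continuous function. -/
def thetaFun (θ : G →ₜ* Multiplicative ℤ_[p]) : C(G, ℤ_[p]) :=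
  ⟨fun g => (θ g).toAdd, continuous_toAdd.comp θ.continuous_toFun⟩

theorem thetaFun_mul (θ : G →ₜ* Multiplicative ℤ_[p]) (g h : G) :
    thetaFun θ (g * h) = thetaFun θ g + thetaFun θ h := by
  simp [thetaFun]

/-- The `Λ(G)`-module `M ⊗_{ℤ_p} E_θ` with diagonal action of `G`, where `E_θ = ℤ_p e₁ ⊕ ℤ_p e₂` with
`g e₁ = e₁` and `g e₂ = e₂ + θ(g) e₁`. The pair `(x, y)` stands for `x ⊗ e₁ + y ⊗ e₂`; thus
`g (x, y) = (g x + θ(g) g y, g y)`. -/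
def ThetaExt (_θ : G →ₜ* Multiplicative ℤ_[p]) (M : Type*) : Type _ := M × M

instance (θ : G →ₜ* Multiplicative ℤ_[p]) (M : Type*) [AddCommGroup M] :
    AddCommGroup (ThetaExt θ M) := inferInstanceAs (AddCommGroup (M × M))

instance (θ : G →ₜ* Multiplicative ℤ_[p]) (M : Type*) [AddCommGroup M] [Module (Iwasawa p G) M] :
    Module (Iwasawa p G) (ThetaExt θ M) where
  smul μ x := (μ • x.1 + Iwasawa.mulFun (thetaFun θ) μ • x.2, μ • x.2)
  one_smul x := by
    change ((1 : Iwasawa p G) • x.1 + _ • x.2, (1 : Iwasawa p G) • x.2) = x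
    rw [Iwasawa.mulFun_one _ (thetaFun_mul θ), one_smul, one_smul, zero_smul, add_zero]
    rfl
  mul_smul μ ν x := by
    change ((μ * ν) • x.1 + _ • x.2, (μ * ν) • x.2) =
      (μ • (ν • x.1 + _ • x.2) + _ • ν • x.2, μ • ν • x.2)
    rw [Iwasawa.mulFun_mul _ (thetaFun_mul θ)]
    simp only [add_smul, mul_smul, smul_add, Prod.mk.injEq, and_true]
    abel
  smul_zero μ := by
    change (μ • (0 : M) + _ • (0 : M), μ • (0 : M)) = (0, 0)
    simp
  smul_add μ x y := by
    change (μ • (x.1 + y.1) + _ • (x.2 + y.2), μ • (x.2 + y.2)) =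
      ((μ • x.1 + _ • x.2) + (μ • y.1 + _ • y.2), μ • x.2 + μ • y.2)
    simp only [smul_add, Prod.mk.injEq, and_true]
    abel
  add_smul μ ν x := by
    change ((μ + ν) • x.1 + _ • x.2, (μ + ν) • x.2) =
      ((μ • x.1 + _ • x.2) + (ν • x.1 + _ • x.2), μ • x.2 + ν • x.2)
    rw [Iwasawa.mulFun_add]
    simp only [add_smul, Prod.mk.injEq, and_true]
    abel
  zero_smul x := by
    change ((0 : Iwasawa p G) • x.1 + _ • x.2, (0 : Iwasawa p G) • x.2) = (0, 0)
    rw [Iwasawa.mulFun_zero]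
    simp

variable (θ : G →ₜ* Multiplicative ℤ_[p]) {M N : Type*} [AddCommGroup M]
  [Module (Iwasawa p G) M] [Module.Projective (Iwasawa p G) M] [AddCommGroup N]
  [Module (Iwasawa p G) N] [Module.Projective (Iwasawa p G) N]

/-- The projection `M ⊗ E_θ → M` onto the second coordinate. -/
def ThetaExt.proj (M : Type*) [AddCommGroup M] [Module (Iwasawa p G) M] :
    ThetaExt θ M →ₗ[Iwasawa p G] M where
  toFun x := x.2
  map_add' _ _ := rfl
  map_smul' _ _ := rfl

theorem ThetaExt.exists_section (M : Type*) [AddCommGroup M] [Module (Iwasawa p G) M]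
    [Module.Projective (Iwasawa p G) M] :
    ∃ σ : M →ₗ[Iwasawa p G] ThetaExt θ M, ThetaExt.proj θ M ∘ₗ σ = LinearMap.id :=
  Module.projective_lifting_property (ThetaExt.proj θ M) LinearMap.id fun y => ⟨(0, y), rfl⟩

/-- A `Λ(G)`-linear section of `M ⊗ E_θ → M`, for `M` projective. -/
def ThetaExt.sec (M : Type*) [AddCommGroup M] [Module (Iwasawa p G) M]
    [Module.Projective (Iwasawa p G) M] : M →ₗ[Iwasawa p G] ThetaExt θ M :=
  (ThetaExt.exists_section θ M).choose

theorem ThetaExt.sec_snd (x : M) : (ThetaExt.sec θ M x).2 = x :=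
  LinearMap.congr_fun (ThetaExt.exists_section θ M).choose_spec x

/-- Let `f : M → N` be a homomorphism of projective `Λ(G)`-modules, and let `σ` be the chosen sections
of `M ⊗ E_θ → M` and `N ⊗ E_θ → N`. Then `(f ⊗ 1) ∘ σ - σ ∘ f` has values in the submodule `N` of
`N ⊗ E_θ`; this is the resulting map. For the differentials of a complex `A` of projective modules,
these maps form a morphism `A → A[1]` which represents `θ ∪ -`: the connecting homomorphisms of
`0 → Y ⊗ A → Y ⊗ (A ⊗ E_θ) → Y ⊗ A → 0` send the class of a cycle `z` to the class of `w`, where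
`w` is the image of the boundary of the lift `σ(z)` of `z`. -/
def cupTheta (f : M →ₗ[Iwasawa p G] N) : M →ₗ[Iwasawa p G] N where
  toFun x := f (ThetaExt.sec θ M x).1 - (ThetaExt.sec θ N (f x)).1
  map_add' x y := by
    have h (a b : ThetaExt θ M) : (a + b).1 = a.1 + b.1 := rfl
    have h' (a b : ThetaExt θ N) : (a + b).1 = a.1 + b.1 := rfl
    rw [map_add, h, map_add, map_add, map_add, h']
    abel
  map_smul' μ x := by
    have h (a : ThetaExt θ M) : (μ • a).1 = μ • a.1 + Iwasawa.mulFun (thetaFun θ) μ • a.2 := rfl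
    have h' (a : ThetaExt θ N) : (μ • a).1 = μ • a.1 + Iwasawa.mulFun (thetaFun θ) μ • a.2 := rfl
    rw [map_smul, h, map_smul, map_smul, h', ThetaExt.sec_snd, ThetaExt.sec_snd, map_add, map_smul,
      map_smul, RingHom.id_apply, smul_sub]
    abel

theorem cupTheta_anticomm {P : Type*} [AddCommGroup P] [Module (Iwasawa p G) P]
    [Module.Projective (Iwasawa p G) P] (f : M →ₗ[Iwasawa p G] N) (g : N →ₗ[Iwasawa p G] P)
    (h : g ∘ₗ f = 0) : g ∘ₗ cupTheta θ f = -(cupTheta θ g ∘ₗ f) := by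
  ext x
  have h1 : ∀ y, g (f y) = 0 := fun y => LinearMap.congr_fun h y
  have h2 : (0 : ThetaExt θ P).1 = 0 := rfl
  simp [cupTheta, h1, h2]

variable {B : Type v} [Ring B] {Y : Type w} [AddCommGroup Y] [Module B Y]

/-- The Bockstein map on the homology of `Y ⊗_{Λ(G)} A`, for three consecutive differentials `f`, `g`,
`h` of a complex of projective `Λ(G)`-modules. -/
def bockstein (act : (Iwasawa p G)ᵐᵒᵖ →+* Module.End B Y) {K₀ K₁ K₂ K₃ : Type*}
    [AddCommGroup K₀] [Module (Iwasawa p G) K₀] [Module.Projective (Iwasawa p G) K₀]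
    [AddCommGroup K₁] [Module (Iwasawa p G) K₁] [Module.Projective (Iwasawa p G) K₁]
    [AddCommGroup K₂] [Module (Iwasawa p G) K₂] [Module.Projective (Iwasawa p G) K₂]
    [AddCommGroup K₃] [Module (Iwasawa p G) K₃] [Module.Projective (Iwasawa p G) K₃]
    (f : K₀ →ₗ[Iwasawa p G] K₁) (g : K₁ →ₗ[Iwasawa p G] K₂) (h : K₂ →ₗ[Iwasawa p G] K₃)
    (hgf : g ∘ₗ f = 0) (hhg : h ∘ₗ g = 0) :
    Hgy (BTensor.map ⊤ act f) (BTensor.map ⊤ act g) →ₗ[B]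
      Hgy (BTensor.map ⊤ act g) (BTensor.map ⊤ act h) :=
  Hgy.map (BTensor.map ⊤ act (cupTheta θ g))
    (fun x hx => by
      have e : BTensor.map ⊤ act h ∘ₗ BTensor.map ⊤ act (cupTheta θ g) +
          BTensor.map ⊤ act (cupTheta θ h) ∘ₗ BTensor.map ⊤ act g = 0 := by
        rw [← BTensor.map_comp, ← BTensor.map_comp, ← BTensor.map_add, cupTheta_anticomm θ g h hhg,
          neg_add_cancel, BTensor.map_zero]
      have e' := LinearMap.congr_fun e x
      simpa [hx] using e')
    (fun x => ⟨-BTensor.map ⊤ act (cupTheta θ f) x, by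
      have e : BTensor.map ⊤ act g ∘ₗ BTensor.map ⊤ act (cupTheta θ f) +
          BTensor.map ⊤ act (cupTheta θ g) ∘ₗ BTensor.map ⊤ act f = 0 := by
        rw [← BTensor.map_comp, ← BTensor.map_comp, ← BTensor.map_add, cupTheta_anticomm θ f g hgf,
          neg_add_cancel, BTensor.map_zero]
      have e' := LinearMap.congr_fun e x
      rw [map_neg]
      exact (neg_eq_of_add_eq_zero_right e').symm⟩)

end Bockstein

/-! ### The arithmetic setting -/

section Setting

variable (p : ℕ) [Fact p.Prime] (L : Type v) [Field L] [Algebra ℚ_[p] L] [FiniteDimensional ℚ_[p] L]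
  [Algebra ℤ_[p] L] [IsScalarTower ℤ_[p] ℚ_[p] L]

/-- The ring of integers `O` of a finite extension `L` of `ℚ_p`. -/
def Integers : Type v := integralClosure ℤ_[p] L

instance : CommRing (Integers p L) := inferInstanceAs (CommRing (integralClosure ℤ_[p] L))
instance : IsDomain (Integers p L) := inferInstanceAs (IsDomain (integralClosure ℤ_[p] L))
instance : Algebra ℤ_[p] (Integers p L) :=
  inferInstanceAs (Algebra ℤ_[p] (integralClosure ℤ_[p] L))
instance : Algebra (Integers p L) L := inferInstanceAs (Algebra (integralClosure ℤ_[p] L) L)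

/-- The `p`-adic topology on `O`, i.e. the product topology on `O ≅ ℤ_p^d`. -/
instance : TopologicalSpace (Integers p L) := moduleTopology ℤ_[p] (Integers p L)

instance : IsModuleTopology ℤ_[p] (Integers p L) := ⟨rfl⟩

instance : Module.Finite ℤ_[p] (Integers p L) :=
  have : Algebra.IsSeparable ℚ_[p] L := inferInstance
  IsIntegralClosure.finite ℤ_[p] ℚ_[p] L (integralClosure ℤ_[p] L)

instance : Module.Free ℤ_[p] (Integers p L) :=
  have : Module.IsTorsionFree ℤ_[p] L := Module.IsTorsionFree.trans_faithfulSMul ℤ_[p] ℚ_[p] L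
  have : Module.Finite ℤ_[p] (integralClosure ℤ_[p] L) :=
    inferInstanceAs (Module.Finite ℤ_[p] (Integers p L))
  inferInstanceAs (Module.Free ℤ_[p] (integralClosure ℤ_[p] L))

/-- The field `Q_O(Γ)`, the quotient field of `Λ_O(Γ) = O[[T]]`. -/
abbrev QGamma : Type v := FractionRing (PowerSeries (Integers p L))

theorem expand_injective : Function.Injective ((HahnSeries.ofPowerSeries ℤ L).comp
    (PowerSeries.map (algebraMap (Integers p L) L))) := by
  have h : Function.Injective (algebraMap (Integers p L) L) := Subtype.val_injective
  rw [RingHom.coe_comp]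
  exact HahnSeries.ofPowerSeries_injective.comp (PowerSeries.map_injective _ h)

/-- The expansion of elements of `Q_O(Γ)` as Laurent series in `T` over `L`. -/
def toLaurent : QGamma p L →+* LaurentSeries L := IsFractionRing.lift (expand_injective p L)

/-- `dim_L (M^Γ ⊗_O L)` for a module `M` over `Λ_O(Γ) = O[[T]]`, where `M^Γ` is the kernel of
multiplication by `T`. -/
def invRank (O : Type v) (L : Type*) [CommRing O] [Field L] [Algebra O L] (M : Type*)
    [AddCommGroup M] [Module (PowerSeries O) M] : ℕ :=
  letI : Module O (Submodule.torsionBy (PowerSeries O) M PowerSeries.X) :=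
    Module.compHom _ (PowerSeries.C (R := O))
  Module.finrank L (L ⊗[O] Submodule.torsionBy (PowerSeries O) M PowerSeries.X)

variable {p L}
variable {G : Type u} [Group G] [TopologicalSpace G] [IsTopologicalGroup G] [CompactSpace G]

/-- The set `S` of all `x ∈ Λ(G)` for which `Λ(G)/Λ(G)x` is a finitely generated `Λ(H)`-module. -/
def oreSet (p : ℕ) [Fact p.Prime] (H : ClosedSubgroup G) : Set (Iwasawa p G) :=
  {x | @Module.Finite (Iwasawa p H.toSubgroup) (Iwasawa p G ⧸ Ideal.span {x}) _ _
    (Module.compHom _ (Iwasawa.ofSubgroup H))}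

/-- The canonical Ore set `S^* = ⋃ p^i S`. -/
def oreSetStar (p : ℕ) [Fact p.Prime] (H : ClosedSubgroup G) : Set (Iwasawa p G) :=
  {x | ∃ (i : ℕ), ∃ s ∈ oreSet p H, x = (p : Iwasawa p G) ^ i * s}

/-- The homomorphism `θ : G → Γ = G/H ≅ ℤ_p` attached to the topological generator `γ` of `Γ` that
corresponds to `1 ∈ ℤ_p`. -/
def thetaOf (H : ClosedSubgroup G) [H.toSubgroup.Normal]
    (e : (G ⧸ H.toSubgroup) ≃ₜ* Multiplicative ℤ_[p]) : G →ₜ* Multiplicative ℤ_[p] where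
  toMonoidHom := e.toMulEquiv.toMonoidHom.comp (QuotientGroup.mk' H.toSubgroup)
  continuous_toFun := e.continuous_toFun.comp QuotientGroup.continuous_mk

variable {n : ℕ} (ρ : G →ₜ* GL (Fin n) (Integers p L)) (θ : G →ₜ* Multiplicative ℤ_[p])

/-- The right `Λ(G)`-module `T_ρ = O^n`. -/
def actO : (Iwasawa p G)ᵐᵒᵖ →+* Module.End (Integers p L) (Fin n → Integers p L) :=
  actMatrix (repO ρ θ)

/-- The right `Λ(G)`-module `L^n`. -/
def actL : (Iwasawa p G)ᵐᵒᵖ →+* Module.End L (Fin n → L) :=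
  actMatrix ((algebraMap (Integers p L) L).mapMatrix.comp (repO ρ θ))

/-- The right `Λ(G)`-module `Λ_O(Γ) ⊗_O O^n`. -/
def actΓ : (Iwasawa p G)ᵐᵒᵖ →+*
    Module.End (PowerSeries (Integers p L)) (Fin n → PowerSeries (Integers p L)) :=
  actMatrix (repΓ ρ θ)

/-- The Bockstein map `H^{i+1} → H^{i+2}` on the cohomology of
`O^n ⊗_{Λ(G)} A = O ⊗_{Λ_O(G)} A(ρ^*)`. -/
def bocksteinO (A : PerfCx (Iwasawa p G)) (i : ℤ) :=
  bockstein θ (actO ρ θ) (A.d i (i + 1)) (A.d (i + 1) (i + 1 + 1)) (A.d (i + 1 + 1) (i + 1 + 1 + 1))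
    (A.d_comp_d _ _ _) (A.d_comp_d _ _ _)

/-- `A` is semisimple at `ρ`: the cohomology of the complex of hyperhomology groups
`H_i(G, A(ρ^*)) = H^{-i}(O^n ⊗_{Λ(G)} A)` with the Bockstein maps is `ℤ_p`-torsion in each degree. -/
def SemisimpleAt (A : PerfCx (Iwasawa p G)) : Prop :=
  ∀ (i : ℤ) (x : Hgy (bocksteinO ρ θ A i) (bocksteinO ρ θ A (i + 1))), ∃ k : ℕ, p ^ k • x = 0

/-- The integer `r_Γ(A_ρ) = ∑_i (-1)^{i+1} dim_L (H^i(A_ρ)^Γ ⊗_O L)`, where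
`A_ρ = (Λ_O(Γ) ⊗_O O^n) ⊗_{Λ(G)} A` and `(-)^Γ` is the kernel of multiplication by `T`. -/
def rankΓ (A : PerfCx (Iwasawa p G)) : ℤ :=
  ∑ᶠ i : ℤ, (Int.negOnePow (i + 1) : ℤ) * (invRank (Integers p L) L
    (Hgy (BTensor.map ⊤ (actΓ ρ θ) (A.d (i - 1) i))
      (BTensor.map ⊤ (actΓ ρ θ) (A.d i (i + 1)))) : ℤ)

theorem dirac_mul_dirac (g h : G) : (Iwasawa.dirac (g * h) : Iwasawa p G) =
    Iwasawa.dirac g * Iwasawa.dirac h := rfl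

/-- Conjugation by `g ∈ G` preserves the image of `Λ(H)` in `Λ(G)`, for `H` normal. -/
theorem conj_mem_range (H : ClosedSubgroup G) [H.toSubgroup.Normal] (g : G) {x : Iwasawa p G}
    (hx : x ∈ (Iwasawa.ofSubgroup (p := p) H).range) :
    Iwasawa.dirac g * x * Iwasawa.dirac g⁻¹ ∈ (Iwasawa.ofSubgroup (p := p) H).range := by
  obtain ⟨μ, rfl⟩ := hx
  let c : C(H.toSubgroup, H.toSubgroup) :=
    ⟨fun h => ⟨g * h * g⁻¹, Subgroup.Normal.conj_mem inferInstance h.1 h.2 g⟩, by fun_prop⟩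
  let ν : Iwasawa p H.toSubgroup :=
    { toFun := fun f => μ (f.comp c)
      map_add' := fun f f' => map_add μ (f.comp c) (f'.comp c)
      map_smul' := fun a f => map_smul μ a (f.comp c)
      cont := (map_continuous μ).comp (ContinuousMap.continuous_precomp _) }
  exact ⟨ν, rfl⟩

/-- The action of `g ∈ G` on `O^n ⊗_{Λ(H)} M = O ⊗_{Λ_O(H)} M(ρ^*)` by
`g (o ⊗ m) = ρ^*(g) o ⊗ g m`, where `M(ρ^*) = M ⊗_{ℤ_p} O^n` with diagonal action of `G`. -/
def gAct (H : ClosedSubgroup G) [H.toSubgroup.Normal] (M : Type*) [AddCommGroup M]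
    [Module (Iwasawa p G) M] (g : G) :
    BTensor (Iwasawa.ofSubgroup H).range (actO ρ θ) M →ₗ[Integers p L]
      BTensor (Iwasawa.ofSubgroup H).range (actO ρ θ) M :=
  BTensor.mapAdd (actO ρ θ (MulOpposite.op (Iwasawa.dirac g⁻¹)))
    (DistribSMul.toAddMonoidHom M (Iwasawa.dirac g : Iwasawa p G)) <| by
    intro r hr y m
    have h1 : (Iwasawa.dirac g : Iwasawa p G) • r • m =
        (Iwasawa.dirac g * r * Iwasawa.dirac g⁻¹) • (Iwasawa.dirac g : Iwasawa p G) • m := by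
      rw [smul_smul, smul_smul, mul_assoc, mul_assoc, ← dirac_mul_dirac]
      simp only [inv_mul_cancel]
      congr 2
      exact (mul_one r).symm
    have h2 : actO ρ θ (MulOpposite.op (Iwasawa.dirac g * r * Iwasawa.dirac g⁻¹))
        (actO ρ θ (MulOpposite.op (Iwasawa.dirac g⁻¹)) y) =
        actO ρ θ (MulOpposite.op (Iwasawa.dirac g⁻¹)) (actO ρ θ (MulOpposite.op r) y) := by
      rw [← Module.End.mul_apply, ← Module.End.mul_apply, ← map_mul, ← map_mul, ← MulOpposite.op_mul,
        ← MulOpposite.op_mul, ← mul_assoc, ← mul_assoc, ← dirac_mul_dirac, inv_mul_cancel]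
      congr 4
      exact one_mul r
    change BTensor.tmul _ _ _ ((Iwasawa.dirac g : Iwasawa p G) • m) =
      BTensor.tmul _ _ _ ((Iwasawa.dirac g : Iwasawa p G) • r • m)
    rw [h1, ← BTensor.act_tmul _ _ (conj_mem_range H g hr), h2]

theorem gAct_map (H : ClosedSubgroup G) [H.toSubgroup.Normal] {M N : Type*} [AddCommGroup M]
    [Module (Iwasawa p G) M] [AddCommGroup N] [Module (Iwasawa p G) N]
    (f : M →ₗ[Iwasawa p G] N) (g : G) (x : BTensor (Iwasawa.ofSubgroup H).range (actO ρ θ) M) :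
    gAct ρ θ H N g (BTensor.map _ _ f x) = BTensor.map _ _ f (gAct ρ θ H M g x) := by
  refine LinearMap.congr_fun (f := gAct ρ θ H N g ∘ₗ BTensor.map _ _ f)
    (g := BTensor.map _ _ f ∘ₗ gAct ρ θ H M g) (BTensor.hom_ext fun y m => ?_) x
  change BTensor.tmul _ _ (actO ρ θ (MulOpposite.op (Iwasawa.dirac g⁻¹)) y)
    ((Iwasawa.dirac g : Iwasawa p G) • f m) =
    BTensor.tmul _ _ (actO ρ θ (MulOpposite.op (Iwasawa.dirac g⁻¹)) y)
      (f ((Iwasawa.dirac g : Iwasawa p G) • m))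
  rw [map_smul]

/-- The hyperhomology group `H_i(H, A(ρ^*)) = Tor_i^{Λ(H)}(O, A(ρ^*))`, i.e. the cohomology in degree
`-i` of `O ⊗_{Λ_O(H)} A(ρ^*) = O^n ⊗_{Λ(H)} A`. The terms of `A` are projective `Λ(G)`-modules, hence
flat over `Λ(H)`, so that no resolution of `A` is needed. -/
abbrev hyperH (H : ClosedSubgroup G) (A : PerfCx (Iwasawa p G)) (i : ℤ) : Type _ :=
  Hgy (BTensor.map (Iwasawa.ofSubgroup H).range (actO ρ θ) (A.d (-i - 1) (-i)))
    (BTensor.map (Iwasawa.ofSubgroup H).range (actO ρ θ) (A.d (-i) (-i + 1)))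

/-- The action of `g ∈ G` on `H_i(H, A(ρ^*))`. -/
def hyperAct (H : ClosedSubgroup G) [H.toSubgroup.Normal] (A : PerfCx (Iwasawa p G)) (i : ℤ)
    (g : G) : hyperH ρ θ H A i →ₗ[Integers p L] hyperH ρ θ H A i :=
  Hgy.map (gAct ρ θ H _ g) (fun x hx => by rw [← gAct_map, hx, map_zero])
    (fun x => ⟨gAct ρ θ H _ g x, gAct_map ρ θ H _ g x⟩)

/-- The submodule `H_i(H, A(ρ^*))^Γ` of elements that are fixed by `G`. -/
def hyperInv (H : ClosedSubgroup G) [H.toSubgroup.Normal] (A : PerfCx (Iwasawa p G)) (i : ℤ) :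
    Submodule (Integers p L) (hyperH ρ θ H A i) :=
  ⨅ g : G, LinearMap.ker (hyperAct ρ θ H A i g - LinearMap.id)

/-- The integer `r_G(A)(ρ) = ∑_i (-1)^{i+1} dim_L (H_i(H, A(ρ^*))^Γ ⊗_O L)`. -/
def rankG (H : ClosedSubgroup G) [H.toSubgroup.Normal] (A : PerfCx (Iwasawa p G)) : ℤ :=
  ∑ᶠ i : ℤ, (Int.negOnePow (i + 1) : ℤ) *
    (Module.finrank L (L ⊗[Integers p L] hyperInv ρ θ H A i) : ℤ)

/-- The differential module formed by the cohomology of `L^n ⊗_{Λ(G)} A`, sorted by parity, with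
zero differential. -/
def cohomZero (A : PerfCx (Iwasawa p G)) : DiffMod.{v, max v u} L where
  ev := Hgy (A.tensor (actL ρ θ)).dOd (A.tensor (actL ρ θ)).dEv
  od := Hgy (A.tensor (actL ρ θ)).dEv (A.tensor (actL ρ θ)).dOd
  dEv := 0
  dOd := 0

/-- The same module as `cohomZero` with the differentials given by the Bockstein maps. -/
def cohomBock (A : PerfCx (Iwasawa p G)) : DiffMod.{v, max v u} L where
  ev := Hgy (A.tensor (actL ρ θ)).dOd (A.tensor (actL ρ θ)).dEv
  od := Hgy (A.tensor (actL ρ θ)).dEv (A.tensor (actL ρ θ)).dOd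
  dEv := bockstein θ (actL ρ θ) A.dOd A.dEv A.dOd A.dEv_comp_dOd A.dOd_comp_dEv
  dOd := bockstein θ (actL ρ θ) A.dEv A.dOd A.dEv A.dOd_comp_dEv A.dEv_comp_dOd

/-- `c` is the leading term `(A, a)^*(ρ)`: it is `(-1)^{r_G(A)(ρ)}` times the element of `L^×` given by
the composite `1 → d_L(L^n ⊗ A) → 1` of the morphism induced by `a` and the inverse of the composite
`1 → d_L(H(L^n ⊗ A)) → d_L(L^n ⊗ A)`. Here the first map is given by the acyclicity of the complex
formed by the cohomology of `L^n ⊗ A` with the Bockstein maps, and the second one by a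
quasi-isomorphism `j` from the cohomology, with zero differential, to `L^n ⊗ A` that induces the
identity on cohomology. -/
def IsLeadingTerm (H : ClosedSubgroup G) [H.toSubgroup.Normal] (A : PerfCx (Iwasawa p G))
    (a : A.Triv) (c : L) : Prop :=
  ∃ (jEv : (cohomZero ρ θ A).ev →ₗ[L] (A.tensor (actL ρ θ)).ev)
    (jOd : (cohomZero ρ θ A).od →ₗ[L] (A.tensor (actL ρ θ)).od),
    (∀ x, ∃ h, (Submodule.Quotient.mk ⟨jEv x, h⟩ : (cohomZero ρ θ A).ev) = x) ∧
    (∀ x, ∃ h, (Submodule.Quotient.mk ⟨jOd x, h⟩ : (cohomZero ρ θ A).od) = x) ∧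
    ∃ (s : Contraction (cohomBock ρ θ A))
      (t : Contraction (cone (cohomZero ρ θ A) (A.tensor (actL ρ θ)) jEv jOd)),
      c = (-1) ^ rankG ρ θ H A * LinearMap.det
        (compareTriv (BTensor.congrProd ⊤ (actL ρ θ) a.iso)
          (compTriv t.acyc (s.acyc.prodCongr (LinearEquiv.refl L PUnit.{1})))).toLinearMap

/-- The homomorphism `ρ_* : K₁(Λ(G)_{S^*}) → K₁(M_n(Q_O(Γ))) ≅ Q_O(Γ)^×` attached to a ring
homomorphism `Λ(G)_{S^*} → M_n(Q_O(Γ))`. The isomorphism is the one given by Morita equivalence and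
the determinant. -/
def rhoStar {S : Set (Iwasawa p G)}
    (ρS : Loc (Iwasawa p G) S →+* Matrix (Fin n) (Fin n) (QGamma p L)) :
    K1 (Loc (Iwasawa p G) S) →* (QGamma p L)ˣ :=
  K1.det (actMatrix ρS)

end Setting

end LeadingTerm

end

open scoped TensorProduct

noncomputable section

set_option linter.unusedSectionVars false
set_option linter.unusedSimpArgs false

namespace LeadingTerm

universe u v w v' w'

/-! ### Invariants of automorphisms -/

section AutInv

/-- An invariant of automorphisms of finitely generated projective modules with the formal
properties of the class in `K₁`. -/
structure AutInv (B : Type v) [Ring B] (Γ : Type*) [CommGroup Γ] where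
  toFun : ∀ {P : Type w} [AddCommGroup P] [Module B P] [Module.Finite B P]
    [Module.Projective B P], (P ≃ₗ[B] P) → Γ
  comp' : ∀ {P : Type w} [AddCommGroup P] [Module B P] [Module.Finite B P]
    [Module.Projective B P] (α β : P ≃ₗ[B] P), toFun (β.trans α) = toFun α * toFun β
  prod' : ∀ {P Q : Type w} [AddCommGroup P] [Module B P] [Module.Finite B P]
    [Module.Projective B P] [AddCommGroup Q] [Module B Q] [Module.Finite B Q]
    [Module.Projective B Q] (α : P ≃ₗ[B] P) (β : Q ≃ₗ[B] Q),
    toFun (α.prodCongr β) = toFun α * toFun β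
  conj' : ∀ {P Q : Type w} [AddCommGroup P] [Module B P] [Module.Finite B P]
    [Module.Projective B P] [AddCommGroup Q] [Module B Q] [Module.Finite B Q]
    [Module.Projective B Q] (α : P ≃ₗ[B] P) (e : P ≃ₗ[B] Q),
    toFun ((e.symm.trans α).trans e) = toFun α

/-- The class in `K₁` as an invariant. -/
def AutInv.k1 (R : Type u) [Ring R] : AutInv.{u, u} R (K1 R) where
  toFun α := K1.mk α
  comp' {P} _ _ _ _ α β := by
    have h := congrArg Abelianization.of
      (PresentedGroup.one_of_mem (rels := {x | K1Rel R x}) (K1Rel.comp P α β))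
    exact mul_inv_eq_one.1 h
  prod' {P Q} _ _ _ _ _ _ _ _ α β := by
    have h := congrArg Abelianization.of
      (PresentedGroup.one_of_mem (rels := {x | K1Rel R x}) (K1Rel.sum P Q α β))
    exact mul_inv_eq_one.1 h
  conj' {P Q} _ _ _ _ _ _ _ _ α e := by
    have h := congrArg Abelianization.of
      (PresentedGroup.one_of_mem (rels := {x | K1Rel R x}) (K1Rel.iso P Q α e))
    exact mul_inv_eq_one.1 h

/-- The determinant over a field as an invariant. -/
def AutInv.det (K : Type v) [Field K] : AutInv.{v, w} K Kˣ where
  toFun α := LinearEquiv.det α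
  comp' α β := map_mul LinearEquiv.det α β
  prod' α β := by
    ext
    rw [Units.val_mul, LinearEquiv.coe_det, LinearEquiv.coe_det, LinearEquiv.coe_det,
      ← LinearMap.det_prodMap]
    rfl
  conj' α e := by
    ext
    rw [LinearEquiv.coe_det, LinearEquiv.coe_det, ← LinearMap.det_conj _ e]
    rfl

/-- Every invariant is trivial on automorphisms with trivial class in `K₁`. -/
theorem AutInv.eq_one_of_k1 {R : Type u} [Ring R] {Γ : Type*} [CommGroup Γ]
    (χ : AutInv.{u, u} R Γ) {P : Type u} [AddCommGroup P] [Module R P] [Module.Finite R P]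
    [Module.Projective R P] (α : P ≃ₗ[R] P) (h : K1.mk α = 1) : χ.toFun α = 1 := by
  have hf : ∀ r ∈ {x | K1Rel R x}, FreeGroup.lift (fun x : K1Gen R => χ.toFun x.auto) r = 1 := by
      rintro _ (⟨P, α, β⟩ | ⟨P, Q, α, β⟩ | ⟨P, Q, α, e⟩)
      · simp only [map_mul, map_inv, FreeGroup.lift_apply_of, χ.comp', mul_inv_cancel]
      · simp only [map_mul, map_inv, FreeGroup.lift_apply_of, χ.prod', mul_inv_cancel]
      · simp [χ.conj']
  let f : K1 R →* Γ := Abelianization.lift <| PresentedGroup.toGroup hf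
  have h1 : f (K1.mk α) = χ.toFun α := by
    exact PresentedGroup.toGroup.of hf
  rw [← h1, h, map_one]

namespace AutInv

variable {B : Type v} [Ring B] {Γ : Type*} [CommGroup Γ] (χ : AutInv.{v, w} B Γ)
variable {P Q P' Q' M N : Type w} [AddCommGroup P] [Module B P] [Module.Finite B P]
  [Module.Projective B P] [AddCommGroup Q] [Module B Q] [Module.Finite B Q]
  [Module.Projective B Q] [AddCommGroup P'] [Module B P'] [Module.Finite B P']
  [Module.Projective B P'] [AddCommGroup Q'] [Module B Q'] [Module.Finite B Q']
  [Module.Projective B Q'] [AddCommGroup M] [Module B M] [Module.Finite B M]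
  [Module.Projective B M] [AddCommGroup N] [Module B N] [Module.Finite B N]
  [Module.Projective B N]

theorem map_refl : χ.toFun (LinearEquiv.refl B P) = 1 := by
  have h := χ.comp' (LinearEquiv.refl B P) (LinearEquiv.refl B P)
  rw [LinearEquiv.trans_refl] at h
  exact left_eq_mul.1 h

theorem map_symm (α : P ≃ₗ[B] P) : χ.toFun α.symm = (χ.toFun α)⁻¹ := by
  rw [eq_inv_iff_mul_eq_one, ← χ.comp', LinearEquiv.self_trans_symm, χ.map_refl]

/-- The class of `φ` relative to `κ`, i.e. of `κ⁻¹ ∘ φ`. -/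
def rel (φ κ : P ≃ₗ[B] Q) : Γ := χ.toFun (φ.trans κ.symm)

theorem rel_self (φ : P ≃ₗ[B] Q) : χ.rel φ φ = 1 := by
  rw [rel, LinearEquiv.self_trans_symm, χ.map_refl]

theorem rel_mul_rel (φ κ μ : P ≃ₗ[B] Q) : χ.rel φ κ * χ.rel κ μ = χ.rel φ μ := by
  rw [rel, rel, rel, mul_comm, ← χ.comp']
  congr 1
  ext x
  simp

theorem rel_symm (φ κ : P ≃ₗ[B] Q) : χ.rel κ φ = (χ.rel φ κ)⁻¹ := by
  rw [eq_inv_iff_mul_eq_one, rel_mul_rel, rel_self]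

theorem rel_trans_left (e : P' ≃ₗ[B] P) (φ κ : P ≃ₗ[B] Q) :
    χ.rel (e.trans φ) (e.trans κ) = χ.rel φ κ := by
  rw [rel, rel, ← χ.conj' (φ.trans κ.symm) e.symm]
  congr 1

theorem rel_trans_right (φ κ : P ≃ₗ[B] Q) (e : Q ≃ₗ[B] Q') :
    χ.rel (φ.trans e) (κ.trans e) = χ.rel φ κ := by
  rw [rel, rel]
  congr 1
  ext x
  simp

theorem rel_prod (φ κ : P ≃ₗ[B] Q) (φ' κ' : P' ≃ₗ[B] Q') :
    χ.rel (φ.prodCongr φ') (κ.prodCongr κ') = χ.rel φ κ * χ.rel φ' κ' := by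
  rw [rel, rel, rel, ← χ.prod']
  congr 1

/-- The automorphism `(x, y) ↦ (x + f y, y)`. -/
def upper {P Q : Type*} [AddCommGroup P] [Module B P] [AddCommGroup Q] [Module B Q]
    (f : Q →ₗ[B] P) : (P × Q) ≃ₗ[B] (P × Q) where
  toFun x := (x.1 + f x.2, x.2)
  map_add' x y := by ext <;> simp; abel
  map_smul' c x := by ext <;> simp
  invFun x := (x.1 - f x.2, x.2)
  left_inv x := by simp
  right_inv x := by simp

/-- The automorphism `(x, y) ↦ (x, y + f x)`. -/
def lower {P Q : Type*} [AddCommGroup P] [Module B P] [AddCommGroup Q] [Module B Q]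
    (f : P →ₗ[B] Q) : (P × Q) ≃ₗ[B] (P × Q) where
  toFun x := (x.1, x.2 + f x.1)
  map_add' x y := by ext <;> simp; abel
  map_smul' c x := by ext <;> simp
  invFun x := (x.1, x.2 - f x.1)
  left_inv x := by simp
  right_inv x := by simp

/-- Unipotent automorphisms have trivial class: `(1 + n) ⊕ 1` is a commutator. -/
theorem eq_one_of_unipotent (α : P ≃ₗ[B] P) (n e : P →ₗ[B] P) (hα : ∀ x, α x = x + n x)
    (hne : ∀ x, n (e x) = n x) (hen : ∀ x, e (n x) = 0) : χ.toFun α = 1 := by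
  have h : α.prodCongr (LinearEquiv.refl B P) =
      (((lower e).symm.trans (upper n).symm).trans (lower e)).trans (upper n) := by
    have hnn : ∀ x, n (n x) = 0 := fun x => by rw [← hne (n x), hen, map_zero]
    ext x
    · simp [upper, lower, hα, hne, hnn]
      abel
    · simp [upper, lower, hen]
  have h2 : χ.toFun (α.prodCongr (LinearEquiv.refl B P)) = 1 := by
    rw [h, χ.comp', χ.comp', χ.comp', map_symm, map_symm]
    rw [← mul_inv, mul_comm (χ.toFun (upper n)) (χ.toFun (lower e)), ← mul_assoc,
      mul_comm (χ.toFun (upper n)) (χ.toFun (lower e)), mul_inv_cancel]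
  rw [χ.prod', map_refl, mul_one] at h2
  exact h2

theorem upper_eq_one (f : Q →ₗ[B] P) : χ.toFun (upper f) = 1 := by
  refine χ.eq_one_of_unipotent _ (LinearMap.inl B P Q ∘ₗ f ∘ₗ LinearMap.snd B P Q)
    (LinearMap.inr B P Q ∘ₗ LinearMap.snd B P Q) (fun x => ?_) (fun x => ?_) (fun x => ?_)
  · ext <;> simp [upper]
  · ext <;> simp
  · ext <;> simp

/-- The class of a triangular isomorphism is the product of the classes of the diagonal. -/
theorem rel_upper (φ : (P × P') ≃ₗ[B] (Q × Q')) (φ₁ κ₁ : P ≃ₗ[B] Q) (φ₂ κ₂ : P' ≃ₗ[B] Q')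
    (f : P' →ₗ[B] Q) (h : ∀ x y, φ (x, y) = (φ₁ x + f y, φ₂ y)) :
    χ.rel φ (κ₁.prodCongr κ₂) = χ.rel φ₁ κ₁ * χ.rel φ₂ κ₂ := by
  have h1 : φ = (upper (φ₁.symm.toLinearMap ∘ₗ f)).trans (φ₁.prodCongr φ₂) := by
    refine LinearEquiv.ext fun x => ?_
    obtain ⟨x, y⟩ := x
    rw [h]
    simp [upper]
  rw [← χ.rel_mul_rel φ (φ₁.prodCongr φ₂), rel_prod]
  have h2 : χ.rel φ (φ₁.prodCongr φ₂) = 1 := by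
    rw [h1, rel]
    have : ((upper (φ₁.symm.toLinearMap ∘ₗ f)).trans (φ₁.prodCongr φ₂)).trans
        (φ₁.prodCongr φ₂).symm = upper (φ₁.symm.toLinearMap ∘ₗ f) := by
      refine LinearEquiv.ext fun x => ?_
      simp
    rw [this, upper_eq_one]
  rw [h2, one_mul]

theorem compareTriv_eq (φ : (P × M) ≃ₗ[B] (Q × M)) (ψ : (P × N) ≃ₗ[B] (Q × N)) (κ : P ≃ₗ[B] Q) :
    χ.toFun (compareTriv φ ψ) = χ.rel φ (κ.prodCongr (LinearEquiv.refl B M)) *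
      (χ.rel ψ (κ.prodCongr (LinearEquiv.refl B N)))⁻¹ := by
  have h : compareTriv φ ψ = ((φ.trans (κ.prodCongr (LinearEquiv.refl B M)).symm).prodCongr
      (LinearEquiv.refl B N)).trans
      (((prodRightComm P N M).symm.trans
        ((ψ.trans (κ.prodCongr (LinearEquiv.refl B N)).symm).symm.prodCongr
          (LinearEquiv.refl B M))).trans (prodRightComm P N M)) := by
    refine LinearEquiv.ext fun x => ?_
    simp [compareTriv, prodRightComm]
  rw [h, χ.comp', χ.conj', χ.prod', χ.prod', map_refl, map_refl, map_symm, mul_one, mul_one,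
    mul_comm, rel, rel]

theorem rel_compTriv (τ τ₀ : (P' × Q) ≃ₗ[B] (Q' × P)) (φ : (P × M) ≃ₗ[B] (Q × M)) :
    χ.rel (compTriv τ φ) (compTriv τ₀ φ) = χ.rel τ τ₀ := by
  rw [compTriv, compTriv]
  rw [χ.rel_trans_left, χ.rel_trans_right, χ.rel_prod, χ.rel_trans_right, χ.rel_self, mul_one]

theorem rel_compTriv_upper (τ : (P' × Q) ≃ₗ[B] (Q' × P)) (φ : (P × M) ≃ₗ[B] (Q × M))
    (κ' : P' ≃ₗ[B] Q') (κ : P ≃ₗ[B] Q) (y : Q →ₗ[B] Q')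
    (h : ∀ x z, τ (x, z) = (κ' x + y z, -κ.symm z)) :
    χ.rel (compTriv τ φ) (κ'.prodCongr (LinearEquiv.refl B (P × M))) =
      χ.rel φ (κ.prodCongr (LinearEquiv.refl B M)) := by
  rw [χ.rel_upper _ κ' _ (φ.trans (κ.prodCongr (LinearEquiv.refl B M)).symm) _
    (y ∘ₗ LinearMap.fst B Q M ∘ₗ φ.toLinearMap), χ.rel_self, one_mul, rel, rel]
  · rfl
  · intro x z
    simp only [compTriv, LinearEquiv.trans_apply, LinearEquiv.prodCongr_apply]
    simp [h]
    exact ⟨rfl, rfl, rfl⟩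

/-- The class of a stable isomorphism does not change under an isomorphism of the stabilizing
module. -/
theorem rel_stab (φ : (P × M) ≃ₗ[B] (Q × M)) (κ : P ≃ₗ[B] Q) (e : M ≃ₗ[B] N)
    (ψ : (P × N) ≃ₗ[B] (Q × N))
    (h : ψ.toLinearMap ∘ₗ LinearMap.id.prodMap e.toLinearMap =
      LinearMap.id.prodMap e.toLinearMap ∘ₗ φ.toLinearMap) :
    χ.rel ψ (κ.prodCongr (LinearEquiv.refl B N)) =
      χ.rel φ (κ.prodCongr (LinearEquiv.refl B M)) := by
  rw [rel, rel, ← χ.conj' (φ.trans _) ((LinearEquiv.refl B P).prodCongr e)]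
  congr 1
  refine LinearEquiv.ext fun x => ?_
  obtain ⟨x, n⟩ := x
  obtain ⟨m, rfl⟩ := e.surjective n
  have h' := LinearMap.congr_fun h (x, m)
  simp only [LinearMap.comp_apply, LinearMap.prodMap_apply, LinearMap.id_apply,
    LinearEquiv.coe_coe] at h'
  simp [h']

end AutInv

/-! ### Contractions -/

namespace Contraction

variable {B : Type v} [Ring B] {X : DiffMod.{v, w} B}

theorem acyc_apply (s : Contraction X) (x : X.od) : s.acyc x = X.dOd x + s.sOd x := rfl

theorem acyc_symm_apply (s : Contraction X) (x : X.ev) : s.acyc.symm x = X.dEv x + s.sEv x := rfl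

theorem ddE (s : Contraction X) (x : X.ev) : X.dOd (X.dEv x) = 0 := LinearMap.congr_fun s.dd_ev x
theorem ddO (s : Contraction X) (x : X.od) : X.dEv (X.dOd x) = 0 := LinearMap.congr_fun s.dd_od x
theorem ssE (s : Contraction X) (x : X.ev) : s.sOd (s.sEv x) = 0 := LinearMap.congr_fun s.ss_ev x
theorem ssO (s : Contraction X) (x : X.od) : s.sEv (s.sOd x) = 0 := LinearMap.congr_fun s.ss_od x
theorem hoE (s : Contraction X) (x : X.ev) : X.dOd (s.sEv x) + s.sOd (X.dEv x) = x := LinearMap.congr_fun s.homotopy_ev x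
theorem hoO (s : Contraction X) (x : X.od) : X.dEv (s.sOd x) + s.sEv (X.dOd x) = x := LinearMap.congr_fun s.homotopy_od x
theorem dsdE (s : Contraction X) (x : X.ev) : X.dEv (s.sOd (X.dEv x)) = X.dEv x := by
  have h := s.hoO (X.dEv x)
  rwa [s.ddE, map_zero, add_zero] at h
theorem dsdO (s : Contraction X) (x : X.od) : X.dOd (s.sEv (X.dOd x)) = X.dOd x := by
  have h := s.hoE (X.dOd x)
  rwa [s.ddO, map_zero, add_zero] at h
theorem sdsO (s : Contraction X) (x : X.od) : s.sOd (X.dEv (s.sOd x)) = s.sOd x := by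
  have h := s.hoE (s.sOd x)
  rwa [s.ssO, map_zero, zero_add] at h

/-- The automorphism `ds + s'd` of the even part. -/
def changeEv (s s' : Contraction X) : X.ev ≃ₗ[B] X.ev :=
  LinearEquiv.ofLinearMap (X.dOd ∘ₗ s.sEv + s'.sOd ∘ₗ X.dEv) (X.dOd ∘ₗ s'.sEv + s.sOd ∘ₗ X.dEv)
    (LinearMap.ext fun x => by simp [s.dsdE, s.dsdO, s.ddE, s.ddO, s.ssE, s.ssO, s'.hoE])
    (LinearMap.ext fun x => by simp [s'.dsdE, s'.dsdO, s.ddE, s.ddO, s'.ssE, s'.ssO, s.hoE])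

/-- The automorphism `ds + s'd` of the odd part. -/
def changeOd (s s' : Contraction X) : X.od ≃ₗ[B] X.od :=
  LinearEquiv.ofLinearMap (X.dEv ∘ₗ s.sOd + s'.sEv ∘ₗ X.dOd) (X.dEv ∘ₗ s'.sOd + s.sEv ∘ₗ X.dOd)
    (LinearMap.ext fun x => by simp [s.dsdE, s.dsdO, s.ddE, s.ddO, s.ssE, s.ssO, s'.hoO])
    (LinearMap.ext fun x => by simp [s'.dsdE, s'.dsdO, s.ddE, s.ddO, s'.ssE, s'.ssO, s.hoO])

variable {Γ : Type*} [CommGroup Γ] (χ : AutInv.{v, w} B Γ) [Module.Finite B X.ev]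
  [Module.Projective B X.ev] [Module.Finite B X.od] [Module.Projective B X.od]

theorem changeEv_eq_one (s s' : Contraction X) : χ.toFun (changeEv s s') = 1 := by
  refine χ.eq_one_of_unipotent _ ((s'.sOd - s.sOd) ∘ₗ X.dEv) (s.sOd ∘ₗ X.dEv) (fun x => ?_)
    (fun x => ?_) (fun x => ?_)
  · have h := s.hoE x
    simp only [changeEv, LinearEquiv.coe_ofLinearMap, LinearMap.add_apply, LinearMap.comp_apply,
      LinearMap.sub_apply]
    rw [← eq_sub_iff_add_eq] at h
    rw [h]; abel
  · simp [s.dsdE]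
  · simp [s.dsdE, s'.dsdE]

theorem changeOd_eq_one (s s' : Contraction X) : χ.toFun (changeOd s s') = 1 := by
  refine χ.eq_one_of_unipotent _ ((s'.sEv - s.sEv) ∘ₗ X.dOd) (s.sEv ∘ₗ X.dOd) (fun x => ?_)
    (fun x => ?_) (fun x => ?_)
  · have h := s.hoO x
    simp only [changeOd, LinearEquiv.coe_ofLinearMap, LinearMap.add_apply, LinearMap.comp_apply,
      LinearMap.sub_apply]
    rw [← eq_sub_iff_add_eq] at h
    rw [h]; abel
  · simp [s.dsdO]
  · simp [s.dsdO, s'.dsdO]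

/-- The trivialisation given by acyclicity does not depend on the contraction. -/
theorem rel_acyc (s s' : Contraction X) : χ.rel s'.acyc s.acyc = 1 := by
  have h : s'.acyc.trans s.acyc.symm = (changeOd s s').symm.trans
      ((s.acyc.trans (changeEv s s')).trans s.acyc.symm) := by
    refine LinearEquiv.ext fun x => ?_
    obtain ⟨x, rfl⟩ := (changeOd s s').surjective x
    have : s'.acyc (changeOd s s' x) = changeEv s s' (s.acyc x) := by
      simp [changeOd, changeEv, acyc_apply, s.dsdO, s'.dsdO, s.ddO, s.ddE, s'.ssE, s.ssO]
    simp [this]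
  have h2 := χ.conj' (changeEv s s') s.acyc.symm
  rw [LinearEquiv.symm_symm] at h2
  rw [AutInv.rel, h, χ.comp', h2, χ.map_symm, changeEv_eq_one, changeOd_eq_one]
  simp


/-- A contraction from a homotopy without the condition `s² = 0`. -/
theorem exists_of_homotopy (Z : DiffMod.{v, w} B) (hEv : Z.ev →ₗ[B] Z.od) (hOd : Z.od →ₗ[B] Z.ev)
    (ddE : ∀ x, Z.dOd (Z.dEv x) = 0) (ddO : ∀ x, Z.dEv (Z.dOd x) = 0)
    (hoE : ∀ x, Z.dOd (hEv x) + hOd (Z.dEv x) = x) (hoO : ∀ x, Z.dEv (hOd x) + hEv (Z.dOd x) = x) :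
    ∃ t : Contraction Z, (∀ x, t.sEv x = hEv (Z.dOd (hEv x))) ∧
      ∀ x, t.sOd x = hOd (Z.dEv (hOd x)) := by
  have e1 : ∀ x, Z.dOd (hEv (Z.dOd x)) = Z.dOd x := fun x => by
    have := hoE (Z.dOd x); rwa [ddO, map_zero, add_zero] at this
  have e2 : ∀ x, Z.dEv (hOd (Z.dEv x)) = Z.dEv x := fun x => by
    have := hoO (Z.dEv x); rwa [ddE, map_zero, add_zero] at this
  have e3 : ∀ x, Z.dEv (hOd (hEv (Z.dOd x))) = 0 := fun x => by
    have := hoO (hEv (Z.dOd x))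
    rwa [e1, add_eq_right] at this
  have e4 : ∀ x, Z.dOd (hEv (hOd (Z.dEv x))) = 0 := fun x => by
    have := hoE (hOd (Z.dEv x))
    rwa [e2, add_eq_right] at this
  refine ⟨⟨hEv ∘ₗ Z.dOd ∘ₗ hEv, hOd ∘ₗ Z.dEv ∘ₗ hOd, LinearMap.ext ddE, LinearMap.ext ddO,
    LinearMap.ext fun x => ?_, LinearMap.ext fun x => ?_, LinearMap.ext fun x => ?_,
    LinearMap.ext fun x => ?_⟩, fun x => rfl, fun x => rfl⟩
  · simp [e3]
  · simp [e4]
  · simpa [e1, e2] using hoE x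
  · simpa [e1, e2] using hoO x

/-- A contraction of an extension of differential modules that is triangular, with given diagonal
entries. -/
theorem exists_extension {A' A'' Z : DiffMod.{v, w} B} (eEv : (A'.ev × A''.ev) ≃ₗ[B] Z.ev)
    (eOd : (A'.od × A''.od) ≃ₗ[B] Z.od) (xEv : A''.ev →ₗ[B] A'.od) (xOd : A''.od →ₗ[B] A'.ev)
    (hdEv : ∀ x y, Z.dEv (eEv (x, y)) = eOd (A'.dEv x + xEv y, A''.dEv y))
    (hdOd : ∀ x y, Z.dOd (eOd (x, y)) = eEv (A'.dOd x + xOd y, A''.dOd y))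
    (ddE : ∀ x, Z.dOd (Z.dEv x) = 0) (ddO : ∀ x, Z.dEv (Z.dOd x) = 0)
    (s' : Contraction A') (s'' : Contraction A'') :
    ∃ (t : Contraction Z) (yOd : A''.od →ₗ[B] A'.ev),
      ∀ x y, t.acyc (eOd (x, y)) = eEv (s'.acyc x + yOd y, s''.acyc y) := by
  have hE : ∀ y, A'.dOd (xEv y) = - xOd (A''.dEv y) := fun y => by
    have h := ddE (eEv (0, y))
    rw [hdEv, hdOd, map_zero, zero_add, EmbeddingLike.map_eq_zero_iff, Prod.mk_eq_zero] at h
    exact eq_neg_of_add_eq_zero_left h.1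
  have hO : ∀ y, A'.dEv (xOd y) = - xEv (A''.dOd y) := fun y => by
    have h := ddO (eOd (0, y))
    rw [hdOd, hdEv, map_zero, zero_add, EmbeddingLike.map_eq_zero_iff, Prod.mk_eq_zero] at h
    exact eq_neg_of_add_eq_zero_left h.1
  let tE : (A'.ev × A''.ev) →ₗ[B] (A'.od × A''.od) :=
    (s'.sEv ∘ₗ LinearMap.fst _ _ _ - s'.sEv ∘ₗ xOd ∘ₗ s''.sEv ∘ₗ LinearMap.snd _ _ _).prod
      (s''.sEv ∘ₗ LinearMap.snd _ _ _)
  let tO : (A'.od × A''.od) →ₗ[B] (A'.ev × A''.ev) :=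
    (s'.sOd ∘ₗ LinearMap.fst _ _ _ - s'.sOd ∘ₗ xEv ∘ₗ s''.sOd ∘ₗ LinearMap.snd _ _ _).prod
      (s''.sOd ∘ₗ LinearMap.snd _ _ _)
  have htE : ∀ x y, tE (x, y) = (s'.sEv x - s'.sEv (xOd (s''.sEv y)), s''.sEv y) := fun x y => rfl
  have htO : ∀ x y, tO (x, y) = (s'.sOd x - s'.sOd (xEv (s''.sOd y)), s''.sOd y) := fun x y => rfl
  refine ⟨⟨eOd.toLinearMap ∘ₗ tE ∘ₗ eEv.symm.toLinearMap,
    eEv.toLinearMap ∘ₗ tO ∘ₗ eOd.symm.toLinearMap, LinearMap.ext ddE, LinearMap.ext ddO,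
    LinearMap.ext fun z => ?_, LinearMap.ext fun z => ?_, LinearMap.ext fun z => ?_,
    LinearMap.ext fun z => ?_⟩, xOd - s'.sOd ∘ₗ xEv ∘ₗ s''.sOd, fun x y => ?_⟩
  · obtain ⟨⟨x, y⟩, rfl⟩ := eEv.surjective z
    simp [htE, htO, s'.ssE, s''.ssE]
  · obtain ⟨⟨x, y⟩, rfl⟩ := eOd.surjective z
    simp [htE, htO, s'.ssO, s''.ssO]
  · obtain ⟨⟨x, y⟩, rfl⟩ := eEv.surjective z
    have h1 := s'.hoE (xOd (s''.sEv y))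
    rw [hO, map_neg] at h1
    have h2 := congrArg (fun z => s'.sOd (xEv z)) (s''.hoE y)
    simp only [map_add] at h2
    simp only [LinearMap.add_apply, LinearMap.comp_apply, LinearEquiv.coe_coe,
      LinearEquiv.symm_apply_apply, htE, htO, hdEv, hdOd, LinearMap.id_apply, ← map_add,
      Prod.mk_add_mk]
    congr 1
    rw [Prod.mk.injEq]
    refine ⟨?_, s''.hoE y⟩
    nth_rewrite 3 [← s'.hoE x]
    rw [map_sub, map_add]
    grind
  · obtain ⟨⟨x, y⟩, rfl⟩ := eOd.surjective z
    have h1 := s'.hoO (xEv (s''.sOd y))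
    rw [hE, map_neg] at h1
    have h2 := congrArg (fun z => s'.sEv (xOd z)) (s''.hoO y)
    simp only [map_add] at h2
    simp only [LinearMap.add_apply, LinearMap.comp_apply, LinearEquiv.coe_coe,
      LinearEquiv.symm_apply_apply, htE, htO, hdEv, hdOd, LinearMap.id_apply, ← map_add,
      Prod.mk_add_mk]
    congr 1
    rw [Prod.mk.injEq]
    refine ⟨?_, s''.hoO y⟩
    nth_rewrite 3 [← s'.hoO x]
    rw [map_sub, map_add]
    grind
  · simp only [acyc_apply, LinearMap.comp_apply, LinearEquiv.coe_coe,
      LinearEquiv.symm_apply_apply, htO, hdOd, ← map_add, Prod.mk_add_mk, LinearMap.sub_apply]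
    congr 2
    abel

/-- The shift of a differential module. -/
abbrev _root_.LeadingTerm.DiffMod.shift (X : DiffMod.{v, w} B) : DiffMod.{v, w} B where
  ev := X.od
  od := X.ev
  dEv := -X.dOd
  dOd := -X.dEv

/-- The shift of a contraction. -/
def shift (s : Contraction X) : Contraction X.shift where
  sEv := -s.sOd
  sOd := -s.sEv
  dd_ev := LinearMap.ext fun x => by simp [s.ddO]
  dd_od := LinearMap.ext fun x => by simp [s.ddE]
  ss_ev := LinearMap.ext fun x => by simp [s.ssO]
  ss_od := LinearMap.ext fun x => by simp [s.ssE]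
  homotopy_ev := LinearMap.ext fun x => by simp [s.hoO]
  homotopy_od := LinearMap.ext fun x => by simp [s.hoE]

variable {X' : DiffMod.{v, w} B} [Module.Finite B X'.ev]
  [Module.Projective B X'.ev] [Module.Finite B X'.od] [Module.Projective B X'.od]
  {M N : Type w} [AddCommGroup M] [Module B M] [Module.Finite B M]
  [Module.Projective B M] [AddCommGroup N] [Module B N] [Module.Finite B N]
  [Module.Projective B N]

/-- The class of a trivialisation that is transported along a quasi-isomorphism of acyclic
differential modules. -/
theorem push_eq (sX : Contraction X) (sX' : Contraction X') (fEv : X.ev →ₗ[B] X'.ev)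
    (fOd : X.od →ₗ[B] X'.od) (t : Contraction (cone X X' fEv fOd))
    (φ : (X.od × M) ≃ₗ[B] (X.ev × M)) (a' : (X'.od × N) ≃ₗ[B] (X'.ev × N)) :
    χ.toFun (compareTriv a' (compTriv t.acyc φ)) =
      χ.rel a' (sX'.acyc.prodCongr (LinearEquiv.refl B N)) *
        (χ.rel φ (sX.acyc.prodCongr (LinearEquiv.refl B M)))⁻¹ := by
  have : Module.Finite B (cone X X' fEv fOd).ev := inferInstanceAs (Module.Finite B (X'.ev × X.od))
  have : Module.Finite B (cone X X' fEv fOd).od := inferInstanceAs (Module.Finite B (X'.od × X.ev))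
  have : Module.Projective B (cone X X' fEv fOd).ev :=
    inferInstanceAs (Module.Projective B (X'.ev × X.od))
  have : Module.Projective B (cone X X' fEv fOd).od :=
    inferInstanceAs (Module.Projective B (X'.od × X.ev))
  obtain ⟨t₀, y, hy⟩ := exists_extension (A' := X') (A'' := X.shift) (Z := cone X X' fEv fOd)
    (LinearEquiv.refl B (X'.ev × X.od)) (LinearEquiv.refl B (X'.od × X.ev)) fOd fEv
    (fun x y => rfl) (fun x y => rfl) t.ddE t.ddO sX' sX.shift
  obtain ⟨τ, hτ⟩ : ∃ τ : (X'.od × X.ev) ≃ₗ[B] (X'.ev × X.od), τ = t.acyc := ⟨_, rfl⟩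
  obtain ⟨τ₀, hτ₀⟩ : ∃ τ : (X'.od × X.ev) ≃ₗ[B] (X'.ev × X.od), τ = t₀.acyc := ⟨_, rfl⟩
  have hy' : ∀ x z, τ₀ (x, z) = (sX'.acyc x + y z, -sX.acyc.symm z) := fun x z => by
    rw [hτ₀]
    refine (hy x z).trans ?_
    change (sX'.acyc x + y z, -X.dEv z + -sX.sEv z) = _
    rw [acyc_symm_apply, neg_add]
  have h1 : χ.rel τ τ₀ = 1 := by
    rw [hτ, hτ₀]
    exact rel_acyc χ t₀ t
  have h3 : χ.toFun (compareTriv a' (compTriv t.acyc φ)) =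
      χ.toFun (compareTriv a' (compTriv τ φ)) := by rw [hτ]
  rw [h3, χ.compareTriv_eq a' _ sX'.acyc, ← χ.rel_mul_rel (compTriv τ φ) (compTriv τ₀ φ),
    χ.rel_compTriv, h1, one_mul, χ.rel_compTriv_upper τ₀ φ sX'.acyc sX.acyc y hy']

/-- Multiplicativity of the classes of trivialisations in extensions. -/
theorem rel_extension {A' A'' Z : DiffMod.{v, w} B} [Module.Finite B A'.ev]
    [Module.Projective B A'.ev] [Module.Finite B A'.od] [Module.Projective B A'.od]
    [Module.Finite B A''.ev] [Module.Projective B A''.ev] [Module.Finite B A''.od]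
    [Module.Projective B A''.od] [Module.Finite B Z.ev]
    [Module.Projective B Z.ev] [Module.Finite B Z.od] [Module.Projective B Z.od]
    (eEv : (A'.ev × A''.ev) ≃ₗ[B] Z.ev)
    (eOd : (A'.od × A''.od) ≃ₗ[B] Z.od) (xEv : A''.ev →ₗ[B] A'.od) (xOd : A''.od →ₗ[B] A'.ev)
    (hdEv : ∀ x y, Z.dEv (eEv (x, y)) = eOd (A'.dEv x + xEv y, A''.dEv y))
    (hdOd : ∀ x y, Z.dOd (eOd (x, y)) = eEv (A'.dOd x + xOd y, A''.dOd y))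
    (s' : Contraction A') (s'' : Contraction A'') (t : Contraction Z) :
    χ.rel t.acyc (eOd.symm.trans ((s'.acyc.prodCongr s''.acyc).trans eEv)) = 1 := by
  obtain ⟨t₀, y, hy⟩ := exists_extension eEv eOd xEv xOd hdEv hdOd t.ddE t.ddO s' s''
  rw [← χ.rel_mul_rel _ t₀.acyc, rel_acyc, one_mul, ← χ.rel_trans_left eOd,
    ← LinearEquiv.trans_assoc, LinearEquiv.self_trans_symm, LinearEquiv.refl_trans,
    ← χ.rel_trans_right _ _ eEv.symm, LinearEquiv.trans_assoc, LinearEquiv.trans_assoc,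
    LinearEquiv.self_trans_symm, LinearEquiv.trans_refl,
    χ.rel_upper _ s'.acyc _ s''.acyc _ y, χ.rel_self, χ.rel_self, one_mul]
  intro x z
  simp [hy]

end Contraction
end AutInv

/-! ### Functoriality of trivialisations in tensor products -/

namespace BTensor

variable {R : Type u} [Ring R] {B : Type v} [Ring B] {Y : Type w} [AddCommGroup Y] [Module B Y]
  (act : Rᵐᵒᵖ →+* Module.End B Y)
variable {M N P Q M' P' : Type*} [AddCommGroup M] [Module R M] [AddCommGroup N] [Module R N]
  [AddCommGroup P] [Module R P] [AddCommGroup Q] [Module R Q] [AddCommGroup M'] [Module R M']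
  [AddCommGroup P'] [Module R P']

@[elab_as_elim]
theorem induction_on {R₀ : Subring R} {act : Rᵐᵒᵖ →+* Module.End B Y}
    {motive : BTensor R₀ act M → Prop} (z : BTensor R₀ act M)
    (tmul : ∀ y m, motive (tmul R₀ act y m)) (add : ∀ a b, motive a → motive b → motive (a + b))
    (zero : motive 0) : motive z := by
  obtain ⟨z, rfl⟩ := Submodule.Quotient.mk_surjective _ z
  induction z using TensorProduct.induction_on with
  | zero => exact zero
  | tmul y m => exact tmul y m
  | add a b ha hb => exact add _ _ ha hb

theorem tmul_zero (R₀ : Subring R) (y : Y) : tmul R₀ act y (0 : M) = 0 := by simp [tmul]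

theorem tmul_neg (R₀ : Subring R) (y : Y) (m : M) : tmul R₀ act y (-m) = -tmul R₀ act y m := by
  simp [tmul, TensorProduct.tmul_neg]

theorem zero_tmul (R₀ : Subring R) (m : M) : tmul R₀ act 0 m = 0 := by simp [tmul]

@[simp] theorem prodEquiv_tmul (y : Y) (m : M) (p : P) :
    prodEquiv ⊤ act M P (tmul ⊤ act y (m, p)) = (tmul ⊤ act y m, tmul ⊤ act y p) := rfl

@[simp] theorem prodEquiv_symm_tmul (y : Y) (m : M) (p : P) :
    (prodEquiv ⊤ act M P).symm (tmul ⊤ act y m, tmul ⊤ act y p) = tmul ⊤ act y (m, p) := by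
  rw [LinearEquiv.symm_apply_eq]; rfl

@[simp] theorem congr_tmul (f : M ≃ₗ[R] N) (y : Y) (m : M) :
    congr ⊤ act f (tmul ⊤ act y m) = tmul ⊤ act y (f m) := rfl

theorem prod_hom_ext {V : Type*} [AddCommGroup V] [Module B V]
    {f g : (BTensor ⊤ act M × BTensor ⊤ act P) →ₗ[B] V}
    (h : ∀ y m p, f (tmul ⊤ act y m, tmul ⊤ act y p) = g (tmul ⊤ act y m, tmul ⊤ act y p)) :
    f = g := by
  have h2 : f ∘ₗ (prodEquiv ⊤ act M P).toLinearMap = g ∘ₗ (prodEquiv ⊤ act M P).toLinearMap :=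
    hom_ext fun y m => h y m.1 m.2
  exact (LinearMap.cancel_right (prodEquiv ⊤ act M P).surjective).1 h2

/-- The map `(Y ⊗ M) ⊕ (Y ⊗ P) → (Y ⊗ N) ⊕ (Y ⊗ Q)` induced by `M ⊕ P → N ⊕ Q`. -/
def mapProd (f : (M × P) →ₗ[R] (N × Q)) :
    (BTensor ⊤ act M × BTensor ⊤ act P) →ₗ[B] (BTensor ⊤ act N × BTensor ⊤ act Q) :=
  (prodEquiv ⊤ act N Q).toLinearMap ∘ₗ map ⊤ act f ∘ₗ (prodEquiv ⊤ act M P).symm.toLinearMap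

@[simp] theorem mapProd_tmul (f : (M × P) →ₗ[R] (N × Q)) (y : Y) (m : M) (p : P) :
    mapProd act f (tmul ⊤ act y m, tmul ⊤ act y p) =
      (tmul ⊤ act y (f (m, p)).1, tmul ⊤ act y (f (m, p)).2) := by
  simp only [mapProd, LinearMap.comp_apply, LinearEquiv.coe_coe, prodEquiv_symm_tmul, map_tmul]
  rfl

@[simp] theorem congrProd_tmul (f : (M × P) ≃ₗ[R] (N × P)) (y : Y) (m : M) (p : P) :
    congrProd ⊤ act f (tmul ⊤ act y m, tmul ⊤ act y p) =
      (tmul ⊤ act y (f (m, p)).1, tmul ⊤ act y (f (m, p)).2) := by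
  simp only [congrProd, LinearEquiv.trans_apply, prodEquiv_symm_tmul, congr_tmul]
  rfl

@[simp] theorem congrProd_symm_tmul (f : (M × P) ≃ₗ[R] (N × P)) (y : Y) (m : N) (p : P) :
    (congrProd ⊤ act f).symm (tmul ⊤ act y m, tmul ⊤ act y p) =
      (tmul ⊤ act y (f.symm (m, p)).1, tmul ⊤ act y (f.symm (m, p)).2) := by
  rw [LinearEquiv.symm_apply_eq, congrProd_tmul]
  simp

theorem mapProd_comp (f : (M × P) →ₗ[R] (N × Q)) (g : (N × Q) →ₗ[R] (M' × P')) :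
    mapProd act (g ∘ₗ f) = mapProd act g ∘ₗ mapProd act f :=
  prod_hom_ext act fun y m p => by simp

theorem mapProd_id : mapProd act (LinearMap.id : (M × P) →ₗ[R] (M × P)) = LinearMap.id :=
  prod_hom_ext act fun y m p => by simp

theorem mapProd_add (f g : (M × P) →ₗ[R] (N × Q)) :
    mapProd act (f + g) = mapProd act f + mapProd act g :=
  prod_hom_ext act fun y m p => by simp [tmul_add]

theorem mapProd_zero : mapProd act (0 : (M × P) →ₗ[R] (N × Q)) = 0 :=
  prod_hom_ext act fun y m p => by simp [tmul_zero]

end BTensor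

section Pull

variable {R : Type u} [Ring R] {B : Type u} [Ring B] {Γ : Type*} [CommGroup Γ]

/-- The invariant `α ↦ χ(B ⊗_R α)`. -/
def AutInv.pull (χ : AutInv.{u, u} B Γ) (φ : R →+* B) : AutInv.{u, u} R Γ where
  toFun α := χ.toFun (BTensor.congr ⊤ (actRing φ) α)
  comp' α β := by
    rw [← χ.comp']
    congr 1
    exact LinearEquiv.toLinearMap_injective (BTensor.map_comp ⊤ _ _ _)
  prod' {P Q} _ _ _ _ _ _ _ _ α β := by
    rw [← χ.prod', ← χ.conj' _ (BTensor.prodEquiv ⊤ (actRing φ) P Q)]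
    congr 1
    refine LinearEquiv.toLinearMap_injective (BTensor.prod_hom_ext _ fun y m p => ?_)
    simp
  conj' α e := by
    rw [← χ.conj' (BTensor.congr ⊤ (actRing φ) α) (BTensor.congr ⊤ (actRing φ) e)]
    congr 1
    exact LinearEquiv.toLinearMap_injective (BTensor.hom_ext fun y m => rfl)

variable (χ : AutInv.{u, u} B Γ) (φ : R →+* B)

theorem AutInv.pull_compareTriv {P Q M N : Type u} [AddCommGroup P] [Module R P] [AddCommGroup Q]
    [Module R Q] [AddCommGroup M] [Module R M] [AddCommGroup N] [Module R N]
    [Module.Finite R P] [Module.Projective R P] [Module.Finite R M] [Module.Projective R M]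
    [Module.Finite R N] [Module.Projective R N]
    (f : (P × M) ≃ₗ[R] (Q × M)) (g : (P × N) ≃ₗ[R] (Q × N)) :
    (χ.pull φ).toFun (compareTriv f g) = χ.toFun (compareTriv
      (BTensor.congrProd ⊤ (actRing φ) f) (BTensor.congrProd ⊤ (actRing φ) g)) := by
  rw [AutInv.pull, ← χ.conj' _ ((BTensor.prodEquiv ⊤ (actRing φ) (P × M) N).trans
    ((BTensor.prodEquiv ⊤ (actRing φ) P M).prodCongr (LinearEquiv.refl _ _)))]
  congr 1
  have h : ∀ z : BTensor ⊤ (actRing φ) ((P × M) × N),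
      ((BTensor.prodEquiv ⊤ (actRing φ) (P × M) N).trans
        ((BTensor.prodEquiv ⊤ (actRing φ) P M).prodCongr (LinearEquiv.refl _ _)))
        (BTensor.congr ⊤ (actRing φ) (compareTriv f g) z) =
      compareTriv (BTensor.congrProd ⊤ (actRing φ) f) (BTensor.congrProd ⊤ (actRing φ) g)
        (((BTensor.prodEquiv ⊤ (actRing φ) (P × M) N).trans
          ((BTensor.prodEquiv ⊤ (actRing φ) P M).prodCongr (LinearEquiv.refl _ _))) z) := by
    intro z
    induction z using BTensor.induction_on with
    | tmul y m =>
      obtain ⟨⟨p, m⟩, n⟩ := m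
      simp [compareTriv, prodRightComm]
    | add a b ha hb => rw [map_add, map_add, ha, hb, map_add, map_add]
    | zero => rw [map_zero, map_zero, map_zero]
  refine LinearEquiv.ext fun z => (h _).trans ?_
  exact congrArg _ (LinearEquiv.apply_symm_apply _ _)

end Pull

section CharElement

variable {R : Type u} [Ring R]

namespace PerfCx

theorem mapOd_dEv {C D : PerfCx R} (f : C.cx ⟶ D.cx) (x : C.ev) :
    mapOd f (C.dEv x) = D.dEv (mapEv f x) := by
  refine LinearMap.congr_fun (f := mapOd f ∘ₗ C.dEv) (g := D.dEv ∘ₗ mapEv f)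
    (DirectSum.linearMap_ext R fun i => LinearMap.ext fun x => ?_) x
  have h := LinearMap.congr_fun (congrArg ModuleCat.Hom.hom (f.comm i.1 (i.1 + 1))) x
  simp only [LinearMap.comp_apply, dEv, mapEv, mapOd, DirectSum.toModule_lof, DirectSum.lmap_lof]
  exact congrArg _ h.symm

theorem mapEv_dOd {C D : PerfCx R} (f : C.cx ⟶ D.cx) (x : C.od) :
    mapEv f (C.dOd x) = D.dOd (mapOd f x) := by
  refine LinearMap.congr_fun (f := mapEv f ∘ₗ C.dOd) (g := D.dOd ∘ₗ mapOd f)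
    (DirectSum.linearMap_ext R fun i => LinearMap.ext fun x => ?_) x
  have h := LinearMap.congr_fun (congrArg ModuleCat.Hom.hom (f.comm i.1 (i.1 + 1))) x
  simp only [LinearMap.comp_apply, dOd, mapEv, mapOd, DirectSum.toModule_lof, DirectSum.lmap_lof]
  exact congrArg _ h.symm

end PerfCx

variable {B : Type u} [Ring B] (φ : R →+* B) {Γ : Type*} [CommGroup Γ] (χ : AutInv.{u, u} B Γ)

/-- The class of the trivialisation of `B ⊗ C` induced by `a` relative to the one given by a
contraction. -/
def charClass {C : PerfCx R} (a : C.Triv) (s : Contraction (C.tensor (actRing φ))) : Γ :=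
  χ.rel (BTensor.congrProd ⊤ (actRing φ) a.iso)
    (s.acyc.prodCongr (LinearEquiv.refl B (BTensor ⊤ (actRing φ) a.stab)))

/-- The contraction of the cone of `Y ⊗ f` induced by a contraction of the cone of `f`. -/
def tensorCone {Y : Type w} {B : Type v} [Ring B] [AddCommGroup Y] [Module B Y]
    (act : Rᵐᵒᵖ →+* Module.End B Y) {C D : PerfCx R} (f : C.cx ⟶ D.cx)
    (s : Contraction (cone C.fold D.fold (PerfCx.mapEv f) (PerfCx.mapOd f))) :
    Contraction (cone (C.tensor act) (D.tensor act) (BTensor.map ⊤ act (PerfCx.mapEv f))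
      (BTensor.map ⊤ act (PerfCx.mapOd f))) := by
  let dE : (D.ev × C.od) →ₗ[R] (D.od × C.ev) :=
    (D.dEv ∘ₗ LinearMap.fst _ _ _ + PerfCx.mapOd f ∘ₗ LinearMap.snd _ _ _).prod
      (-(C.dOd ∘ₗ LinearMap.snd _ _ _))
  let dO : (D.od × C.ev) →ₗ[R] (D.ev × C.od) :=
    (D.dOd ∘ₗ LinearMap.fst _ _ _ + PerfCx.mapEv f ∘ₗ LinearMap.snd _ _ _).prod
      (-(C.dEv ∘ₗ LinearMap.snd _ _ _))
  let sE : (D.ev × C.od) →ₗ[R] (D.od × C.ev) := s.sEv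
  let sO : (D.od × C.ev) →ₗ[R] (D.ev × C.od) := s.sOd
  have hE : (BTensor.map ⊤ act D.dEv ∘ₗ LinearMap.fst _ _ _ +
      BTensor.map ⊤ act (PerfCx.mapOd f) ∘ₗ LinearMap.snd _ _ _).prod
      (-(BTensor.map ⊤ act C.dOd ∘ₗ LinearMap.snd _ _ _)) = BTensor.mapProd act dE := by
    refine BTensor.prod_hom_ext act fun y m p => ?_
    rw [BTensor.mapProd_tmul]
    simp [dE, BTensor.tmul_add, BTensor.tmul_neg]
  have hO : (BTensor.map ⊤ act D.dOd ∘ₗ LinearMap.fst _ _ _ +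
      BTensor.map ⊤ act (PerfCx.mapEv f) ∘ₗ LinearMap.snd _ _ _).prod
      (-(BTensor.map ⊤ act C.dEv ∘ₗ LinearMap.snd _ _ _)) = BTensor.mapProd act dO := by
    refine BTensor.prod_hom_ext act fun y m p => ?_
    rw [BTensor.mapProd_tmul]
    simp [dO, BTensor.tmul_add, BTensor.tmul_neg]
  have c1 {f : (D.od × C.ev) →ₗ[R] (D.ev × C.od)} {g : (D.ev × C.od) →ₗ[R] (D.od × C.ev)}
      (h : f ∘ₗ g = 0) : BTensor.mapProd act f ∘ₗ BTensor.mapProd act g = 0 := by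
    rw [← BTensor.mapProd_comp, h, BTensor.mapProd_zero]
  have c2 {f : (D.od × C.ev) →ₗ[R] (D.ev × C.od)} {g : (D.ev × C.od) →ₗ[R] (D.od × C.ev)}
      (h : g ∘ₗ f = 0) : BTensor.mapProd act g ∘ₗ BTensor.mapProd act f = 0 := by
    rw [← BTensor.mapProd_comp, h, BTensor.mapProd_zero]
  refine ⟨BTensor.mapProd act sE, BTensor.mapProd act sO, ?_, ?_, c1 s.ss_ev, c2 s.ss_od, ?_, ?_⟩
  · exact (congrArg₂ (fun a b => LinearMap.comp a b) hO hE).trans (c1 s.dd_ev)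
  · exact (congrArg₂ (fun a b => LinearMap.comp a b) hE hO).trans (c2 s.dd_od)
  · have h : BTensor.mapProd act dO ∘ₗ BTensor.mapProd act sE +
        BTensor.mapProd act sO ∘ₗ BTensor.mapProd act dE = LinearMap.id := by
      rw [← BTensor.mapProd_comp, ← BTensor.mapProd_comp, ← BTensor.mapProd_add]
      exact (congrArg _ s.homotopy_ev).trans (BTensor.mapProd_id act)
    rw [← hE, ← hO] at h
    exact h
  · have h : BTensor.mapProd act dE ∘ₗ BTensor.mapProd act sO +
        BTensor.mapProd act sE ∘ₗ BTensor.mapProd act dO = LinearMap.id := by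
      rw [← BTensor.mapProd_comp, ← BTensor.mapProd_comp, ← BTensor.mapProd_add]
      exact (congrArg _ s.homotopy_od).trans (BTensor.mapProd_id act)
    rw [← hE, ← hO] at h
    exact h

theorem tensorCone_acyc_tmul {Y : Type w} {B : Type v} [Ring B] [AddCommGroup Y] [Module B Y]
    (act : Rᵐᵒᵖ →+* Module.End B Y) {C D : PerfCx R} (f : C.cx ⟶ D.cx)
    (s : Contraction (cone C.fold D.fold (PerfCx.mapEv f) (PerfCx.mapOd f)))
    (τ : (D.od × C.ev) ≃ₗ[R] (D.ev × C.od)) (hτ : τ = s.acyc) (y : Y) (m : D.od) (p : C.ev) :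
    (tensorCone act f s).acyc (BTensor.tmul ⊤ act y m, BTensor.tmul ⊤ act y p) =
      (BTensor.tmul ⊤ act y (τ (m, p)).1, BTensor.tmul ⊤ act y (τ (m, p)).2) := by
  subst hτ
  have h := BTensor.mapProd_tmul act (N := D.ev) (Q := C.od) s.sOd y m p
  obtain ⟨z, hz⟩ : ∃ z : D.ev × C.od, z = s.sOd (m, p) := ⟨_, rfl⟩
  have hz' : s.acyc (m, p) = (D.dOd m + PerfCx.mapEv f p + z.1, -C.dEv p + z.2) := by
    rw [hz]; rfl
  have h2 : (tensorCone act f s).acyc (BTensor.tmul ⊤ act y m, BTensor.tmul ⊤ act y p) =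
      (BTensor.map ⊤ act D.dOd (BTensor.tmul ⊤ act y m) +
      BTensor.map ⊤ act (PerfCx.mapEv f) (BTensor.tmul ⊤ act y p) + BTensor.tmul ⊤ act y z.1,
      -BTensor.map ⊤ act C.dEv (BTensor.tmul ⊤ act y p) + BTensor.tmul ⊤ act y z.2) := by
    rw [hz]
    exact congrArg₂ (fun a b => a + b) (rfl : (BTensor.map ⊤ act D.dOd (BTensor.tmul ⊤ act y m) +
      BTensor.map ⊤ act (PerfCx.mapEv f) (BTensor.tmul ⊤ act y p),
      -BTensor.map ⊤ act C.dEv (BTensor.tmul ⊤ act y p)) = _) h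
  refine h2.trans ?_
  have h3 : ∀ w : D.ev × C.od, w = (D.dOd m + PerfCx.mapEv f p + z.1, -C.dEv p + z.2) →
      (BTensor.map ⊤ act D.dOd (BTensor.tmul ⊤ act y m) +
      BTensor.map ⊤ act (PerfCx.mapEv f) (BTensor.tmul ⊤ act y p) + BTensor.tmul ⊤ act y z.1,
      -BTensor.map ⊤ act C.dEv (BTensor.tmul ⊤ act y p) + BTensor.tmul ⊤ act y z.2) =
      (BTensor.tmul ⊤ act y w.1, BTensor.tmul ⊤ act y w.2) := by
    rintro w rfl
    simp [BTensor.tmul_add, BTensor.tmul_neg]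
  exact h3 _ hz'

theorem charClass_push {C D : PerfCx R} (f : C.cx ⟶ D.cx) (a : C.Triv) (a' : D.Triv)
    (h : PerfCx.IsPush f a a') (sC : Contraction (C.tensor (actRing φ)))
    (sD : Contraction (D.tensor (actRing φ))) :
    charClass φ χ a' sD = charClass φ χ a sC := by
  obtain ⟨s, hs⟩ := h
  obtain ⟨τ, hτ⟩ : ∃ τ : (D.od × C.ev) ≃ₗ[R] (D.ev × C.od), τ = s.acyc := ⟨_, rfl⟩
  have hs' := (χ.pull φ).eq_one_of_k1 (compareTriv a'.iso (compTriv τ a.iso)) (by rw [hτ]; exact hs)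
  rw [χ.pull_compareTriv, χ.compareTriv_eq _ _ sD.acyc, mul_inv_eq_one] at hs'
  obtain ⟨τ', hτ'⟩ : ∃ τ : (BTensor ⊤ (actRing φ) D.od × BTensor ⊤ (actRing φ) C.ev) ≃ₗ[B]
    (BTensor ⊤ (actRing φ) D.ev × BTensor ⊤ (actRing φ) C.od), τ = (tensorCone (actRing φ) f s).acyc
    := ⟨_, rfl⟩
  have hτ2 : ∀ y m p, τ' (BTensor.tmul ⊤ (actRing φ) y m, BTensor.tmul ⊤ (actRing φ) y p) =
      (BTensor.tmul ⊤ (actRing φ) y (τ (m, p)).1, BTensor.tmul ⊤ (actRing φ) y (τ (m, p)).2) := by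
    intro y m p
    rw [hτ']
    exact tensorCone_acyc_tmul (actRing φ) f s τ hτ y m p
  have h1 := Contraction.push_eq χ sC sD _ _ (tensorCone (actRing φ) f s)
    (BTensor.congrProd ⊤ (actRing φ) a.iso) (BTensor.congrProd ⊤ (actRing φ) a'.iso)
  have h2 : χ.toFun (compareTriv (BTensor.congrProd ⊤ (actRing φ) a'.iso)
      (compTriv τ' (BTensor.congrProd ⊤ (actRing φ) a.iso))) = 1 := by
    rw [χ.compareTriv_eq _ _ sD.acyc, hs', mul_inv_eq_one]
    symm
    refine χ.rel_stab _ _ (BTensor.prodEquiv ⊤ (actRing φ) C.od a.stab) _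
      (BTensor.prod_hom_ext _ fun y x p => ?_)
    obtain ⟨c, m⟩ := p
    have e1 : ∀ x c m, compTriv τ a.iso (x, (c, m)) = ((τ (x, (a.iso (c, m)).1)).1,
      (-(τ (x, (a.iso (c, m)).1)).2, (a.iso (c, m)).2)) := fun _ _ _ => rfl
    have e2 : ∀ x c, compTriv τ' (BTensor.congrProd ⊤ (actRing φ) a.iso) (x, c) =
      ((τ' (x, (BTensor.congrProd ⊤ (actRing φ) a.iso c).1)).1,
      (-(τ' (x, (BTensor.congrProd ⊤ (actRing φ) a.iso c).1)).2,
        (BTensor.congrProd ⊤ (actRing φ) a.iso c).2)) := fun _ _ => rfl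
    simp only [LinearMap.comp_apply, LinearMap.prodMap_apply, LinearMap.id_apply,
      LinearEquiv.coe_coe, BTensor.prodEquiv_tmul, BTensor.congrProd_tmul, e1, e2, hτ2,
      BTensor.tmul_neg]
  rw [hτ'] at h2
  exact mul_inv_eq_one.1 (h1.symm.trans h2)

theorem charClass_prod {C' C C'' : PerfCx R} (f : C'.cx ⟶ C.cx) (g : C.cx ⟶ C''.cx)
    (a' : C'.Triv) (a : C.Triv) (a'' : C''.Triv) (h : PerfCx.IsProd f g a' a a'')
    (s' : Contraction (C'.tensor (actRing φ))) (s : Contraction (C.tensor (actRing φ)))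
    (s'' : Contraction (C''.tensor (actRing φ))) :
    charClass φ χ a s = charClass φ χ a' s' * charClass φ χ a'' s'' := by
  obtain ⟨eEv, eOd, h1, h2, h3, h4, h5⟩ := h
  have h6 := (χ.pull φ).eq_one_of_k1 _ h5
  rw [χ.pull_compareTriv, χ.compareTriv_eq _ _ s.acyc, mul_inv_eq_one] at h6
  refine h6.trans ?_
  let fEv := (BTensor.prodEquiv ⊤ (actRing φ) C'.ev C''.ev).symm.trans
    (BTensor.congr ⊤ (actRing φ) eEv)
  let fOd := (BTensor.prodEquiv ⊤ (actRing φ) C'.od C''.od).symm.trans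
    (BTensor.congr ⊤ (actRing φ) eOd)
  have hfE : ∀ y m p, fEv (BTensor.tmul ⊤ (actRing φ) y m, BTensor.tmul ⊤ (actRing φ) y p) =
      BTensor.tmul ⊤ (actRing φ) y (eEv (m, p)) := fun y m p => by simp [fEv]
  have hfO : ∀ y m p, fOd (BTensor.tmul ⊤ (actRing φ) y m, BTensor.tmul ⊤ (actRing φ) y p) =
      BTensor.tmul ⊤ (actRing φ) y (eOd (m, p)) := fun y m p => by simp [fOd]
  have hfO' : ∀ y m, fOd.symm (BTensor.tmul ⊤ (actRing φ) y m) =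
      (BTensor.tmul ⊤ (actRing φ) y (eOd.symm m).1, BTensor.tmul ⊤ (actRing φ) y (eOd.symm m).2) :=
    fun y m => by rw [LinearEquiv.symm_apply_eq, hfO]; simp
  let F := BTensor.congrProd ⊤ (actRing φ) a'.iso
  let F'' := BTensor.congrProd ⊤ (actRing φ) a''.iso
  let Ψ := ((fOd.symm.prodCongr (LinearEquiv.refl B (BTensor ⊤ (actRing φ) a'.stab ×
    BTensor ⊤ (actRing φ) a''.stab))).trans
      ((LinearEquiv.prodProdProdComm B _ _ _ _).trans ((F.prodCongr F'').trans
        (LinearEquiv.prodProdProdComm B _ _ _ _)))).trans (fEv.prodCongr (LinearEquiv.refl B _))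
  let xEv : C''.ev →ₗ[R] C'.od := LinearMap.fst R _ _ ∘ₗ eOd.symm.toLinearMap ∘ₗ C.dEv ∘ₗ
    eEv.toLinearMap ∘ₗ LinearMap.inr R _ _
  let xOd : C''.od →ₗ[R] C'.ev := LinearMap.fst R _ _ ∘ₗ eEv.symm.toLinearMap ∘ₗ C.dOd ∘ₗ
    eOd.toLinearMap ∘ₗ LinearMap.inr R _ _
  have hdE : ∀ x y, C.dEv (eEv (x, y)) = eOd (C'.dEv x + xEv y, C''.dEv y) := fun x y => by
    have e1 : C.dEv (eEv (0, y)) = eOd (xEv y, C''.dEv y) := by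
      rw [← LinearEquiv.symm_apply_eq]
      ext1
      · rfl
      · have := h4 (eOd.symm (C.dEv (eEv (0, y)))).1 (eOd.symm (C.dEv (eEv (0, y)))).2
        rw [← this, Prod.mk.eta, LinearEquiv.apply_symm_apply, PerfCx.mapOd_dEv, h2]
    have e2 : ((x, y) : C'.ev × C''.ev) = (x, 0) + (0, y) := by simp
    rw [e2, map_add, map_add, h1, ← PerfCx.mapOd_dEv, ← h3, e1, ← map_add]
    simp
  have hdO : ∀ x y, C.dOd (eOd (x, y)) = eEv (C'.dOd x + xOd y, C''.dOd y) := fun x y => by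
    have e1 : C.dOd (eOd (0, y)) = eEv (xOd y, C''.dOd y) := by
      rw [← LinearEquiv.symm_apply_eq]
      ext1
      · rfl
      · have := h2 (eEv.symm (C.dOd (eOd (0, y)))).1 (eEv.symm (C.dOd (eOd (0, y)))).2
        rw [← this, Prod.mk.eta, LinearEquiv.apply_symm_apply, PerfCx.mapEv_dOd, h4]
    have e2 : ((x, y) : C'.od × C''.od) = (x, 0) + (0, y) := by simp
    rw [e2, map_add, map_add, h3, ← PerfCx.mapEv_dOd, ← h1, e1, ← map_add]
    simp
  have hext := Contraction.rel_extension χ (Z := C.tensor (actRing φ)) fEv fOd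
    (BTensor.map ⊤ (actRing φ) xEv) (BTensor.map ⊤ (actRing φ) xOd)
    (fun x y => by
      refine LinearMap.congr_fun (f := BTensor.map ⊤ (actRing φ) C.dEv ∘ₗ fEv.toLinearMap)
        (g := fOd.toLinearMap ∘ₗ (LinearMap.prod (BTensor.map ⊤ (actRing φ) C'.dEv ∘ₗ
          LinearMap.fst _ _ _ + BTensor.map ⊤ (actRing φ) xEv ∘ₗ LinearMap.snd _ _ _)
          (BTensor.map ⊤ (actRing φ) C''.dEv ∘ₗ LinearMap.snd _ _ _)))
        (BTensor.prod_hom_ext _ fun y m p => ?_) (x, y)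
      simp [hfE, ← BTensor.tmul_add, hfO, hdE])
    (fun x y => by
      refine LinearMap.congr_fun (f := BTensor.map ⊤ (actRing φ) C.dOd ∘ₗ fOd.toLinearMap)
        (g := fEv.toLinearMap ∘ₗ (LinearMap.prod (BTensor.map ⊤ (actRing φ) C'.dOd ∘ₗ
          LinearMap.fst _ _ _ + BTensor.map ⊤ (actRing φ) xOd ∘ₗ LinearMap.snd _ _ _)
          (BTensor.map ⊤ (actRing φ) C''.dOd ∘ₗ LinearMap.snd _ _ _)))
        (BTensor.prod_hom_ext _ fun y m p => ?_) (x, y)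
      simp [hfE, ← BTensor.tmul_add, hfO, hdO])
    s' s'' s
  let κ₀ := fOd.symm.trans ((s'.acyc.prodCongr s''.acyc).trans fEv)
  have hstab := χ.rel_stab (BTensor.congrProd ⊤ (actRing φ) (((eOd.symm.prodCongr (LinearEquiv.refl R (a'.stab × a''.stab))).trans
        ((LinearEquiv.prodProdProdComm R C'.od C''.od a'.stab a''.stab).trans
          ((a'.iso.prodCongr a''.iso).trans
            (LinearEquiv.prodProdProdComm R C'.ev a'.stab C''.ev a''.stab)))).trans
        (eEv.prodCongr (LinearEquiv.refl R (a'.stab × a''.stab)))))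
        s.acyc (BTensor.prodEquiv ⊤ (actRing φ) a'.stab a''.stab) Ψ
        (BTensor.prod_hom_ext _ fun y x p => by
          obtain ⟨m, m''⟩ := p
          simp [Ψ, hfO', hfE, F, F''])
  rw [← hstab, ← χ.rel_mul_rel Ψ (κ₀.prodCongr (LinearEquiv.refl B _)), χ.rel_prod, χ.rel_self,
    mul_one, χ.rel_symm s.acyc κ₀, hext, inv_one, mul_one, charClass, charClass, ← χ.rel_prod]
  have hκ : κ₀.prodCongr (LinearEquiv.refl B (BTensor ⊤ (actRing φ) a'.stab ×
    BTensor ⊤ (actRing φ) a''.stab)) =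
    ((fOd.symm.prodCongr (LinearEquiv.refl B (BTensor ⊤ (actRing φ) a'.stab ×
    BTensor ⊤ (actRing φ) a''.stab))).trans
      ((LinearEquiv.prodProdProdComm B _ _ _ _).trans (((s'.acyc.prodCongr
        (LinearEquiv.refl B _)).prodCongr (s''.acyc.prodCongr (LinearEquiv.refl B _))).trans
        (LinearEquiv.prodProdProdComm B _ _ _ _)))).trans (fEv.prodCongr (LinearEquiv.refl B _)) :=
    LinearEquiv.ext fun x => rfl
  rw [hκ, χ.rel_trans_right, χ.rel_trans_left, χ.rel_trans_left, χ.rel_trans_right]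

end CharElement

section NullHomotopy

open CategoryTheory CategoryTheory.Limits

variable {R : Type u} [Ring R] {B : Type v} [Ring B] {Y : Type w} [AddCommGroup Y] [Module B Y]

/-- `t` acts null-homotopically on the graded complex `Y ⊗_R C`. -/
def NullHtpy (act : Rᵐᵒᵖ →+* Module.End B Y) (t : B) (C : PerfCx R) : Prop :=
  ∃ h : ∀ i j : ℤ, BTensor ⊤ act (C.cx.X i) →ₗ[B] BTensor ⊤ act (C.cx.X j),
    ∀ i j k, i + 1 = j → j + 1 = k → ∀ x, BTensor.map ⊤ act (C.d i j) (h j i x) +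
      h k j (BTensor.map ⊤ act (C.d j k) x) = t • x

/-- Multiplication by a central element as a linear map. -/
def centralSmul (t : B) (ht : ∀ b, t * b = b * t) (V : Type*) [AddCommGroup V] [Module B V] :
    V →ₗ[B] V where
  toFun x := t • x
  map_add' := smul_add t
  map_smul' b x := by simp only [smul_smul, ht, RingHom.id_apply]

variable {act : Rᵐᵒᵖ →+* Module.End B Y} {t : B}

theorem BTensor.map_map {M N P : Type*} [AddCommGroup M] [Module R M] [AddCommGroup N] [Module R N]
    [AddCommGroup P] [Module R P] (g : N →ₗ[R] P) (f : M →ₗ[R] N) (x : BTensor ⊤ act M) :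
    BTensor.map ⊤ act g (BTensor.map ⊤ act f x) = BTensor.map ⊤ act (g ∘ₗ f) x := by
  rw [BTensor.map_comp]; rfl

theorem BTensor.map_sum {M N : Type*} [AddCommGroup M] [Module R M] [AddCommGroup N] [Module R N]
    {ι : Type*} (s : Finset ι) (f : ι → M →ₗ[R] N) :
    BTensor.map ⊤ act (∑ i ∈ s, f i) = ∑ i ∈ s, BTensor.map ⊤ act (f i) := by
  classical
  induction s using Finset.induction_on with
  | empty => simp [BTensor.map_zero]
  | insert a s ha ih => rw [Finset.sum_insert ha, Finset.sum_insert ha, BTensor.map_add, ih]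

theorem BTensor.subsingleton {M : Type*} [AddCommGroup M] [Module R M] [Subsingleton M] :
    Subsingleton (BTensor ⊤ act M) := by
  refine ⟨fun x y => ?_⟩
  have h : (LinearMap.id : M →ₗ[R] M) = 0 := LinearMap.ext fun m => Subsingleton.elim _ _
  have h' : (LinearMap.id : BTensor ⊤ act M →ₗ[B] _) = 0 := by
    rw [← BTensor.map_id, h, BTensor.map_zero]
  rw [← LinearMap.id_apply (R := B) x, ← LinearMap.id_apply (R := B) y, h']
  rfl

theorem PerfCx.map_f_d {C D : PerfCx R} (f : C.cx ⟶ D.cx) (i j : ℤ) :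
    (f.f j).hom ∘ₗ C.d i j = D.d i j ∘ₗ (f.f i).hom :=
  (congrArg ModuleCat.Hom.hom (f.comm i j)).symm

theorem NullHtpy.of_retract (ht : ∀ b, t * b = b * t) {C D : PerfCx R} (f : C.cx ⟶ D.cx)
    (g : D.cx ⟶ C.cx) (k : Homotopy (g ≫ f) (𝟙 D.cx)) (hC : NullHtpy act t C) :
    NullHtpy act t D := by
  obtain ⟨h, hh⟩ := hC
  refine ⟨fun i j => BTensor.map ⊤ act (f.f j).hom ∘ₗ h i j ∘ₗ BTensor.map ⊤ act (g.f i).hom -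
    centralSmul t ht _ ∘ₗ BTensor.map ⊤ act (k.hom i j).hom, fun i j l hij hjl x => ?_⟩
  have hk := k.comm j
  rw [dNext_eq k.hom (show (ComplexShape.up ℤ).Rel j l from hjl),
    prevD_eq k.hom (show (ComplexShape.up ℤ).Rel i j from hij)] at hk
  have hk' : (f.f j).hom ∘ₗ (g.f j).hom = (k.hom l j).hom ∘ₗ D.d j l + D.d i j ∘ₗ (k.hom j i).hom +
      LinearMap.id := congrArg ModuleCat.Hom.hom hk
  have e1 : BTensor.map ⊤ act (D.d i j) (BTensor.map ⊤ act (f.f i).hom (h j i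
      (BTensor.map ⊤ act (g.f j).hom x))) =
      BTensor.map ⊤ act (f.f j).hom (BTensor.map ⊤ act (C.d i j) (h j i
      (BTensor.map ⊤ act (g.f j).hom x))) := by
    rw [BTensor.map_map, BTensor.map_map, PerfCx.map_f_d]
  have e2 : BTensor.map ⊤ act (g.f l).hom (BTensor.map ⊤ act (D.d j l) x) =
      BTensor.map ⊤ act (C.d j l) (BTensor.map ⊤ act (g.f j).hom x) := by
    rw [BTensor.map_map, BTensor.map_map, PerfCx.map_f_d]
  have e3 := hh i j l hij hjl (BTensor.map ⊤ act (g.f j).hom x)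
  have e4 : BTensor.map ⊤ act (f.f j).hom (BTensor.map ⊤ act (g.f j).hom x) =
      BTensor.map ⊤ act (k.hom l j).hom (BTensor.map ⊤ act (D.d j l) x) +
      BTensor.map ⊤ act (D.d i j) (BTensor.map ⊤ act (k.hom j i).hom x) + x := by
    rw [BTensor.map_map, hk', BTensor.map_add, BTensor.map_add, BTensor.map_comp, BTensor.map_comp,
      BTensor.map_id]
    rfl
  have e5 := congrArg (BTensor.map ⊤ act (f.f j).hom) e3
  simp only [map_add, map_smul, e4, smul_add] at e5
  simp only [LinearMap.sub_apply, LinearMap.comp_apply, centralSmul, LinearMap.coe_mk,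
    AddHom.coe_mk, map_sub, e1, e2, map_smul]
  rw [← sub_eq_zero] at e5 ⊢
  rw [← e5]
  abel

theorem NullHtpy.of_isZero {C : PerfCx R} (h : IsZero C.cx) : NullHtpy act t C := by
  refine ⟨fun i j => 0, fun i j k _ _ x => ?_⟩
  have h1 : (LinearMap.id : C.cx.X j →ₗ[R] _) = 0 :=
    congrArg (fun q : C.cx ⟶ C.cx => (q.f j).hom) (h.eq_of_src (𝟙 C.cx) 0)
  have : Subsingleton (C.cx.X j) := ⟨fun x y => by
    rw [← LinearMap.id_apply (R := R) x, ← LinearMap.id_apply (R := R) y, h1]; rfl⟩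
  have := BTensor.subsingleton (act := act) (M := C.cx.X j)
  exact Subsingleton.elim _ _

instance (C : PerfCx R) (i : ℤ) : CategoryTheory.Projective (C.cx.X i) :=
  (IsProjective.iff_projective _).1 (C.projective i)

theorem PerfCx.isKProjective (C : PerfCx R) : C.cx.IsKProjective := by
  obtain ⟨a, b, h⟩ := C.bounded
  have : C.cx.IsStrictlyLE b := by
    rw [CochainComplex.isStrictlyLE_iff]
    intro i hi
    have := h i (Or.inr hi)
    exact ModuleCat.isZero_of_subsingleton _
  exact CochainComplex.isKProjective_of_projective C.cx b

theorem PerfCx.exists_homotopyEquiv {C D : PerfCx R} (f : C.cx ⟶ D.cx) (hf : QuasiIso f) :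
    Nonempty (HomotopyEquiv C.cx D.cx) := by
  have := C.isKProjective
  have := D.isKProjective
  obtain ⟨e, -⟩ := (CochainComplex.IsKProjective.quasiIso_iff f).1 hf
  exact ⟨e⟩

theorem NullHtpy.of_shift {C D : PerfCx R} (n : ℤ)
    (e : D.cx ≅ C.cx⟦n⟧) (hC : NullHtpy act t C) : NullHtpy act t D := by
  obtain ⟨h, hh⟩ := hC
  let f : ∀ i, D.cx.X i →ₗ[R] C.cx.X (i + n) := fun i => (e.hom.f i).hom
  let g : ∀ i, C.cx.X (i + n) →ₗ[R] D.cx.X i := fun i => (e.inv.f i).hom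
  have hgf : ∀ i, g i ∘ₗ f i = LinearMap.id := fun i =>
    congrArg (fun q : D.cx ⟶ D.cx => (q.f i).hom) e.hom_inv_id
  let ε : ℤ := (n.negOnePow : ℤˣ)
  have hε : ε * ε = 1 := by
    simp only [ε]
    rw [← Units.val_mul, Int.units_mul_self, Units.val_one]
  have hf : ∀ i j, f j ∘ₗ D.d i j = ε • (C.d (i + n) (j + n) ∘ₗ f i) := fun i j =>
    (congrArg ModuleCat.Hom.hom (e.hom.comm i j)).symm
  have hg : ∀ i j, D.d i j ∘ₗ g i = ε • (g j ∘ₗ C.d (i + n) (j + n)) := fun i j => by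
    have h1 : D.d i j ∘ₗ g i = g j ∘ₗ (ε • C.d (i + n) (j + n)) :=
      congrArg ModuleCat.Hom.hom (e.inv.comm i j)
    rw [h1]
    ext x
    simp
  have hz : ∀ {M N : Type u} [AddCommGroup M] [AddCommGroup N] [Module R M] [Module R N]
      (q : M →ₗ[R] N), BTensor.map ⊤ act (ε • q) = ε • BTensor.map ⊤ act q := by
    intro M N _ _ _ _ q
    exact _root_.map_zsmul (AddMonoidHom.mk' (fun q : M →ₗ[R] N => BTensor.map ⊤ act q)
      (BTensor.map_add ⊤ act)) ε q
  refine ⟨fun i j => ε • (BTensor.map ⊤ act (g j) ∘ₗ h (i + n) (j + n) ∘ₗ BTensor.map ⊤ act (f i)),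
    fun i j l hij hjl x => ?_⟩
  have e3 := hh (i + n) (j + n) (l + n) (by omega) (by omega) (BTensor.map ⊤ act (f j) x)
  have e5 := congrArg (BTensor.map ⊤ act (g j)) e3
  simp only [map_add, map_smul, BTensor.map_map, hgf, BTensor.map_id, LinearMap.id_apply] at e5
  simp only [LinearMap.smul_apply, LinearMap.comp_apply, map_zsmul, BTensor.map_map, hf, hg, hz,
    smul_smul, hε, one_smul]
  exact e5

theorem NullHtpy.of_sum {C D E : PerfCx R} (e : E.cx ≅ C.cx ⊞ D.cx)
    (hC : NullHtpy act t C) (hD : NullHtpy act t D) : NullHtpy act t E := by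
  obtain ⟨h, hh⟩ := hC
  obtain ⟨k, hk⟩ := hD
  let p₁ : E.cx ⟶ C.cx := e.hom ≫ biprod.fst
  let p₂ : E.cx ⟶ D.cx := e.hom ≫ biprod.snd
  let i₁ : C.cx ⟶ E.cx := biprod.inl ≫ e.inv
  let i₂ : D.cx ⟶ E.cx := biprod.inr ≫ e.inv
  have htot : p₁ ≫ i₁ + p₂ ≫ i₂ = 𝟙 E.cx := by
    have : p₁ ≫ i₁ + p₂ ≫ i₂ = e.hom ≫ (biprod.fst ≫ biprod.inl + biprod.snd ≫ biprod.inr) ≫ e.inv := by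
      simp only [p₁, p₂, i₁, i₂, Category.assoc, Preadditive.comp_add, Preadditive.add_comp]
    rw [this, biprod.total]
    simp
  have ht : ∀ j, (i₁.f j).hom ∘ₗ (p₁.f j).hom + (i₂.f j).hom ∘ₗ (p₂.f j).hom = LinearMap.id :=
    fun j => congrArg (fun q : E.cx ⟶ E.cx => (q.f j).hom) htot
  refine ⟨fun i j => BTensor.map ⊤ act (i₁.f j).hom ∘ₗ h i j ∘ₗ BTensor.map ⊤ act (p₁.f i).hom +
    BTensor.map ⊤ act (i₂.f j).hom ∘ₗ k i j ∘ₗ BTensor.map ⊤ act (p₂.f i).hom,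
    fun i j l hij hjl x => ?_⟩
  have e1 := congrArg (BTensor.map ⊤ act (i₁.f j).hom)
    (hh i j l hij hjl (BTensor.map ⊤ act (p₁.f j).hom x))
  have e2 := congrArg (BTensor.map ⊤ act (i₂.f j).hom)
    (hk i j l hij hjl (BTensor.map ⊤ act (p₂.f j).hom x))
  have e3 := LinearMap.congr_fun (congrArg (BTensor.map ⊤ act) (ht j)) x
  rw [BTensor.map_id, BTensor.map_add] at e3
  replace e3 : BTensor.map ⊤ act ((i₁.f j).hom ∘ₗ (p₁.f j).hom) x +
    BTensor.map ⊤ act ((i₂.f j).hom ∘ₗ (p₂.f j).hom) x = x := e3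
  simp only [map_add, map_smul, BTensor.map_map] at e1 e2
  simp only [LinearMap.add_apply, LinearMap.comp_apply, map_add, BTensor.map_map,
    PerfCx.map_f_d]
  rw [← PerfCx.map_f_d, ← PerfCx.map_f_d]
  conv_rhs => rw [← e3, smul_add, ← e1, ← e2]
  abel

theorem NullHtpy.of_sigmaGen (ht : ∀ b, t * b = b * t) {A C : PerfCx R} (hA : NullHtpy act t A)
    (hC : SigmaGen A C) : NullHtpy act t C := by
  induction hC with
  | base => exact hA
  | zero C h => exact .of_isZero h
  | quasi C D f hf _ ih =>
    obtain ⟨e⟩ := PerfCx.exists_homotopyEquiv f hf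
    exact ih.of_retract ht e.hom e.inv e.homotopyInvHomId
  | quasi' C D f hf _ ih =>
    obtain ⟨e⟩ := PerfCx.exists_homotopyEquiv f hf
    exact ih.of_retract ht e.inv e.hom e.homotopyHomInvId
  | shift C D n e _ ih => exact ih.of_shift n e
  | sum C D E e _ _ ih₁ ih₂ => exact .of_sum e ih₁ ih₂

theorem BTensor.sum_component {ι : Type} [DecidableEq ι] (X : ι → Type u)
    [∀ i, AddCommGroup (X i)] [∀ i, Module R (X i)] (s : Finset ι)
    (hs : ∀ i, i ∉ s → Subsingleton (X i)) (x : BTensor ⊤ act (DirectSum ι X)) :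
    ∑ i ∈ s, BTensor.map ⊤ act (DirectSum.lof R ι X i)
      (BTensor.map ⊤ act (DirectSum.component R ι X i) x) = x := by
  have h : ∑ i ∈ s, DirectSum.lof R ι X i ∘ₗ DirectSum.component R ι X i = LinearMap.id := by
    refine DirectSum.linearMap_ext R fun i => LinearMap.ext fun m => ?_
    rw [LinearMap.comp_apply, LinearMap.sum_apply]
    by_cases hi : i ∈ s
    · rw [Finset.sum_eq_single i]
      · simp [DirectSum.component.lof_self]
      · intro j _ hj
        simp [DirectSum.component.of, Ne.symm hj]
      · exact fun h => absurd hi h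
    · have := hs i hi
      rw [Subsingleton.elim m 0]
      simp
  have h' := LinearMap.congr_fun (congrArg (BTensor.map ⊤ act) h) x
  rw [BTensor.map_id, BTensor.map_sum] at h'
  simp only [LinearMap.sum_apply] at h'
  simp only [BTensor.map_map]
  exact h'

/-- The indices of a given parity that support a bounded complex. -/
theorem PerfCx.exists_support (C : PerfCx R) (q : ℤ → Prop) :
    ∃ s : Finset {i : ℤ // q i}, ∀ i, i ∉ s → Subsingleton (C.cx.X i) := by
  classical
  obtain ⟨a, b, h⟩ := C.bounded
  refine ⟨(Finset.Icc a b).subtype q, fun i hi => h i ?_⟩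
  simp only [Finset.mem_subtype, Finset.mem_Icc, not_and, not_le] at hi
  by_contra hc
  push Not at hc
  exact absurd (hi hc.1) (not_lt.2 hc.2)

theorem PerfCx.exists_foldMap (C : PerfCx R) (q q' : ℤ → Prop) (hq : ∀ i, q i → q' (i - 1))
    (h : ∀ i j : ℤ, BTensor ⊤ act (C.cx.X i) →ₗ[B] BTensor ⊤ act (C.cx.X j)) :
    ∃ H : BTensor ⊤ act (DirectSum {i : ℤ // q i} fun i => C.cx.X i) →ₗ[B]
      BTensor ⊤ act (DirectSum {i : ℤ // q' i} fun i => C.cx.X i),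
      ∀ (i j : ℤ) (hi : q i) (hj : q' j), j + 1 = i → ∀ z,
        H (BTensor.map ⊤ act (DirectSum.lof R {i : ℤ // q i} (fun i => C.cx.X i) ⟨i, hi⟩) z) =
          BTensor.map ⊤ act (DirectSum.lof R {i : ℤ // q' i} (fun i => C.cx.X i) ⟨j, hj⟩) (h i j z) := by
  obtain ⟨s, hs⟩ := C.exists_support q
  refine ⟨∑ i ∈ s, BTensor.map ⊤ act (DirectSum.lof R {i : ℤ // q' i} (fun i => C.cx.X i)
    ⟨i.1 - 1, hq _ i.2⟩) ∘ₗ h i.1 (i.1 - 1) ∘ₗ BTensor.map ⊤ act (DirectSum.component R _ _ i), ?_⟩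
  intro i j hi hj hij z
  obtain rfl : j = i - 1 := by omega
  rw [LinearMap.sum_apply]
  by_cases his : (⟨i, hi⟩ : {i : ℤ // q i}) ∈ s
  · rw [Finset.sum_eq_single ⟨i, hi⟩]
    · simp only [LinearMap.comp_apply]
      rw [BTensor.map_map]
      have : DirectSum.component R {i : ℤ // q i} (fun i => C.cx.X i) ⟨i, hi⟩ ∘ₗ
          DirectSum.lof R {i : ℤ // q i} (fun i => C.cx.X i) ⟨i, hi⟩ = LinearMap.id :=
        LinearMap.ext fun m => by simp [DirectSum.component.lof_self]
      rw [this, BTensor.map_id]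
      rfl
    · intro k _ hk
      simp only [LinearMap.comp_apply]
      rw [BTensor.map_map]
      have : DirectSum.component R {i : ℤ // q i} (fun i => C.cx.X i) k ∘ₗ
          DirectSum.lof R {i : ℤ // q i} (fun i => C.cx.X i) ⟨i, hi⟩ = 0 :=
        LinearMap.ext fun m => by simp [DirectSum.component.of, Ne.symm hk]
      rw [this, BTensor.map_zero]
      simp
    · exact fun h => absurd his h
  · have := hs _ his
    have := BTensor.subsingleton (act := act) (M := C.cx.X i)
    rw [Subsingleton.elim z 0]
    simp

theorem NullHtpy.exists_fold {C : PerfCx R} (hC : NullHtpy act t C) :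
    ∃ (hEv : BTensor ⊤ act C.ev →ₗ[B] BTensor ⊤ act C.od)
      (hOd : BTensor ⊤ act C.od →ₗ[B] BTensor ⊤ act C.ev),
      (∀ x, BTensor.map ⊤ act C.dOd (hEv x) + hOd (BTensor.map ⊤ act C.dEv x) = t • x) ∧
      (∀ x, BTensor.map ⊤ act C.dEv (hOd x) + hEv (BTensor.map ⊤ act C.dOd x) = t • x) := by
  obtain ⟨h, hh⟩ := hC
  obtain ⟨hEv, h1⟩ := C.exists_foldMap Even Odd (fun i hi => hi.sub_odd odd_one) h
  obtain ⟨hOd, h2⟩ := C.exists_foldMap Odd Even (fun i hi => hi.sub_odd odd_one) h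
  refine ⟨hEv, hOd, fun x => ?_, fun x => ?_⟩
  · obtain ⟨s, hs⟩ := C.exists_support Even
    rw [← BTensor.sum_component (act := act) _ s hs x]
    simp only [map_sum, Finset.smul_sum, ← Finset.sum_add_distrib]
    refine Finset.sum_congr rfl fun ⟨i, hi⟩ _ => ?_
    generalize BTensor.map ⊤ act (DirectSum.component R {i : ℤ // Even i}
      (fun i => C.cx.X i) ⟨i, hi⟩) x = z
    have e1 : C.dEv ∘ₗ DirectSum.lof R {i : ℤ // Even i} (fun i => C.cx.X i) ⟨i, hi⟩ =
        DirectSum.lof R {i : ℤ // Odd i} (fun i => C.cx.X i) ⟨i + 1, hi.add_one⟩ ∘ₗ C.d i (i + 1) := by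
      ext x; simp [PerfCx.dEv]
    have e2 (j : ℤ) (hj : Odd j) (hij : j + 1 = i) :
        C.dOd ∘ₗ DirectSum.lof R {i : ℤ // Odd i} (fun i => C.cx.X i) ⟨j, hj⟩ =
        DirectSum.lof R {i : ℤ // Even i} (fun i => C.cx.X i) ⟨i, hi⟩ ∘ₗ C.d j i := by
      subst hij
      ext x; simp [PerfCx.dOd]
    have hi' : Odd (i - 1) := hi.sub_odd odd_one
    rw [h1 i (i - 1) hi hi' (by omega), BTensor.map_map, BTensor.map_map, e1,
      e2 _ hi' (by omega), BTensor.map_comp, BTensor.map_comp, LinearMap.comp_apply,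
      LinearMap.comp_apply, h2 (i + 1) i _ hi rfl, ← map_add, ← map_smul,
      hh (i - 1) i (i + 1) (by omega) rfl]
  · obtain ⟨s, hs⟩ := C.exists_support Odd
    rw [← BTensor.sum_component (act := act) _ s hs x]
    simp only [map_sum, Finset.smul_sum, ← Finset.sum_add_distrib]
    refine Finset.sum_congr rfl fun ⟨i, hi⟩ _ => ?_
    generalize BTensor.map ⊤ act (DirectSum.component R {i : ℤ // Odd i}
      (fun i => C.cx.X i) ⟨i, hi⟩) x = z
    have e1 : C.dOd ∘ₗ DirectSum.lof R {i : ℤ // Odd i} (fun i => C.cx.X i) ⟨i, hi⟩ =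
        DirectSum.lof R {i : ℤ // Even i} (fun i => C.cx.X i) ⟨i + 1, hi.add_one⟩ ∘ₗ C.d i (i + 1) := by
      ext x; simp [PerfCx.dOd]
    have e2 (j : ℤ) (hj : Even j) (hij : j + 1 = i) :
        C.dEv ∘ₗ DirectSum.lof R {i : ℤ // Even i} (fun i => C.cx.X i) ⟨j, hj⟩ =
        DirectSum.lof R {i : ℤ // Odd i} (fun i => C.cx.X i) ⟨i, hi⟩ ∘ₗ C.d j i := by
      subst hij
      ext x; simp [PerfCx.dEv]
    have hi' : Even (i - 1) := hi.sub_odd odd_one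
    rw [h2 i (i - 1) hi hi' (by omega), BTensor.map_map, BTensor.map_map, e1,
      e2 _ hi' (by omega), BTensor.map_comp, BTensor.map_comp, LinearMap.comp_apply,
      LinearMap.comp_apply, h1 (i + 1) i _ hi rfl, ← map_add, ← map_smul,
      hh (i - 1) i (i + 1) (by omega) rfl]

/-- The functor `Y ⊗_R -`. -/
def tensorFunctor (R : Type u) [Ring R] (B : Type u) [Ring B] (φ : R →+* B) :
    ModuleCat.{u} R ⥤ ModuleCat.{u} B where
  obj M := ModuleCat.of B (BTensor ⊤ (actRing φ) M)
  map f := ModuleCat.ofHom (BTensor.map ⊤ (actRing φ) f.hom)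
  map_id M := by
    rw [ModuleCat.hom_id, BTensor.map_id]
    rfl
  map_comp f g := by
    rw [ModuleCat.hom_comp, BTensor.map_comp]
    rfl

instance (B : Type u) [Ring B] (φ : R →+* B) : (tensorFunctor R B φ).Additive where
  map_add {M N f g} := by
    ext1
    exact BTensor.map_add ⊤ (actRing φ) f.hom g.hom

theorem NullHtpy.of_sigmaLoc (S : Set R) (C : PerfCx R) (hC : SigmaLoc S C) :
    NullHtpy (actRing (toLoc S)) 1 C := by
  let F := tensorFunctor R (Loc R S) (toLoc S)
  let X : CochainComplex (ModuleCat.{u} (Loc R S)) ℤ := (F.mapHomologicalComplex _).obj C.cx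
  have hp : ∀ i, CategoryTheory.Projective (X.X i) := fun i => by
    have : Module.Projective (Loc R S) (X.X i) :=
      inferInstanceAs (Module.Projective (Loc R S) (BTensor ⊤ (actRing (toLoc S)) (C.cx.X i)))
    exact (IsProjective.iff_projective _).1 this
  obtain ⟨a, b, h⟩ := C.bounded
  have : X.IsStrictlyLE b := by
    rw [CochainComplex.isStrictlyLE_iff]
    intro i hi
    have := h i (Or.inr hi)
    have : Subsingleton (X.X i) := BTensor.subsingleton (act := actRing (toLoc S)) (M := C.cx.X i)
    exact ModuleCat.isZero_of_subsingleton _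
  have := CochainComplex.isKProjective_of_projective X b
  have hX : X.Acyclic := fun i => by
    rw [X.exactAt_iff' (i - 1) i (i + 1) (by simp) (by simp),
      ShortComplex.ShortExact.moduleCat_exact_iff_function_exact]
    exact hC i
  have k := CochainComplex.IsKProjective.homotopyZero (𝟙 X) hX
  refine ⟨fun i j => (k.hom i j).hom, fun i j l hij hjl x => ?_⟩
  have hk := k.comm j
  rw [dNext_eq k.hom (show (ComplexShape.up ℤ).Rel j l from hjl),
    prevD_eq k.hom (show (ComplexShape.up ℤ).Rel i j from hij)] at hk
  have h1 := congrArg (fun q => ModuleCat.Hom.hom q x) hk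
  rw [one_smul]
  refine Eq.trans ?_ h1.symm
  rw [add_comm]
  exact (add_zero _).symm

theorem exists_contraction_of_sigmaGen (S : Set R) {A C : PerfCx R} (hA : SigmaLoc S A)
    (hC : SigmaGen A C) : Nonempty (Contraction (C.tensor (actRing (toLoc S)))) := by
  obtain ⟨hEv, hOd, h1, h2⟩ := ((NullHtpy.of_sigmaLoc S A hA).of_sigmaGen (by simp) hC).exists_fold
  obtain ⟨s, -⟩ := Contraction.exists_of_homotopy (C.tensor (actRing (toLoc S))) hEv hOd
    (fun x => by rw [BTensor.map_map, C.dOd_comp_dEv, BTensor.map_zero]; rfl)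
    (fun x => by rw [BTensor.map_map, C.dEv_comp_dOd, BTensor.map_zero]; rfl)
    (fun x => (h1 x).trans (one_smul _ x)) (fun x => (h2 x).trans (one_smul _ x))
  exact ⟨s⟩

theorem charClass_eq_one {B : Type u} [Ring B] (φ : R →+* B) {Γ : Type*} [CommGroup Γ]
    (χ : AutInv.{u, u} B Γ) {C : PerfCx R} [Subsingleton C.od] (a : C.Triv) [Subsingleton a.stab]
    (s : Contraction (C.tensor (actRing φ))) : charClass φ χ a s = 1 := by
  have := BTensor.subsingleton (act := actRing φ) (M := C.od)
  have := BTensor.subsingleton (act := actRing φ) (M := a.stab)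
  refine Eq.trans ?_ (χ.map_refl (P := BTensor ⊤ (actRing φ) C.od × BTensor ⊤ (actRing φ) a.stab))
  exact congrArg χ.toFun (LinearEquiv.ext fun x => Subsingleton.elim
    (α := BTensor ⊤ (actRing φ) C.od × BTensor ⊤ (actRing φ) a.stab) _ _)

/-- The characteristic homomorphism on the localized `K₁`-group. -/
theorem exists_charHom (S : Set R) (A : PerfCx R) (hA : SigmaLoc S A) :
    ∃ ch : K1Loc (SigmaGen A) →* K1 (Loc R S),
      ∀ C hC a, IsCharElement S C a (ch (K1Loc.mk C hC a)) := by
  let s : ∀ (C : PerfCx R) (_ : SigmaGen A C), Contraction (C.tensor (actRing (toLoc S))) :=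
    fun C hC => (exists_contraction_of_sigmaGen S hA hC).some
  let f : K1LocGen (SigmaGen A) → K1 (Loc R S) := fun x =>
    charClass (toLoc S) (AutInv.k1 (Loc R S)) x.triv (s x.cx x.mem)
  have hf : ∀ r ∈ {x | K1LocRel (SigmaGen A) x}, FreeGroup.lift f r = 1 := by
    rintro _ (⟨C, hC⟩ | ⟨C, D, hC, hD, q, hq, a, a', h⟩ |
      ⟨C', C, C'', hC', hC, hC'', q, g, hq, hqg, hg, a', a, a'', h⟩)
    · rw [FreeGroup.lift_apply_of]
      have : Subsingleton C.zeroTriv.stab := inferInstanceAs (Subsingleton PUnit)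
      exact charClass_eq_one _ _ C.zeroTriv _
    · simp only [map_mul, map_inv, FreeGroup.lift_apply_of]
      rw [mul_inv_eq_one]
      exact charClass_push (toLoc S) (AutInv.k1 (Loc R S)) q a a' h (s C hC) (s D hD)
    · simp only [map_mul, map_inv, FreeGroup.lift_apply_of]
      rw [mul_inv_eq_one]
      exact charClass_prod (toLoc S) (AutInv.k1 (Loc R S)) q g a' a a'' h (s C' hC') (s C hC) (s C'' hC'')
  refine ⟨Abelianization.lift (PresentedGroup.toGroup hf), fun C hC a => ⟨s C hC, ?_⟩⟩
  have h1 : Abelianization.lift (PresentedGroup.toGroup hf) (K1Loc.mk C hC a) = f ⟨C, hC, a⟩ :=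
    (Abelianization.lift_apply_of _ _).trans (PresentedGroup.toGroup.of hf)
  exact h1.trans rfl

end NullHomotopy

/-! ### Base change along semilinear maps -/

section BaseChange

variable {B B' : Type*} [CommRing B] [CommRing B'] {σ : B →+* B'}
  {V V₂ W W₂ : Type*} [AddCommGroup V] [Module B V] [AddCommGroup V₂] [Module B V₂]
  [AddCommGroup W] [Module B' W] [AddCommGroup W₂] [Module B' W₂]

/-- The product of two semilinear maps. -/
def sprod (f : V →ₛₗ[σ] W) (g : V₂ →ₛₗ[σ] W₂) : (V × V₂) →ₛₗ[σ] (W × W₂) where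
  toFun x := (f x.1, g x.2)
  map_add' x y := by simp
  map_smul' b x := by simp

@[simp] theorem sprod_apply (f : V →ₛₗ[σ] W) (g : V₂ →ₛₗ[σ] W₂) (x : V × V₂) :
    sprod f g x = (f x.1, g x.2) := rfl

/-- A semilinear map `V → W` exhibits `W` as the base change of the finite free module `V` if it
sends some basis to a basis. -/
def IsBC (f : V →ₛₗ[σ] W) : Prop :=
  ∃ (k : ℕ) (b : Module.Basis (Fin k) B V) (b' : Module.Basis (Fin k) B' W), ∀ i, f (b i) = b' i

theorem IsBC.of_basis {ι : Type*} [Fintype ι] {f : V →ₛₗ[σ] W} (b : Module.Basis ι B V)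
    (b' : Module.Basis ι B' W) (h : ∀ i, f (b i) = b' i) : IsBC f :=
  ⟨_, b.reindex (Fintype.equivFin ι), b'.reindex (Fintype.equivFin ι), fun i => by simp [h]⟩

namespace IsBC

variable {f : V →ₛₗ[σ] W} {g : V₂ →ₛₗ[σ] W₂}

theorem apply_eq_sum {k : ℕ} {b : Module.Basis (Fin k) B V} {b' : Module.Basis (Fin k) B' W}
    (hb : ∀ i, f (b i) = b' i) (x : V) : f x = ∑ i, σ (b.repr x i) • b' i := by
  conv_lhs => rw [← b.sum_repr x]
  simp only [map_sum, LinearMap.map_smulₛₗ, hb]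

theorem repr_apply {k : ℕ} {b : Module.Basis (Fin k) B V} {b' : Module.Basis (Fin k) B' W}
    (hb : ∀ i, f (b i) = b' i) (x : V) (i : Fin k) : b'.repr (f x) i = σ (b.repr x i) := by
  rw [apply_eq_sum hb, b'.repr_sum_self]

theorem prod (hf : IsBC f) (hg : IsBC g) : IsBC (sprod f g) := by
  obtain ⟨k, b, b', h⟩ := hf
  obtain ⟨l, c, c', h'⟩ := hg
  refine of_basis (b.prod c) (b'.prod c') fun i => ?_
  rcases i with i | i <;> simp [h, h', Module.Basis.prod_apply]

theorem finite (hf : IsBC f) : Module.Finite B V := by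
  obtain ⟨k, b, -⟩ := hf
  exact .of_basis b

theorem free (hf : IsBC f) : Module.Free B V := by
  obtain ⟨k, b, -⟩ := hf
  exact .of_basis b

theorem finite' (hf : IsBC f) : Module.Finite B' W := by
  obtain ⟨k, b, b', -⟩ := hf
  exact .of_basis b'

theorem det (hf : IsBC f) (α : V →ₗ[B] V) (α' : W →ₗ[B'] W) (h : ∀ x, α' (f x) = f (α x)) :
    LinearMap.det α' = σ (LinearMap.det α) := by
  obtain ⟨k, b, b', hb⟩ := hf
  rw [← LinearMap.det_toMatrix b, ← LinearMap.det_toMatrix b', RingHom.map_det]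
  congr 1
  ext i j
  rw [LinearMap.toMatrix_apply, ← hb, h, RingHom.mapMatrix_apply, Matrix.map_apply,
    LinearMap.toMatrix_apply, repr_apply hb]

theorem hom_ext {B'' : Type*} [CommRing B''] {W₃ : Type*} [AddCommGroup W₃] [Module B'' W₃]
    {τ : B' →+* B''} (hf : IsBC f) {β β' : W →ₛₗ[τ] W₃} (h : ∀ x, β (f x) = β' (f x)) :
    β = β' := by
  obtain ⟨k, b, b', hb⟩ := hf
  exact b'.ext fun i => by rw [← hb, h]

theorem exists_extend (hf : IsBC f) (g : V₂ →ₛₗ[σ] W₂) (β : V →ₗ[B] V₂) :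
    ∃ β' : W →ₗ[B'] W₂, ∀ x, β' (f x) = g (β x) := by
  obtain ⟨k, b, b', hb⟩ := hf
  refine ⟨b'.constr B' fun i => g (β (b i)), fun x => ?_⟩
  conv_rhs => rw [← b.sum_repr x]
  simp only [Module.Basis.constr_apply_fintype, Module.Basis.equivFun_apply, repr_apply hb, map_sum,
    LinearMap.map_smulₛₗ, RingHom.id_apply]

theorem exists_lift (hf : IsBC f) (hg : Function.Surjective g) (β : W →ₗ[B'] W₂) :
    ∃ β' : V →ₗ[B] V₂, ∀ x, g (β' x) = β (f x) := by
  obtain ⟨k, b, b', hb⟩ := hf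
  choose q hq using fun i => hg (β (b' i))
  refine ⟨b.constr B q, fun x => ?_⟩
  rw [apply_eq_sum hb]
  simp only [Module.Basis.constr_apply_fintype, Module.Basis.equivFun_apply, map_sum,
    LinearMap.map_smulₛₗ, RingHom.id_apply, hq]

theorem surjective (hf : IsBC f) (hσ : Function.Surjective σ) : Function.Surjective f := by
  obtain ⟨k, b, b', hb⟩ := hf
  intro w
  choose c hc using fun i => hσ (b'.repr w i)
  refine ⟨∑ i, c i • b i, ?_⟩
  conv_rhs => rw [← b'.sum_repr w]
  simp [hb, hc]

theorem exists_smul (hf : IsBC f) {t : B} (ht : ∀ c, σ c = 0 → ∃ c', c = t * c') {x : V}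
    (hx : f x = 0) : ∃ y, x = t • y := by
  obtain ⟨k, b, b', hb⟩ := hf
  rw [← b.sum_repr x] at hx
  simp only [map_sum, LinearMap.map_smulₛₗ, hb] at hx
  choose c hc using fun i => ht _ (Fintype.linearIndependent_iff.1 b'.linearIndependent _ hx i)
  refine ⟨∑ i, c i • b i, ?_⟩
  conv_lhs => rw [← b.sum_repr x]
  rw [Finset.smul_sum]
  exact Finset.sum_congr rfl fun i _ => by rw [hc, mul_smul]

end IsBC

variable {M N M' N' : Type*} [AddCommGroup M] [Module B M] [AddCommGroup N] [Module B N]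
  [AddCommGroup M'] [Module B' M'] [AddCommGroup N'] [Module B' N']
  {V₃ V₄ W₃ W₄ : Type*} [AddCommGroup V₃] [Module B V₃] [AddCommGroup V₄] [Module B V₄]
  [AddCommGroup W₃] [Module B' W₃] [AddCommGroup W₄] [Module B' W₄]

theorem symm_semilinear {f : V →ₛₗ[σ] W} {g : V₂ →ₛₗ[σ] W₂} {φ : V ≃ₗ[B] V₂} {φ' : W ≃ₗ[B'] W₂}
    (h : ∀ x, φ' (f x) = g (φ x)) (x : V₂) : φ'.symm (g x) = f (φ.symm x) := by
  rw [LinearEquiv.symm_apply_eq, h, LinearEquiv.apply_symm_apply]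

theorem compareTriv_semilinear (f : V →ₛₗ[σ] W) (g : V₂ →ₛₗ[σ] W₂) (m : M →ₛₗ[σ] M')
    (n : N →ₛₗ[σ] N') {φ : (V × M) ≃ₗ[B] (V₂ × M)} {ψ : (V × N) ≃ₗ[B] (V₂ × N)}
    {φ' : (W × M') ≃ₗ[B'] (W₂ × M')} {ψ' : (W × N') ≃ₗ[B'] (W₂ × N')}
    (hφ : ∀ x, φ' (sprod f m x) = sprod g m (φ x)) (hψ : ∀ x, ψ' (sprod f n x) = sprod g n (ψ x))
    (x : (V × M) × N) : compareTriv φ' ψ' (sprod (sprod f m) n x) =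
      sprod (sprod f m) n (compareTriv φ ψ x) := by
  obtain ⟨y, z⟩ := x
  have h1 := hφ y
  have h2 := symm_semilinear hψ ((φ y).1, z)
  simp only [sprod_apply] at h1 h2
  simp [compareTriv, prodRightComm, h1, h2]

theorem compTriv_semilinear (f : V →ₛₗ[σ] W) (g : V₂ →ₛₗ[σ] W₂) (f₃ : V₃ →ₛₗ[σ] W₃)
    (g₄ : V₄ →ₛₗ[σ] W₄) (m : M →ₛₗ[σ] M')
    {τ : (V₃ × V₂) ≃ₗ[B] (V₄ × V)} {φ : (V × M) ≃ₗ[B] (V₂ × M)}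
    {τ' : (W₃ × W₂) ≃ₗ[B'] (W₄ × W)} {φ' : (W × M') ≃ₗ[B'] (W₂ × M')}
    (hτ : ∀ x, τ' (sprod f₃ g x) = sprod g₄ f (τ x))
    (hφ : ∀ x, φ' (sprod f m x) = sprod g m (φ x))
    (x : V₃ × (V × M)) : compTriv τ' φ' (sprod f₃ (sprod f m) x) =
      sprod g₄ (sprod f m) (compTriv τ φ x) := by
  obtain ⟨y, z⟩ := x
  have h1 := hφ z
  have h2 := hτ (y, (φ z).1)
  simp only [sprod_apply] at h1 h2
  have h3 : ∀ z₂ : V₂ × M, (LinearEquiv.prodAssoc B V₃ V₂ M).symm (y, z₂) = ((y, z₂.1), z₂.2) :=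
    fun _ => rfl
  have h4 : ∀ z₂ : W₂ × M', (LinearEquiv.prodAssoc B' W₃ W₂ M').symm (f₃ y, z₂) =
    ((f₃ y, z₂.1), z₂.2) := fun _ => rfl
  simp [compTriv, h1, h2, h3, h4]

end BaseChange

/-! ### Homotopies over principal ideal domains -/

section PID

variable {B : Type v} [CommRing B] [IsDomain B] [IsPrincipalIdealRing B]
  {M N Q : Type*} [AddCommGroup M] [Module B M] [AddCommGroup N] [Module B N] [AddCommGroup Q]
  [Module B Q]

theorem exists_ker_projection [Module.Finite B N] [Module.Free B N]
    (f : M →ₗ[B] N) : ∃ p : M →ₗ[B] M, (∀ x, f (p x) = 0) ∧ ∀ x, f x = 0 → p x = x := by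
  have : Module.Free B (LinearMap.range f) := inferInstance
  obtain ⟨g, hg⟩ := Module.projective_lifting_property f.rangeRestrict LinearMap.id
    f.surjective_rangeRestrict
  have hg' : ∀ x, f (g x) = x := fun x => congrArg Subtype.val (LinearMap.congr_fun hg x)
  refine ⟨LinearMap.id - g ∘ₗ f.rangeRestrict, fun x => ?_, fun x hx => ?_⟩
  · simp [hg']
  · have : f.rangeRestrict x = 0 := Subtype.ext hx
    simp [this]

theorem exists_partial_inverse [Module.Finite B N] [Module.Free B N] (t : B) (f : M →ₗ[B] N)
    (g : N →ₗ[B] Q) (h : ∀ x, g x = 0 → ∃ y, f y = t • x) (pM : M →ₗ[B] M)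
    (hp : ∀ x, f (pM x) = 0) (pN : N →ₗ[B] N) (hpN : ∀ x, g (pN x) = 0) :
    ∃ s : N →ₗ[B] M, (∀ x, f (s x) = t • pN x) ∧ ∀ x, ∃ y, s x = y - pM y ∧ f y = t • pN x := by
  have : Module.Free B (LinearMap.ker g) := inferInstance
  let T : LinearMap.ker g →ₗ[B] LinearMap.range f :=
    LinearMap.codRestrict _ (t • (LinearMap.ker g).subtype) fun x => h x.1 x.2
  obtain ⟨q, hq⟩ := Module.projective_lifting_property f.rangeRestrict T
    f.surjective_rangeRestrict
  have hq' : ∀ x, f (q x) = t • (x : N) := fun x => congrArg Subtype.val (LinearMap.congr_fun hq x)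
  let π : N →ₗ[B] LinearMap.ker g := LinearMap.codRestrict _ pN hpN
  refine ⟨(LinearMap.id - pM) ∘ₗ q ∘ₗ π, fun x => ?_, fun x => ⟨q (π x), rfl, hq' _⟩⟩
  simp only [LinearMap.comp_apply, LinearMap.sub_apply, LinearMap.id_apply, map_sub, hp, hq',
    sub_zero]
  rfl

/-- Multiplication by `t` is null-homotopic if it kills the cohomology. -/
theorem homotopy_identity {t : B} {f : M →ₗ[B] N} {g : N →ₗ[B] Q}
    {pN : N →ₗ[B] N} {pQ : Q →ₗ[B] Q}
    (hpN' : ∀ x, g x = 0 → pN x = x) (hpQ : ∀ x, pQ (g x) = g x)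
    {s : N →ₗ[B] M} {s' : Q →ₗ[B] N} (hs : ∀ x, f (s x) = t • pN x)
    (hs' : ∀ x, ∃ y, s' x = y - pN y ∧ g y = t • pQ x) (x : N) :
    f (s x) + s' (g x) = t • x := by
  obtain ⟨y, h1, h2⟩ := hs' (g x)
  have h3 : pN (y - t • x) = y - t • x := hpN' _ (by rw [map_sub, map_smul, h2, hpQ, sub_self])
  rw [map_sub, map_smul] at h3
  rw [hs, h1, ← sub_eq_zero]
  rw [← sub_eq_zero] at h3
  rw [← neg_eq_zero, ← h3]
  abel

/-- An exact differential module of finite free modules over a principal ideal domain is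
contractible. -/
theorem Contraction.exists_of_exact (X : DiffMod.{v, w} B) [Module.Finite B X.ev]
    [Module.Free B X.ev] [Module.Finite B X.od] [Module.Free B X.od]
    (ddE : ∀ x, X.dOd (X.dEv x) = 0) (ddO : ∀ x, X.dEv (X.dOd x) = 0)
    (hE : ∀ x, X.dEv x = 0 → ∃ y, X.dOd y = x) (hO : ∀ x, X.dOd x = 0 → ∃ y, X.dEv y = x) :
    Nonempty (Contraction X) := by
  obtain ⟨pE, h1, h2⟩ := exists_ker_projection X.dEv
  obtain ⟨pO, h3, h4⟩ := exists_ker_projection X.dOd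
  obtain ⟨sE, h5, h6⟩ := exists_partial_inverse 1 X.dOd X.dEv (by simpa using hE) pO h3 pE h1
  obtain ⟨sO, h7, h8⟩ := exists_partial_inverse 1 X.dEv X.dOd (by simpa using hO) pE h1 pO h3
  obtain ⟨s, -⟩ := Contraction.exists_of_homotopy X sE sO ddE ddO
    (fun x => (homotopy_identity h2 (fun x => h4 _ (ddE x)) h5 h8 x).trans (one_smul B x))
    (fun x => (homotopy_identity h4 (fun x => h2 _ (ddO x)) h7 h6 x).trans (one_smul B x))
  exact ⟨s⟩

theorem NullHtpy.of_exact {R : Type u} [Ring R] {Y : Type*} [AddCommGroup Y] [Module B Y]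
    {act : Rᵐᵒᵖ →+* Module.End B Y} (t : B) (C : PerfCx R)
    (hfin : ∀ i, Module.Finite B (BTensor ⊤ act (C.cx.X i)))
    (hfree : ∀ i, Module.Free B (BTensor ⊤ act (C.cx.X i)))
    (h : ∀ i j k, i + 1 = j → j + 1 = k → ∀ x, BTensor.map ⊤ act (C.d j k) x = 0 →
      ∃ y, BTensor.map ⊤ act (C.d i j) y = t • x) : NullHtpy act t C := by
  choose p hp hp' using fun i => exists_ker_projection (BTensor.map ⊤ act (C.d i (i + 1)))
  have hs : ∀ i j : ℤ, ∃ s : BTensor ⊤ act (C.cx.X i) →ₗ[B] BTensor ⊤ act (C.cx.X j),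
      j + 1 = i → (∀ x, BTensor.map ⊤ act (C.d j i) (s x) = t • p i x) ∧
        ∀ x, ∃ y, s x = y - p j y ∧ BTensor.map ⊤ act (C.d j i) y = t • p i x := by
    intro i j
    by_cases hij : j + 1 = i
    · subst hij
      obtain ⟨s, h1, h2⟩ := exists_partial_inverse t _ _ (h j (j + 1) (j + 1 + 1) rfl rfl)
        (p j) (hp j) (p (j + 1)) (hp (j + 1))
      exact ⟨s, fun _ => ⟨h1, h2⟩⟩
    · exact ⟨0, fun h => absurd h hij⟩
  choose s hs using hs
  refine ⟨s, fun i j k hij hjk x => ?_⟩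
  subst hjk
  refine homotopy_identity (hp' j) (fun x => hp' _ _ ?_) (hs j i hij).1 (hs (j + 1) j rfl).2 x
  rw [BTensor.map_map, C.d_comp_d, BTensor.map_zero]
  rfl

end PID

/-! ### Reduction and extension of differential modules -/

section BCMap

variable {B : Type v} {B' : Type v'} [CommRing B] [CommRing B']

/-- A semilinear morphism of differential modules that is a base change in both degrees. -/
structure BCMap (σ : B →+* B') (X : DiffMod.{v, w} B) (X' : DiffMod.{v', w'} B') where
  ev : X.ev →ₛₗ[σ] X'.ev
  od : X.od →ₛₗ[σ] X'.od
  bcEv : IsBC ev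
  bcOd : IsBC od
  dEv : ∀ x, X'.dEv (ev x) = od (X.dEv x)
  dOd : ∀ x, X'.dOd (od x) = ev (X.dOd x)

variable {σ : B →+* B'}

/-- The induced morphism of cones. -/
def BCMap.cone {X Y : DiffMod.{v, w} B} {X' Y' : DiffMod.{v', w'} B'} (α : BCMap σ X X')
    (β : BCMap σ Y Y') (fE : X.ev →ₗ[B] Y.ev) (fO : X.od →ₗ[B] Y.od) (fE' : X'.ev →ₗ[B'] Y'.ev)
    (fO' : X'.od →ₗ[B'] Y'.od) (hE : ∀ x, fE' (α.ev x) = β.ev (fE x))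
    (hO : ∀ x, fO' (α.od x) = β.od (fO x)) :
    BCMap σ (cone X Y fE fO) (cone X' Y' fE' fO') where
  ev := sprod β.ev α.od
  od := sprod β.od α.ev
  bcEv := β.bcEv.prod α.bcOd
  bcOd := β.bcOd.prod α.bcEv
  dEv := by
    rintro ⟨x, y⟩
    change (Y'.dEv (β.ev x) + fO' (α.od y), -X'.dOd (α.od y)) =
      (β.od (Y.dEv x + fO y), α.ev (-X.dOd y))
    rw [β.dEv, α.dOd, hO, map_add, map_neg]
  dOd := by
    rintro ⟨x, y⟩
    change (Y'.dOd (β.od x) + fE' (α.ev y), -X'.dEv (α.ev y)) =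
      (β.ev (Y.dOd x + fE y), α.od (-X.dEv y))
    rw [β.dOd, α.dEv, hE, map_add, map_neg]

theorem BCMap.acyc {X : DiffMod.{v, w} B} {X' : DiffMod.{v', w'} B'} (β : BCMap σ X X')
    {s : Contraction X} {s' : Contraction X'} (h : ∀ x, s'.sOd (β.od x) = β.ev (s.sOd x)) (x : X.od) :
    s'.acyc (β.od x) = β.ev (s.acyc x) := by
  rw [Contraction.acyc_apply, Contraction.acyc_apply, map_add, β.dOd, h]

theorem BCMap.extend_contraction {X : DiffMod.{v, w} B} {X' : DiffMod.{v', w'} B'}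
    (β : BCMap σ X X') (s : Contraction X) : ∃ s' : Contraction X',
      (∀ x, s'.sEv (β.ev x) = β.od (s.sEv x)) ∧ ∀ x, s'.sOd (β.od x) = β.ev (s.sOd x) := by
  obtain ⟨sE, hE⟩ := β.bcEv.exists_extend β.od s.sEv
  obtain ⟨sO, hO⟩ := β.bcOd.exists_extend β.ev s.sOd
  refine ⟨⟨sE, sO, ?_, ?_, ?_, ?_, ?_, ?_⟩, hE, hO⟩
  · exact β.bcEv.hom_ext fun x => by simp [β.dEv, β.dOd, s.ddE]
  · exact β.bcOd.hom_ext fun x => by simp [β.dEv, β.dOd, s.ddO]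
  · exact β.bcEv.hom_ext fun x => by simp [hE, hO, s.ssE]
  · exact β.bcOd.hom_ext fun x => by simp [hE, hO, s.ssO]
  · exact β.bcEv.hom_ext fun x => by simp [hE, hO, β.dEv, β.dOd, ← map_add, s.hoE]
  · exact β.bcOd.hom_ext fun x => by simp [hE, hO, β.dEv, β.dOd, ← map_add, s.hoO]

theorem exists_equiv_of_unit_det {V W : Type*} [AddCommGroup V] [Module B V] [AddCommGroup W]
    [Module B' W] {f : V →ₛₗ[σ] W} (hf : IsBC f) [IsLocalHom σ] (α : V →ₗ[B] V)
    (h : ∀ x, f (α x) = f x) : ∃ e : V ≃ₗ[B] V, ∀ x, e x = α x := by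
  have h1 := hf.det α LinearMap.id fun x => by simp [h]
  have h2 : IsUnit (LinearMap.det α) := IsLocalHom.map_nonunit (f := σ) _ (by rw [← h1]; simp)
  have := hf.finite
  have := hf.free
  exact ⟨LinearEquiv.ofIsUnitDet (f := α) (v := Module.Free.chooseBasis B V)
    (v' := Module.Free.chooseBasis B V) (by rwa [LinearMap.det_toMatrix]), fun x => rfl⟩

/-- Contractions lift along the reduction modulo an ideal contained in the radical. -/
theorem BCMap.lift_contraction [IsLocalHom σ] (hσ : Function.Surjective σ)
    {X : DiffMod.{v, w} B} {X' : DiffMod.{v', w'} B'}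
    (β : BCMap σ X X') (ddE : ∀ x, X.dOd (X.dEv x) = 0) (ddO : ∀ x, X.dEv (X.dOd x) = 0)
    (s' : Contraction X') : ∃ s : Contraction X, ∀ x, s'.sOd (β.od x) = β.ev (s.sOd x) := by
  obtain ⟨hE, h1⟩ := β.bcEv.exists_lift (β.bcOd.surjective hσ) s'.sEv
  obtain ⟨hO, h2⟩ := β.bcOd.exists_lift (β.bcEv.surjective hσ) s'.sOd
  obtain ⟨uE, h3⟩ := exists_equiv_of_unit_det β.bcEv (X.dOd ∘ₗ hE + hO ∘ₗ X.dEv) fun x => by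
    simp [h1, h2, ← β.dEv, ← β.dOd, s'.hoE]
  obtain ⟨uO, h4⟩ := exists_equiv_of_unit_det β.bcOd (X.dEv ∘ₗ hO + hE ∘ₗ X.dOd) fun x => by
    simp [h1, h2, ← β.dEv, ← β.dOd, s'.hoO]
  have h5 : ∀ x, uO.symm (X.dEv x) = X.dEv (uE.symm x) := fun x => by
    rw [LinearEquiv.symm_apply_eq, h4]
    have := h3 (uE.symm x)
    rw [LinearEquiv.apply_symm_apply] at this
    conv_lhs => rw [this]
    simp [ddE, ddO]
  have h6 : ∀ x, uE.symm (X.dOd x) = X.dOd (uO.symm x) := fun x => by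
    rw [LinearEquiv.symm_apply_eq, h3]
    have := h4 (uO.symm x)
    rw [LinearEquiv.apply_symm_apply] at this
    conv_lhs => rw [this]
    simp [ddE, ddO]
  have h7 : ∀ x, β.ev (uE.symm x) = β.ev x := fun x => by
    conv_rhs => rw [← uE.apply_symm_apply x, h3]
    simp [h1, h2, ← β.dEv, ← β.dOd, s'.hoE]
  have h8 : ∀ x, β.od (uO.symm x) = β.od x := fun x => by
    conv_rhs => rw [← uO.apply_symm_apply x, h4]
    simp [h1, h2, ← β.dEv, ← β.dOd, s'.hoO]
  obtain ⟨s, -, hs⟩ := Contraction.exists_of_homotopy X (hE ∘ₗ uE.symm.toLinearMap)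
    (hO ∘ₗ uO.symm.toLinearMap) ddE ddO
    (fun x => by
      simp only [LinearMap.comp_apply, LinearEquiv.coe_coe, h5]
      have := h3 (uE.symm x)
      rw [LinearEquiv.apply_symm_apply] at this
      exact this.symm)
    (fun x => by
      simp only [LinearMap.comp_apply, LinearEquiv.coe_coe, h6]
      have := h4 (uO.symm x)
      rw [LinearEquiv.apply_symm_apply] at this
      exact this.symm)
  refine ⟨s, fun x => ?_⟩
  simp [hs, h2, h8, ← β.dEv, s'.sdsO]

/-- Coordinates with respect to a basis, as a semilinear map. -/
def constMap (σ : B →+* B') {ι H : Type*} [Fintype ι] [AddCommGroup H] [Module B H]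
    (b : Module.Basis ι B H) : H →ₛₗ[σ] (ι → B') where
  toFun x i := σ (b.repr x i)
  map_add' x y := by ext i; simp
  map_smul' c x := by ext i; simp

theorem constMap_isBC (σ : B →+* B') {ι H : Type*} [Fintype ι] [AddCommGroup H] [Module B H]
    (b : Module.Basis ι B H) : IsBC (constMap σ b) := by
  classical
  refine .of_basis b (Pi.basisFun B' ι) fun i => ?_
  ext j
  simp [constMap, Finsupp.single_apply, Pi.single_apply, eq_comm]

/-- Linear combinations of a basis, as a semilinear map. -/
def evalMap (σ : B →+* B') {ι H : Type*} [Fintype ι] [AddCommGroup H] [Module B' H]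
    (b : Module.Basis ι B' H) : (ι → B) →ₛₗ[σ] H where
  toFun x := ∑ i, σ (x i) • b i
  map_add' x y := by simp [add_smul, Finset.sum_add_distrib]
  map_smul' c x := by simp [Finset.smul_sum, mul_smul]

theorem evalMap_single (σ : B →+* B') {ι H : Type*} [Fintype ι] [DecidableEq ι] [AddCommGroup H]
    [Module B' H] (b : Module.Basis ι B' H) (i : ι) : evalMap σ b (Pi.single i 1) = b i := by
  simp [evalMap, Pi.single_apply]

theorem evalMap_isBC (σ : B →+* B') {ι H : Type*} [Fintype ι] [AddCommGroup H] [Module B' H]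
    (b : Module.Basis ι B' H) : IsBC (evalMap σ b) := by
  classical
  exact .of_basis (Pi.basisFun B ι) b fun i => by simp [evalMap_single]

end BCMap

section Laurent

variable {L : Type v} [Field L]

theorem exists_X_mul {c : PowerSeries L} (h : PowerSeries.constantCoeff c = 0) :
    ∃ c', c = PowerSeries.X * c' := PowerSeries.X_dvd_iff.2 h

theorem constantCoeff_surjective :
    Function.Surjective (PowerSeries.constantCoeff (R := L)) := fun c => ⟨PowerSeries.C c, by simp⟩

theorem order_leadingCoeff (u : PowerSeries L) (hu : PowerSeries.constantCoeff u ≠ 0) (c : L)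
    (hc : c ≠ 0) (r : ℤ) :
    (HahnSeries.ofPowerSeries ℤ L u * (HahnSeries.C c * HahnSeries.single r 1)).order = r ∧
    (HahnSeries.ofPowerSeries ℤ L u * (HahnSeries.C c * HahnSeries.single r 1)).leadingCoeff =
      PowerSeries.constantCoeff u * c := by
  have h1 : (HahnSeries.ofPowerSeries ℤ L u).coeff 0 = PowerSeries.constantCoeff u := by
    have := HahnSeries.ofPowerSeries_apply_coeff (Γ := ℤ) u 0
    simpa using this
  have hne : HahnSeries.ofPowerSeries ℤ L u ≠ 0 := fun h => hu (by rw [← h1, h]; rfl)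
  have h2 : (HahnSeries.ofPowerSeries ℤ L u).order = 0 := by
    refine le_antisymm (HahnSeries.order_le_of_coeff_ne_zero (by rwa [h1])) ?_
    by_contra hlt
    push Not at hlt
    have h5 : ∀ o : ℤ, o < 0 → (HahnSeries.ofPowerSeries ℤ L u).coeff o = 0 := fun o ho => by
      rw [HahnSeries.ofPowerSeries_apply]
      refine HahnSeries.embDomain_of_notMem_range ?_
      rintro ⟨n, hn⟩
      have : (0 : ℤ) ≤ (n : ℤ) := by positivity
      exact absurd ho (not_lt.2 (by rw [← hn]; exact this))
    exact HahnSeries.coeff_order_eq_zero.not.2 hne (h5 _ hlt)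
  have h4 : (HahnSeries.C c * HahnSeries.single r 1 : LaurentSeries L) = HahnSeries.single r c := by
    rw [HahnSeries.C_apply, HahnSeries.single_mul_single]; simp
  rw [h4]
  have hne' : (HahnSeries.single r c : LaurentSeries L) ≠ 0 := HahnSeries.single_ne_zero hc
  constructor
  · rw [HahnSeries.order_mul hne hne', h2, HahnSeries.order_single hc, zero_add]
  · rw [HahnSeries.leadingCoeff_mul, HahnSeries.leadingCoeff_of_single,
      HahnSeries.leadingCoeff_eq, h2, h1]

end Laurent

/-! ### The leading term of a complex over a power series ring -/

section Core

variable {L : Type v} [Field L]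

/-- Lifts of cohomology classes of the reduction. -/
theorem exists_cocycle_lift {U U' U₀ U₀' H V : Type*} [AddCommGroup U] [Module (PowerSeries L) U]
    [AddCommGroup U'] [Module (PowerSeries L) U'] [AddCommGroup U₀] [Module L U₀]
    [AddCommGroup U₀'] [Module L U₀'] [AddCommGroup H] [Module L H] [AddCommGroup V]
    [Module (PowerSeries L) V]
    (π : U →ₛₗ[PowerSeries.constantCoeff (R := L)] U₀)
    (π' : U' →ₛₗ[PowerSeries.constantCoeff (R := L)] U₀') (hπ : IsBC π) (hπ' : IsBC π')
    (d : U →ₗ[PowerSeries L] U') (d₀ : U₀ →ₗ[L] U₀') (hd : ∀ x, d₀ (π x) = π' (d x))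
    (c : LinearMap.ker d₀ →ₗ[L] H) (hc : Function.Surjective c)
    (ε : V →ₛₗ[PowerSeries.constantCoeff (R := L)] H) (hε : IsBC ε) :
    ∃ (q : V →ₗ[PowerSeries L] U) (D : V →ₗ[PowerSeries L] U'),
      (∀ v, d (q v) = (PowerSeries.X : PowerSeries L) • D v) ∧
      ∀ v, ∃ h : d₀ (π (q v)) = 0, c ⟨π (q v), h⟩ = ε v := by
  obtain ⟨k, b, b', hb⟩ := hε
  choose z hz using fun i => hc (b' i)
  choose q hq using fun i => hπ.surjective constantCoeff_surjective (z i : U₀)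
  have h1 : ∀ i, π' (d (q i)) = 0 := fun i => by
    rw [← hd, hq]
    exact (z i).2
  choose D hD using fun i => hπ'.exists_smul (t := PowerSeries.X) (fun c => exists_X_mul) (h1 i)
  refine ⟨b.constr (PowerSeries L) q, b.constr (PowerSeries L) D, ?_, fun v => ?_⟩
  · refine fun v => LinearMap.congr_fun (f := d ∘ₗ b.constr (PowerSeries L) q)
      (g := (PowerSeries.X : PowerSeries L) • b.constr (PowerSeries L) D)
      (b.ext fun i => ?_) v
    simp only [LinearMap.comp_apply, LinearMap.smul_apply, Module.Basis.constr_basis, hD]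
  · have h2 : π (b.constr (PowerSeries L) q v) =
        (∑ i, PowerSeries.constantCoeff (b.repr v i) • z i : LinearMap.ker d₀) := by
      simp [Module.Basis.constr_apply_fintype, hq]
    have h4 : d₀ (π (b.constr (PowerSeries L) q v)) = 0 := by
      rw [h2]
      exact LinearMap.mem_ker.1 (Subtype.property _)
    refine ⟨h4, ?_⟩
    have h3 : (⟨π (b.constr (PowerSeries L) q v), h4⟩ : LinearMap.ker d₀) =
        ∑ i, PowerSeries.constantCoeff (b.repr v i) • z i := Subtype.ext h2
    rw [h3, IsBC.apply_eq_sum hb]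
    simp [hz]

/-- The extension of a differential module over `L` to power series and Laurent series. -/
theorem exists_const_model (Z : DiffMod.{v, max v w} L) {ι₁ ι₂ : Type (max v w)} [Fintype ι₁] [Fintype ι₂]
    (b₁ : Module.Basis ι₁ L Z.ev) (b₂ : Module.Basis ι₂ L Z.od) :
    ∃ (V : DiffMod.{v, max v w} (PowerSeries L)) (VK : DiffMod.{v, max v w} (LaurentSeries L))
      (γ : BCMap (PowerSeries.C (R := L)) Z V) (ε : BCMap (PowerSeries.constantCoeff (R := L)) V Z)
      (κ : BCMap (HahnSeries.ofPowerSeries ℤ L) V VK) (b : Module.Basis ι₂ (LaurentSeries L) VK.od),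
      (∀ x, ε.ev (γ.ev x) = x) ∧ (∀ x, ε.od (γ.od x) = x) ∧ ∀ i, b i = κ.od (γ.od (b₂ i)) := by
  classical
  obtain ⟨dE, hE⟩ := (constMap_isBC (PowerSeries.C (R := L)) b₁).exists_extend
    (constMap (PowerSeries.C (R := L)) b₂) Z.dEv
  obtain ⟨dO, hO⟩ := (constMap_isBC (PowerSeries.C (R := L)) b₂).exists_extend
    (constMap (PowerSeries.C (R := L)) b₁) Z.dOd
  let κ₁ := constMap (HahnSeries.ofPowerSeries ℤ L) (Pi.basisFun (PowerSeries L) ι₁)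
  let κ₂ := constMap (HahnSeries.ofPowerSeries ℤ L) (Pi.basisFun (PowerSeries L) ι₂)
  obtain ⟨dEK, hEK⟩ := (constMap_isBC (HahnSeries.ofPowerSeries ℤ L)
    (Pi.basisFun (PowerSeries L) ι₁)).exists_extend κ₂ dE
  obtain ⟨dOK, hOK⟩ := (constMap_isBC (HahnSeries.ofPowerSeries ℤ L)
    (Pi.basisFun (PowerSeries L) ι₂)).exists_extend κ₁ dO
  have e1 : ∀ x, evalMap PowerSeries.constantCoeff b₁ (constMap (PowerSeries.C (R := L)) b₁ x) = x :=
    fun x => by simp [evalMap, constMap, b₁.sum_repr]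
  have e2 : ∀ x, evalMap PowerSeries.constantCoeff b₂ (constMap (PowerSeries.C (R := L)) b₂ x) = x :=
    fun x => by simp [evalMap, constMap, b₂.sum_repr]
  refine ⟨⟨ι₁ → PowerSeries L, ι₂ → PowerSeries L, dE, dO⟩,
    ⟨ι₁ → LaurentSeries L, ι₂ → LaurentSeries L, dEK, dOK⟩,
    ⟨constMap PowerSeries.C b₁, constMap PowerSeries.C b₂, constMap_isBC _ _, constMap_isBC _ _,
      hE, hO⟩, ⟨evalMap PowerSeries.constantCoeff b₁, evalMap PowerSeries.constantCoeff b₂,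
      evalMap_isBC _ _, evalMap_isBC _ _, fun x => ?_, fun x => ?_⟩,
    ⟨κ₁, κ₂, constMap_isBC _ _, constMap_isBC _ _, hEK, hOK⟩, Pi.basisFun _ ι₂, e1, e2, fun i => ?_⟩
  · refine LinearMap.congr_fun (f := Z.dEv.comp (evalMap PowerSeries.constantCoeff b₁))
      (g := (evalMap PowerSeries.constantCoeff b₂).comp dE)
      ((constMap_isBC (PowerSeries.C (R := L)) b₁).hom_ext fun y => ?_) x
    simp only [LinearMap.comp_apply, hE, e1, e2]
  · refine LinearMap.congr_fun (f := Z.dOd.comp (evalMap PowerSeries.constantCoeff b₂))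
      (g := (evalMap PowerSeries.constantCoeff b₁).comp dO)
      ((constMap_isBC (PowerSeries.C (R := L)) b₂).hom_ext fun y => ?_) x
    simp only [LinearMap.comp_apply, hO, e1, e2]
  · ext1 j
    simp only [κ₂, constMap, LinearMap.coe_mk, AddHom.coe_mk, Pi.basisFun_apply, Pi.basisFun_repr,
      Module.Basis.repr_self]
    by_cases h : j = i
    · subst h; simp
    · simp [Finsupp.single_apply, Pi.single_apply, h, Ne.symm h]

/-- A basis adapted to an idempotent. -/
theorem exists_idempotent_basis {H : Type w} [AddCommGroup H] [Module L H] [Module.Finite L H]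
    (e : H →ₗ[L] H) (he : ∀ x, e (e x) = e x) :
    ∃ (ι₁ ι₂ : Type w) (_ : Fintype ι₁) (_ : Fintype ι₂) (b : Module.Basis (ι₁ ⊕ ι₂) L H),
      (∀ i, e (b (Sum.inl i)) = b (Sum.inl i)) ∧ (∀ i, e (b (Sum.inr i)) = 0) ∧
      Fintype.card ι₁ = Module.finrank L (LinearMap.range e) ∧
      Fintype.card ι₂ = Module.finrank L (LinearMap.ker e) := by
  classical
  have hc : IsCompl (LinearMap.range e) (LinearMap.ker e) := by
    refine ⟨Submodule.disjoint_def.2 ?_, codisjoint_iff.2 (eq_top_iff.2 fun x _ => ?_)⟩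
    · rintro _ ⟨x, rfl⟩ hx
      rw [← he]
      exact hx
    · exact Submodule.mem_sup.2 ⟨e x, ⟨x, rfl⟩, x - e x, by simp [he], by simp⟩
  let b₁ := Module.Basis.ofVectorSpace L (LinearMap.range e)
  let b₂ := Module.Basis.ofVectorSpace L (LinearMap.ker e)
  let f₁ : Fintype (Module.Basis.ofVectorSpaceIndex L (LinearMap.range e)) :=
    FiniteDimensional.fintypeBasisIndex b₁
  let f₂ : Fintype (Module.Basis.ofVectorSpaceIndex L (LinearMap.ker e)) :=
    FiniteDimensional.fintypeBasisIndex b₂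
  refine ⟨_, _, f₁, f₂, (b₁.prod b₂).map (Submodule.prodEquivOfIsCompl _ _ hc), fun i => ?_,
    fun i => ?_, (Module.finrank_eq_card_basis b₁).symm, (Module.finrank_eq_card_basis b₂).symm⟩
  · obtain ⟨x, hx⟩ := (b₁ i).2
    simp [Module.Basis.prod_apply, ← hx, he]
  · have : e (b₂ i : H) = 0 := (b₂ i).2
    simp [Module.Basis.prod_apply, this]

/-- The differential module of the cohomology groups with zero differentials. -/
abbrev zeroDiff (Z : DiffMod.{v, w} L) : DiffMod.{v, w} L where
  ev := Z.ev
  od := Z.od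
  dEv := 0
  dOd := 0

/-- The differential module obtained by multiplying the differentials by a scalar. -/
abbrev scaleDiff {B : Type v} [CommRing B] (t : B) (Z : DiffMod.{v, w} B) : DiffMod.{v, w} B where
  ev := Z.ev
  od := Z.od
  dEv := t • Z.dEv
  dOd := t • Z.dOd

/-- The contraction of a rescaled differential module. -/
def Contraction.scale {B : Type v} [CommRing B] {Z : DiffMod.{v, w} B} (s : Contraction Z)
    (t t' : B) (h : t * t' = 1) : Contraction (scaleDiff t Z) where
  sEv := t' • s.sEv
  sOd := t' • s.sOd
  dd_ev := by ext x; simp [s.ddE]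
  dd_od := by ext x; simp [s.ddO]
  ss_ev := by ext x; simp [s.ssE]
  ss_od := by ext x; simp [s.ssO]
  homotopy_ev := by
    ext x
    simp only [LinearMap.add_apply, LinearMap.comp_apply, LinearMap.smul_apply, map_smul, smul_smul,
      h, mul_comm t' t, one_smul, s.hoE, LinearMap.id_apply]
  homotopy_od := by
    ext x
    simp only [LinearMap.add_apply, LinearMap.comp_apply, LinearMap.smul_apply, map_smul, smul_smul,
      h, mul_comm t' t, one_smul, s.hoO, LinearMap.id_apply]

/-- The cone of a map from the cohomology of a differential module over a field to the module that
induces the identity on cohomology is contractible. -/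
theorem exists_cone_contraction {X₀ HB : DiffMod.{v, w} L} [Module.Finite L X₀.ev]
    [Module.Finite L X₀.od] [Module.Finite L HB.ev] [Module.Finite L HB.od]
    (ddE : ∀ x, X₀.dOd (X₀.dEv x) = 0) (ddO : ∀ x, X₀.dEv (X₀.dOd x) = 0)
    (cE : LinearMap.ker X₀.dEv →ₗ[L] HB.ev) (cO : LinearMap.ker X₀.dOd →ₗ[L] HB.od)
    (hcE : ∀ z, cE z = 0 ↔ ∃ y, X₀.dOd y = z) (hcO : ∀ z, cO z = 0 ↔ ∃ y, X₀.dEv y = z)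
    (jE : HB.ev →ₗ[L] X₀.ev) (jO : HB.od →ₗ[L] X₀.od)
    (hjE : ∀ x, ∃ h, cE ⟨jE x, h⟩ = x) (hjO : ∀ x, ∃ h, cO ⟨jO x, h⟩ = x) :
    Nonempty (Contraction (cone (zeroDiff HB) X₀ jE jO)) := by
  have f1 : Module.Finite L (cone (zeroDiff HB) X₀ jE jO).ev :=
    inferInstanceAs (Module.Finite L (X₀.ev × HB.od))
  have f2 : Module.Finite L (cone (zeroDiff HB) X₀ jE jO).od :=
    inferInstanceAs (Module.Finite L (X₀.od × HB.ev))
  have kE : ∀ x, X₀.dEv (jE x) = 0 := fun x => (hjE x).1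
  have kO : ∀ x, X₀.dOd (jO x) = 0 := fun x => (hjO x).1
  refine Contraction.exists_of_exact _ ?_ ?_ ?_ ?_
  · rintro ⟨x, y⟩
    change (X₀.dOd (X₀.dEv x + jO y) + jE (-0), -(0 : HB.od)) = (0, 0)
    rw [map_add, ddE, kO]
    simp
  · rintro ⟨x, y⟩
    change (X₀.dEv (X₀.dOd x + jE y) + jO (-0), -(0 : HB.ev)) = (0, 0)
    rw [map_add, ddO, kE]
    simp
  · rintro ⟨x, y⟩ hxy
    have h1 : X₀.dEv x + jO y = 0 := congrArg Prod.fst hxy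
    obtain ⟨h2, h3⟩ := hjO y
    have h4 : y = 0 := by
      rw [← h3, hcO]
      exact ⟨-x, by rw [map_neg]; exact neg_eq_of_add_eq_zero_right h1⟩
    rw [h4, map_zero, add_zero] at h1
    obtain ⟨h5, h6⟩ := hjE (cE ⟨x, h1⟩)
    rw [← sub_eq_zero, ← map_sub, hcE] at h6
    obtain ⟨z, hz⟩ := h6
    refine ⟨(-z, cE ⟨x, h1⟩), ?_⟩
    change (X₀.dOd (-z) + jE (cE ⟨x, h1⟩), -(0 : HB.od)) = (x, y)
    rw [map_neg, hz, h4]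
    simp
  · rintro ⟨x, y⟩ hxy
    have h1 : X₀.dOd x + jE y = 0 := congrArg Prod.fst hxy
    obtain ⟨h2, h3⟩ := hjE y
    have h4 : y = 0 := by
      rw [← h3, hcE]
      exact ⟨-x, by rw [map_neg]; exact neg_eq_of_add_eq_zero_right h1⟩
    rw [h4, map_zero, add_zero] at h1
    obtain ⟨h5, h6⟩ := hjO (cO ⟨x, h1⟩)
    rw [← sub_eq_zero, ← map_sub, hcO] at h6
    obtain ⟨z, hz⟩ := h6
    refine ⟨(-z, cO ⟨x, h1⟩), ?_⟩
    change (X₀.dEv (-z) + jO (cO ⟨x, h1⟩), -(0 : HB.ev)) = (x, y)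
    rw [map_neg, hz, h4]
    simp


theorem finrank_range_contraction {Z : DiffMod.{v, w} L} [Module.Finite L Z.ev]
    [Module.Finite L Z.od] (s : Contraction Z) :
    Module.finrank L (LinearMap.range (Z.dEv ∘ₗ s.sOd)) = Module.finrank L (LinearMap.range Z.dEv) ∧
    Module.finrank L (LinearMap.ker (Z.dEv ∘ₗ s.sOd)) = Module.finrank L (LinearMap.range Z.dOd) := by
  constructor
  · have h : LinearMap.range (Z.dEv ∘ₗ s.sOd) = LinearMap.range Z.dEv := ?_
    · rw [h]
    refine le_antisymm ?_ ?_
    · rintro _ ⟨x, rfl⟩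
      exact ⟨_, rfl⟩
    · rintro _ ⟨x, rfl⟩
      exact ⟨Z.dEv x, s.dsdE x⟩
  · let f : LinearMap.ker (Z.dEv ∘ₗ s.sOd) →ₗ[L] LinearMap.range Z.dOd :=
      Z.dOd.rangeRestrict ∘ₗ (LinearMap.ker (Z.dEv ∘ₗ s.sOd)).subtype
    refine LinearEquiv.finrank_eq (LinearEquiv.ofBijective f ⟨?_, ?_⟩)
    · rw [injective_iff_map_eq_zero]
      rintro ⟨x, hx⟩ h
      have h1 : Z.dOd x = 0 := congrArg Subtype.val h
      have h2 := s.hoO x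
      have h3 : Z.dEv (s.sOd x) = 0 := hx
      rw [h1, h3, map_zero, add_zero] at h2
      exact Subtype.ext h2.symm
    · rintro ⟨_, x, rfl⟩
      refine ⟨⟨s.sEv (Z.dOd x), ?_⟩, Subtype.ext (s.dsdO x)⟩
      simp [s.ssE]

/-- The determinant of the two trivialisations of an acyclic differential module that differ by
scaling. -/
theorem det_scale {K : Type v} [Field K] {Z : DiffMod.{v, w} K} (s : Contraction Z) {ι₁ ι₂ : Type*}
    [Fintype ι₁] [Fintype ι₂] (b : Module.Basis (ι₁ ⊕ ι₂) K Z.od)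
    (h₁ : ∀ i, Z.dEv (s.sOd (b (Sum.inl i))) = b (Sum.inl i))
    (h₂ : ∀ i, Z.dEv (s.sOd (b (Sum.inr i))) = 0) (t t' : K) (ht : t * t' = 1) :
    (LinearEquiv.det (s.acyc.trans (s.scale t t' ht).acyc.symm) : K) =
      t ^ Fintype.card ι₁ * t' ^ Fintype.card ι₂ := by
  classical
  have h : ∀ x, (s.acyc.trans (s.scale t t' ht).acyc.symm) x =
      t • Z.dEv (s.sOd x) + t' • s.sEv (Z.dOd x) := fun x => by
    rw [LinearEquiv.trans_apply, Contraction.acyc_symm_apply, Contraction.acyc_apply]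
    change t • Z.dEv (Z.dOd x + s.sOd x) + t' • s.sEv (Z.dOd x + s.sOd x) = _
    rw [map_add, map_add, s.ddO, s.ssO, zero_add, add_zero]
  have h3 : ∀ i, s.sEv (Z.dOd (b (Sum.inl i))) = 0 := fun i => by
    have := s.hoO (b (Sum.inl i))
    rwa [h₁, add_eq_left] at this
  have h4 : ∀ i, s.sEv (Z.dOd (b (Sum.inr i))) = b (Sum.inr i) := fun i => by
    have := s.hoO (b (Sum.inr i))
    rwa [h₂, zero_add] at this
  rw [LinearEquiv.coe_det, ← LinearMap.det_toMatrix b]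
  have h5 : LinearMap.toMatrix b b (s.acyc.trans (s.scale t t' ht).acyc.symm).toLinearMap =
      Matrix.diagonal (Sum.elim (fun _ => t) fun _ => t') := by
    ext i j
    rw [LinearMap.toMatrix_apply, LinearEquiv.coe_coe, h]
    rcases j with j | j
    · rw [h₁, h3, smul_zero, add_zero, map_smul, b.repr_self, Finsupp.smul_apply,
        Finsupp.single_apply, Matrix.diagonal_apply]
      by_cases hij : Sum.inl j = i
      · subst hij; simp
      · simp [hij, Ne.symm hij]
    · rw [h₂, h4, smul_zero, zero_add, map_smul, b.repr_self, Finsupp.smul_apply,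
        Finsupp.single_apply, Matrix.diagonal_apply]
      by_cases hij : Sum.inr j = i
      · subst hij; simp
      · simp [hij, Ne.symm hij]
  rw [h5, Matrix.det_diagonal, Fintype.prod_sum_type]
  simp


theorem isBC_zero_punit {B B' : Type*} [CommRing B] [CommRing B'] (σ : B →+* B') :
    IsBC (0 : PUnit.{v' + 1} →ₛₗ[σ] PUnit.{w' + 1}) :=
  ⟨0, Module.Basis.empty _, Module.Basis.empty _, fun i => i.elim0⟩

theorem neg_single_pow {L : Type*} [Field L] (a c : ℕ) :
    (-HahnSeries.single (1 : ℤ) (1 : L)) ^ a * (-HahnSeries.single (-1 : ℤ) (1 : L)) ^ c =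
      HahnSeries.C ((-1) ^ (a + c)) * HahnSeries.single ((a : ℤ) - c) (1 : L) := by
  rw [neg_pow, neg_pow (HahnSeries.single (-1 : ℤ) (1 : L)), HahnSeries.single_pow,
    HahnSeries.single_pow, mul_mul_mul_comm, ← pow_add, HahnSeries.single_mul_single, map_pow,
    map_neg, map_one]
  simp [sub_eq_add_neg]

/-- The order and the leading coefficient of the characteristic element of a differential module
over `L[[T]]` that becomes acyclic after inverting `T`, in terms of the Bockstein maps on the
cohomology of its reduction modulo `T`. -/
theorem order_and_leadingCoeff {X : DiffMod.{v, max v w} (PowerSeries L)}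
    {X₀ : DiffMod.{v, max v w} L} {XK : DiffMod.{v, max v w} (LaurentSeries L)}
    (π : BCMap (PowerSeries.constantCoeff (R := L)) X X₀)
    (κ : BCMap (HahnSeries.ofPowerSeries ℤ L) X XK)
    (ddE : ∀ x, X.dOd (X.dEv x) = 0) (ddO : ∀ x, X.dEv (X.dOd x) = 0)
    {HB : DiffMod.{v, max v w} L}
    (cE : LinearMap.ker X₀.dEv →ₗ[L] HB.ev) (cO : LinearMap.ker X₀.dOd →ₗ[L] HB.od)
    (hcE' : Function.Surjective cE) (hcO' : Function.Surjective cO)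
    (hcE : ∀ z, cE z = 0 ↔ ∃ y, X₀.dOd y = z) (hcO : ∀ z, cO z = 0 ↔ ∃ y, X₀.dEv y = z)
    (hbE : ∀ x y, X.dEv x = (PowerSeries.X : PowerSeries L) • y → ∀ h h',
      cO ⟨π.od y, h'⟩ = -HB.dEv (cE ⟨π.ev x, h⟩))
    (hbO : ∀ x y, X.dOd x = (PowerSeries.X : PowerSeries L) • y → ∀ h h',
      cE ⟨π.ev y, h'⟩ = -HB.dOd (cO ⟨π.od x, h⟩))
    (s : Contraction HB) (sK : Contraction XK)
    {M₀ M MK : Type (max v w)} [AddCommGroup M₀] [Module L M₀] [AddCommGroup M]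
    [Module (PowerSeries L) M] [AddCommGroup MK] [Module (LaurentSeries L) MK]
    (m₀ : M →ₛₗ[PowerSeries.constantCoeff (R := L)] M₀) (hm₀ : IsBC m₀)
    (mK : M →ₛₗ[HahnSeries.ofPowerSeries ℤ L] MK) (hmK : IsBC mK)
    (φ₀ : (X₀.od × M₀) ≃ₗ[L] (X₀.ev × M₀)) (φ : (X.od × M) ≃ₗ[PowerSeries L] (X.ev × M))
    (φK : (XK.od × MK) ≃ₗ[LaurentSeries L] (XK.ev × MK))
    (hφ₀ : ∀ x, φ₀ (sprod π.od m₀ x) = sprod π.ev m₀ (φ x))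
    (hφK : ∀ x, φK (sprod κ.od mK x) = sprod κ.ev mK (φ x)) :
    ∃ (jE : HB.ev →ₗ[L] X₀.ev) (jO : HB.od →ₗ[L] X₀.od),
      (∀ x, ∃ h, cE ⟨jE x, h⟩ = x) ∧ (∀ x, ∃ h, cO ⟨jO x, h⟩ = x) ∧
      ∃ t : Contraction (cone (zeroDiff HB) X₀ jE jO),
        (LinearEquiv.det (φK.trans (sK.acyc.prodCongr
          (LinearEquiv.refl (LaurentSeries L) MK)).symm) : LaurentSeries L).order =
          (Module.finrank L (LinearMap.range HB.dEv) : ℤ) -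
            Module.finrank L (LinearMap.range HB.dOd) ∧
        (LinearEquiv.det (φK.trans (sK.acyc.prodCongr
          (LinearEquiv.refl (LaurentSeries L) MK)).symm) : LaurentSeries L).leadingCoeff =
          (-1) ^ (Module.finrank L (LinearMap.range HB.dEv) +
            Module.finrank L (LinearMap.range HB.dOd)) *
          LinearMap.det (compareTriv φ₀ (compTriv t.acyc
            (s.acyc.prodCongr (LinearEquiv.refl L PUnit.{1})))).toLinearMap := by
  classical
  have hσ := constantCoeff_surjective (L := L)
  have hloc : IsLocalHom (PowerSeries.constantCoeff (R := L)) :=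
    ⟨fun _ h => PowerSeries.isUnit_iff_constantCoeff.2 h⟩
  have fX₀E := π.bcEv.finite'
  have fX₀O := π.bcOd.finite'
  have fXE := π.bcEv.finite
  have fXO := π.bcOd.finite
  have frXE := π.bcEv.free
  have frXO := π.bcOd.free
  have fXKE := κ.bcEv.finite'
  have fXKO := κ.bcOd.finite'
  have fMK := hmK.finite'
  have fHE : Module.Finite L HB.ev := Module.Finite.of_surjective cE hcE'
  have fHO : Module.Finite L HB.od := Module.Finite.of_surjective cO hcO'
  have ddE₀ : ∀ x, X₀.dOd (X₀.dEv x) = 0 := fun x => by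
    obtain ⟨x, rfl⟩ := π.bcEv.surjective hσ x
    rw [π.dEv, π.dOd, ddE, map_zero]
  have ddO₀ : ∀ x, X₀.dEv (X₀.dOd x) = 0 := fun x => by
    obtain ⟨x, rfl⟩ := π.bcOd.surjective hσ x
    rw [π.dOd, π.dEv, ddO, map_zero]
  obtain ⟨ι₁, ι₂, _, _, b₂, hb₁, hb₂, hc₁, hc₂⟩ := exists_idempotent_basis (HB.dEv ∘ₗ s.sOd)
    (fun x => by simp [s.dsdE])
  obtain ⟨r₁, r₂⟩ := finrank_range_contraction s
  let b₁ := Module.Basis.ofVectorSpace L HB.ev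
  let _ : Fintype (Module.Basis.ofVectorSpaceIndex L HB.ev) := FiniteDimensional.fintypeBasisIndex b₁
  obtain ⟨V, VK, γ, ε, κV, bK, hεγE, hεγO, hbK⟩ := exists_const_model HB b₁ b₂
  obtain ⟨sP, hsE, hsO⟩ := γ.extend_contraction s
  obtain ⟨sVK, hsKE, hsKO⟩ := κV.extend_contraction sP
  have hεsE : ∀ x, s.sEv (ε.ev x) = ε.od (sP.sEv x) := fun x => by
    refine LinearMap.congr_fun (f := s.sEv.comp ε.ev) (g := ε.od.comp sP.sEv)
      (γ.bcEv.hom_ext fun y => ?_) x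
    simp only [LinearMap.comp_apply, hsE, hεγE, hεγO]
  have hεsO : ∀ x, s.sOd (ε.od x) = ε.ev (sP.sOd x) := fun x => by
    refine LinearMap.congr_fun (f := s.sOd.comp ε.od) (g := ε.ev.comp sP.sOd)
      (γ.bcOd.hom_ext fun y => ?_) x
    simp only [LinearMap.comp_apply, hsO, hεγE, hεγO]
  obtain ⟨qE, DE, hqE, hqE'⟩ := exists_cocycle_lift π.ev π.od π.bcEv π.bcOd X.dEv X₀.dEv π.dEv cE hcE'
    ε.ev ε.bcEv
  obtain ⟨qO, DO, hqO, hqO'⟩ := exists_cocycle_lift π.od π.ev π.bcOd π.bcEv X.dOd X₀.dOd π.dOd cO hcO'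
    ε.od ε.bcOd
  have hX0 : (PowerSeries.X : PowerSeries L) ≠ 0 := PowerSeries.X_ne_zero
  have tfE : ∀ x : X.ev, (PowerSeries.X : PowerSeries L) • x = 0 → x = 0 := fun x h =>
    (smul_eq_zero.1 h).resolve_left hX0
  have tfO : ∀ x : X.od, (PowerSeries.X : PowerSeries L) • x = 0 → x = 0 := fun x h =>
    (smul_eq_zero.1 h).resolve_left hX0
  have dDE : ∀ v, X.dOd (DE v) = 0 := fun v => tfE _ (by rw [← map_smul, ← hqE, ddE])
  have dDO : ∀ v, X.dEv (DO v) = 0 := fun v => tfO _ (by rw [← map_smul, ← hqO, ddO])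
  let JE : V.ev →ₗ[PowerSeries L] X.ev := qE ∘ₗ sP.sOd ∘ₗ V.dEv - DO ∘ₗ sP.sEv
  let JO : V.od →ₗ[PowerSeries L] X.od := qO ∘ₗ sP.sEv ∘ₗ V.dOd - DE ∘ₗ sP.sOd
  have hJE : ∀ v, ∃ h, cE ⟨π.ev (JE v), h⟩ = ε.ev v := fun v => by
    obtain ⟨h1, h2⟩ := hqE' (sP.sOd (V.dEv v))
    obtain ⟨h3, h4⟩ := hqO' (sP.sEv v)
    have h5 : X₀.dEv (π.ev (DO (sP.sEv v))) = 0 := by rw [π.dEv, dDO, map_zero]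
    have h6 := hbO _ _ (hqO (sP.sEv v)) h3 h5
    have h7 : X₀.dEv (π.ev (JE v)) = 0 := by
      simp only [JE, LinearMap.sub_apply, LinearMap.comp_apply, map_sub, h1, h5, sub_zero]
    refine ⟨h7, ?_⟩
    have h8 : (⟨π.ev (JE v), h7⟩ : LinearMap.ker X₀.dEv) =
        ⟨π.ev (qE (sP.sOd (V.dEv v))), h1⟩ - ⟨π.ev (DO (sP.sEv v)), h5⟩ :=
      Subtype.ext (by simp [JE])
    rw [h8, map_sub, h2, h6, h4, sub_neg_eq_add, ← hεsO, ← hεsE, ← ε.dEv, add_comm, s.hoE]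
  have hJO : ∀ v, ∃ h, cO ⟨π.od (JO v), h⟩ = ε.od v := fun v => by
    obtain ⟨h1, h2⟩ := hqO' (sP.sEv (V.dOd v))
    obtain ⟨h3, h4⟩ := hqE' (sP.sOd v)
    have h5 : X₀.dOd (π.od (DE (sP.sOd v))) = 0 := by rw [π.dOd, dDE, map_zero]
    have h6 := hbE _ _ (hqE (sP.sOd v)) h3 h5
    have h7 : X₀.dOd (π.od (JO v)) = 0 := by
      simp only [JO, LinearMap.sub_apply, LinearMap.comp_apply, map_sub, h1, h5, sub_zero]
    refine ⟨h7, ?_⟩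
    have h8 : (⟨π.od (JO v), h7⟩ : LinearMap.ker X₀.dOd) =
        ⟨π.od (qO (sP.sEv (V.dOd v))), h1⟩ - ⟨π.od (DE (sP.sOd v)), h5⟩ :=
      Subtype.ext (by simp [JO])
    rw [h8, map_sub, h2, h6, h4, sub_neg_eq_add, ← hεsE, ← hεsO, ← ε.dOd, add_comm, s.hoO]
  let jE : HB.ev →ₗ[L] X₀.ev :=
    { toFun := fun x => π.ev (JE (γ.ev x))
      map_add' := fun x y => by simp
      map_smul' := fun c x => by simp }
  let jO : HB.od →ₗ[L] X₀.od :=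
    { toFun := fun x => π.od (JO (γ.od x))
      map_add' := fun x y => by simp
      map_smul' := fun c x => by simp }
  have hjE : ∀ v, jE (ε.ev v) = π.ev (JE v) := fun v => by
    obtain ⟨w, hw⟩ := ε.bcEv.exists_smul (t := PowerSeries.X) (fun c => exists_X_mul)
      (show ε.ev (γ.ev (ε.ev v) - v) = 0 by rw [map_sub, hεγE, sub_self])
    change π.ev (JE (γ.ev (ε.ev v))) = _
    rw [← sub_eq_zero, ← map_sub, ← map_sub, hw]
    simp
  have hjO : ∀ v, jO (ε.od v) = π.od (JO v) := fun v => by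
    obtain ⟨w, hw⟩ := ε.bcOd.exists_smul (t := PowerSeries.X) (fun c => exists_X_mul)
      (show ε.od (γ.od (ε.od v) - v) = 0 by rw [map_sub, hεγO, sub_self])
    change π.od (JO (γ.od (ε.od v))) = _
    rw [← sub_eq_zero, ← map_sub, ← map_sub, hw]
    simp
  have hjE' : ∀ x, ∃ h, cE ⟨jE x, h⟩ = x := fun x => by
    obtain ⟨h1, h2⟩ := hJE (γ.ev x)
    exact ⟨h1, h2.trans (hεγE x)⟩
  have hjO' : ∀ x, ∃ h, cO ⟨jO x, h⟩ = x := fun x => by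
    obtain ⟨h1, h2⟩ := hJO (γ.od x)
    exact ⟨h1, h2.trans (hεγO x)⟩
  obtain ⟨t⟩ := exists_cone_contraction ddE₀ ddO₀ cE cO hcE hcO jE jO hjE' hjO'
  refine ⟨jE, jO, hjE', hjO', t, ?_⟩
  have JdE : ∀ v, X.dEv (JE v) = JO (-(PowerSeries.X : PowerSeries L) • V.dEv v) := fun v => by
    simp [JE, JO, hqE, dDO, sP.ddE]
  have JdO : ∀ v, X.dOd (JO v) = JE (-(PowerSeries.X : PowerSeries L) • V.dOd v) := fun v => by
    simp [JE, JO, hqO, dDE, sP.ddO]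
  let VT := scaleDiff (-(PowerSeries.X : PowerSeries L)) V
  let α₀ : BCMap (PowerSeries.constantCoeff (R := L)) VT (zeroDiff HB) :=
    ⟨ε.ev, ε.od, ε.bcEv, ε.bcOd,
      fun x => by
        change 0 = ε.od (-(PowerSeries.X : PowerSeries L) • V.dEv x)
        simp,
      fun x => by
        change 0 = ε.ev (-(PowerSeries.X : PowerSeries L) • V.dOd x)
        simp⟩
  let βc := α₀.cone π JE JO jE jO hjE hjO
  obtain ⟨tP, htP⟩ := βc.lift_contraction hσ
    (by
      rintro ⟨x, y⟩
      change (X.dOd (X.dEv x + JO y) + JE (-(-(PowerSeries.X : PowerSeries L) • V.dOd y)),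
        -(-(PowerSeries.X : PowerSeries L) • V.dEv (-(-(PowerSeries.X : PowerSeries L) • V.dOd y)))) =
        (0, 0)
      rw [map_add, ddE, JdO, zero_add, map_neg JE, add_neg_cancel]
      simp [sP.ddO])
    (by
      rintro ⟨x, y⟩
      change (X.dEv (X.dOd x + JE y) + JO (-(-(PowerSeries.X : PowerSeries L) • V.dEv y)),
        -(-(PowerSeries.X : PowerSeries L) • V.dOd (-(-(PowerSeries.X : PowerSeries L) • V.dEv y)))) =
        (0, 0)
      rw [map_add, ddO, JdE, zero_add, map_neg JO, add_neg_cancel]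
      simp [sP.ddE]) t
  let TK : LaurentSeries L := HahnSeries.ofPowerSeries ℤ L PowerSeries.X
  let αK : BCMap (HahnSeries.ofPowerSeries ℤ L) VT (scaleDiff (-TK) VK) :=
    ⟨κV.ev, κV.od, κV.bcEv, κV.bcOd,
      fun x => by
        change (-TK) • VK.dEv (κV.ev x) = κV.od (-(PowerSeries.X : PowerSeries L) • V.dEv x)
        rw [κV.dEv, LinearMap.map_smulₛₗ, map_neg],
      fun x => by
        change (-TK) • VK.dOd (κV.od x) = κV.ev (-(PowerSeries.X : PowerSeries L) • V.dOd x)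
        rw [κV.dOd, LinearMap.map_smulₛₗ, map_neg]⟩
  obtain ⟨JKE, hJKE⟩ := κV.bcEv.exists_extend κ.ev JE
  obtain ⟨JKO, hJKO⟩ := κV.bcOd.exists_extend κ.od JO
  let κc := αK.cone κ JE JO JKE JKO hJKE hJKO
  obtain ⟨tK, -, htK⟩ := κc.extend_contraction tP
  have hTK : TK = HahnSeries.single (1 : ℤ) (1 : L) := HahnSeries.ofPowerSeries_X
  have hT : -TK * -HahnSeries.single (-1 : ℤ) (1 : L) = 1 := by
    rw [neg_mul_neg, hTK, HahnSeries.single_mul_single]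
    simp
  have fVKE : Module.Finite (LaurentSeries L) VK.ev := κV.bcEv.finite'
  have fVKO : Module.Finite (LaurentSeries L) VK.od := κV.bcOd.finite'
  have hp := Contraction.push_eq (AutInv.det (LaurentSeries L))
    (sVK.scale (-TK) (-HahnSeries.single (-1 : ℤ) (1 : L)) hT) sK JKE JKO tK
    (sVK.acyc.prodCongr (LinearEquiv.refl (LaurentSeries L) PUnit.{(max v w) + 1})) φK
  rw [(AutInv.det (LaurentSeries L)).rel_prod, (AutInv.det (LaurentSeries L)).rel_self, mul_one,
    eq_mul_inv_iff_mul_eq] at hp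
  have hdet := congrArg Units.val hp
  have hsc := det_scale sVK bK
    (fun i => by
      rw [hbK, hsKO, hsO, κV.dEv, γ.dEv]
      exact congrArg _ (congrArg _ (hb₁ i)))
    (fun i => by
      rw [hbK, hsKO, hsO, κV.dEv, γ.dEv]
      exact (congrArg _ ((congrArg _ (hb₂ i)).trans (map_zero _))).trans (map_zero _))
    (-TK) (-HahnSeries.single (-1 : ℤ) (1 : L)) hT
  obtain ⟨τ₀, hτ₀⟩ : ∃ τ : (X₀.od × HB.ev) ≃ₗ[L] (X₀.ev × HB.od), τ = t.acyc := ⟨_, rfl⟩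
  obtain ⟨τ, hτ⟩ : ∃ τ : (X.od × V.ev) ≃ₗ[PowerSeries L] (X.ev × V.od), τ = tP.acyc := ⟨_, rfl⟩
  obtain ⟨τK, hτK⟩ : ∃ τ : (XK.od × VK.ev) ≃ₗ[LaurentSeries L] (XK.ev × VK.od), τ = tK.acyc :=
    ⟨_, rfl⟩
  have cτ₀ : ∀ x, τ₀ (sprod π.od ε.ev x) = sprod π.ev ε.od (τ x) := fun x => by
    rw [hτ₀, hτ]
    exact βc.acyc htP x
  have cτK : ∀ x, τK (sprod κ.od κV.ev x) = sprod κ.ev κV.od (τ x) := fun x => by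
    rw [hτK, hτ]
    exact κc.acyc htK x
  let ψ := sP.acyc.prodCongr (LinearEquiv.refl (PowerSeries L) PUnit.{1})
  let z₀ : PUnit.{1} →ₛₗ[PowerSeries.constantCoeff (R := L)] PUnit.{1} := 0
  let zK : PUnit.{1} →ₛₗ[HahnSeries.ofPowerSeries ℤ L] PUnit.{(max v w) + 1} := 0
  have cψ₀ : ∀ x, (s.acyc.prodCongr (LinearEquiv.refl L PUnit.{1})) (sprod ε.od z₀ x) =
      sprod ε.ev z₀ (ψ x) := fun x => Prod.ext (ε.acyc hεsO x.1) rfl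
  have cψK : ∀ x, (sVK.acyc.prodCongr (LinearEquiv.refl (LaurentSeries L) PUnit.{(max v w) + 1}))
      (sprod κV.od zK x) = sprod κV.ev zK (ψ x) := fun x => Prod.ext (κV.acyc hsKO x.1) rfl
  have d₀ := ((π.bcOd.prod hm₀).prod (ε.bcOd.prod (isBC_zero_punit _))).det
    (compareTriv φ (compTriv τ ψ)).toLinearMap
    (compareTriv φ₀ (compTriv τ₀ (s.acyc.prodCongr (LinearEquiv.refl L PUnit.{1})))).toLinearMap
    (compareTriv_semilinear π.od π.ev m₀ (sprod ε.od z₀) hφ₀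
      (compTriv_semilinear ε.od ε.ev π.od π.ev z₀ cτ₀ cψ₀))
  have dK := ((κ.bcOd.prod hmK).prod (κV.bcOd.prod (isBC_zero_punit _ : IsBC zK))).det
    (compareTriv φ (compTriv τ ψ)).toLinearMap
    (compareTriv φK (compTriv τK (sVK.acyc.prodCongr
      (LinearEquiv.refl (LaurentSeries L) PUnit.{(max v w) + 1})))).toLinearMap
    (compareTriv_semilinear κ.od κ.ev mK (sprod κV.od zK) hφK
      (compTriv_semilinear κV.od κV.ev κ.od κ.ev zK cτK cψK))
  obtain ⟨u, hu⟩ : ∃ u, u = LinearMap.det (compareTriv φ (compTriv τ ψ)).toLinearMap := ⟨_, rfl⟩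
  rw [← hu] at d₀ dK
  have hF : (LinearEquiv.det (φK.trans (sK.acyc.prodCongr
      (LinearEquiv.refl (LaurentSeries L) MK)).symm) : LaurentSeries L) =
      HahnSeries.ofPowerSeries ℤ L u * (HahnSeries.C ((-1) ^ (Fintype.card ι₁ + Fintype.card ι₂)) *
        HahnSeries.single ((Fintype.card ι₁ : ℤ) - Fintype.card ι₂) 1) := by
    refine hdet.symm.trans ?_
    rw [Units.val_mul]
    refine congrArg₂ (· * ·) ?_ ?_
    · rw [← dK, hτK]
      exact LinearEquiv.coe_det _
    · refine hsc.trans ?_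
      rw [hTK]
      exact neg_single_pow _ _
  have hu0 : PowerSeries.constantCoeff u ≠ 0 := by
    rw [← d₀]
    exact (LinearEquiv.isUnit_det' _).ne_zero
  obtain ⟨o1, o2⟩ := order_leadingCoeff u hu0 ((-1) ^ (Fintype.card ι₁ + Fintype.card ι₂))
    (pow_ne_zero _ (by simp)) ((Fintype.card ι₁ : ℤ) - Fintype.card ι₂)
  rw [hF, o1, o2, ← d₀, hc₁, hc₂, r₁, r₂, hτ₀]
  exact ⟨rfl, mul_comm _ _⟩

end Core

/-! ### Maps out of tensor products -/

section Lift

variable {R : Type u} [Ring R] {B : Type v} [Ring B] {Y : Type w} [AddCommGroup Y] [Module B Y]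
  {R₀ : Subring R} {act : Rᵐᵒᵖ →+* Module.End B Y} {M N : Type*} [AddCommGroup M] [Module R M]
  [AddCommGroup N] [Module R N]

namespace BTensor

theorem hom_ext_add {V : Type*} [AddCommGroup V] {f g : BTensor R₀ act M →+ V}
    (h : ∀ y m, f (tmul R₀ act y m) = g (tmul R₀ act y m)) : f = g := by
  refine AddMonoidHom.ext fun x => ?_
  induction x using BTensor.induction_on with
  | zero => simp
  | tmul y m => exact h y m
  | add a b ha hb => rw [_root_.map_add, _root_.map_add, ha, hb]

/-- The additive map induced by a balanced biadditive map. -/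
def liftAdd {V : Type*} [AddCommGroup V] (f : Y →+ M →+ V)
    (h : ∀ r ∈ R₀, ∀ y m, f (act (MulOpposite.op r) y) m = f y (r • m)) : BTensor R₀ act M →+ V :=
  QuotientAddGroup.lift (tensorRel R₀ act M).toAddSubgroup
    (TensorProduct.liftAddHom f fun n y m => by simp) <| by
    intro x hx
    have key : ∀ b : B, TensorProduct.liftAddHom f (fun n y m => by simp) (b • x) = 0 := by
      refine Submodule.span_induction (p := fun x _ => ∀ b : B,
        TensorProduct.liftAddHom f (fun n y m => by simp) (b • x) = 0) ?_ ?_ ?_ ?_ hx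
      · rintro _ ⟨r, hr, y, m, rfl⟩ b
        rw [smul_sub, TensorProduct.smul_tmul', TensorProduct.smul_tmul', _root_.map_sub,
          ← _root_.map_smul, TensorProduct.liftAddHom_tmul, TensorProduct.liftAddHom_tmul, h r hr,
          sub_self]
      · intro b; simp
      · intro x y _ _ hx hy b
        rw [smul_add, _root_.map_add, hx, hy, add_zero]
      · intro c x _ hx b
        rw [smul_smul, hx]
    simpa using key 1

@[simp] theorem liftAdd_tmul {V : Type*} [AddCommGroup V] (f : Y →+ M →+ V)
    (h : ∀ r ∈ R₀, ∀ y m, f (act (MulOpposite.op r) y) m = f y (r • m)) (y : Y) (m : M) :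
    liftAdd f h (tmul R₀ act y m) = f y m := rfl

/-- The semilinear map induced by a balanced biadditive map that is semilinear in the first
variable. -/
def lift {B' : Type*} [Ring B'] {σ : B →+* B'} {V : Type*} [AddCommGroup V] [Module B' V]
    (f : Y →+ M →+ V) (h : ∀ r ∈ R₀, ∀ y m, f (act (MulOpposite.op r) y) m = f y (r • m))
    (hs : ∀ b y m, f (b • y) m = σ b • f y m) : BTensor R₀ act M →ₛₗ[σ] V where
  toFun := liftAdd f h
  map_add' := _root_.map_add _
  map_smul' b x := by
    induction x using BTensor.induction_on with
    | zero => simp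
    | tmul y m => rw [← smul_tmul, liftAdd_tmul, liftAdd_tmul, hs]
    | add x y hx hy => rw [smul_add, _root_.map_add, hx, hy, _root_.map_add, smul_add]

@[simp] theorem lift_tmul {B' : Type*} [Ring B'] {σ : B →+* B'} {V : Type*} [AddCommGroup V]
    [Module B' V] (f : Y →+ M →+ V)
    (h : ∀ r ∈ R₀, ∀ y m, f (act (MulOpposite.op r) y) m = f y (r • m))
    (hs : ∀ b y m, f (b • y) m = σ b • f y m) (y : Y) (m : M) :
    lift f h hs (tmul R₀ act y m) = f y m := rfl

theorem hom_ext' {B' : Type*} [Ring B'] {σ : B →+* B'} {V : Type*} [AddCommGroup V] [Module B' V]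
    {f g : BTensor R₀ act M →ₛₗ[σ] V} (h : ∀ y m, f (tmul R₀ act y m) = g (tmul R₀ act y m)) :
    f = g := by
  refine LinearMap.ext fun x => ?_
  exact DFunLike.congr_fun (hom_ext_add (f := f.toAddMonoidHom) (g := g.toAddMonoidHom) h) x

variable (R₀ act) in
/-- `y ↦ (m ↦ y ⊗ m)` as a biadditive map. -/
def tmulHom (M : Type*) [AddCommGroup M] [Module R M] : Y →+ M →+ BTensor R₀ act M :=
  AddMonoidHom.mk' (fun y => AddMonoidHom.mk' (tmul R₀ act y) (tmul_add R₀ act y))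
    fun y y' => by ext m; exact add_tmul R₀ act y y' m

@[simp] theorem tmulHom_apply (y : Y) (m : M) : tmulHom R₀ act M y m = tmul R₀ act y m := rfl

theorem tmul_sum_right {ι : Type*} (s : Finset ι) (y : Y) (m : ι → M) :
    tmul R₀ act y (∑ i ∈ s, m i) = ∑ i ∈ s, tmul R₀ act y (m i) :=
  _root_.map_sum (tmulHom R₀ act M y) m s

theorem tmul_sum_left {ι : Type*} (s : Finset ι) (y : ι → Y) (m : M) :
    tmul R₀ act (∑ i ∈ s, y i) m = ∑ i ∈ s, tmul R₀ act (y i) m :=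
  _root_.map_sum ((tmulHom R₀ act M).flip m) y s

variable (act) in
/-- The map `y ⊗ m ↦ y ℓ(m)` attached to a linear form `ℓ`. -/
def coord (ℓ : M →ₗ[R] R) : BTensor ⊤ act M →ₗ[B] Y :=
  lift (AddMonoidHom.mk' (fun y => AddMonoidHom.mk' (fun m => act (MulOpposite.op (ℓ m)) y)
      fun m m' => by simp) fun y y' => by ext m; simp)
    (fun r _ y m => by
      simp only [AddMonoidHom.mk'_apply, _root_.map_smul, smul_eq_mul, MulOpposite.op_mul, map_mul,
        Module.End.mul_apply])
    fun b y m => by simp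

@[simp] theorem coord_tmul (ℓ : M →ₗ[R] R) (y : Y) (m : M) :
    coord act ℓ (tmul ⊤ act y m) = act (MulOpposite.op (ℓ m)) y := rfl

end BTensor

/-- A dual basis of a finitely generated projective module. -/
theorem exists_dualBasis (R : Type u) [Ring R] (M : Type*) [AddCommGroup M] [Module R M]
    [Module.Finite R M] [Module.Projective R M] :
    ∃ (k : ℕ) (m : Fin k → M) (ℓ : Fin k → M →ₗ[R] R), ∀ x, ∑ i, ℓ i x • m i = x := by
  obtain ⟨k, f, g, -, -, hfg⟩ := Module.Finite.exists_comp_eq_id_of_projective R M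
  refine ⟨k, fun i => f (Pi.single i 1), fun i => LinearMap.proj i ∘ₗ g, fun x => ?_⟩
  conv_rhs => rw [← LinearMap.id_apply (R := R) x, ← hfg, LinearMap.comp_apply,
    ← Finset.univ_sum_single (g x), map_sum]
  refine Finset.sum_congr rfl fun i _ => ?_
  rw [← map_smul, ← Pi.single_smul]
  simp

namespace BTensor

theorem sum_coord {k : ℕ} {m : Fin k → M} {ℓ : Fin k → M →ₗ[R] R} (h : ∀ x, ∑ i, ℓ i x • m i = x)
    (x : BTensor ⊤ act M) : ∑ i, tmul ⊤ act (coord act (ℓ i) x) (m i) = x := by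
  induction x using BTensor.induction_on with
  | zero => simp [zero_tmul]
  | tmul y p =>
    simp only [coord_tmul, act_tmul ⊤ act (Subring.mem_top _)]
    rw [← tmul_sum_right, h]
  | add a b ha hb =>
    simp only [_root_.map_add, add_tmul, Finset.sum_add_distrib, ha, hb]

theorem projective [Module.Projective B Y] [Module.Finite R M] [Module.Projective R M] :
    Module.Projective B (BTensor ⊤ act M) := by
  obtain ⟨k, m, ℓ, h⟩ := exists_dualBasis R M
  let s : BTensor ⊤ act M →ₗ[B] (Fin k → Y) := LinearMap.pi fun i => coord act (ℓ i)
  let t : (Fin k → Y) →ₗ[B] BTensor ⊤ act M :=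
    { toFun := fun c => ∑ i, tmul ⊤ act (c i) (m i)
      map_add' := fun c c' => by simp [add_tmul, Finset.sum_add_distrib]
      map_smul' := fun b c => by simp [smul_tmul, Finset.smul_sum] }
  have : Module.Projective B (Fin k → Y) :=
    Module.Projective.of_equiv (DFinsupp.linearEquivFunOnFintype (R := B) (M := fun _ : Fin k => Y))
  exact Module.Projective.of_split s t (LinearMap.ext fun x => sum_coord h x)

variable {B' : Type v'} [Ring B'] {σ : B →+* B'} {Y' : Type w'} [AddCommGroup Y'] [Module B' Y']
  {act' : Rᵐᵒᵖ →+* Module.End B' Y'}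

/-- The map `y ⊗ m ↦ κ(y) ⊗ m` for an equivariant semilinear map `κ`. -/
def baseMap (κ : Y →ₛₗ[σ] Y')
    (hκ : ∀ r ∈ R₀, ∀ y, κ (act (MulOpposite.op r) y) = act' (MulOpposite.op r) (κ y))
    (M : Type*) [AddCommGroup M] [Module R M] : BTensor R₀ act M →ₛₗ[σ] BTensor R₀ act' M :=
  lift ((tmulHom R₀ act' M).comp κ.toAddMonoidHom)
    (fun r hr y m => by simp [hκ r hr, act_tmul R₀ act' hr])
    (fun b y m => by simp [smul_tmul])

variable {κ : Y →ₛₗ[σ] Y'}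
  {hκ : ∀ r ∈ R₀, ∀ y, κ (act (MulOpposite.op r) y) = act' (MulOpposite.op r) (κ y)}

@[simp] theorem baseMap_tmul (y : Y) (m : M) :
    baseMap κ hκ M (tmul R₀ act y m) = tmul R₀ act' (κ y) m := rfl

theorem baseMap_map (f : M →ₗ[R] N) (x : BTensor R₀ act M) :
    map R₀ act' f (baseMap κ hκ M x) = baseMap κ hκ N (map R₀ act f x) := by
  refine LinearMap.congr_fun (f := (map R₀ act' f).comp (baseMap κ hκ M))
    (g := (baseMap κ hκ N).comp (map R₀ act f)) (hom_ext' fun y m => ?_) x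
  simp

theorem coord_baseMap {hκ : ∀ r ∈ (⊤ : Subring R), ∀ y,
    κ (act (MulOpposite.op r) y) = act' (MulOpposite.op r) (κ y)} (ℓ : M →ₗ[R] R)
    (x : BTensor ⊤ act M) : coord act' ℓ (baseMap κ hκ M x) = κ (coord act ℓ x) := by
  refine LinearMap.congr_fun (f := (coord act' ℓ).comp (baseMap κ hκ M))
    (g := κ.comp (coord act ℓ)) (hom_ext' fun y m => ?_) x
  simp [hκ _ (Subring.mem_top _)]

theorem baseMap_injective (hinj : Function.Injective κ) {hκ : ∀ r ∈ (⊤ : Subring R), ∀ y,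
    κ (act (MulOpposite.op r) y) = act' (MulOpposite.op r) (κ y)} [Module.Finite R M]
    [Module.Projective R M] : Function.Injective (baseMap κ hκ M) := by
  obtain ⟨k, m, ℓ, h⟩ := exists_dualBasis R M
  rw [injective_iff_map_eq_zero]
  intro x hx
  rw [← sum_coord h x]
  refine Finset.sum_eq_zero fun i _ => ?_
  have h1 := coord_baseMap (hκ := hκ) (ℓ i) x
  rw [hx, _root_.map_zero] at h1
  rw [hinj (h1.symm.trans (_root_.map_zero κ).symm), zero_tmul]

/-- The map `l ⊗ m ↦ y l ⊗ m`. -/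
def towerAux {S : Type*} [Ring S] (ψ : R →+* S) (actS : Sᵐᵒᵖ →+* Module.End B Y)
    (h : ∀ r, act (MulOpposite.op r) = actS (MulOpposite.op (ψ r))) (M : Type*) [AddCommGroup M]
    [Module R M] (y : Y) : BTensor ⊤ (actRing ψ) M →+ BTensor ⊤ act M :=
  liftAdd (AddMonoidHom.mk' (fun l => tmulHom ⊤ act M (actS (MulOpposite.op l) y))
      fun l l' => by ext m; simp [add_tmul])
    (fun r hr l m => by
      simp only [AddMonoidHom.mk'_apply, tmulHom_apply, ← act_tmul ⊤ act hr, h,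
        ← Module.End.mul_apply, ← map_mul]
      simp [actRing])

@[simp] theorem towerAux_tmul {S : Type*} [Ring S] (ψ : R →+* S) (actS : Sᵐᵒᵖ →+* Module.End B Y)
    (h : ∀ r, act (MulOpposite.op r) = actS (MulOpposite.op (ψ r))) (y : Y) (l : S) (m : M) :
    towerAux ψ actS h M y (tmul ⊤ (actRing ψ) l m) = tmul ⊤ act (actS (MulOpposite.op l) y) m := rfl

theorem hom_ext₂ {S : Type*} [Ring S] {ψ : R →+* S} {actS : Sᵐᵒᵖ →+* Module.End B Y}
    {V : Type*} [AddCommGroup V] [Module B' V]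
    {f g : BTensor ⊤ actS (BTensor ⊤ (actRing ψ) M) →ₛₗ[σ] V}
    (h : ∀ y l m, f (tmul ⊤ actS y (tmul ⊤ (actRing ψ) l m)) =
      g (tmul ⊤ actS y (tmul ⊤ (actRing ψ) l m))) : f = g := by
  refine hom_ext' fun y z => ?_
  induction z using BTensor.induction_on with
  | zero => simp [tmul_zero]
  | tmul l m => exact h y l m
  | add a b ha hb => rw [tmul_add, _root_.map_add, _root_.map_add, ha, hb]

section Tower

variable {S : Type*} [Ring S] (ψ : R →+* S) (actS : Sᵐᵒᵖ →+* Module.End B Y)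
  (h : ∀ r, act (MulOpposite.op r) = actS (MulOpposite.op (ψ r)))

/-- The map `y ⊗ (l ⊗ m) ↦ y l ⊗ m`. -/
def towerHom (M : Type*) [AddCommGroup M] [Module R M] :
    BTensor ⊤ actS (BTensor ⊤ (actRing ψ) M) →ₗ[B] BTensor ⊤ act M :=
  lift (AddMonoidHom.mk' (towerAux ψ actS h M)
      fun y y' => hom_ext_add fun l m => by simp [add_tmul])
    (fun s _ y z => by
      refine DFunLike.congr_fun (f := towerAux ψ actS h M (actS (MulOpposite.op s) y))
        (g := (towerAux ψ actS h M y).comp (DistribSMul.toAddMonoidHom _ s))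
        (hom_ext_add fun l m => ?_) z
      simp only [AddMonoidHom.comp_apply, DistribSMul.toAddMonoidHom_apply, ← smul_tmul,
        towerAux_tmul, ← Module.End.mul_apply, ← map_mul]
      rfl)
    (fun b y z => by
      refine DFunLike.congr_fun (f := towerAux ψ actS h M (b • y))
        (g := (DistribSMul.toAddMonoidHom _ b).comp (towerAux ψ actS h M y))
        (hom_ext_add fun l m => ?_) z
      simp [smul_tmul])

@[simp] theorem towerHom_tmul (y : Y) (l : S) (m : M) :
    towerHom ψ actS h M (tmul ⊤ actS y (tmul ⊤ (actRing ψ) l m)) =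
      tmul ⊤ act (actS (MulOpposite.op l) y) m := rfl

/-- The map `y ⊗ m ↦ y ⊗ (1 ⊗ m)`. -/
def towerInv (M : Type*) [AddCommGroup M] [Module R M] :
    BTensor ⊤ act M →ₗ[B] BTensor ⊤ actS (BTensor ⊤ (actRing ψ) M) :=
  lift (AddMonoidHom.mk' (fun y => AddMonoidHom.mk'
      (fun m => tmul ⊤ actS y (tmul ⊤ (actRing ψ) 1 m)) fun m m' => by simp [tmul_add])
      fun y y' => by ext m; simp [add_tmul])
    (fun r hr y m => by
      simp only [AddMonoidHom.mk'_apply, h, act_tmul ⊤ actS (Subring.mem_top _),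
        ← act_tmul ⊤ (actRing ψ) hr, ← smul_tmul]
      simp [actRing])
    (fun b y m => by simp [smul_tmul])

@[simp] theorem towerInv_tmul (y : Y) (m : M) :
    towerInv ψ actS h M (tmul ⊤ act y m) = tmul ⊤ actS y (tmul ⊤ (actRing ψ) 1 m) := rfl

/-- Transitivity of the tensor product. -/
def tower (M : Type*) [AddCommGroup M] [Module R M] :
    BTensor ⊤ actS (BTensor ⊤ (actRing ψ) M) ≃ₗ[B] BTensor ⊤ act M :=
  LinearEquiv.ofLinearMap (towerHom ψ actS h M) (towerInv ψ actS h M)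
    (hom_ext fun y m => by simp)
    (hom_ext₂ fun y l m => by simp [act_tmul ⊤ actS (Subring.mem_top _), ← smul_tmul])

@[simp] theorem tower_tmul (y : Y) (l : S) (m : M) :
    tower ψ actS h M (tmul ⊤ actS y (tmul ⊤ (actRing ψ) l m)) =
      tmul ⊤ act (actS (MulOpposite.op l) y) m := rfl

theorem tower_map (f : M →ₗ[R] N) (x : BTensor ⊤ actS (BTensor ⊤ (actRing ψ) M)) :
    tower ψ actS h N (map ⊤ actS (map ⊤ (actRing ψ) f) x) = map ⊤ act f (tower ψ actS h M x) :=
  LinearMap.congr_fun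
    (f := (tower ψ actS h N).toLinearMap ∘ₗ map ⊤ actS (map ⊤ (actRing ψ) f))
    (g := map ⊤ act f ∘ₗ (tower ψ actS h M).toLinearMap) (hom_ext₂ fun y l m => by simp) x

end Tower

end BTensor

end Lift


/-! ### Base change for matrix representations -/

section Matrix

variable {R : Type u} [Ring R] {B : Type v} [CommRing B] {B' : Type v'} [CommRing B']
  (σ : B →+* B') {n : ℕ} (φ : R →+* Matrix (Fin n) (Fin n) B)
  (φ' : R →+* Matrix (Fin n) (Fin n) B') {M N : Type*} [AddCommGroup M] [Module R M]
  [AddCommGroup N] [Module R N]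

/-- Application of a ring homomorphism to all coordinates. -/
def vecMap (n : ℕ) : (Fin n → B) →ₛₗ[σ] (Fin n → B') where
  toFun y i := σ (y i)
  map_add' y y' := by ext; simp
  map_smul' b y := by ext; simp

@[simp] theorem vecMap_apply (y : Fin n → B) (i : Fin n) : vecMap σ n y i = σ (y i) := rfl

variable {σ φ φ'} in
theorem vecMap_act (h : ∀ r i j, φ' r i j = σ (φ r i j)) (r : R) (_ : r ∈ (⊤ : Subring R))
    (y : Fin n → B) : vecMap σ n (actMatrix φ (MulOpposite.op r) y) =
      actMatrix φ' (MulOpposite.op r) (vecMap σ n y) := by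
  ext i
  simp [actMatrix, Matrix.vecMul, dotProduct, h]

/-- The base change map on tensor products. -/
def matBase (h : ∀ r i j, φ' r i j = σ (φ r i j)) (M : Type*) [AddCommGroup M] [Module R M] :
    BTensor ⊤ (actMatrix φ) M →ₛₗ[σ] BTensor ⊤ (actMatrix φ') M :=
  BTensor.baseMap (vecMap σ n) (vecMap_act h) M

variable {σ φ φ'} (h : ∀ r i j, φ' r i j = σ (φ r i j))

@[simp] theorem matBase_tmul (y : Fin n → B) (m : M) : matBase σ φ φ' h M
    (BTensor.tmul ⊤ (actMatrix φ) y m) = BTensor.tmul ⊤ (actMatrix φ') (vecMap σ n y) m := rfl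

theorem matBase_map (f : M →ₗ[R] N) (x : BTensor ⊤ (actMatrix φ) M) :
    BTensor.map ⊤ (actMatrix φ') f (matBase σ φ φ' h M x) =
      matBase σ φ φ' h N (BTensor.map ⊤ (actMatrix φ) f x) :=
  BTensor.baseMap_map f x

theorem tmul_eq_sum (y : Fin n → B) (m : M) : BTensor.tmul ⊤ (actMatrix φ) y m =
    ∑ i, y i • BTensor.tmul ⊤ (actMatrix φ) (Pi.single i 1) m := by
  conv_lhs => rw [pi_eq_sum_univ' y, BTensor.tmul_sum_left]
  refine Finset.sum_congr rfl fun i _ => ?_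
  rw [BTensor.smul_tmul]

/-- The map from a base change to coordinates. -/
def matCoord {k : ℕ} (b : Module.Basis (Fin k) B (BTensor ⊤ (actMatrix φ) M)) :
    BTensor ⊤ (actMatrix φ') M →ₗ[B'] (Fin k → B') :=
  BTensor.lift
    (AddMonoidHom.mk' (fun y => AddMonoidHom.mk' (fun m l => ∑ i, y i *
        σ (b.repr (BTensor.tmul ⊤ (actMatrix φ) (Pi.single i 1) m) l))
        fun m m' => by ext l; simp [BTensor.tmul_add, mul_add, Finset.sum_add_distrib])
      fun y y' => by ext m l; simp [add_mul, Finset.sum_add_distrib])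
    (fun r hr y m => by
      ext l
      have e : ∀ i, BTensor.tmul ⊤ (actMatrix φ) (Pi.single i 1) (r • m) =
          ∑ j, φ r i j • BTensor.tmul ⊤ (actMatrix φ) (Pi.single j 1) m := fun i => by
        rw [← BTensor.act_tmul ⊤ _ hr, tmul_eq_sum]
        simp [actMatrix]
      simp only [AddMonoidHom.mk'_apply, e]
      simp only [map_sum, map_smul, Finsupp.coe_finsetSum, Finset.sum_apply, Finsupp.smul_apply,
        smul_eq_mul, map_mul, Finset.mul_sum, ← h]
      rw [Finset.sum_comm]
      refine Finset.sum_congr rfl fun i _ => ?_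
      simp [actMatrix, Matrix.vecMul, dotProduct, Finset.sum_mul, mul_assoc])
    (fun c y m => by ext l; simp [Finset.mul_sum, mul_assoc])

theorem matCoord_tmul {k : ℕ} (b : Module.Basis (Fin k) B (BTensor ⊤ (actMatrix φ) M))
    (y : Fin n → B') (m : M) (l : Fin k) : matCoord h b (BTensor.tmul ⊤ (actMatrix φ') y m) l =
      ∑ i, y i * σ (b.repr (BTensor.tmul ⊤ (actMatrix φ) (Pi.single i 1) m) l) := rfl

theorem matBase_isBC [Module.Finite B (BTensor ⊤ (actMatrix φ) M)]
    [Module.Free B (BTensor ⊤ (actMatrix φ) M)] [Nontrivial B] : IsBC (matBase σ φ φ' h M) := by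
  let b := Module.finBasis B (BTensor ⊤ (actMatrix φ) M)
  let ψ : (Fin _ → B') →ₗ[B'] BTensor ⊤ (actMatrix φ') M :=
    Fintype.linearCombination B' fun l => matBase σ φ φ' h M (b l)
  have hψ : ∀ c, ψ c = ∑ l, c l • matBase σ φ φ' h M (b l) := fun c => rfl
  have e1 : ∀ x l, matCoord h b (matBase σ φ φ' h M x) l = σ (b.repr x l) := fun x l => by
    induction x using BTensor.induction_on with
    | zero => simp
    | tmul y m =>
      rw [matBase_tmul, matCoord_tmul, tmul_eq_sum y m]
      simp [map_sum]
    | add x y hx hy => simp [hx, hy]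
  have e2 : ∀ x, ψ (fun l => σ (b.repr x l)) = matBase σ φ φ' h M x := fun x => by
    rw [hψ]
    conv_rhs => rw [← b.sum_repr x]
    simp only [map_sum, LinearMap.map_smulₛₗ]
  let e : BTensor ⊤ (actMatrix φ') M ≃ₗ[B'] (Fin _ → B') := LinearEquiv.ofLinearMap (matCoord h b) ψ
    (by
      classical
      refine LinearMap.pi_ext' fun l => LinearMap.ext_ring ?_
      ext l'
      simp only [LinearMap.comp_apply, LinearMap.single_apply, LinearMap.id_apply]
      have : ψ (Pi.single l 1) = matBase σ φ φ' h M (b l) := by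
        rw [hψ, Finset.sum_eq_single l] <;> simp +contextual [Pi.single_apply]
      rw [this, e1, b.repr_self, Finsupp.single_apply, Pi.single_apply]
      by_cases hl : l = l' <;> simp [hl, eq_comm])
    (BTensor.hom_ext fun y m => by
      have : matCoord h b (BTensor.tmul ⊤ (actMatrix φ') y m) =
          ∑ i, y i • fun l => σ (b.repr (BTensor.tmul ⊤ (actMatrix φ) (Pi.single i 1) m) l) := by
        ext l
        simp [matCoord_tmul]
      rw [LinearMap.comp_apply, this, map_sum, LinearMap.id_apply, tmul_eq_sum y m]
      refine Finset.sum_congr rfl fun i _ => ?_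
      rw [map_smul, e2, matBase_tmul]
      congr 2
      ext j
      by_cases hj : j = i
      · subst hj; simp
      · simp [hj])
  refine ⟨_, b, Module.Basis.ofEquivFun e, fun l => ?_⟩
  rw [← e2, Module.Basis.coe_ofEquivFun, b.repr_self]
  change _ = ψ _
  congr 1
  ext l'
  by_cases hl : l' = l
  · subst hl; simp
  · simp [Function.update, hl, Ne.symm hl]

end Matrix

/-! ### The Bockstein map and multiplication by `T` -/

section Derivation

variable {p : ℕ} [Fact p.Prime] {G : Type u} [Group G] [TopologicalSpace G] [IsTopologicalGroup G]
  [CompactSpace G] (θ : G →ₜ* Multiplicative ℤ_[p]) {B : Type v} [CommRing B] {n : ℕ}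
  {φ : Iwasawa p G →+* Matrix (Fin n) (Fin n) (PowerSeries B)}
  {φ₀ : Iwasawa p G →+* Matrix (Fin n) (Fin n) B}
  (h0 : ∀ r i j, φ₀ r i j = PowerSeries.constantCoeff (φ r i j))
  (h1 : ∀ r i j, PowerSeries.coeff 1 (φ r i j) = φ₀ (Iwasawa.mulFun (thetaFun θ) r) i j)
  {M N : Type*} [AddCommGroup M] [Module (Iwasawa p G) M] [Module.Projective (Iwasawa p G) M]
  [AddCommGroup N] [Module (Iwasawa p G) N] [Module.Projective (Iwasawa p G) N]

theorem sec_add (m m' : M) : (ThetaExt.sec θ M (m + m')).1 =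
    (ThetaExt.sec θ M m).1 + (ThetaExt.sec θ M m').1 := by
  rw [map_add]; rfl

theorem sec_smul (r : Iwasawa p G) (m : M) : (ThetaExt.sec θ M (r • m)).1 =
    r • (ThetaExt.sec θ M m).1 + Iwasawa.mulFun (thetaFun θ) r • m := by
  rw [map_smul]
  have h (a : ThetaExt θ M) : (r • a).1 = r • a.1 + Iwasawa.mulFun (thetaFun θ) r • a.2 := rfl
  rw [h, ThetaExt.sec_snd]

theorem coeff_one_mul (a b : PowerSeries B) : PowerSeries.coeff 1 (a * b) =
    PowerSeries.coeff 1 a * PowerSeries.constantCoeff b +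
      PowerSeries.constantCoeff a * PowerSeries.coeff 1 b := by
  simp [PowerSeries.coeff_mul, Finset.Nat.antidiagonal_succ, add_comm]

include h0 h1 in
theorem coeff_one_act (r : Iwasawa p G) (y : Fin n → PowerSeries B) :
    (fun i => PowerSeries.coeff 1 (actMatrix φ (MulOpposite.op r) y i)) =
      actMatrix φ₀ (MulOpposite.op r) (fun i => PowerSeries.coeff 1 (y i)) +
      actMatrix φ₀ (MulOpposite.op (Iwasawa.mulFun (thetaFun θ) r))
        (vecMap PowerSeries.constantCoeff n y) := by
  ext j
  simp only [actMatrix, RingHom.coe_mk, MonoidHom.coe_mk, OneHom.coe_mk, Matrix.vecMulLinear_apply,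
    Matrix.vecMul, dotProduct, map_sum, coeff_one_mul, h1, Pi.add_apply, MulOpposite.unop_op, h0,
    vecMap_apply, Finset.sum_add_distrib]

/-- The derivation `y ⊗ m ↦ y'(0) ⊗ m + y(0) ⊗ σ(m)`, where `σ` is the chosen section of
`M ⊗ E_θ → M`. -/
def derivT (M : Type*) [AddCommGroup M] [Module (Iwasawa p G) M]
    [Module.Projective (Iwasawa p G) M] :
    BTensor ⊤ (actMatrix φ) M →+ BTensor ⊤ (actMatrix φ₀) M :=
  BTensor.liftAdd
    (AddMonoidHom.mk' (fun y => AddMonoidHom.mk'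
      (fun m => BTensor.tmul ⊤ (actMatrix φ₀) (fun i => PowerSeries.coeff 1 (y i)) m +
        BTensor.tmul ⊤ (actMatrix φ₀) (vecMap PowerSeries.constantCoeff n y) (ThetaExt.sec θ M m).1)
      fun m m' => by rw [sec_add, BTensor.tmul_add, BTensor.tmul_add]; abel)
      fun y y' => by
        ext m
        have e : (fun i => PowerSeries.coeff 1 ((y + y') i)) = (fun i => PowerSeries.coeff 1 (y i)) +
          fun i => PowerSeries.coeff 1 (y' i) := by ext i; simp
        simp only [AddMonoidHom.mk'_apply, AddMonoidHom.add_apply, e, map_add, BTensor.add_tmul]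
        abel)
    (fun r hr y m => by
      simp only [AddMonoidHom.mk'_apply]
      rw [coeff_one_act θ h0 h1, sec_smul, vecMap_act h0 r hr, BTensor.add_tmul, BTensor.tmul_add,
        BTensor.act_tmul ⊤ _ hr, BTensor.act_tmul ⊤ _ hr, BTensor.act_tmul ⊤ _ (Subring.mem_top _)]
      abel)

theorem derivT_tmul (y : Fin n → PowerSeries B) (m : M) :
    derivT θ h0 h1 M (BTensor.tmul ⊤ (actMatrix φ) y m) =
      BTensor.tmul ⊤ (actMatrix φ₀) (fun i => PowerSeries.coeff 1 (y i)) m +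
        BTensor.tmul ⊤ (actMatrix φ₀) (vecMap PowerSeries.constantCoeff n y)
          (ThetaExt.sec θ M m).1 := rfl

theorem derivT_X_smul (x : BTensor ⊤ (actMatrix φ) M) :
    derivT θ h0 h1 M ((PowerSeries.X : PowerSeries B) • x) =
      matBase PowerSeries.constantCoeff φ φ₀ h0 M x := by
  induction x using BTensor.induction_on with
  | zero => simp
  | tmul y m =>
    rw [← BTensor.smul_tmul, derivT_tmul, matBase_tmul]
    have e1 : (fun i => PowerSeries.coeff 1 (((PowerSeries.X : PowerSeries B) • y) i)) =
        vecMap PowerSeries.constantCoeff n y := by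
      ext i
      simp [coeff_one_mul]
    have e2 : vecMap PowerSeries.constantCoeff n ((PowerSeries.X : PowerSeries B) • y) = 0 := by
      ext i
      simp
    rw [e1, e2, BTensor.zero_tmul, add_zero]
  | add a b ha hb => rw [smul_add, map_add, ha, hb, map_add]

theorem derivT_map (f : M →ₗ[Iwasawa p G] N) (x : BTensor ⊤ (actMatrix φ) M) :
    derivT θ h0 h1 N (BTensor.map ⊤ (actMatrix φ) f x) =
      BTensor.map ⊤ (actMatrix φ₀) f (derivT θ h0 h1 M x) -
        BTensor.map ⊤ (actMatrix φ₀) (cupTheta θ f)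
          (matBase PowerSeries.constantCoeff φ φ₀ h0 M x) := by
  induction x using BTensor.induction_on with
  | zero => simp
  | tmul y m =>
    rw [BTensor.map_tmul, derivT_tmul, derivT_tmul, matBase_tmul, BTensor.map_tmul, map_add,
      BTensor.map_tmul, BTensor.map_tmul]
    have : cupTheta θ f m = f (ThetaExt.sec θ M m).1 + -(ThetaExt.sec θ N (f m)).1 :=
      sub_eq_add_neg _ _
    rw [this, BTensor.tmul_add, BTensor.tmul_neg]
    abel
  | add a b ha hb => simp only [map_add, ha, hb]; abel

/-- If `f x = T y`, then the reduction of `y` is, up to a boundary, minus the image of the reduction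
of `x` under the cup product with `θ`. -/
theorem reduction_of_map_eq (f : M →ₗ[Iwasawa p G] N) (x : BTensor ⊤ (actMatrix φ) M)
    (y : BTensor ⊤ (actMatrix φ) N)
    (h : BTensor.map ⊤ (actMatrix φ) f x = (PowerSeries.X : PowerSeries B) • y) :
    matBase PowerSeries.constantCoeff φ φ₀ h0 N y =
      BTensor.map ⊤ (actMatrix φ₀) f (derivT θ h0 h1 M x) -
        BTensor.map ⊤ (actMatrix φ₀) (cupTheta θ f)
          (matBase PowerSeries.constantCoeff φ φ₀ h0 M x) := by
  rw [← derivT_X_smul θ h0 h1, ← h, derivT_map]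

end Derivation

section Representations

variable {p : ℕ} [Fact p.Prime] {L : Type v} [Field L] [Algebra ℚ_[p] L] [FiniteDimensional ℚ_[p] L]
  [Algebra ℤ_[p] L] [IsScalarTower ℤ_[p] ℚ_[p] L]
  {G : Type u} [Group G] [TopologicalSpace G] [IsTopologicalGroup G] [CompactSpace G]
  {n : ℕ} (ρ : G →ₜ* GL (Fin n) (Integers p L)) (θ : G →ₜ* Multiplicative ℤ_[p])

/-- The homomorphism `Λ(G) → M_n(L[[T]])`. -/
def repP : Iwasawa p G →+* Matrix (Fin n) (Fin n) (PowerSeries L) :=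
  (PowerSeries.map (algebraMap (Integers p L) L)).mapMatrix.comp (repΓ ρ θ)

/-- The right `Λ(G)`-module `L[[T]]^n`. -/
abbrev actP : (Iwasawa p G)ᵐᵒᵖ →+* Module.End (PowerSeries L) (Fin n → PowerSeries L) :=
  actMatrix (repP ρ θ)

/-- The homomorphism `Λ(G) → M_n(L)`. -/
def repL : Iwasawa p G →+* Matrix (Fin n) (Fin n) L :=
  (algebraMap (Integers p L) L).mapMatrix.comp (repO ρ θ)

/-- The homomorphism `Λ(G) → M_n(L((T)))`. -/
def repK : Iwasawa p G →+* Matrix (Fin n) (Fin n) (LaurentSeries L) :=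
  (HahnSeries.ofPowerSeries ℤ L).mapMatrix.comp (repP ρ θ)

theorem repO_apply (r : Iwasawa p G) (i j : Fin n) :
    repO ρ θ r i j = PowerSeries.constantCoeff (repΓ ρ θ r i j) := rfl

theorem repL_apply (r : Iwasawa p G) (i j : Fin n) :
    repL ρ θ r i j = algebraMap (Integers p L) L (repO ρ θ r i j) := rfl

theorem repP_apply (r : Iwasawa p G) (i j : Fin n) :
    repP ρ θ r i j = PowerSeries.map (algebraMap (Integers p L) L) (repΓ ρ θ r i j) := rfl

theorem repL_eq_constantCoeff (r : Iwasawa p G) (i j : Fin n) :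
    repL ρ θ r i j = PowerSeries.constantCoeff (repP ρ θ r i j) := by
  rw [repL_apply, repP_apply, repO_apply, ← PowerSeries.coeff_zero_eq_constantCoeff_apply,
    ← PowerSeries.coeff_zero_eq_constantCoeff_apply, PowerSeries.coeff_map]

theorem integral_mulFun {O : Type*} [CommRing O] [Algebra ℤ_[p] O] [Module.Finite ℤ_[p] O]
    [Module.Free ℤ_[p] O] [TopologicalSpace O] [IsModuleTopology ℤ_[p] O] (ξ : C(G, ℤ_[p]))
    (μ : Iwasawa p G) (f f' : C(G, O)) (h : ∀ g, f' g = ξ g • f g) :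
    (Iwasawa.mulFun ξ μ).integral f = μ.integral f' := by
  refine Iwasawa.dual_ext (p := p) fun ℓ => ?_
  rw [Iwasawa.apply_integral, Iwasawa.apply_integral, Iwasawa.mulFun_apply]
  congr 1
  ext g
  simp [Iwasawa.compDual, h]

theorem coeff_one_repΓ (r : Iwasawa p G) (i j : Fin n) : PowerSeries.coeff 1 (repΓ ρ θ r i j) =
    repO ρ θ (Iwasawa.mulFun (thetaFun θ) r) i j := by
  have h1 : PowerSeries.coeff 1 (repΓ ρ θ r i j) = r.integral (repCoeff ρ θ i j 1) :=
    PowerSeries.coeff_mk 1 fun k => r.integral (repCoeff ρ θ i j k)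
  have h2 : repO ρ θ (Iwasawa.mulFun (thetaFun θ) r) i j =
      (Iwasawa.mulFun (thetaFun θ) r).integral (repCoeff ρ θ i j 0) :=
    (PowerSeries.coeff_zero_eq_constantCoeff_apply _).symm.trans (PowerSeries.coeff_mk 0 fun k =>
      (Iwasawa.mulFun (thetaFun θ) r).integral (repCoeff ρ θ i j k))
  rw [h1, h2]
  refine (integral_mulFun _ _ _ _ fun g => ?_).symm
  simp [repCoeff, thetaFun]

theorem coeff_one_repP (r : Iwasawa p G) (i j : Fin n) : PowerSeries.coeff 1 (repP ρ θ r i j) =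
    repL ρ θ (Iwasawa.mulFun (thetaFun θ) r) i j := by
  rw [repP_apply, PowerSeries.coeff_map, coeff_one_repΓ, repL_apply]

end Representations

/-! ### Semisimplicity -/

namespace Hgy

variable {B : Type v} [Ring B] {M N P M' N' P' : Type*} [AddCommGroup M] [Module B M]
  [AddCommGroup N] [Module B N] [AddCommGroup P] [Module B P] [AddCommGroup M'] [Module B M']
  [AddCommGroup N'] [Module B N'] [AddCommGroup P'] [Module B P']

/-- The class of a cycle. -/
def mk (f : M →ₗ[B] N) (g : N →ₗ[B] P) (x : N) (hx : g x = 0) : Hgy f g :=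
  Submodule.Quotient.mk ⟨x, hx⟩

theorem exists_rep {f : M →ₗ[B] N} {g : N →ₗ[B] P} (c : Hgy f g) :
    ∃ x hx, mk f g x hx = c := by
  obtain ⟨⟨x, hx⟩, rfl⟩ := Submodule.Quotient.mk_surjective _ c
  exact ⟨x, hx, rfl⟩

theorem mk_eq_zero {f : M →ₗ[B] N} {g : N →ₗ[B] P} {x : N} {hx : g x = 0} :
    mk f g x hx = 0 ↔ ∃ y, f y = x := by
  rw [mk, Submodule.Quotient.mk_eq_zero]
  rfl

theorem mk_eq_mk {f : M →ₗ[B] N} {g : N →ₗ[B] P} {x x' : N} {hx : g x = 0} {hx' : g x' = 0} :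
    mk f g x hx = mk f g x' hx' ↔ ∃ y, f y = x - x' := by
  rw [mk, mk, Submodule.Quotient.eq]
  rfl

theorem smul_mk {f : M →ₗ[B] N} {g : N →ₗ[B] P} (b : B) (x : N) (hx : g x = 0) :
    b • mk f g x hx = mk f g (b • x) (by rw [map_smul, hx, smul_zero]) := rfl

theorem nsmul_mk {f : M →ₗ[B] N} {g : N →ₗ[B] P} (k : ℕ) (x : N) (hx : g x = 0) :
    k • mk f g x hx = mk f g (k • x) (by rw [map_nsmul, hx, smul_zero]) := rfl

end Hgy

section Semisimple

variable {p : ℕ} [Fact p.Prime] {L : Type v} [Field L] [Algebra ℚ_[p] L] [FiniteDimensional ℚ_[p] L]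
  [Algebra ℤ_[p] L] [IsScalarTower ℤ_[p] ℚ_[p] L]
  {G : Type u} [Group G] [TopologicalSpace G] [IsTopologicalGroup G] [CompactSpace G]
  {n : ℕ} (ρ : G →ₜ* GL (Fin n) (Integers p L)) (θ : G →ₜ* Multiplicative ℤ_[p])
  (M : Type*) [AddCommGroup M] [Module (Iwasawa p G) M] [Module.Finite (Iwasawa p G) M]
  [Module.Projective (Iwasawa p G) M] {N : Type*} [AddCommGroup N] [Module (Iwasawa p G) N]
  [Module.Finite (Iwasawa p G) N] [Module.Projective (Iwasawa p G) N]
  {N' : Type*} [AddCommGroup N'] [Module (Iwasawa p G) N']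
  [Module.Finite (Iwasawa p G) N'] [Module.Projective (Iwasawa p G) N']

instance projective_powerSeries {B : Type*} [CommRing B] {φ : Iwasawa p G →+*
    Matrix (Fin n) (Fin n) B} : Module.Projective B (BTensor ⊤ (actMatrix φ) M) :=
  BTensor.projective

instance free_powerSeries {φ : Iwasawa p G →+* Matrix (Fin n) (Fin n) (PowerSeries L)} :
    Module.Free (PowerSeries L) (BTensor ⊤ (actMatrix φ) M) :=
  inferInstance

/-- Reduction modulo `T`. -/
abbrev redT : BTensor ⊤ (actP ρ θ) M →ₛₗ[PowerSeries.constantCoeff (R := L)]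
    BTensor ⊤ (actMatrix (repL ρ θ)) M :=
  matBase PowerSeries.constantCoeff (repP ρ θ) (repL ρ θ) (repL_eq_constantCoeff ρ θ) M

/-- The derivative at `T = 0`. -/
abbrev derT : BTensor ⊤ (actP ρ θ) M →+ BTensor ⊤ (actMatrix (repL ρ θ)) M :=
  derivT θ (repL_eq_constantCoeff ρ θ) (coeff_one_repP ρ θ) M

theorem redT_isBC : IsBC (redT ρ θ M) := matBase_isBC _

variable {M}

theorem exists_redT (x : BTensor ⊤ (actMatrix (repL ρ θ)) M) : ∃ y, redT ρ θ M y = x :=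
  (redT_isBC ρ θ M).surjective constantCoeff_surjective x

theorem exists_of_redT_eq_zero {x : BTensor ⊤ (actP ρ θ) M}
    (h : redT ρ θ M x = 0) : ∃ y, x = (PowerSeries.X : PowerSeries L) • y :=
  (redT_isBC ρ θ M).exists_smul (fun _ hc => exists_X_mul hc) h

theorem redT_X_smul (x : BTensor ⊤ (actP ρ θ) M) :
    redT ρ θ M ((PowerSeries.X : PowerSeries L) • x) = 0 := by
  rw [map_smulₛₗ, PowerSeries.constantCoeff_X, zero_smul]

theorem X_smul_cancel {x : BTensor ⊤ (actP ρ θ) M}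
    (h : (PowerSeries.X : PowerSeries L) • x = 0) : x = 0 :=
  (smul_eq_zero.1 h).resolve_left PowerSeries.X_ne_zero

theorem map_redT (f : M →ₗ[Iwasawa p G] N) (x : BTensor ⊤ (actP ρ θ) M) :
    BTensor.map ⊤ (actMatrix (repL ρ θ)) f (redT ρ θ M x) =
      redT ρ θ N (BTensor.map ⊤ (actP ρ θ) f x) := matBase_map _ f x

theorem redT_of_map_eq (f : M →ₗ[Iwasawa p G] N) {x : BTensor ⊤ (actP ρ θ) M}
    {y : BTensor ⊤ (actP ρ θ) N}
    (h : BTensor.map ⊤ (actP ρ θ) f x = (PowerSeries.X : PowerSeries L) • y) :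
    redT ρ θ N y = BTensor.map ⊤ (actMatrix (repL ρ θ)) f (derT ρ θ M x) -
      BTensor.map ⊤ (actMatrix (repL ρ θ)) (cupTheta θ f) (redT ρ θ M x) :=
  reduction_of_map_eq θ (repL_eq_constantCoeff ρ θ) (coeff_one_repP ρ θ) f x y h

theorem cup_of_map_eq_zero (f : M →ₗ[Iwasawa p G] N) {x : BTensor ⊤ (actP ρ θ) M}
    (h : BTensor.map ⊤ (actP ρ θ) f x = 0) :
    BTensor.map ⊤ (actMatrix (repL ρ θ)) (cupTheta θ f) (redT ρ θ M x) =
      BTensor.map ⊤ (actMatrix (repL ρ θ)) f (derT ρ θ M x) := by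
  have := redT_of_map_eq ρ θ f (y := 0) (h.trans (smul_zero _).symm)
  rw [map_zero] at this
  exact (sub_eq_zero.1 this.symm).symm

theorem map_map_of_comp {B : Type*} [Ring B] {Y : Type*} [AddCommGroup Y] [Module B Y]
    (act : (Iwasawa p G)ᵐᵒᵖ →+* Module.End B Y) {f : M →ₗ[Iwasawa p G] N}
    {g : N →ₗ[Iwasawa p G] N'} (h : g ∘ₗ f = 0) (x : BTensor ⊤ act M) :
    BTensor.map ⊤ act g (BTensor.map ⊤ act f x) = 0 := by
  rw [← LinearMap.comp_apply, ← BTensor.map_comp, h, BTensor.map_zero, LinearMap.zero_apply]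

/-- If the Bockstein sequence over `L` is exact at `N`, then `T` kills the cohomology over
`L[[T]]`. -/
theorem exists_map_eq_X_smul (f : M →ₗ[Iwasawa p G] N) (g : N →ₗ[Iwasawa p G] N') (hgf : g ∘ₗ f = 0)
    (hex : ∀ x y, BTensor.map ⊤ (actMatrix (repL ρ θ)) g x = 0 →
      BTensor.map ⊤ (actMatrix (repL ρ θ)) (cupTheta θ g) x =
        BTensor.map ⊤ (actMatrix (repL ρ θ)) g y →
      ∃ v u, BTensor.map ⊤ (actMatrix (repL ρ θ)) f v = 0 ∧
        x = BTensor.map ⊤ (actMatrix (repL ρ θ)) (cupTheta θ f) v +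
          BTensor.map ⊤ (actMatrix (repL ρ θ)) f u)
    (z : BTensor ⊤ (actP ρ θ) N) (hz : BTensor.map ⊤ (actP ρ θ) g z = 0) :
    ∃ y, BTensor.map ⊤ (actP ρ θ) f y = (PowerSeries.X : PowerSeries L) • z := by
  let F := BTensor.map ⊤ (actP ρ θ) f
  let Gm := BTensor.map ⊤ (actP ρ θ) g
  let Q : Submodule (PowerSeries L) (BTensor ⊤ (actP ρ θ) N) :=
    (LinearMap.ker Gm).map (LinearMap.lsmul (PowerSeries L) _ PowerSeries.X)
  have key : Q ≤ LinearMap.range F ⊔ (Ideal.span {(PowerSeries.X : PowerSeries L)}) • Q := by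
    rintro _ ⟨z, hz, rfl⟩
    have hz : Gm z = 0 := hz
    obtain ⟨v₀, u₀, hv₀, hzv⟩ := hex (redT ρ θ N z) (derT ρ θ N z)
      (by rw [map_redT, hz, map_zero]) (cup_of_map_eq_zero ρ θ g hz)
    obtain ⟨v, rfl⟩ := exists_redT ρ θ v₀
    rw [map_redT] at hv₀
    obtain ⟨y, hy⟩ := exists_of_redT_eq_zero ρ θ hv₀
    have hred := redT_of_map_eq ρ θ f hy
    obtain ⟨w, hw⟩ := exists_redT ρ θ (derT ρ θ M v + u₀)
    have h0 : redT ρ θ N (z + y - F w) = 0 := by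
      rw [map_sub, map_add, ← map_redT, hw, hzv, hred, map_add]
      abel
    obtain ⟨z', hz'⟩ := exists_of_redT_eq_zero ρ θ h0
    have hGF : ∀ x, Gm (F x) = 0 := map_map_of_comp _ hgf
    have hgy : Gm y = 0 := by
      refine X_smul_cancel ρ θ ?_
      rw [← map_smul, ← hy]
      exact hGF v
    have hgz' : Gm z' = 0 := by
      refine X_smul_cancel ρ θ ?_
      rw [← map_smul, ← hz', map_sub, map_add, hz, hgy, hGF, add_zero, sub_zero]
    have e : LinearMap.lsmul (PowerSeries L) _ PowerSeries.X z =
        F ((PowerSeries.X : PowerSeries L) • w - v) +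
          (PowerSeries.X : PowerSeries L) • (LinearMap.lsmul (PowerSeries L)
            (BTensor ⊤ (actP ρ θ) N) PowerSeries.X z') := by
      rw [LinearMap.lsmul_apply, LinearMap.lsmul_apply, ← hz', map_sub, map_smul,
        show F v = _ from hy, smul_sub, smul_add]
      abel
    rw [e]
    exact Submodule.add_mem_sup ⟨_, rfl⟩ (Submodule.smul_mem_smul (Ideal.mem_span_singleton_self _)
      ⟨z', hgz', rfl⟩)
  have hfg : Q.FG := IsNoetherian.noetherian _
  have hjac : Ideal.span {(PowerSeries.X : PowerSeries L)} ≤ Ideal.jacobson ⊥ := by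
    rw [IsLocalRing.jacobson_eq_maximalIdeal _ bot_ne_top, Ideal.span_le,
      Set.singleton_subset_iff]
    exact (PowerSeries.X_prime (R := L)).not_isUnit
  exact Submodule.le_of_le_smul_of_le_jacobson_bot hfg hjac key ⟨z, hz, rfl⟩

/-- If `T` is null-homotopic over `L[[T]]`, then the Bockstein sequence over `L` is exact. -/
theorem exists_of_homotopy {f : M →ₗ[Iwasawa p G] N} {g : N →ₗ[Iwasawa p G] M} (hgf : g ∘ₗ f = 0)
    (hM : BTensor ⊤ (actP ρ θ) M →ₗ[PowerSeries L] BTensor ⊤ (actP ρ θ) N)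
    (hN : BTensor ⊤ (actP ρ θ) N →ₗ[PowerSeries L] BTensor ⊤ (actP ρ θ) M)
    (h₁ : ∀ x, BTensor.map ⊤ (actP ρ θ) g (hM x) +
      hN (BTensor.map ⊤ (actP ρ θ) f x) = (PowerSeries.X : PowerSeries L) • x)
    (h₂ : ∀ x, BTensor.map ⊤ (actP ρ θ) f (hN x) +
      hM (BTensor.map ⊤ (actP ρ θ) g x) = (PowerSeries.X : PowerSeries L) • x)
    (z y : BTensor ⊤ (actMatrix (repL ρ θ)) M)
    (hz : BTensor.map ⊤ (actMatrix (repL ρ θ)) f z = 0)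
    (hy : BTensor.map ⊤ (actMatrix (repL ρ θ)) (cupTheta θ f) z =
      BTensor.map ⊤ (actMatrix (repL ρ θ)) f y) :
    ∃ v u, BTensor.map ⊤ (actMatrix (repL ρ θ)) g v = 0 ∧
        z = BTensor.map ⊤ (actMatrix (repL ρ θ)) (cupTheta θ g) v +
          BTensor.map ⊤ (actMatrix (repL ρ θ)) g u := by
  have hGF : ∀ x : BTensor ⊤ (actP ρ θ) M, BTensor.map ⊤ (actP ρ θ) g
      (BTensor.map ⊤ (actP ρ θ) f x) = 0 := fun x => map_map_of_comp _ hgf x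
  obtain ⟨x, rfl⟩ := exists_redT ρ θ z
  rw [map_redT] at hz
  obtain ⟨a, ha⟩ := exists_of_redT_eq_zero ρ θ hz
  have hred := redT_of_map_eq ρ θ f ha
  obtain ⟨w, hw⟩ := exists_redT ρ θ (derT ρ θ M x - y)
  have h0 : redT ρ θ N (a - BTensor.map ⊤ (actP ρ θ) f w) = 0 := by
    rw [map_sub, hred, ← map_redT, hw, map_sub, hy]
    abel
  obtain ⟨v, hv⟩ := exists_of_redT_eq_zero ρ θ h0
  have hga : BTensor.map ⊤ (actP ρ θ) g a = 0 := by
    refine X_smul_cancel ρ θ ?_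
    rw [← map_smul, ← ha, hGF]
  have hgv : BTensor.map ⊤ (actP ρ θ) g v = 0 := by
    refine X_smul_cancel ρ θ ?_
    rw [← map_smul, ← hv, map_sub, hga, hGF, sub_zero]
  have hTv := h₂ v
  rw [hgv, map_zero, add_zero] at hTv
  obtain ⟨x', hx'⟩ : ∃ x', x' = x - (PowerSeries.X : PowerSeries L) • (w + hN v) := ⟨_, rfl⟩
  have hfx' : BTensor.map ⊤ (actP ρ θ) f x' = 0 := by
    rw [hx', map_sub, ha, map_smul, map_add, hTv, ← hv, ← smul_sub]
    simp
  have hrx' : redT ρ θ M x' = redT ρ θ M x := by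
    rw [hx', map_sub, redT_X_smul, sub_zero]
  have hT := h₁ x'
  rw [hfx', map_zero, add_zero] at hT
  have hr := redT_of_map_eq ρ θ g hT
  refine ⟨-redT ρ θ N (hM x'), derT ρ θ N (hM x'), ?_, ?_⟩
  · rw [map_neg, map_redT, hT, redT_X_smul, neg_zero]
  · rw [← hrx', hr, map_neg]
    abel

theorem cup_cup {f : M →ₗ[Iwasawa p G] N} {g : N →ₗ[Iwasawa p G] N'} (hgf : g ∘ₗ f = 0)
    (z : BTensor ⊤ (actMatrix (repL ρ θ)) M) (hz : BTensor.map ⊤ (actMatrix (repL ρ θ)) f z = 0) :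
    ∃ y, BTensor.map ⊤ (actMatrix (repL ρ θ)) g y = BTensor.map ⊤ (actMatrix (repL ρ θ))
      (cupTheta θ g) (BTensor.map ⊤ (actMatrix (repL ρ θ)) (cupTheta θ f) z) := by
  obtain ⟨x, rfl⟩ := exists_redT ρ θ z
  rw [map_redT] at hz
  obtain ⟨a, ha⟩ := exists_of_redT_eq_zero ρ θ hz
  have hred := redT_of_map_eq ρ θ f ha
  have hga : BTensor.map ⊤ (actP ρ θ) g a = 0 := by
    refine X_smul_cancel ρ θ ?_
    rw [← map_smul, ← ha, map_map_of_comp _ hgf]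
  have h1 := cup_of_map_eq_zero ρ θ g hga
  have h2 : BTensor.map ⊤ (actMatrix (repL ρ θ)) (cupTheta θ g)
      (BTensor.map ⊤ (actMatrix (repL ρ θ)) f (derT ρ θ M x)) =
      -BTensor.map ⊤ (actMatrix (repL ρ θ)) g
        (BTensor.map ⊤ (actMatrix (repL ρ θ)) (cupTheta θ f) (derT ρ θ M x)) := by
    have e := cupTheta_anticomm θ f g hgf
    have e' := congrArg (BTensor.map ⊤ (actMatrix (repL ρ θ))) (eq_neg_iff_add_eq_zero.1 e)
    rw [BTensor.map_add, BTensor.map_comp, BTensor.map_comp, BTensor.map_zero] at e'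
    have e'' := LinearMap.congr_fun e' (derT ρ θ M x)
    exact eq_neg_of_add_eq_zero_right e''
  rw [hred, map_sub, h2] at h1
  refine ⟨-(BTensor.map ⊤ (actMatrix (repL ρ θ)) (cupTheta θ f) (derT ρ θ M x)) -
    derT ρ θ N a, ?_⟩
  rw [map_sub, ← h1, map_neg]
  abel

/-! ### Passage from `O` to `L` -/

theorem repL_eq_algebraMap (r : Iwasawa p G) (i j : Fin n) :
    repL ρ θ r i j = algebraMap (Integers p L) L (repO ρ θ r i j) := rfl

variable (M) in
/-- The map from `O^n ⊗ M` to `L^n ⊗ M`. -/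
abbrev toL : BTensor ⊤ (actMatrix (repO ρ θ)) M →ₛₗ[algebraMap (Integers p L) L]
    BTensor ⊤ (actMatrix (repL ρ θ)) M :=
  matBase (algebraMap (Integers p L) L) (repO ρ θ) (repL ρ θ) (repL_eq_algebraMap ρ θ) M

theorem algebraMap_integers_injective : Function.Injective (algebraMap (Integers p L) L) :=
  Subtype.val_injective

theorem toL_injective : Function.Injective (toL ρ θ M) :=
  BTensor.baseMap_injective (fun x y h => by
    ext i
    exact algebraMap_integers_injective (congrFun h i))

theorem exists_pow_mul_integer (x : L) : ∃ (k : ℕ) (y : Integers p L),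
    (p : L) ^ k * x = algebraMap (Integers p L) L y := by
  obtain ⟨y, hy, h⟩ := exists_integral_multiples ℤ_[p] ℚ_[p] {x}
  have hy' := PadicInt.unitCoeff_spec hy
  have h1 := h x (Finset.mem_singleton_self x)
  refine ⟨y.valuation, ⟨(p : L) ^ y.valuation * x, ?_⟩, rfl⟩
  have : (p : L) ^ y.valuation * x = ((PadicInt.unitCoeff hy)⁻¹ : ℤ_[p]ˣ).1 • y • x := by
    have e : ((PadicInt.unitCoeff hy)⁻¹ : ℤ_[p]ˣ).1 * y = (p : ℤ_[p]) ^ y.valuation := by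
      rw [Units.inv_mul_eq_iff_eq_mul]
      exact hy'
    rw [smul_smul, e, Algebra.smul_def]
    simp
  rw [this]
  exact IsIntegral.smul _ h1

theorem exists_pow_smul_toL (x : BTensor ⊤ (actMatrix (repL ρ θ)) M) :
    ∃ (k : ℕ) (y : BTensor ⊤ (actMatrix (repO ρ θ)) M), (p : L) ^ k • x = toL ρ θ M y := by
  induction x using BTensor.induction_on with
  | zero => exact ⟨0, 0, by simp⟩
  | tmul y m =>
    choose k c hc using fun i => exists_pow_mul_integer (p := p) (y i)
    refine ⟨∑ i, k i, BTensor.tmul _ _ (fun i => (p : Integers p L) ^ (∑ j ∈ Finset.univ.erase i, k j)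
      * c i) m, ?_⟩
    rw [matBase_tmul, ← BTensor.smul_tmul]
    congr 1
    ext i
    rw [vecMap_apply, map_mul, ← hc, map_pow, map_natCast, Pi.smul_apply, smul_eq_mul, ← mul_assoc,
      ← pow_add, Finset.sum_erase_add _ _ (Finset.mem_univ i)]
  | add a b ha hb =>
    obtain ⟨k, y, hy⟩ := ha
    obtain ⟨k', y', hy'⟩ := hb
    refine ⟨k + k', (p : Integers p L) ^ k' • y + (p : Integers p L) ^ k • y', ?_⟩
    rw [map_add, map_smulₛₗ, map_smulₛₗ, ← hy, ← hy', map_pow, map_pow, map_natCast, smul_add,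
      smul_smul, smul_smul, ← pow_add, ← pow_add, add_comm k' k]

theorem p_ne_zero : (p : L) ≠ 0 := by
  have : CharZero L := charZero_of_injective_algebraMap (algebraMap ℚ_[p] L).injective
  exact_mod_cast (Fact.out : p.Prime).ne_zero

/-- Exactness of the Bockstein sequence over `L` from semisimplicity. -/
theorem SemisimpleAt.exists_cup {A : PerfCx (Iwasawa p G)} (hss : SemisimpleAt ρ θ A) (i : ℤ)
    (x y : BTensor ⊤ (actMatrix (repL ρ θ)) (A.cx.X (i + 1 + 1)))
    (hx : BTensor.map ⊤ (actMatrix (repL ρ θ)) (A.d (i + 1 + 1) (i + 1 + 1 + 1)) x = 0)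
    (hy : BTensor.map ⊤ (actMatrix (repL ρ θ)) (cupTheta θ (A.d (i + 1 + 1) (i + 1 + 1 + 1))) x =
      BTensor.map ⊤ (actMatrix (repL ρ θ)) (A.d (i + 1 + 1) (i + 1 + 1 + 1)) y) :
    ∃ v u, BTensor.map ⊤ (actMatrix (repL ρ θ)) (A.d (i + 1) (i + 1 + 1)) v = 0 ∧
      x = BTensor.map ⊤ (actMatrix (repL ρ θ)) (cupTheta θ (A.d (i + 1) (i + 1 + 1))) v +
        BTensor.map ⊤ (actMatrix (repL ρ θ)) (A.d (i + 1) (i + 1 + 1)) u := by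
  obtain ⟨k, x₀, hx₀⟩ := exists_pow_smul_toL ρ θ x
  obtain ⟨l, y₀, hy₀⟩ := exists_pow_smul_toL ρ θ y
  have hpk (k : ℕ) : (p : L) ^ k ≠ 0 := pow_ne_zero _ p_ne_zero
  have hp (k : ℕ) : algebraMap (Integers p L) L ((p : Integers p L) ^ k) = (p : L) ^ k := by simp
  obtain ⟨x₁, hx₁⟩ : ∃ x₁, x₁ = (p : Integers p L) ^ l • x₀ := ⟨_, rfl⟩
  obtain ⟨y₁, hy₁⟩ : ∃ y₁, y₁ = (p : Integers p L) ^ k • y₀ := ⟨_, rfl⟩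
  have ex : toL ρ θ _ x₁ = (p : L) ^ (k + l) • x := by
    rw [hx₁, map_smulₛₗ, hp, ← hx₀, smul_smul, ← pow_add, add_comm l k]
  have ey : toL ρ θ _ y₁ = (p : L) ^ (k + l) • y := by
    rw [hy₁, map_smulₛₗ, hp, ← hy₀, smul_smul, ← pow_add]
  have dx : BTensor.map ⊤ (actMatrix (repO ρ θ)) (A.d (i + 1 + 1) (i + 1 + 1 + 1)) x₁ = 0 := by
    apply toL_injective ρ θ
    rw [← matBase_map, ex, map_smul, hx, smul_zero, map_zero]
  have dy : BTensor.map ⊤ (actMatrix (repO ρ θ)) (cupTheta θ (A.d (i + 1 + 1) (i + 1 + 1 + 1))) x₁ =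
      BTensor.map ⊤ (actMatrix (repO ρ θ)) (A.d (i + 1 + 1) (i + 1 + 1 + 1)) y₁ := by
    apply toL_injective ρ θ
    rw [← matBase_map, ← matBase_map, ex, ey, map_smul, map_smul, hy]
  obtain ⟨m, hm⟩ := hss i (Hgy.mk _ _ (Hgy.mk _ _ x₁ dx) (Hgy.mk_eq_zero.2 ⟨y₁, dy.symm⟩))
  obtain ⟨c, hc⟩ := Hgy.mk_eq_zero.1 ((Hgy.nsmul_mk _ _ _).symm.trans hm)
  obtain ⟨v, u, hv, hu⟩ : ∃ v u : BTensor ⊤ (actMatrix (repO ρ θ)) (A.cx.X (i + 1)),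
      BTensor.map ⊤ (actMatrix (repO ρ θ)) (A.d (i + 1) (i + 1 + 1)) v = 0 ∧
      BTensor.map ⊤ (actMatrix (repO ρ θ)) (A.d (i + 1) (i + 1 + 1)) u = p ^ m • x₁ -
        BTensor.map ⊤ (actMatrix (repO ρ θ)) (cupTheta θ (A.d (i + 1) (i + 1 + 1))) v := by
    obtain ⟨v, hv, rfl⟩ := Hgy.exists_rep c
    obtain ⟨u, hu⟩ := Hgy.mk_eq_mk.1 (hc.symm.trans rfl)
    exact ⟨v, u, hv, hu⟩
  have hu' := congrArg (toL ρ θ _) hu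
  rw [← matBase_map, map_sub, map_nsmul, ← matBase_map, ex, ← Nat.cast_smul_eq_nsmul L, smul_smul,
    Nat.cast_pow, ← pow_add] at hu'
  refine ⟨((p : L) ^ (m + (k + l)))⁻¹ • toL ρ θ _ v, ((p : L) ^ (m + (k + l)))⁻¹ • toL ρ θ _ u,
    ?_, ?_⟩
  · rw [map_smul, matBase_map]
    rw [hv, map_zero, smul_zero]
  · rw [map_smul, map_smul, ← smul_add, hu', add_sub_cancel, inv_smul_smul₀ (hpk _)]

theorem SemisimpleAt.nullHtpy {A : PerfCx (Iwasawa p G)} (hss : SemisimpleAt ρ θ A) :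
    NullHtpy (actP ρ θ) (PowerSeries.X : PowerSeries L) A := by
  refine NullHtpy.of_exact _ A (fun i => inferInstance) (fun i => inferInstance) ?_
  intro i j k hij hjk x hx
  obtain ⟨m, rfl⟩ : ∃ m, i = m + 1 := ⟨i - 1, by ring⟩
  subst hij
  subst hjk
  exact exists_map_eq_X_smul ρ θ _ _ (A.d_comp_d _ _ _) (hss.exists_cup ρ θ m) x hx

theorem SemisimpleAt.exists_contraction {A C : PerfCx (Iwasawa p G)} (hss : SemisimpleAt ρ θ A)
    (hC : SigmaGen A C) : Nonempty (Contraction (cohomBock ρ θ C)) := by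
  obtain ⟨hE, hO, h₁, h₂⟩ := ((hss.nullHtpy ρ θ).of_sigmaGen (fun b => mul_comm _ _) hC).exists_fold
  have f1 : Module.Finite L (cohomBock ρ θ C).ev := by
    unfold cohomBock actL; infer_instance
  have f2 : Module.Finite L (cohomBock ρ θ C).od := by
    unfold cohomBock actL; infer_instance
  refine Contraction.exists_of_exact _ (fun x => ?_) (fun x => ?_) (fun x hx => ?_) (fun x hx => ?_)
  · obtain ⟨z, hz, rfl⟩ := Hgy.exists_rep x
    exact Hgy.mk_eq_zero.2 (cup_cup ρ θ C.dOd_comp_dEv z hz)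
  · obtain ⟨z, hz, rfl⟩ := Hgy.exists_rep x
    exact Hgy.mk_eq_zero.2 (cup_cup ρ θ C.dEv_comp_dOd z hz)
  · obtain ⟨z, hz, rfl⟩ := Hgy.exists_rep x
    obtain ⟨y, hy⟩ := Hgy.mk_eq_zero.1 hx
    obtain ⟨v, u, hv, hu⟩ := exists_of_homotopy ρ θ C.dOd_comp_dEv hE hO h₁ h₂ z y hz hy.symm
    obtain ⟨z, rfl⟩ : ∃ z' : BTensor ⊤ (actMatrix (repL ρ θ)) C.ev, z' = z := ⟨z, rfl⟩
    have hu' : BTensor.map ⊤ (actMatrix (repL ρ θ)) C.dOd (-u) =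
        BTensor.map ⊤ (actMatrix (repL ρ θ)) (cupTheta θ C.dOd) v - z := by
      rw [hu, map_neg]; abel
    exact ⟨Hgy.mk _ _ v hv, Hgy.mk_eq_mk.2 ⟨-u, hu'⟩⟩
  · obtain ⟨z, hz, rfl⟩ := Hgy.exists_rep x
    obtain ⟨y, hy⟩ := Hgy.mk_eq_zero.1 hx
    obtain ⟨v, u, hv, hu⟩ := exists_of_homotopy ρ θ C.dEv_comp_dOd hO hE h₂ h₁ z y hz hy.symm
    obtain ⟨z, rfl⟩ : ∃ z' : BTensor ⊤ (actMatrix (repL ρ θ)) C.od, z' = z := ⟨z, rfl⟩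
    have hu' : BTensor.map ⊤ (actMatrix (repL ρ θ)) C.dEv (-u) =
        BTensor.map ⊤ (actMatrix (repL ρ θ)) (cupTheta θ C.dEv) v - z := by
      rw [hu, map_neg]; abel
    exact ⟨Hgy.mk _ _ v hv, Hgy.mk_eq_mk.2 ⟨-u, hu'⟩⟩

end Semisimple

/-! ### Characteristic elements after base change -/

theorem K1.det_mk {R : Type u} [Ring R] {K : Type v} [Field K] {Y : Type w} [AddCommGroup Y]
    [Module K Y] [Module.Finite K Y] (act : Rᵐᵒᵖ →+* Module.End K Y) {P : Type u} [AddCommGroup P]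
    [Module R P] [Module.Finite R P] [Module.Projective R P] (α : P ≃ₗ[R] P) :
    K1.det act (K1.mk α) = LinearEquiv.det (BTensor.congr ⊤ act α) :=
  (Abelianization.lift_apply_of _ _).trans (PresentedGroup.toGroup.of _)

section TowerContraction

open BTensor

variable {R : Type u} [Ring R] {B : Type v} [Ring B] {Y : Type w} [AddCommGroup Y] [Module B Y]
  {S : Type v'} [Ring S] (ψ : R →+* S) (actS : Sᵐᵒᵖ →+* Module.End B Y)
  {act : Rᵐᵒᵖ →+* Module.End B Y}
  (h : ∀ r, act (MulOpposite.op r) = actS (MulOpposite.op (ψ r)))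

theorem exists_tower_contraction {C : PerfCx R} (s : Contraction (C.tensor (actRing ψ))) :
    ∃ sK : Contraction (C.tensor act), ∀ x,
      sK.acyc (tower ψ actS h C.od x) = tower ψ actS h C.ev (map ⊤ actS s.acyc.toLinearMap x) := by
  let TE := tower ψ actS h C.ev
  let TO := tower ψ actS h C.od
  have e1 : ∀ x, map ⊤ act C.dOd (TO x) = TE (map ⊤ actS (map ⊤ (actRing ψ) C.dOd) x) :=
    fun x => (tower_map ψ actS h C.dOd x).symm
  have e2 : ∀ x, map ⊤ act C.dEv (TE x) = TO (map ⊤ actS (map ⊤ (actRing ψ) C.dEv) x) :=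
    fun x => (tower_map ψ actS h C.dEv x).symm
  let sE : BTensor ⊤ act C.ev →ₗ[B] BTensor ⊤ act C.od :=
    TO.toLinearMap ∘ₗ map ⊤ actS s.sEv ∘ₗ TE.symm.toLinearMap
  let sO : BTensor ⊤ act C.od →ₗ[B] BTensor ⊤ act C.ev :=
    TE.toLinearMap ∘ₗ map ⊤ actS s.sOd ∘ₗ TO.symm.toLinearMap
  have e3 : ∀ x, sE (TE x) = TO (map ⊤ actS s.sEv x) := fun x => by simp [sE]
  have e4 : ∀ x, sO (TO x) = TE (map ⊤ actS s.sOd x) := fun x => by simp [sO]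
  let sK : Contraction (C.tensor act) :=
    { sEv := sE
      sOd := sO
      dd_ev := by
        rw [← BTensor.map_comp, C.dOd_comp_dEv, BTensor.map_zero]
      dd_od := by
        rw [← BTensor.map_comp, C.dEv_comp_dOd, BTensor.map_zero]
      ss_ev := LinearMap.ext fun x => by
        obtain ⟨x, rfl⟩ := TE.surjective x
        rw [LinearMap.comp_apply, e3, e4, BTensor.map_map, s.ss_ev, BTensor.map_zero]
        simp
      ss_od := LinearMap.ext fun x => by
        obtain ⟨x, rfl⟩ := TO.surjective x
        rw [LinearMap.comp_apply, e4, e3, BTensor.map_map, s.ss_od, BTensor.map_zero]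
        simp
      homotopy_ev := LinearMap.ext fun x => by
        obtain ⟨x, rfl⟩ := TE.surjective x
        change map ⊤ act C.dOd (sE (TE x)) + sO (map ⊤ act C.dEv (TE x)) = TE x
        rw [e3, e1, e2, e4, BTensor.map_map,
          BTensor.map_map, ← _root_.map_add, ← LinearMap.add_apply, ← BTensor.map_add, s.homotopy_ev, BTensor.map_id, LinearMap.id_apply]
      homotopy_od := LinearMap.ext fun x => by
        obtain ⟨x, rfl⟩ := TO.surjective x
        change map ⊤ act C.dEv (sO (TO x)) + sE (map ⊤ act C.dOd (TO x)) = TO x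
        rw [e4, e2, e1, e3, BTensor.map_map,
          BTensor.map_map, ← _root_.map_add, ← LinearMap.add_apply, ← BTensor.map_add, s.homotopy_od, BTensor.map_id, LinearMap.id_apply] }
  refine ⟨sK, fun x => ?_⟩
  have e5 : map ⊤ actS s.acyc.toLinearMap =
      map ⊤ actS (map ⊤ (actRing ψ) C.dOd) + map ⊤ actS s.sOd := by
    rw [← BTensor.map_add]
    rfl
  rw [e5, LinearMap.add_apply, _root_.map_add, tower_map]
  exact congrArg₂ (· + ·) rfl (e4 x)

variable (M P N : Type*) [AddCommGroup M] [Module R M] [AddCommGroup P] [Module R P]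
  [AddCommGroup N] [Module R N]

/-- Transitivity of tensor products for a sum of two modules. -/
def towerProd : BTensor ⊤ actS (BTensor ⊤ (actRing ψ) M × BTensor ⊤ (actRing ψ) P) ≃ₗ[B]
    BTensor ⊤ act M × BTensor ⊤ act P :=
  (prodEquiv ⊤ actS _ _).trans ((tower ψ actS h M).prodCongr (tower ψ actS h P))

theorem towerProd_tmul (y : Y) (a : BTensor ⊤ (actRing ψ) M) (b : BTensor ⊤ (actRing ψ) P) :
    towerProd ψ actS h M P (tmul ⊤ actS y (a, b)) =
      (tower ψ actS h M (tmul ⊤ actS y a), tower ψ actS h P (tmul ⊤ actS y b)) := rfl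

theorem towerProd_prodEquiv (w : BTensor ⊤ actS (BTensor ⊤ (actRing ψ) (M × P))) :
    towerProd ψ actS h M P (map ⊤ actS (prodEquiv ⊤ (actRing ψ) M P).toLinearMap w) =
      prodEquiv ⊤ act M P (tower ψ actS h (M × P) w) :=
  LinearMap.congr_fun (f := (towerProd ψ actS h M P).toLinearMap ∘ₗ
      map ⊤ actS (prodEquiv ⊤ (actRing ψ) M P).toLinearMap)
    (g := (prodEquiv ⊤ act M P).toLinearMap ∘ₗ (tower ψ actS h (M × P)).toLinearMap)
    (hom_ext₂ fun _ _ _ => rfl) w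

variable {M P N}

theorem towerProd_congrProd (a : (M × P) ≃ₗ[R] (N × P))
    (x : BTensor ⊤ actS (BTensor ⊤ (actRing ψ) M × BTensor ⊤ (actRing ψ) P)) :
    towerProd ψ actS h N P (map ⊤ actS (congrProd ⊤ (actRing ψ) a).toLinearMap x) =
      congrProd ⊤ act a (towerProd ψ actS h M P x) := by
  obtain ⟨w, rfl⟩ := (congr ⊤ actS (prodEquiv ⊤ (actRing ψ) M P)).surjective x
  have e1 : map ⊤ actS (congrProd ⊤ (actRing ψ) a).toLinearMap
      (congr ⊤ actS (prodEquiv ⊤ (actRing ψ) M P) w) =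
      map ⊤ actS (prodEquiv ⊤ (actRing ψ) N P).toLinearMap
        (map ⊤ actS (map ⊤ (actRing ψ) a.toLinearMap) w) := by
    change map ⊤ actS _ (map ⊤ actS _ w) = _
    rw [BTensor.map_map, BTensor.map_map]
    congr 1
    congr 1
    refine LinearMap.ext fun z => ?_
    simp only [LinearMap.comp_apply, LinearEquiv.coe_coe, congrProd, LinearEquiv.trans_apply,
      LinearEquiv.symm_apply_apply]
    rfl
  have e2 : towerProd ψ actS h M P (congr ⊤ actS (prodEquiv ⊤ (actRing ψ) M P) w) = _ :=
    towerProd_prodEquiv ψ actS h M P w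
  rw [e1, towerProd_prodEquiv, e2, tower_map]
  simp only [congrProd, LinearEquiv.trans_apply, LinearEquiv.symm_apply_apply]
  rfl

theorem towerProd_prodCongr (σ : BTensor ⊤ (actRing ψ) M ≃ₗ[S] BTensor ⊤ (actRing ψ) N)
    (τ : BTensor ⊤ act M ≃ₗ[B] BTensor ⊤ act N)
    (hσ : ∀ x, τ (tower ψ actS h M x) = tower ψ actS h N (map ⊤ actS σ.toLinearMap x))
    (x : BTensor ⊤ actS (BTensor ⊤ (actRing ψ) M × BTensor ⊤ (actRing ψ) P)) :
    towerProd ψ actS h N P (map ⊤ actS (σ.prodCongr (LinearEquiv.refl S _)).toLinearMap x) =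
      τ.prodCongr (LinearEquiv.refl B _) (towerProd ψ actS h M P x) := by
  refine LinearMap.congr_fun (f := (towerProd ψ actS h N P).toLinearMap ∘ₗ
      map ⊤ actS (σ.prodCongr (LinearEquiv.refl S _)).toLinearMap)
    (g := (τ.prodCongr (LinearEquiv.refl B _)).toLinearMap ∘ₗ
      (towerProd ψ actS h M P).toLinearMap) (hom_ext fun y ab => ?_) x
  obtain ⟨a, b⟩ := ab
  exact Prod.ext (hσ (tmul ⊤ actS y a)).symm rfl

theorem det_tower {B : Type v} [CommRing B] {Y : Type w} [AddCommGroup Y] [Module B Y]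
    (actS : Sᵐᵒᵖ →+* Module.End B Y) {act : Rᵐᵒᵖ →+* Module.End B Y}
    (h : ∀ r, act (MulOpposite.op r) = actS (MulOpposite.op (ψ r))) (a : (M × P) ≃ₗ[R] (N × P))
    (σ : BTensor ⊤ (actRing ψ) M ≃ₗ[S] BTensor ⊤ (actRing ψ) N)
    (τ : BTensor ⊤ act M ≃ₗ[B] BTensor ⊤ act N)
    (hσ : ∀ x, τ (tower ψ actS h M x) = tower ψ actS h N (map ⊤ actS σ.toLinearMap x)) :
    LinearMap.det (map ⊤ actS ((congrProd ⊤ (actRing ψ) a).trans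
      (σ.prodCongr (LinearEquiv.refl S (BTensor ⊤ (actRing ψ) P))).symm).toLinearMap) =
    LinearEquiv.det ((congrProd ⊤ act a).trans
      (τ.prodCongr (LinearEquiv.refl B (BTensor ⊤ act P))).symm) := by
  rw [LinearEquiv.coe_det, ← LinearMap.det_conj _ (towerProd ψ actS h M P)]
  congr 1
  refine LinearMap.ext fun z => ?_
  obtain ⟨z, rfl⟩ := (towerProd ψ actS h M P).surjective z
  rw [LinearMap.comp_apply, LinearMap.comp_apply, LinearEquiv.coe_coe, LinearEquiv.coe_coe,
    LinearEquiv.symm_apply_apply, LinearEquiv.coe_coe, LinearEquiv.trans_apply,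
    LinearEquiv.eq_symm_apply]
  refine (towerProd_prodCongr ψ actS h σ τ hσ _).symm.trans
    (Eq.trans ?_ (towerProd_congrProd ψ actS h a z))
  congr 1
  rw [BTensor.map_map]
  congr 2
  refine LinearMap.ext fun w => ?_
  simp

end TowerContraction

section Comparison

variable {p : ℕ} [Fact p.Prime] {L : Type v} [Field L] [Algebra ℚ_[p] L] [FiniteDimensional ℚ_[p] L]
  [Algebra ℤ_[p] L] [IsScalarTower ℤ_[p] ℚ_[p] L]
  {G : Type u} [Group G] [TopologicalSpace G] [IsTopologicalGroup G] [CompactSpace G]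
  {n : ℕ} (ρ : G →ₜ* GL (Fin n) (Integers p L)) (θ : G →ₜ* Multiplicative ℤ_[p])

/-- The right `Λ(G)`-module `L((T))^n`. -/
abbrev actK : (Iwasawa p G)ᵐᵒᵖ →+* Module.End (LaurentSeries L) (Fin n → LaurentSeries L) :=
  actMatrix (repK ρ θ)

theorem toLaurent_algebraMap (x : PowerSeries (Integers p L)) :
    toLaurent p L (algebraMap _ _ x) =
      HahnSeries.ofPowerSeries ℤ L (PowerSeries.map (algebraMap (Integers p L) L) x) :=
  IsFractionRing.lift_algebraMap _ _

variable {S : Set (Iwasawa p G)}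
  (ρS : Loc (Iwasawa p G) S →+* Matrix (Fin n) (Fin n) (QGamma p L))

/-- The composite of `ρS` with the expansion of elements of `Q_O(Γ)` as Laurent series. -/
def rhoK : Loc (Iwasawa p G) S →+* Matrix (Fin n) (Fin n) (LaurentSeries L) :=
  (toLaurent p L).mapMatrix.comp ρS

theorem rhoK_apply (x : Loc (Iwasawa p G) S) (i j : Fin n) :
    rhoK ρS x i j = toLaurent p L (ρS x i j) := rfl

theorem actK_eq (hρS : ∀ x, ρS (toLoc S x) =
    (algebraMap (PowerSeries (Integers p L)) (QGamma p L)).mapMatrix (repΓ ρ θ x))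
    (r : Iwasawa p G) : actK ρ θ (MulOpposite.op r) =
      actMatrix (rhoK ρS) (MulOpposite.op (toLoc S r)) := by
  have : repK ρ θ r = rhoK ρS (toLoc S r) := by
    ext i j
    rw [rhoK_apply, hρS, RingHom.mapMatrix_apply, Matrix.map_apply, toLaurent_algebraMap]
    rfl
  exact congrArg Matrix.vecMulLinear this

theorem toLaurent_rhoStar {P : Type u} [AddCommGroup P] [Module (Loc (Iwasawa p G) S) P]
    [Module.Finite (Loc (Iwasawa p G) S) P] [Module.Projective (Loc (Iwasawa p G) S) P]
    (α : P ≃ₗ[Loc (Iwasawa p G) S] P) : toLaurent p L (rhoStar ρS (K1.mk α)) =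
      LinearMap.det (BTensor.map ⊤ (actMatrix (rhoK ρS)) α.toLinearMap) := by
  have e : (rhoStar ρS (K1.mk α) : QGamma p L) =
      LinearMap.det (BTensor.map ⊤ (actMatrix ρS) α.toLinearMap) := by
    have e' : rhoStar ρS (K1.mk α) = LinearEquiv.det (BTensor.congr ⊤ (actMatrix ρS) α) :=
      K1.det_mk _ α
    rw [e', LinearEquiv.coe_det]
    rfl
  rw [e]
  exact ((matBase_isBC (rhoK_apply ρS)).det _ _ (matBase_map (rhoK_apply ρS) α.toLinearMap)).symm

theorem exists_contraction_laurent (hρS : ∀ x, ρS (toLoc S x) =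
    (algebraMap (PowerSeries (Integers p L)) (QGamma p L)).mapMatrix (repΓ ρ θ x))
    {C : PerfCx (Iwasawa p G)} (a : C.Triv) {x : K1 (Loc (Iwasawa p G) S)}
    (hx : IsCharElement S C a x) : ∃ sK : Contraction (C.tensor (actK ρ θ)),
      toLaurent p L (rhoStar ρS x) = LinearEquiv.det ((BTensor.congrProd ⊤ (actK ρ θ) a.iso).trans
        (sK.acyc.prodCongr (LinearEquiv.refl _ (BTensor ⊤ (actK ρ θ) a.stab))).symm) := by
  obtain ⟨s, rfl⟩ := hx
  obtain ⟨sK, hsK⟩ := exists_tower_contraction (toLoc S) (actMatrix (rhoK ρS)) (actK_eq ρ θ ρS hρS) s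
  refine ⟨sK, ?_⟩
  rw [toLaurent_rhoStar]
  exact det_tower (toLoc S) (actMatrix (rhoK ρS)) (actK_eq ρ θ ρS hρS) a.iso s.acyc sK.acyc hsK

end Comparison

/-! ### The leading term -/

section MatBaseProd

variable {R : Type u} [Ring R] {B : Type v} [CommRing B] {B' : Type v'} [CommRing B']
  {σ : B →+* B'} {n : ℕ} {φ : R →+* Matrix (Fin n) (Fin n) B}
  {φ' : R →+* Matrix (Fin n) (Fin n) B'} (h : ∀ r i j, φ' r i j = σ (φ r i j))
  {M N P : Type*} [AddCommGroup M] [Module R M] [AddCommGroup P] [Module R P]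
  [AddCommGroup N] [Module R N]

theorem sprod_matBase_prodEquiv (w : BTensor ⊤ (actMatrix φ) (M × P)) :
    sprod (matBase σ φ φ' h M) (matBase σ φ φ' h P) (BTensor.prodEquiv ⊤ (actMatrix φ) M P w) =
      BTensor.prodEquiv ⊤ (actMatrix φ') M P (matBase σ φ φ' h (M × P) w) :=
  Prod.ext (matBase_map h (LinearMap.fst R M P) w).symm (matBase_map h (LinearMap.snd R M P) w).symm

theorem congrProd_sprod_matBase (a : (M × P) ≃ₗ[R] (N × P))
    (x : BTensor ⊤ (actMatrix φ) M × BTensor ⊤ (actMatrix φ) P) :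
    BTensor.congrProd ⊤ (actMatrix φ') a (sprod (matBase σ φ φ' h M) (matBase σ φ φ' h P) x) =
      sprod (matBase σ φ φ' h N) (matBase σ φ φ' h P) (BTensor.congrProd ⊤ (actMatrix φ) a x) := by
  obtain ⟨w, rfl⟩ := (BTensor.prodEquiv ⊤ (actMatrix φ) M P).surjective x
  rw [sprod_matBase_prodEquiv]
  simp only [BTensor.congrProd, LinearEquiv.trans_apply, LinearEquiv.symm_apply_apply]
  rw [sprod_matBase_prodEquiv]
  exact congrArg _ (matBase_map h a.toLinearMap w)

variable (φ) in
/-- The base change of a complex. -/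
def matBaseBC (C : PerfCx R) (hE : IsBC (matBase σ φ φ' h C.ev))
    (hO : IsBC (matBase σ φ φ' h C.od)) :
    BCMap σ (C.tensor (actMatrix φ)) (C.tensor (actMatrix φ')) where
  ev := matBase σ φ φ' h C.ev
  od := matBase σ φ φ' h C.od
  bcEv := hE
  bcOd := hO
  dEv := matBase_map h C.dEv
  dOd := matBase_map h C.dOd

end MatBaseProd

section Leading

variable {p : ℕ} [Fact p.Prime] {L : Type v} [Field L] [Algebra ℚ_[p] L] [FiniteDimensional ℚ_[p] L]
  [Algebra ℤ_[p] L] [IsScalarTower ℤ_[p] ℚ_[p] L]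
  {G : Type u} [Group G] [TopologicalSpace G] [IsTopologicalGroup G] [CompactSpace G]
  {n : ℕ} (ρ : G →ₜ* GL (Fin n) (Integers p L)) (θ : G →ₜ* Multiplicative ℤ_[p])

/-- The rank of the Bockstein map from even to odd cohomology. -/
def bockRankEv (C : PerfCx (Iwasawa p G)) : ℕ :=
  Module.finrank L (LinearMap.range (cohomBock ρ θ C).dEv)

/-- The rank of the Bockstein map from odd to even cohomology. -/
def bockRankOd (C : PerfCx (Iwasawa p G)) : ℕ :=
  Module.finrank L (LinearMap.range (cohomBock ρ θ C).dOd)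

theorem repK_eq_ofPowerSeries (r : Iwasawa p G) (i j : Fin n) :
    repK ρ θ r i j = HahnSeries.ofPowerSeries ℤ L (repP ρ θ r i j) := rfl

theorem bock_of_map_eq {M N : Type*} [AddCommGroup M] [Module (Iwasawa p G) M]
    [Module.Finite (Iwasawa p G) M] [Module.Projective (Iwasawa p G) M] [AddCommGroup N]
    [Module (Iwasawa p G) N] [Module.Finite (Iwasawa p G) N] [Module.Projective (Iwasawa p G) N]
    (f : M →ₗ[Iwasawa p G] N) (g : N →ₗ[Iwasawa p G] M) (hfg : f ∘ₗ g = 0) (hgf : g ∘ₗ f = 0)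
    (x : BTensor ⊤ (actP ρ θ) M) (y : BTensor ⊤ (actP ρ θ) N)
    (h : BTensor.map ⊤ (actP ρ θ) f x = (PowerSeries.X : PowerSeries L) • y)
    (h₁ : BTensor.map ⊤ (actMatrix (repL ρ θ)) f (redT ρ θ M x) = 0)
    (h₂ : BTensor.map ⊤ (actMatrix (repL ρ θ)) g (redT ρ θ N y) = 0) :
    Hgy.mk (BTensor.map ⊤ (actMatrix (repL ρ θ)) f) (BTensor.map ⊤ (actMatrix (repL ρ θ)) g)
      (redT ρ θ N y) h₂ = -bockstein θ (actMatrix (repL ρ θ)) g f g hfg hgf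
        (Hgy.mk _ _ (redT ρ θ M x) h₁) :=
  Hgy.mk_eq_mk.2 ⟨derT ρ θ M x, by
    rw [redT_of_map_eq ρ θ f h]
    exact (sub_add_cancel _ _).symm.trans (sub_neg_eq_add _ _).symm⟩

theorem exists_leadingTerm {C : PerfCx (Iwasawa p G)} (s : Contraction (cohomBock ρ θ C))
    (a : C.Triv) (sK : Contraction (C.tensor (actK ρ θ))) (F : LaurentSeries L)
    (hF : F = LinearEquiv.det ((BTensor.congrProd ⊤ (actK ρ θ) a.iso).trans
        (sK.acyc.prodCongr (LinearEquiv.refl _ (BTensor ⊤ (actK ρ θ) a.stab))).symm)) :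
    F.order = (bockRankEv ρ θ C : ℤ) - bockRankOd ρ θ C ∧
    ∃ (jEv : (cohomZero ρ θ C).ev →ₗ[L] (C.tensor (actL ρ θ)).ev)
      (jOd : (cohomZero ρ θ C).od →ₗ[L] (C.tensor (actL ρ θ)).od),
      (∀ x, ∃ h, (Submodule.Quotient.mk ⟨jEv x, h⟩ : (cohomZero ρ θ C).ev) = x) ∧
      (∀ x, ∃ h, (Submodule.Quotient.mk ⟨jOd x, h⟩ : (cohomZero ρ θ C).od) = x) ∧
      ∃ t : Contraction (cone (cohomZero ρ θ C) (C.tensor (actL ρ θ)) jEv jOd),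
        F.leadingCoeff = (-1) ^ (bockRankEv ρ θ C + bockRankOd ρ θ C) * LinearMap.det
          (compareTriv (BTensor.congrProd ⊤ (actL ρ θ) a.iso)
            (compTriv t.acyc (s.acyc.prodCongr (LinearEquiv.refl L PUnit.{1})))).toLinearMap := by
  obtain ⟨jE, jO, h1, h2, t, h3, h4⟩ := order_and_leadingCoeff (X := C.tensor (actP ρ θ))
    (X₀ := C.tensor (actMatrix (repL ρ θ))) (XK := C.tensor (actK ρ θ))
    (matBaseBC (repP ρ θ) (repL_eq_constantCoeff ρ θ) C (redT_isBC ρ θ _) (redT_isBC ρ θ _))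
    (matBaseBC (repP ρ θ) (repK_eq_ofPowerSeries ρ θ) C (matBase_isBC _) (matBase_isBC _))
    (fun x => map_map_of_comp (actP ρ θ) C.dOd_comp_dEv x)
    (fun x => map_map_of_comp (actP ρ θ) C.dEv_comp_dOd x) (HB := cohomBock ρ θ C)
    (Submodule.mkQ _) (Submodule.mkQ _) (Submodule.mkQ_surjective _) (Submodule.mkQ_surjective _)
    (fun z => Hgy.mk_eq_zero) (fun z => Hgy.mk_eq_zero)
    (fun x y h h₁ h₂ => bock_of_map_eq ρ θ C.dEv C.dOd C.dEv_comp_dOd C.dOd_comp_dEv x y h h₁ h₂)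
    (fun x y h h₁ h₂ => bock_of_map_eq ρ θ C.dOd C.dEv C.dOd_comp_dEv C.dEv_comp_dOd x y h h₁ h₂)
    s sK (redT ρ θ a.stab) (redT_isBC ρ θ _)
    (matBase _ (repP ρ θ) _ (repK_eq_ofPowerSeries ρ θ) a.stab) (matBase_isBC _)
    (BTensor.congrProd ⊤ (actMatrix (repL ρ θ)) a.iso) (BTensor.congrProd ⊤ (actP ρ θ) a.iso)
    (BTensor.congrProd ⊤ (actK ρ θ) a.iso)
    (congrProd_sprod_matBase (repL_eq_constantCoeff ρ θ) a.iso)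
    (congrProd_sprod_matBase (repK_eq_ofPowerSeries ρ θ) a.iso)
  rw [hF]
  exact ⟨h3, jE, jO, h1, h2, t, h4⟩

end Leading

/-! ### The extension of `ρ` to the localization -/

section Localization

variable {R : Type u} [Ring R] (S : Set R)

theorem exists_loc_lift {A : Type*} [Ring A] (φ : R →+* A) (h : ∀ s ∈ S, IsUnit (φ s)) :
    ∃ ψ : Loc R S →+* A, ∀ x, ψ (toLoc S x) = φ x := by
  choose u hu using h
  let f : R ⊕ S → A := Sum.elim φ fun s => ((u s.1 s.2)⁻¹ : Aˣ)
  let F : FreeAlgebra ℤ (R ⊕ S) →+* A := (FreeAlgebra.lift ℤ f).toRingHom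
  have hF : ∀ x, F (FreeAlgebra.ι ℤ x) = f x := fun x => FreeAlgebra.lift_ι_apply f x
  have hrel : ∀ ⦃x y⦄, LocRel R S x y → F x = F y := by
    rintro _ _ (_ | ⟨a, b⟩ | ⟨a, b⟩ | s | s)
    · rw [hF, map_one]; exact map_one φ
    · rw [hF, map_add, hF, hF]; exact map_add φ a b
    · rw [hF, map_mul, hF, hF]; exact map_mul φ a b
    · rw [map_mul, hF, hF, map_one]
      change ((u s.1 s.2)⁻¹ : Aˣ).1 * φ s.1 = 1
      rw [← hu s.1 s.2, Units.inv_mul]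
    · rw [map_mul, hF, hF, map_one]
      change φ s.1 * ((u s.1 s.2)⁻¹ : Aˣ).1 = 1
      rw [← hu s.1 s.2, Units.mul_inv]
  exact ⟨RingQuot.lift ⟨F, hrel⟩, fun x => (RingQuot.lift_mkRingHom_apply F hrel _).trans (hF _)⟩

end Localization

section MonicPolynomial

variable {O : Type v} [CommRing O]

/-- A finitely generated `O`-submodule of an `O[[T]]`-module that is stable under `T` is killed by a
monic polynomial in `T`. -/
theorem exists_monic_smul_eq_zero {Q : Type*} [AddCommGroup Q] [Module (PowerSeries O) Q] [Module O Q]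
    [IsScalarTower O (PowerSeries O) Q] (Y : Submodule O Q) (hY : Y.FG)
    (hT : ∀ y ∈ Y, (PowerSeries.X : PowerSeries O) • y ∈ Y) :
    ∃ P : Polynomial O, P.Monic ∧ ∀ y ∈ Y, (P : PowerSeries O) • y = 0 := by
  have : Module.Finite O Y := Module.Finite.iff_fg.2 hY
  let X' : Q →ₗ[O] Q :=
    { toFun := fun y => (PowerSeries.X : PowerSeries O) • y
      map_add' := fun _ _ => smul_add _ _ _
      map_smul' := fun c y => by
        simp only [RingHom.id_apply]
        rw [← smul_one_smul (PowerSeries O) c y, smul_smul, ← smul_one_smul (PowerSeries O) c (_ • y),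
          smul_smul, mul_comm] }
  obtain ⟨P, hP, h⟩ := LinearMap.exists_monic_and_aeval_eq_zero O (X'.restrict hT)
  refine ⟨P, hP, fun y hy => ?_⟩
  have key : ∀ (P : Polynomial O) (y : Y), ((Polynomial.aeval (X'.restrict hT) P y : Y) : Q) =
      (P : PowerSeries O) • (y : Q) := by
    intro P
    induction P using Polynomial.induction_on' with
    | add P P' h h' => intro y; simp [h, h', add_smul]
    | monomial k c =>
      intro y
      have hmon : PowerSeries.monomial k c = PowerSeries.C c * (PowerSeries.X : PowerSeries O) ^ k := by
        ext m
        rw [PowerSeries.coeff_C_mul_X_pow, PowerSeries.coeff_monomial]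
      rw [Polynomial.aeval_monomial, Polynomial.coe_monomial, Module.End.mul_apply,
        Module.algebraMap_end_apply, hmon, mul_smul]
      have e : ∀ k : ℕ, (((X'.restrict hT) ^ k) y : Q) = (PowerSeries.X : PowerSeries O) ^ k • (y : Q) := by
        intro k
        induction k with
        | zero => simp
        | succ k ih =>
          rw [pow_succ', Module.End.mul_apply, pow_succ', mul_smul, ← ih]
          rfl
      rw [Submodule.coe_smul, e, ← smul_one_smul (PowerSeries O) c]
      congr 1
      rw [PowerSeries.smul_eq_C_mul, mul_one]
  have h2 := key P ⟨y, hy⟩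
  rw [h] at h2
  exact h2.symm

theorem det_ne_zero_of_vecMul [IsDomain O] {n : ℕ} (N : Matrix (Fin n) (Fin n) O) {c : O} (hc : c ≠ 0)
    (h : ∀ j, ∃ w, Matrix.vecMul w N = c • Pi.single j 1) : N.det ≠ 0 := by
  choose w hw using h
  have e : Matrix.of w * N = c • (1 : Matrix (Fin n) (Fin n) O) := by
    ext i j
    have := congrFun (hw i) j
    rw [Matrix.mul_apply_eq_vecMul]
    change Matrix.vecMul (w i) N j = _
    rw [this, Matrix.smul_apply, Pi.smul_apply, Matrix.one_apply, Pi.single_apply]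
    simp [eq_comm]
  intro h0
  have := congrArg Matrix.det e
  rw [Matrix.det_mul, h0, mul_zero, Matrix.det_smul, Matrix.det_one, mul_one] at this
  exact pow_ne_zero _ hc this.symm

end MonicPolynomial

section RhoS

variable {p : ℕ} [Fact p.Prime]
  {G : Type u} [Group G] [TopologicalSpace G] [IsTopologicalGroup G] [CompactSpace G]
  (H : ClosedSubgroup G) [H.toSubgroup.Normal]
  (e : (G ⧸ H.toSubgroup) ≃ₜ* Multiplicative ℤ_[p])

theorem thetaOf_of_mem {g : G} (hg : g ∈ H.toSubgroup) : thetaOf H e g = 1 := by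
  have : (QuotientGroup.mk' H.toSubgroup g) = 1 := (QuotientGroup.eq_one_iff g).2 hg
  change e (QuotientGroup.mk' H.toSubgroup g) = 1
  rw [this, map_one]

theorem mem_of_thetaOf {g : G} (hg : thetaOf H e g = 1) : g ∈ H.toSubgroup := by
  have h : e (QuotientGroup.mk' H.toSubgroup g) = 1 := hg
  rw [map_eq_one_iff e e.injective] at h
  exact (QuotientGroup.eq_one_iff g).1 h

theorem thetaOf_surjective : Function.Surjective (thetaOf H e) := fun x => by
  obtain ⟨y, rfl⟩ := e.surjective x
  obtain ⟨g, rfl⟩ := QuotientGroup.mk'_surjective H.toSubgroup y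
  exact ⟨g, rfl⟩

variable {O : Type v} [CommRing O] [Algebra ℤ_[p] O] [Module.Finite ℤ_[p] O] [Module.Free ℤ_[p] O]
  [TopologicalSpace O] [IsModuleTopology ℤ_[p] O] {n : ℕ} (ρ : G →ₜ* GL (Fin n) O)

theorem repΓ_apply (θ : G →ₜ* Multiplicative ℤ_[p]) (r : Iwasawa p G) (i j : Fin n) :
    repΓ ρ θ r i j = PowerSeries.mk fun k => r.integral (repCoeff ρ θ i j k) := rfl

theorem repΓ_ofSubgroup (μ : Iwasawa p H.toSubgroup) (i j : Fin n) :
    repΓ ρ (thetaOf H e) (Iwasawa.ofSubgroup H μ) i j =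
      PowerSeries.C (repO ρ (thetaOf H e) (Iwasawa.ofSubgroup H μ) i j) := by
  ext k
  rw [PowerSeries.coeff_C]
  split_ifs with hk
  · subst hk
    rw [PowerSeries.coeff_zero_eq_constantCoeff_apply]
    rfl
  · rw [repΓ_apply, PowerSeries.coeff_mk]
    refine Iwasawa.dual_ext (p := p) fun ℓ => ?_
    rw [Iwasawa.apply_integral, map_zero]
    refine Eq.trans ?_ (map_zero μ)
    change μ _ = μ 0
    congr 1
    ext h
    change ℓ (Ring.choose ((thetaOf H e) (h : G)).toAdd k • _) = 0
    rw [thetaOf_of_mem H e h.2, toAdd_one, Ring.choose_zero_ite, if_neg hk, zero_smul, map_zero]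

theorem repΓ_dirac (θ : G →ₜ* Multiplicative ℤ_[p]) (g : G) (i j : Fin n) :
    repΓ ρ θ (Iwasawa.dirac g) i j =
      PowerSeries.mk fun k => Ring.choose (θ g).toAdd k • (ρ g : Matrix (Fin n) (Fin n) O) i j := by
  rw [repΓ_apply]
  ext k
  rw [PowerSeries.coeff_mk, PowerSeries.coeff_mk, Iwasawa.integral_dirac]
  rfl

theorem repΓ_dirac_of_one (θ : G →ₜ* Multiplicative ℤ_[p]) (g : G)
    (hg : θ g = Multiplicative.ofAdd 1) : repΓ ρ θ (Iwasawa.dirac g) =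
      (1 + PowerSeries.X : PowerSeries O) • (PowerSeries.C (R := O)).mapMatrix (ρ g : Matrix (Fin n) (Fin n) O) := by
  ext i j k
  rw [repΓ_dirac, PowerSeries.coeff_mk, hg, toAdd_ofAdd, Matrix.smul_apply, RingHom.mapMatrix_apply,
    Matrix.map_apply, smul_eq_mul, add_mul, one_mul, map_add, PowerSeries.coeff_C]
  have h1 : Ring.choose (1 : ℤ_[p]) k = ((Nat.choose 1 k : ℕ) : ℤ_[p]) := by
    have := Ring.choose_natCast (R := ℤ_[p]) 1 k
    rwa [Nat.cast_one] at this
  rw [h1]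
  rcases k with _ | _ | k
  · simp
  · simp [PowerSeries.coeff_succ_X_mul]
  · simp [PowerSeries.coeff_X, Nat.choose_eq_zero_of_lt]

theorem det_repΓ_ne_zero [IsDomain O] {x : Iwasawa p G} (hx : x ∈ oreSet p H) :
    (repΓ ρ (thetaOf H e) x).det ≠ 0 := by
  let φ := repΓ ρ (thetaOf H e)
  let W' : Submodule (PowerSeries O) (Fin n → PowerSeries O) := LinearMap.range (φ x).vecMulLinear
  let Q := (Fin n → PowerSeries O) ⧸ W'
  let q : (Fin n → PowerSeries O) →ₗ[PowerSeries O] Q := W'.mkQ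
  let _ : Module (Iwasawa p H.toSubgroup) (Iwasawa p G ⧸ Ideal.span {x}) :=
    Module.compHom _ (Iwasawa.ofSubgroup H)
  have hfin : Module.Finite (Iwasawa p H.toSubgroup) (Iwasawa p G ⧸ Ideal.span {x}) := hx
  obtain ⟨k, s, hs⟩ := Module.Finite.exists_fin (R := Iwasawa p H.toSubgroup)
    (M := Iwasawa p G ⧸ Ideal.span {x})
  choose m hm using fun i => Submodule.Quotient.mk_surjective (Ideal.span {x}) (s i)
  have hgen : ∀ y : Iwasawa p G, ∃ (c : Fin k → Iwasawa p H.toSubgroup) (z : Iwasawa p G),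
      y = ∑ i, Iwasawa.ofSubgroup H (c i) * m i + z * x := by
    intro y
    have hy : (Submodule.Quotient.mk y : Iwasawa p G ⧸ Ideal.span {x}) ∈
        Submodule.span (Iwasawa p H.toSubgroup) (Set.range s) := hs ▸ Submodule.mem_top
    obtain ⟨c, hc⟩ := (Submodule.mem_span_range_iff_exists_fun _).1 hy
    have e1 : (Submodule.Quotient.mk (∑ i, Iwasawa.ofSubgroup H (c i) * m i) :
        Iwasawa p G ⧸ Ideal.span {x}) = Submodule.Quotient.mk y := by
      rw [← hc]
      change Submodule.mkQ _ (∑ i, Iwasawa.ofSubgroup H (c i) * m i) = _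
      rw [map_sum]
      refine Finset.sum_congr rfl fun i _ => ?_
      rw [← hm i]
      rfl
    have e2 := (Submodule.Quotient.eq _).1 e1.symm
    obtain ⟨z, hz⟩ := Ideal.mem_span_singleton'.1 e2
    exact ⟨c, z, by rw [hz]; abel⟩
  let Y : Submodule O Q := Submodule.span O
    (Set.range fun x : Fin n × Fin k => q (Matrix.vecMul (Pi.single x.1 1) (φ (m x.2))))
  have hYfg : Y.FG := Submodule.fg_span (Set.finite_range _)
  have hC : ∀ (c : O) (w : Q), (PowerSeries.C c : PowerSeries O) • w = c • w := fun c w => by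
    rw [← smul_one_smul (PowerSeries O) c w, PowerSeries.smul_eq_C_mul, mul_one]
  have hrow : ∀ (v : Fin n → O) (N : Matrix (Fin n) (Fin n) (PowerSeries O)),
      Matrix.vecMul (fun l => PowerSeries.C (v l)) N =
        ∑ l, PowerSeries.C (v l) • Matrix.vecMul (Pi.single l 1) N := by
    intro v N
    have : (fun l => PowerSeries.C (v l)) =
        ∑ l, (PowerSeries.C (v l) : PowerSeries O) • (Pi.single l 1 : Fin n → PowerSeries O) := by
      ext1 l
      simp [Finset.sum_apply, Pi.single_apply]
    rw [this, Matrix.sum_vecMul]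
    exact Finset.sum_congr rfl fun l _ => Matrix.smul_vecMul _ _ _
  have hmem : ∀ (y : Iwasawa p G) (v : Fin n → O),
      q (Matrix.vecMul (fun l => PowerSeries.C (v l)) (φ y)) ∈ Y := by
    intro y v
    obtain ⟨c, z, rfl⟩ := hgen y
    rw [map_add, map_mul, Matrix.vecMul_add, map_add, ← Matrix.vecMul_vecMul]
    have e0 : q (Matrix.vecMul (Matrix.vecMul (fun l => PowerSeries.C (v l)) (φ z)) (φ x)) = 0 :=
      (Submodule.Quotient.mk_eq_zero _).2 ⟨_, rfl⟩
    rw [e0, add_zero, map_sum, Matrix.vecMul_sum, map_sum]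
    refine Submodule.sum_mem _ fun i _ => ?_
    rw [map_mul, ← Matrix.vecMul_vecMul]
    have e1 : Matrix.vecMul (fun l => PowerSeries.C (v l)) (φ (Iwasawa.ofSubgroup H (c i))) =
        fun l => PowerSeries.C (Matrix.vecMul v
          (repO ρ (thetaOf H e) (Iwasawa.ofSubgroup H (c i))) l) := by
      ext1 l
      simp only [Matrix.vecMul, dotProduct, map_sum, map_mul]
      refine Finset.sum_congr rfl fun l' _ => ?_
      rw [show φ _ l' l = _ from repΓ_ofSubgroup H e ρ (c i) l' l]
    rw [e1, hrow, map_sum]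
    refine Submodule.sum_mem _ fun l _ => ?_
    rw [map_smul, hC]
    exact Submodule.smul_mem _ _ (Submodule.subset_span ⟨(l, i), rfl⟩)
  obtain ⟨g, hg⟩ := thetaOf_surjective H e (Multiplicative.ofAdd 1)
  have hT : ∀ y ∈ Y, (PowerSeries.X : PowerSeries O) • y ∈ Y := by
    intro y hy
    induction hy using Submodule.span_induction with
    | zero => rw [smul_zero]; exact Submodule.zero_mem _
    | add a b _ _ ha hb => rw [smul_add]; exact Submodule.add_mem _ ha hb
    | smul c a _ ha =>
      rw [← hC, smul_smul, mul_comm, ← smul_smul, hC]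
      exact Submodule.smul_mem _ _ ha
    | mem a ha =>
      obtain ⟨⟨l, i⟩, rfl⟩ := ha
      have e1 : Matrix.vecMul (fun l' => PowerSeries.C (((ρ g)⁻¹ : GL (Fin n) O).1 l l'))
          (φ (Iwasawa.dirac g * m i)) = (1 + PowerSeries.X : PowerSeries O) •
            Matrix.vecMul (Pi.single l 1) (φ (m i)) := by
        rw [map_mul, ← Matrix.vecMul_vecMul, show φ (Iwasawa.dirac g) = _ from
          repΓ_dirac_of_one ρ _ g hg, Matrix.vecMul_smul, Matrix.smul_vecMul]
        congr 2
        ext1 l'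
        simp only [Matrix.vecMul, dotProduct, RingHom.mapMatrix_apply, Matrix.map_apply, ← map_mul,
          ← map_sum]
        rw [← Matrix.mul_apply, ← Units.val_mul, inv_mul_cancel, Units.val_one, Matrix.one_apply,
          Pi.single_apply]
        split_ifs with h1 h2 h2 <;> simp_all
      have e2 := hmem (Iwasawa.dirac g * m i) fun l' => ((ρ g)⁻¹ : GL (Fin n) O).1 l l'
      rw [e1, map_smul, add_smul, one_smul] at e2
      have e3 : q (Matrix.vecMul (Pi.single l 1) (φ (m i))) ∈ Y := Submodule.subset_span ⟨(l, i), rfl⟩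
      exact (Submodule.add_mem_iff_right _ e3).1 e2
  obtain ⟨P, hP, hPY⟩ := exists_monic_smul_eq_zero Y hYfg hT
  refine det_ne_zero_of_vecMul _ (c := (P : PowerSeries O))
    (fun h => hP.ne_zero (Polynomial.coe_injective O (by simpa using h))) fun j => ?_
  have h1 := hmem 1 (Pi.single j 1)
  rw [map_one, Matrix.vecMul_one] at h1
  have h2 := hPY _ h1
  rw [← map_smul] at h2
  obtain ⟨w, hw⟩ := (Submodule.Quotient.mk_eq_zero _).1 h2
  refine ⟨w, hw.trans ?_⟩
  congr 1
  ext1 l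
  rcases eq_or_ne l j with rfl | h
  · simp
  · simp [h]

theorem exists_rhoS {L : Type v} [Field L] [Algebra ℚ_[p] L] [FiniteDimensional ℚ_[p] L]
    [Algebra ℤ_[p] L] [IsScalarTower ℤ_[p] ℚ_[p] L] (ρ : G →ₜ* GL (Fin n) (Integers p L)) :
    ∃ ρS : Loc (Iwasawa p G) (oreSetStar p H) →+* Matrix (Fin n) (Fin n) (QGamma p L),
      ∀ x, ρS (toLoc (oreSetStar p H) x) =
        (algebraMap (PowerSeries (Integers p L)) (QGamma p L)).mapMatrix
          (repΓ ρ (thetaOf H e) x) := by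
  refine exists_loc_lift (oreSetStar p H)
    ((algebraMap (PowerSeries (Integers p L)) (QGamma p L)).mapMatrix.comp
      (repΓ ρ (thetaOf H e))) ?_
  rintro _ ⟨i, s, hs, rfl⟩
  rw [Matrix.isUnit_iff_isUnit_det, isUnit_iff_ne_zero, RingHom.comp_apply, ← RingHom.map_det,
    map_mul, map_pow, map_natCast, Matrix.det_mul, Matrix.det_pow, ne_eq,
    map_eq_zero_iff _ (IsFractionRing.injective _ _), mul_eq_zero, not_or]
  refine ⟨pow_ne_zero _ ?_, det_repΓ_ne_zero H e ρ hs⟩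
  rw [← Matrix.diagonal_natCast, Matrix.det_diagonal, Finset.prod_const]
  refine pow_ne_zero _ ?_
  intro h
  have h1 := congrArg (fun f => algebraMap (Integers p L) L (PowerSeries.constantCoeff f)) h
  simp only [map_natCast, map_zero] at h1
  exact p_ne_zero h1

end RhoS

/-! ### Integral structures over `O[[T]]` -/

section Integral

variable {p : ℕ} [Fact p.Prime] {L : Type v} [Field L] [Algebra ℚ_[p] L] [FiniteDimensional ℚ_[p] L]
  [Algebra ℤ_[p] L] [IsScalarTower ℤ_[p] ℚ_[p] L]
  {G : Type u} [Group G] [TopologicalSpace G] [IsTopologicalGroup G] [CompactSpace G]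
  {n : ℕ} (ρ : G →ₜ* GL (Fin n) (Integers p L)) (θ : G →ₜ* Multiplicative ℤ_[p])
  (M : Type*) [AddCommGroup M] [Module (Iwasawa p G) M] [Module.Finite (Iwasawa p G) M]
  [Module.Projective (Iwasawa p G) M] {N : Type*} [AddCommGroup N] [Module (Iwasawa p G) N]
  [Module.Finite (Iwasawa p G) N] [Module.Projective (Iwasawa p G) N]

/-- The right `Λ(G)`-module `O[[T]]^n`. -/
abbrev actI : (Iwasawa p G)ᵐᵒᵖ →+*
    Module.End (PowerSeries (Integers p L)) (Fin n → PowerSeries (Integers p L)) :=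
  actMatrix (repΓ ρ θ)

/-- The inclusion of `O[[T]]` in `L[[T]]`. -/
abbrev inclP (p : ℕ) [Fact p.Prime] (L : Type v) [Field L] [Algebra ℚ_[p] L]
    [FiniteDimensional ℚ_[p] L] [Algebra ℤ_[p] L] [IsScalarTower ℤ_[p] ℚ_[p] L] :
    PowerSeries (Integers p L) →+* PowerSeries L :=
  PowerSeries.map (algebraMap (Integers p L) L)

theorem inclP_injective : Function.Injective (inclP p L) :=
  PowerSeries.map_injective _ algebraMap_integers_injective

theorem inclP_X : inclP p L PowerSeries.X = PowerSeries.X := PowerSeries.map_X _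

/-- The map from `O[[T]]^n ⊗ M` to `L[[T]]^n ⊗ M`. -/
abbrev toP : BTensor ⊤ (actI ρ θ) M →ₛₗ[inclP p L] BTensor ⊤ (actP ρ θ) M :=
  matBase (inclP p L) (repΓ ρ θ) (repP ρ θ) (repP_apply ρ θ) M

variable {M}

theorem toP_injective : Function.Injective (toP ρ θ M) :=
  BTensor.baseMap_injective (fun x y h => by
    ext1 i
    exact inclP_injective (congrFun h i))

theorem map_toP (f : M →ₗ[Iwasawa p G] N) (x : BTensor ⊤ (actI ρ θ) M) :
    BTensor.map ⊤ (actP ρ θ) f (toP ρ θ M x) = toP ρ θ N (BTensor.map ⊤ (actI ρ θ) f x) :=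
  matBase_map _ f x

theorem toP_X_smul (k : ℕ) (x : BTensor ⊤ (actI ρ θ) M) :
    toP ρ θ M ((PowerSeries.X : PowerSeries (Integers p L)) ^ k • x) =
      (PowerSeries.X : PowerSeries L) ^ k • toP ρ θ M x := by
  rw [map_smulₛₗ, map_pow, inclP_X]

theorem toP_p_smul (k : ℕ) (x : BTensor ⊤ (actI ρ θ) M) :
    toP ρ θ M ((p : PowerSeries (Integers p L)) ^ k • x) =
      (p : PowerSeries L) ^ k • toP ρ θ M x := by
  rw [map_smulₛₗ, map_pow, map_natCast]

theorem X_pow_smul_cancel {k : ℕ} {x y : BTensor ⊤ (actP ρ θ) M}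
    (h : (PowerSeries.X : PowerSeries L) ^ k • x = (PowerSeries.X : PowerSeries L) ^ k • y) :
    x = y := by
  rw [← sub_eq_zero, ← smul_sub] at h
  exact sub_eq_zero.1 ((smul_eq_zero.1 h).resolve_left (pow_ne_zero _ PowerSeries.X_ne_zero))

theorem X_pow_smul_cancel' {k : ℕ} {x y : BTensor ⊤ (actI ρ θ) M}
    (h : (PowerSeries.X : PowerSeries (Integers p L)) ^ k • x =
      (PowerSeries.X : PowerSeries (Integers p L)) ^ k • y) : x = y := by
  apply toP_injective ρ θ
  apply X_pow_smul_cancel ρ θ (k := k)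
  rw [← toP_X_smul, h, toP_X_smul]

/-- An element of the integral structure that is divisible by `T` is divisible by `T` in the integral
structure. -/
theorem exists_of_toP_eq {x : BTensor ⊤ (actI ρ θ) M} {z : BTensor ⊤ (actP ρ θ) M} {k : ℕ}
    (h : toP ρ θ M x = (PowerSeries.X : PowerSeries L) ^ k • z) :
    ∃ y, x = (PowerSeries.X : PowerSeries (Integers p L)) ^ k • y ∧ toP ρ θ M y = z := by
  obtain ⟨l, m, ℓ, hm⟩ := exists_dualBasis (Iwasawa p G) M
  have hdiv : ∀ i j, (PowerSeries.X : PowerSeries (Integers p L)) ^ k ∣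
      BTensor.coord (actI ρ θ) (ℓ i) x j := by
    intro i j
    rw [PowerSeries.X_pow_dvd_iff]
    intro a ha
    have h1 := congrFun (congrArg (BTensor.coord (actP ρ θ) (ℓ i)) h) j
    rw [map_smul] at h1
    have h2 : BTensor.coord (actP ρ θ) (ℓ i) (toP ρ θ M x) j =
      inclP p L (BTensor.coord (actI ρ θ) (ℓ i) x j) := congrFun (BTensor.coord_baseMap (ℓ i) x) j
    rw [h2] at h1
    have h3 := PowerSeries.X_pow_dvd_iff.1 (Dvd.intro _ h1.symm) a ha
    rw [PowerSeries.coeff_map] at h3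
    exact algebraMap_integers_injective (h3.trans (map_zero _).symm)
  choose c hc using hdiv
  have hx : x = (PowerSeries.X : PowerSeries (Integers p L)) ^ k •
      ∑ i, BTensor.tmul ⊤ (actI ρ θ) (c i) (m i) := by
    conv_lhs => rw [← BTensor.sum_coord hm x]
    rw [Finset.smul_sum]
    refine Finset.sum_congr rfl fun i _ => ?_
    rw [← BTensor.smul_tmul]
    congr 1
    ext1 j
    exact hc i j
  refine ⟨_, hx, X_pow_smul_cancel ρ θ (k := k) ?_⟩
  rw [← toP_X_smul, ← hx, h]

theorem exists_trunc (N : ℕ) (f : PowerSeries L) : ∃ (k : ℕ) (g : PowerSeries (Integers p L))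
    (f' : PowerSeries L), (p : PowerSeries L) ^ k * f = inclP p L g + PowerSeries.X ^ N * f' := by
  induction N with
  | zero => exact ⟨0, 0, f, by simp⟩
  | succ N ih =>
    obtain ⟨k, g, f', h⟩ := ih
    obtain ⟨l, a, ha⟩ := exists_pow_mul_integer (p := p) (PowerSeries.constantCoeff f')
    obtain ⟨f'', hf''⟩ := PowerSeries.X_dvd_iff.2
      (show PowerSeries.constantCoeff (f' - PowerSeries.C (PowerSeries.constantCoeff f')) = 0 by simp)
    refine ⟨l + k, (p : PowerSeries (Integers p L)) ^ l * g + PowerSeries.X ^ N * PowerSeries.C a,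
      (p : PowerSeries L) ^ l * f'', ?_⟩
    have e1 : inclP p L (PowerSeries.C a) = (p : PowerSeries L) ^ l *
        PowerSeries.C (PowerSeries.constantCoeff f') := by
      rw [PowerSeries.map_C, ← ha, map_mul, map_pow, map_natCast]
    have e2 : f' = PowerSeries.X * f'' + PowerSeries.C (PowerSeries.constantCoeff f') := by
      rw [← hf'', sub_add_cancel]
    rw [pow_add, mul_assoc, h, map_add, map_mul, map_mul, e1, map_pow, map_pow, map_natCast, inclP_X]
    conv_lhs => rw [e2]
    ring

theorem exists_toP_add (K : ℕ) (z : BTensor ⊤ (actP ρ θ) M) :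
    ∃ (k : ℕ) (x : BTensor ⊤ (actI ρ θ) M) (z' : BTensor ⊤ (actP ρ θ) M),
      (p : PowerSeries L) ^ k • z = toP ρ θ M x + (PowerSeries.X : PowerSeries L) ^ K • z' := by
  induction z using BTensor.induction_on with
  | zero => exact ⟨0, 0, 0, by simp⟩
  | tmul y m =>
    choose k g f' h using fun i => exists_trunc (p := p) K (y i)
    refine ⟨∑ i, k i, BTensor.tmul _ _ (fun i => (p : PowerSeries (Integers p L)) ^
      (∑ j ∈ Finset.univ.erase i, k j) * g i) m, BTensor.tmul _ _ (fun i => (p : PowerSeries L) ^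
      (∑ j ∈ Finset.univ.erase i, k j) * f' i) m, ?_⟩
    rw [matBase_tmul, ← BTensor.smul_tmul, ← BTensor.smul_tmul, ← BTensor.add_tmul]
    congr 1
    ext1 i
    rw [Pi.smul_apply, Pi.add_apply, Pi.smul_apply, vecMap_apply, smul_eq_mul, smul_eq_mul,
      ← Finset.sum_erase_add _ _ (Finset.mem_univ i), pow_add, mul_assoc, h, map_mul, map_pow,
      map_natCast]
    ring
  | add a b ha hb =>
    obtain ⟨k, y, z, h⟩ := ha
    obtain ⟨k', y', z', h'⟩ := hb
    refine ⟨k' + k, (p : PowerSeries (Integers p L)) ^ k' • y +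
      (p : PowerSeries (Integers p L)) ^ k • y', (p : PowerSeries L) ^ k' • z +
      (p : PowerSeries L) ^ k • z', ?_⟩
    rw [smul_add, pow_add, mul_smul, h, mul_comm, mul_smul, h', map_add, toP_p_smul, toP_p_smul]
    simp only [smul_add, smul_smul]
    rw [mul_comm (PowerSeries.X ^ K) ((p : PowerSeries L) ^ k'),
      mul_comm (PowerSeries.X ^ K) ((p : PowerSeries L) ^ k)]
    abel

/-- Every map over `L[[T]]` is, up to powers of `p` and modulo a power of `T`, defined over
`O[[T]]`. -/
theorem exists_integral_approx (K : ℕ)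
    (h : BTensor ⊤ (actP ρ θ) M →ₗ[PowerSeries L] BTensor ⊤ (actP ρ θ) N) :
    ∃ k₀ : ℕ, ∀ k, k₀ ≤ k → ∃ h₀ : BTensor ⊤ (actI ρ θ) M →ₗ[PowerSeries (Integers p L)]
      BTensor ⊤ (actI ρ θ) N, ∀ x, ∃ z, toP ρ θ N (h₀ x) = (p : PowerSeries L) ^ k • h (toP ρ θ M x) +
        (PowerSeries.X : PowerSeries L) ^ K • z := by
  obtain ⟨l, m, ℓ, hm⟩ := exists_dualBasis (Iwasawa p G) M
  choose k y z hyz using fun (i : Fin l) (j : Fin n) => exists_toP_add ρ θ K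
    (h (BTensor.tmul ⊤ (actP ρ θ) (Pi.single j 1) (m i)))
  refine ⟨∑ i, ∑ j, k i j, fun k₁ hk₁ => ?_⟩
  have hle : ∀ i j, k i j ≤ k₁ := fun i j => le_trans
    ((Finset.single_le_sum (f := fun j => k i j) (fun _ _ => Nat.zero_le _) (Finset.mem_univ j)).trans
      (Finset.single_le_sum (f := fun i => ∑ j, k i j) (fun _ _ => Nat.zero_le _)
        (Finset.mem_univ i))) hk₁
  let h₀ : BTensor ⊤ (actI ρ θ) M →ₗ[PowerSeries (Integers p L)] BTensor ⊤ (actI ρ θ) N :=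
    ∑ i, ∑ j, (LinearMap.toSpanSingleton (PowerSeries (Integers p L)) _
      ((p : PowerSeries (Integers p L)) ^ (k₁ - k i j) • y i j)) ∘ₗ LinearMap.proj j ∘ₗ
        BTensor.coord (actI ρ θ) (ℓ i)
  have e0 : ∀ x, h₀ x = ∑ i, ∑ j, BTensor.coord (actI ρ θ) (ℓ i) x j •
      ((p : PowerSeries (Integers p L)) ^ (k₁ - k i j) • y i j) := fun x => by
    simp [h₀, LinearMap.sum_apply]
  refine ⟨h₀, fun x => ⟨-∑ i, ∑ j, inclP p L (BTensor.coord (actI ρ θ) (ℓ i) x j) •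
    ((p : PowerSeries L) ^ (k₁ - k i j) • z i j), ?_⟩⟩
  have e1 : toP ρ θ M x = ∑ i, ∑ j, inclP p L (BTensor.coord (actI ρ θ) (ℓ i) x j) •
      BTensor.tmul ⊤ (actP ρ θ) (Pi.single j 1) (m i) := by
    conv_lhs => rw [← BTensor.sum_coord hm x]
    rw [map_sum]
    refine Finset.sum_congr rfl fun i _ => ?_
    rw [matBase_tmul, tmul_eq_sum]
    rfl
  rw [e0, e1]
  simp only [map_sum, Finset.smul_sum, smul_neg, map_smulₛₗ, RingHom.id_apply, map_smul]
  rw [← sub_eq_add_neg, ← Finset.sum_sub_distrib]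
  refine Finset.sum_congr rfl fun i _ => ?_
  rw [← Finset.sum_sub_distrib]
  refine Finset.sum_congr rfl fun j _ => ?_
  have e2 := eq_sub_of_add_eq (hyz i j).symm
  rw [map_pow, map_natCast, e2]
  have e3 : (p : PowerSeries L) ^ k₁ = (p : PowerSeries L) ^ (k₁ - k i j) * (p : PowerSeries L) ^ k i j := by
    rw [← pow_add, Nat.sub_add_cancel (hle i j)]
  rw [e3]
  simp only [smul_sub, smul_smul]
  congr 2 <;> ring

variable {M₀ M₁ M₂ M₃ : Type*} [AddCommGroup M₀] [Module (Iwasawa p G) M₀]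
  [Module.Finite (Iwasawa p G) M₀] [Module.Projective (Iwasawa p G) M₀] [AddCommGroup M₁]
  [Module (Iwasawa p G) M₁] [Module.Finite (Iwasawa p G) M₁] [Module.Projective (Iwasawa p G) M₁]
  [AddCommGroup M₂] [Module (Iwasawa p G) M₂] [Module.Finite (Iwasawa p G) M₂]
  [Module.Projective (Iwasawa p G) M₂] [AddCommGroup M₃] [Module (Iwasawa p G) M₃]
  [Module.Finite (Iwasawa p G) M₃] [Module.Projective (Iwasawa p G) M₃]

/-- If `T` is null-homotopic over `L[[T]]`, then a power of `p` kills `T · H[T²]` for the cohomology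
`H` over `O[[T]]`. -/
theorem exists_pow_smul_X_smul {f₀ : M₀ →ₗ[Iwasawa p G] M₁} {f₁ : M₁ →ₗ[Iwasawa p G] M₂}
    {f₂ : M₂ →ₗ[Iwasawa p G] M₃} (h10 : f₁ ∘ₗ f₀ = 0)
    (g₀ : BTensor ⊤ (actP ρ θ) M₁ →ₗ[PowerSeries L] BTensor ⊤ (actP ρ θ) M₀)
    (g₁ : BTensor ⊤ (actP ρ θ) M₂ →ₗ[PowerSeries L] BTensor ⊤ (actP ρ θ) M₁)
    (g₂ : BTensor ⊤ (actP ρ θ) M₃ →ₗ[PowerSeries L] BTensor ⊤ (actP ρ θ) M₂)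
    (h₁ : ∀ x, BTensor.map ⊤ (actP ρ θ) f₀ (g₀ x) + g₁ (BTensor.map ⊤ (actP ρ θ) f₁ x) =
      (PowerSeries.X : PowerSeries L) • x)
    (h₂ : ∀ x, BTensor.map ⊤ (actP ρ θ) f₁ (g₁ x) + g₂ (BTensor.map ⊤ (actP ρ θ) f₂ x) =
      (PowerSeries.X : PowerSeries L) • x) :
    ∃ k : ℕ, ∀ v x, BTensor.map ⊤ (actI ρ θ) f₂ v = 0 → BTensor.map ⊤ (actI ρ θ) f₁ x =
      (PowerSeries.X : PowerSeries (Integers p L)) ^ 2 • v →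
      ∃ y, BTensor.map ⊤ (actI ρ θ) f₁ y = (p : PowerSeries (Integers p L)) ^ k •
        (PowerSeries.X : PowerSeries (Integers p L)) • v := by
  obtain ⟨k₀, hk₀⟩ := exists_integral_approx ρ θ 2 g₀
  obtain ⟨k₁, hk₁⟩ := exists_integral_approx ρ θ 2 g₁
  obtain ⟨k₂, hk₂⟩ := exists_integral_approx ρ θ 2 g₂
  obtain ⟨k, e0, e1, e2⟩ : ∃ k, k₀ ≤ k ∧ k₁ ≤ k ∧ k₂ ≤ k := ⟨k₀ + k₁ + k₂, by omega, by omega, by omega⟩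
  obtain ⟨u₀, hu₀⟩ := hk₀ k e0
  obtain ⟨u₁, hu₁⟩ := hk₁ k e1
  obtain ⟨u₂, hu₂⟩ := hk₂ k e2
  have F₁ : ∀ x, ∃ y, BTensor.map ⊤ (actI ρ θ) f₀ (u₀ x) + u₁ (BTensor.map ⊤ (actI ρ θ) f₁ x) =
      (p : PowerSeries (Integers p L)) ^ k • (PowerSeries.X : PowerSeries (Integers p L)) • x +
        (PowerSeries.X : PowerSeries (Integers p L)) ^ 2 • y := by
    intro x
    obtain ⟨z, hz⟩ := hu₀ x
    obtain ⟨z', hz'⟩ := hu₁ (BTensor.map ⊤ (actI ρ θ) f₁ x)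
    have e : toP ρ θ M₁ (BTensor.map ⊤ (actI ρ θ) f₀ (u₀ x) + u₁ (BTensor.map ⊤ (actI ρ θ) f₁ x) -
        (p : PowerSeries (Integers p L)) ^ k • (PowerSeries.X : PowerSeries (Integers p L)) • x) =
        (PowerSeries.X : PowerSeries L) ^ 2 • (BTensor.map ⊤ (actP ρ θ) f₀ z + z') := by
      rw [map_sub, map_add, ← map_toP, hz, hz', toP_p_smul, ← map_toP,
        ← pow_one (PowerSeries.X : PowerSeries (Integers p L)), toP_X_smul, pow_one, ← h₁, map_add,
        map_smul, map_smul]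
      simp only [smul_add]
      abel
    obtain ⟨y, hy, -⟩ := exists_of_toP_eq ρ θ e
    exact ⟨y, by rw [← hy]; abel⟩
  have F₂ : ∀ x, ∃ y, BTensor.map ⊤ (actI ρ θ) f₁ (u₁ x) + u₂ (BTensor.map ⊤ (actI ρ θ) f₂ x) =
      (p : PowerSeries (Integers p L)) ^ k • (PowerSeries.X : PowerSeries (Integers p L)) • x +
        (PowerSeries.X : PowerSeries (Integers p L)) ^ 2 • y := by
    intro x
    obtain ⟨z, hz⟩ := hu₁ x
    obtain ⟨z', hz'⟩ := hu₂ (BTensor.map ⊤ (actI ρ θ) f₂ x)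
    have e : toP ρ θ M₂ (BTensor.map ⊤ (actI ρ θ) f₁ (u₁ x) + u₂ (BTensor.map ⊤ (actI ρ θ) f₂ x) -
        (p : PowerSeries (Integers p L)) ^ k • (PowerSeries.X : PowerSeries (Integers p L)) • x) =
        (PowerSeries.X : PowerSeries L) ^ 2 • (BTensor.map ⊤ (actP ρ θ) f₁ z + z') := by
      rw [map_sub, map_add, ← map_toP, hz, hz', toP_p_smul, ← map_toP,
        ← pow_one (PowerSeries.X : PowerSeries (Integers p L)), toP_X_smul, pow_one, ← h₂, map_add,
        map_smul, map_smul]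
      simp only [smul_add]
      abel
    obtain ⟨y, hy, -⟩ := exists_of_toP_eq ρ θ e
    exact ⟨y, by rw [← hy]; abel⟩
  refine ⟨k, fun v x hv hx => ?_⟩
  obtain ⟨y, hy⟩ := F₂ v
  obtain ⟨y', hy'⟩ := F₁ x
  rw [hv, map_zero, add_zero] at hy
  have hdd : BTensor.map ⊤ (actI ρ θ) f₁ (BTensor.map ⊤ (actI ρ θ) f₀ (u₀ x)) = 0 :=
    map_map_of_comp _ h10 _
  have h3 := congrArg (BTensor.map ⊤ (actI ρ θ) f₁) hy'
  rw [map_add, hdd, zero_add, hx, map_add, map_smul, map_smul, map_smul, map_smul, map_smul, hx, hy]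
    at h3
  have h4 : (PowerSeries.X : PowerSeries (Integers p L)) ^ 2 •
      (PowerSeries.X : PowerSeries (Integers p L)) ^ 2 • y =
      (PowerSeries.X : PowerSeries (Integers p L)) ^ 2 • BTensor.map ⊤ (actI ρ θ) f₁ y' := by
    rw [smul_add] at h3
    have e : ∀ v : BTensor ⊤ (actI ρ θ) M₂, (p : PowerSeries (Integers p L)) ^ k •
        (PowerSeries.X : PowerSeries (Integers p L)) •
          (PowerSeries.X : PowerSeries (Integers p L)) ^ 2 • v =
        (PowerSeries.X : PowerSeries (Integers p L)) ^ 2 • (p : PowerSeries (Integers p L)) ^ k •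
        (PowerSeries.X : PowerSeries (Integers p L)) • v := fun v => by
      simp only [smul_smul]
      congr 1
      ring
    rw [e] at h3
    exact add_left_cancel h3
  refine ⟨u₁ v - y', ?_⟩
  rw [map_sub, hy, X_pow_smul_cancel' ρ θ h4]
  abel

end Integral

/-! ### Dimensions of cohomology groups -/

section Dimension

variable (L : Type v) [Field L]

/-- The dimension over `L` of an `L[[T]]`-module. -/
def dimC (V : Type*) [AddCommGroup V] [Module (PowerSeries L) V] : ℕ :=
  letI : Module L V := Module.compHom V (PowerSeries.C (R := L))
  Module.finrank L V

/-- An `L[[T]]`-module has finite dimension over `L`. -/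
def FinC (V : Type*) [AddCommGroup V] [Module (PowerSeries L) V] : Prop :=
  letI : Module L V := Module.compHom V (PowerSeries.C (R := L))
  Module.Finite L V

variable {L}

theorem dimC_of_injective {V W : Type*} [AddCommGroup V] [Module (PowerSeries L) V] [AddCommGroup W]
    [Module L W] (f : V →ₛₗ[PowerSeries.constantCoeff (R := L)] W) (hf : Function.Injective f)
    (S : Submodule L W) (hS : ∀ w, w ∈ S ↔ ∃ v, f v = w) : dimC L V = Module.finrank L S := by
  let _ : Module L V := Module.compHom V (PowerSeries.C (R := L))
  let f' : V →ₗ[L] W :=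
    { toFun := f
      map_add' := map_add f
      map_smul' := fun c v => (map_smulₛₗ f (PowerSeries.C c) v).trans (by simp) }
  have : S = LinearMap.range f' := by
    ext w
    rw [hS]
    rfl
  rw [this]
  exact (LinearMap.finrank_range_of_inj (f := f') hf).symm

theorem finC_of_injective {V W : Type*} [AddCommGroup V] [Module (PowerSeries L) V] [AddCommGroup W]
    [Module L W] [Module.Finite L W] (f : V →ₛₗ[PowerSeries.constantCoeff (R := L)] W)
    (hf : Function.Injective f) : FinC L V := by
  let _ : Module L V := Module.compHom V (PowerSeries.C (R := L))
  let f' : V →ₗ[L] W :=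
    { toFun := f
      map_add' := map_add f
      map_smul' := fun c v => (map_smulₛₗ f (PowerSeries.C c) v).trans (by simp) }
  exact Module.Finite.of_injective f' hf

theorem dimC_eq_zero {V : Type*} [AddCommGroup V] [Module (PowerSeries L) V] [Subsingleton V] :
    dimC L V = 0 := by
  let _ : Module L V := Module.compHom V (PowerSeries.C (R := L))
  exact Module.finrank_zero_of_subsingleton

theorem dimC_eq_sum {ι : Type*} (s : Finset ι) {V : Type*} [AddCommGroup V]
    [Module (PowerSeries L) V] (hV : FinC L V) {W : ι → Type*} [∀ i, AddCommGroup (W i)]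
    [∀ i, Module (PowerSeries L) (W i)] (a : ∀ i, W i →ₗ[PowerSeries L] V)
    (b : ∀ i, V →ₗ[PowerSeries L] W i) (hba : ∀ i x, b i (a i x) = x)
    (hba' : ∀ i j x, i ≠ j → b j (a i x) = 0) (hab : ∀ v, ∑ i ∈ s, a i (b i v) = v) :
    dimC L V = ∑ i ∈ s, dimC L (W i) := by
  let _ : Module L V := Module.compHom V (PowerSeries.C (R := L))
  let _ : ∀ i, Module L (W i) := fun i => Module.compHom (W i) (PowerSeries.C (R := L))
  have hV : Module.Finite L V := hV
  let a' : ∀ i, W i →ₗ[L] V := fun i =>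
    { toFun := a i
      map_add' := map_add _
      map_smul' := fun c v => map_smul (a i) (PowerSeries.C c) v }
  let b' : ∀ i, V →ₗ[L] W i := fun i =>
    { toFun := b i
      map_add' := map_add _
      map_smul' := fun c v => map_smul (b i) (PowerSeries.C c) v }
  have hW : ∀ i, Module.Finite L (W i) := fun i => Module.Finite.of_injective (a' i)
    (Function.LeftInverse.injective (g := b i) (hba i))
  classical
  let e : V ≃ₗ[L] (∀ i : s, W i) := LinearEquiv.ofLinearMap (LinearMap.pi fun i => b' i)
    (∑ i : s, a' i ∘ₗ LinearMap.proj i)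
    (LinearMap.ext fun c => funext fun j => by
      rw [LinearMap.comp_apply, LinearMap.pi_apply, LinearMap.sum_apply, map_sum,
        Finset.sum_eq_single j]
      · exact hba j.1 (c j)
      · exact fun i _ hij => hba' i j (c i) fun h => hij (Subtype.ext h)
      · exact fun h => absurd (Finset.mem_univ j) h)
    (LinearMap.ext fun v => by
      rw [LinearMap.comp_apply, LinearMap.sum_apply]
      refine Eq.trans ?_ (hab v)
      exact Finset.sum_coe_sort s fun i => a i (b i v))
  have h1 : Module.finrank L V = Module.finrank L (∀ i : s, W i) := e.finrank_eq
  rw [Module.finrank_pi_fintype] at h1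
  exact h1.trans (Finset.sum_coe_sort s fun i => Module.finrank L (W i))

theorem finrank_tensor_eq {O : Type*} [CommRing O] [Algebra O L] (t : O) (ht : algebraMap O L t ≠ 0)
    (hL : ∀ l : L, ∃ (k : ℕ) (c : O), algebraMap O L t ^ k * l = algebraMap O L c)
    {N W : Type*} [AddCommGroup N] [Module O N] [AddCommGroup W] [Module L W]
    (f : N →ₛₗ[algebraMap O L] W) (h₁ : ∀ x, f x = 0 → ∃ k : ℕ, t ^ k • x = 0)
    (h₂ : ∀ w, ∃ (k : ℕ) (x : N), algebraMap O L t ^ k • w = f x) :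
    Module.finrank L (L ⊗[O] N) = Module.finrank L W := by
  let _ : Module O W := Module.compHom W (algebraMap O L)
  have : IsScalarTower O L W := ⟨fun c l w => by
    rw [Algebra.smul_def, mul_smul]
    rfl⟩
  let f' : N →ₗ[O] W :=
    { toFun := f
      map_add' := map_add f
      map_smul' := fun c x => map_smulₛₗ f c x }
  have htk (k : ℕ) : algebraMap O L t ^ k ≠ 0 := pow_ne_zero _ ht
  have key : ∀ z : L ⊗[O] N, ∃ (k : ℕ) (x : N), algebraMap O L t ^ k • z = (1 : L) ⊗ₜ[O] x := by
    intro z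
    induction z using TensorProduct.induction_on with
    | zero => exact ⟨0, 0, by simp⟩
    | tmul l x =>
      obtain ⟨k, c, hc⟩ := hL l
      refine ⟨k, c • x, ?_⟩
      rw [TensorProduct.smul_tmul', smul_eq_mul, hc, ← TensorProduct.smul_tmul, Algebra.smul_def,
        mul_one]
    | add a b ha hb =>
      obtain ⟨k, x, hx⟩ := ha
      obtain ⟨k', x', hx'⟩ := hb
      refine ⟨k' + k, t ^ k' • x + t ^ k • x', ?_⟩
      have e : ∀ (m : ℕ) (y : N), (1 : L) ⊗ₜ[O] (t ^ m • y) = algebraMap O L t ^ m • (1 : L) ⊗ₜ[O] y :=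
        fun m y => by
          rw [← TensorProduct.smul_tmul, Algebra.smul_def, map_pow, TensorProduct.smul_tmul',
            smul_eq_mul]
      rw [TensorProduct.tmul_add, e, e, ← hx, ← hx', smul_add, smul_smul, smul_smul, ← pow_add,
        ← pow_add, add_comm k k']
  let F : L ⊗[O] N →ₗ[L] W := LinearMap.liftBaseChange L f'
  have hF : ∀ x, F ((1 : L) ⊗ₜ[O] x) = f x := fun x => by
    rw [LinearMap.liftBaseChange_tmul, one_smul]
    rfl
  refine (LinearEquiv.ofBijective F ⟨?_, fun w => ?_⟩).finrank_eq
  · rw [injective_iff_map_eq_zero]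
    intro z hz
    obtain ⟨k, x, hx⟩ := key z
    have h3 := congrArg F hx
    rw [map_smul, hz, smul_zero, hF] at h3
    obtain ⟨m, hm⟩ := h₁ x h3.symm
    have h4 : algebraMap O L t ^ (m + k) • z = 0 := by
      rw [pow_add, mul_smul, hx, TensorProduct.smul_tmul', smul_eq_mul, mul_one, ← map_pow,
        ← mul_one (algebraMap O L (t ^ m)), ← Algebra.smul_def, TensorProduct.smul_tmul, hm,
        TensorProduct.tmul_zero]
    exact (smul_eq_zero.1 h4).resolve_left (htk _)
  · obtain ⟨k, x, hx⟩ := h₂ w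
    refine ⟨(algebraMap O L t ^ k)⁻¹ • (1 : L) ⊗ₜ[O] x, ?_⟩
    rw [map_smul, hF, ← hx, inv_smul_smul₀ (htk k)]

variable {B B' : Type*} [Ring B] [Ring B'] {σ : B →+* B'} {M N P M' N' P' : Type*} [AddCommGroup M]
  [Module B M] [AddCommGroup N] [Module B N] [AddCommGroup P] [Module B P] [AddCommGroup M']
  [Module B' M'] [AddCommGroup N'] [Module B' N'] [AddCommGroup P'] [Module B' P']

/-- The semilinear map on homology induced by a map that preserves cycles and boundaries. -/
def Hgy.smap {f : M →ₗ[B] N} {g : N →ₗ[B] P} {f' : M' →ₗ[B'] N'} {g' : N' →ₗ[B'] P'}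
    (b : N →ₛₗ[σ] N') (hg : ∀ x, g x = 0 → g' (b x) = 0) (hf : ∀ x, ∃ y, b (f x) = f' y) :
    Hgy f g →ₛₗ[σ] Hgy f' g' :=
  Submodule.mapQ _ _ ((b.domRestrict (LinearMap.ker g)).codRestrict (LinearMap.ker g')
    fun x => hg x x.2) <| by
    rintro ⟨x, hx⟩ ⟨y, hy⟩
    obtain ⟨z, hz⟩ := hf y
    exact ⟨z, by rw [← hz, hy]; rfl⟩

theorem Hgy.smap_mk {f : M →ₗ[B] N} {g : N →ₗ[B] P} {f' : M' →ₗ[B'] N'} {g' : N' →ₗ[B'] P'}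
    (b : N →ₛₗ[σ] N') (hg : ∀ x, g x = 0 → g' (b x) = 0) (hf : ∀ x, ∃ y, b (f x) = f' y) (x : N)
    (hx : g x = 0) : Hgy.smap b hg hf (Hgy.mk f g x hx) = Hgy.mk f' g' (b x) (hg x hx) := rfl

end Dimension

section Ranks

variable {p : ℕ} [Fact p.Prime] {L : Type v} [Field L] [Algebra ℚ_[p] L] [FiniteDimensional ℚ_[p] L]
  [Algebra ℤ_[p] L] [IsScalarTower ℤ_[p] ℚ_[p] L]
  {G : Type u} [Group G] [TopologicalSpace G] [IsTopologicalGroup G] [CompactSpace G]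
  {n : ℕ} (ρ : G →ₜ* GL (Fin n) (Integers p L)) (θ : G →ₜ* Multiplicative ℤ_[p])
  {M₀ M₁ M₂ M₃ : Type*} [AddCommGroup M₀] [Module (Iwasawa p G) M₀]
  [Module.Finite (Iwasawa p G) M₀] [Module.Projective (Iwasawa p G) M₀] [AddCommGroup M₁]
  [Module (Iwasawa p G) M₁] [Module.Finite (Iwasawa p G) M₁] [Module.Projective (Iwasawa p G) M₁]
  [AddCommGroup M₂] [Module (Iwasawa p G) M₂] [Module.Finite (Iwasawa p G) M₂]
  [Module.Projective (Iwasawa p G) M₂] [AddCommGroup M₃] [Module (Iwasawa p G) M₃]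
  [Module.Finite (Iwasawa p G) M₃] [Module.Projective (Iwasawa p G) M₃]

theorem invRank_eq_dimC {M : Type*} [AddCommGroup M] [Module (PowerSeries (Integers p L)) M]
    {W : Type*} [AddCommGroup W] [Module (PowerSeries L) W] (f : M →ₛₗ[inclP p L] W)
    (h₁ : ∀ x, (PowerSeries.X : PowerSeries (Integers p L)) • x = 0 → f x = 0 →
      ∃ k : ℕ, (p : PowerSeries (Integers p L)) ^ k • x = 0)
    (h₂ : ∀ w, ∃ (k : ℕ) (x : M), (PowerSeries.X : PowerSeries (Integers p L)) • x = 0 ∧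
      (p : PowerSeries L) ^ k • w = f x) : invRank (Integers p L) L M = dimC L W := by
  let _ : Module (Integers p L) (Submodule.torsionBy (PowerSeries (Integers p L)) M PowerSeries.X) :=
    Module.compHom _ (PowerSeries.C (R := Integers p L))
  let _ : Module L W := Module.compHom W (PowerSeries.C (R := L))
  let f' : Submodule.torsionBy (PowerSeries (Integers p L)) M PowerSeries.X
      →ₛₗ[algebraMap (Integers p L) L] W :=
    { toFun := fun x => f x.1
      map_add' := fun x y => map_add f x.1 y.1
      map_smul' := fun c x => (map_smulₛₗ f (PowerSeries.C c) x.1).trans (by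
        rw [PowerSeries.map_C]
        rfl) }
  refine finrank_tensor_eq (L := L) (p : Integers p L) ?_ ?_ f' ?_ ?_
  · rw [map_natCast]
    exact p_ne_zero
  · intro l
    rw [map_natCast]
    exact exists_pow_mul_integer l
  · intro x hx
    obtain ⟨k, hk⟩ := h₁ x.1 ((Submodule.mem_torsionBy_iff _ _).1 x.2) hx
    refine ⟨k, Subtype.ext ?_⟩
    refine Eq.trans ?_ hk
    change PowerSeries.C ((p : Integers p L) ^ k) • x.1 = _
    rw [map_pow, map_natCast]
  · intro w
    obtain ⟨k, x, hx, hw⟩ := h₂ w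
    refine ⟨k, ⟨x, (Submodule.mem_torsionBy_iff _ _).2 hx⟩, ?_⟩
    refine Eq.trans ?_ hw
    rw [map_natCast]
    change PowerSeries.C ((p : L) ^ k) • w = _
    rw [map_pow, map_natCast]

/-- If `T` is null-homotopic over `L[[T]]`, then the rank of the `Γ`-invariants of the cohomology over
`O[[T]]` is the dimension of the cohomology over `L[[T]]`. -/
theorem invRank_hgy_eq {f₀ : M₀ →ₗ[Iwasawa p G] M₁} {f₁ : M₁ →ₗ[Iwasawa p G] M₂}
    {f₂ : M₂ →ₗ[Iwasawa p G] M₃} (h10 : f₁ ∘ₗ f₀ = 0) (h21 : f₂ ∘ₗ f₁ = 0)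
    (g₀ : BTensor ⊤ (actP ρ θ) M₁ →ₗ[PowerSeries L] BTensor ⊤ (actP ρ θ) M₀)
    (g₁ : BTensor ⊤ (actP ρ θ) M₂ →ₗ[PowerSeries L] BTensor ⊤ (actP ρ θ) M₁)
    (g₂ : BTensor ⊤ (actP ρ θ) M₃ →ₗ[PowerSeries L] BTensor ⊤ (actP ρ θ) M₂)
    (h₁ : ∀ x, BTensor.map ⊤ (actP ρ θ) f₀ (g₀ x) + g₁ (BTensor.map ⊤ (actP ρ θ) f₁ x) =
      (PowerSeries.X : PowerSeries L) • x)
    (h₂ : ∀ x, BTensor.map ⊤ (actP ρ θ) f₁ (g₁ x) + g₂ (BTensor.map ⊤ (actP ρ θ) f₂ x) =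
      (PowerSeries.X : PowerSeries L) • x) :
    invRank (Integers p L) L (Hgy (BTensor.map ⊤ (actI ρ θ) f₁) (BTensor.map ⊤ (actI ρ θ) f₂)) =
      dimC L (Hgy (BTensor.map ⊤ (actP ρ θ) f₁) (BTensor.map ⊤ (actP ρ θ) f₂)) := by
  obtain ⟨k₀, hk₀⟩ := exists_pow_smul_X_smul ρ θ h10 g₀ g₁ g₂ h₁ h₂
  have hddI : ∀ x, BTensor.map ⊤ (actI ρ θ) f₂ (BTensor.map ⊤ (actI ρ θ) f₁ x) = 0 :=
    fun x => map_map_of_comp _ h21 x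
  have hddP : ∀ x, BTensor.map ⊤ (actP ρ θ) f₂ (BTensor.map ⊤ (actP ρ θ) f₁ x) = 0 :=
    fun x => map_map_of_comp _ h21 x
  refine invRank_eq_dimC (Hgy.smap (toP ρ θ M₂) (fun x hx => by rw [map_toP, hx, map_zero])
    fun x => ⟨toP ρ θ M₁ x, (map_toP ρ θ f₁ x).symm⟩) ?_ ?_
  · intro c hc hc'
    obtain ⟨y, hy, rfl⟩ := Hgy.exists_rep c
    obtain ⟨x, hx⟩ := Hgy.mk_eq_zero.1 ((Hgy.smul_mk _ _ _).symm.trans hc)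
    obtain ⟨w, hw⟩ := Hgy.mk_eq_zero.1 hc'
    have hw : BTensor.map ⊤ (actP ρ θ) f₁ w = toP ρ θ M₂ y := hw
    obtain ⟨k, w₀, w', hw'⟩ := exists_toP_add ρ θ 1 w
    have e1 : toP ρ θ M₂ ((p : PowerSeries (Integers p L)) ^ k • y -
        BTensor.map ⊤ (actI ρ θ) f₁ w₀) =
        (PowerSeries.X : PowerSeries L) ^ 1 • BTensor.map ⊤ (actP ρ θ) f₁ w' := by
      rw [map_sub, toP_p_smul, ← map_toP, ← hw, ← map_smul, ← map_smul, ← map_sub, hw',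
        add_sub_cancel_left]
    obtain ⟨v, hv, -⟩ := exists_of_toP_eq ρ θ e1
    have hdv : BTensor.map ⊤ (actI ρ θ) f₂ v = 0 := by
      refine X_pow_smul_cancel' ρ θ (k := 1) ?_
      rw [← map_smul, ← hv, map_sub, map_smul, hy, hddI, smul_zero, smul_zero, sub_zero]
    have hv2 : BTensor.map ⊤ (actI ρ θ) f₁ ((p : PowerSeries (Integers p L)) ^ k • x -
        (PowerSeries.X : PowerSeries (Integers p L)) • w₀) =
        (PowerSeries.X : PowerSeries (Integers p L)) ^ 2 • v := by
      rw [map_sub, map_smul, map_smul, hx, pow_succ', mul_smul, ← hv, smul_sub, smul_smul, smul_smul,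
        mul_comm]
    obtain ⟨u, hu⟩ := hk₀ v _ hdv hv2
    refine ⟨k₀ + k, (Hgy.smul_mk _ _ _).trans (Hgy.mk_eq_zero.2 ⟨u +
      (p : PowerSeries (Integers p L)) ^ k₀ • w₀, ?_⟩)⟩
    rw [pow_one] at hv
    rw [map_add, hu, ← hv, map_smul, smul_sub, sub_add_cancel, pow_add, mul_smul]
  · intro c
    obtain ⟨z, hz, rfl⟩ := Hgy.exists_rep c
    have hTz := h₂ z
    rw [hz, map_zero, add_zero] at hTz
    obtain ⟨k, u₀, u', hu⟩ := exists_toP_add ρ θ 1 (g₁ z)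
    have e1 : toP ρ θ M₂ (BTensor.map ⊤ (actI ρ θ) f₁ u₀) = (PowerSeries.X : PowerSeries L) ^ 1 •
        ((p : PowerSeries L) ^ k • z - BTensor.map ⊤ (actP ρ θ) f₁ u') := by
      rw [← map_toP, ← sub_eq_iff_eq_add.2 hu, map_sub, map_smul, hTz, map_smul, pow_one, smul_sub,
        smul_smul, smul_smul, mul_comm]
    obtain ⟨y, hy, hy'⟩ := exists_of_toP_eq ρ θ e1
    have hdy : BTensor.map ⊤ (actI ρ θ) f₂ y = 0 := by
      apply toP_injective ρ θ
      rw [← map_toP, hy', map_sub, map_smul, hz, hddP, smul_zero, sub_zero, map_zero]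
    refine ⟨k, Hgy.mk _ _ y hdy, (Hgy.smul_mk _ _ _).trans (Hgy.mk_eq_zero.2 ⟨u₀, ?_⟩),
      (Hgy.smul_mk _ _ _).trans (Eq.trans (Hgy.mk_eq_mk.2 ⟨u', ?_⟩) (Hgy.smap_mk _ _ _ _ _).symm)⟩
    · rw [hy, pow_one]
    · rw [hy', sub_sub_cancel]

section Fold

variable {f : M₀ →ₗ[Iwasawa p G] M₁} {g : M₁ →ₗ[Iwasawa p G] M₀} (hfg : f ∘ₗ g = 0)
  (hgf : g ∘ₗ f = 0)
  (hM : BTensor ⊤ (actP ρ θ) M₀ →ₗ[PowerSeries L] BTensor ⊤ (actP ρ θ) M₁)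
  (hN : BTensor ⊤ (actP ρ θ) M₁ →ₗ[PowerSeries L] BTensor ⊤ (actP ρ θ) M₀)
  (h₂ : ∀ x, BTensor.map ⊤ (actP ρ θ) f (hN x) +
    hM (BTensor.map ⊤ (actP ρ θ) g x) = (PowerSeries.X : PowerSeries L) • x)

variable (f g) in
/-- Reduction modulo `T` on cohomology. -/
def redH : Hgy (BTensor.map ⊤ (actP ρ θ) f) (BTensor.map ⊤ (actP ρ θ) g)
    →ₛₗ[PowerSeries.constantCoeff (R := L)]
    Hgy (BTensor.map ⊤ (actMatrix (repL ρ θ)) f) (BTensor.map ⊤ (actMatrix (repL ρ θ)) g) :=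
  Hgy.smap (redT ρ θ M₁) (fun x hx => by rw [map_redT, hx, map_zero])
    fun x => ⟨redT ρ θ M₀ x, (map_redT ρ θ f x).symm⟩

include hgf h₂ in
theorem redH_injective : Function.Injective (redH ρ θ f g) := by
  rw [injective_iff_map_eq_zero]
  intro c hc
  obtain ⟨y, hy, rfl⟩ := Hgy.exists_rep c
  obtain ⟨u, hu⟩ := Hgy.mk_eq_zero.1 hc
  have hu : BTensor.map ⊤ (actMatrix (repL ρ θ)) f u = redT ρ θ M₁ y := hu
  obtain ⟨w, rfl⟩ := exists_redT ρ θ u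
  rw [map_redT, eq_comm, ← sub_eq_zero, ← map_sub] at hu
  obtain ⟨v, hv⟩ := exists_of_redT_eq_zero ρ θ hu
  have hgv : BTensor.map ⊤ (actP ρ θ) g v = 0 := by
    refine X_smul_cancel ρ θ ?_
    rw [← map_smul, ← hv, map_sub, hy, map_map_of_comp _ hgf, sub_zero]
  have h := h₂ v
  rw [hgv, map_zero, add_zero] at h
  exact Hgy.mk_eq_zero.2 ⟨hN v + w, by rw [map_add, h, ← hv, sub_add_cancel]⟩

include h₂ in
theorem mem_range_bockstein_iff
    (c : Hgy (BTensor.map ⊤ (actMatrix (repL ρ θ)) f) (BTensor.map ⊤ (actMatrix (repL ρ θ)) g)) :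
    c ∈ LinearMap.range (bockstein θ (actMatrix (repL ρ θ)) g f g hfg hgf) ↔
      ∃ d, redH ρ θ f g d = c := by
  constructor
  · rintro ⟨z, rfl⟩
    obtain ⟨z, hz, rfl⟩ := Hgy.exists_rep z
    obtain ⟨x, rfl⟩ := exists_redT ρ θ z
    have hz' := hz
    rw [map_redT] at hz'
    obtain ⟨y, hy⟩ := exists_of_redT_eq_zero ρ θ hz'
    have hgy : BTensor.map ⊤ (actP ρ θ) g y = 0 := by
      refine X_smul_cancel ρ θ ?_
      rw [← map_smul, ← hy, map_map_of_comp _ hgf]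
    refine ⟨-Hgy.mk _ _ y hgy, ?_⟩
    have h := bock_of_map_eq ρ θ f g hfg hgf x y hy hz (by rw [map_redT, hgy, map_zero])
    rw [map_neg]
    exact neg_eq_iff_eq_neg.2 h
  · rintro ⟨d, rfl⟩
    obtain ⟨y, hy, rfl⟩ := Hgy.exists_rep d
    have h := h₂ y
    rw [hy, map_zero, add_zero] at h
    have hx : BTensor.map ⊤ (actMatrix (repL ρ θ)) f (redT ρ θ M₀ (hN y)) = 0 := by
      rw [map_redT, h, redT_X_smul]
    have hb := bock_of_map_eq ρ θ f g hfg hgf (hN y) y h hx (by rw [map_redT, hy, map_zero])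
    refine ⟨-Hgy.mk _ _ _ hx, ?_⟩
    rw [map_neg]
    exact hb.symm

include h₂ in
theorem dimC_hgy_eq : dimC L (Hgy (BTensor.map ⊤ (actP ρ θ) f) (BTensor.map ⊤ (actP ρ θ) g)) =
    Module.finrank L (LinearMap.range (bockstein θ (actMatrix (repL ρ θ)) g f g hfg hgf)) :=
  dimC_of_injective _ (redH_injective ρ θ hgf hM hN h₂) _
    (mem_range_bockstein_iff ρ θ hfg hgf hM hN h₂)

include hgf h₂ in
theorem finC_hgy : FinC L (Hgy (BTensor.map ⊤ (actP ρ θ) f) (BTensor.map ⊤ (actP ρ θ) g)) :=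
  finC_of_injective _ (redH_injective ρ θ hgf hM hN h₂)

end Fold

end Ranks

/-! ### Cohomology of the folded complex -/

section FoldedCohomology

variable {R : Type u} [Ring R] {L : Type v} [Field L] {Y : Type w} [AddCommGroup Y]
  [Module (PowerSeries L) Y] (act : Rᵐᵒᵖ →+* Module.End (PowerSeries L) Y)

/-- A direct sum of differentials. -/
def IsFoldedD (C : PerfCx R) {q q' : ℤ → Prop}
    (D : (DirectSum {i : ℤ // q i} fun i => C.cx.X i) →ₗ[R]
      DirectSum {i : ℤ // q' i} fun i => C.cx.X i) : Prop :=
  ∀ (i j : ℤ) (hi : q i) (hj : q' j), i + 1 = j →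
    D ∘ₗ DirectSum.lof R {i : ℤ // q i} (fun i => C.cx.X i) ⟨i, hi⟩ =
      DirectSum.lof R {i : ℤ // q' i} (fun i => C.cx.X i) ⟨j, hj⟩ ∘ₗ C.d i j

theorem isFoldedD_dEv (C : PerfCx R) : IsFoldedD C C.dEv := by
  rintro i _ hi hj rfl
  exact LinearMap.ext fun x => by simp [PerfCx.dEv]

theorem isFoldedD_dOd (C : PerfCx R) : IsFoldedD C C.dOd := by
  rintro i _ hi hj rfl
  exact LinearMap.ext fun x => by simp [PerfCx.dOd]

theorem IsFoldedD.component {C : PerfCx R} {q q' : ℤ → Prop}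
    {D : (DirectSum {i : ℤ // q i} fun i => C.cx.X i) →ₗ[R]
      DirectSum {i : ℤ // q' i} fun i => C.cx.X i} (hD : IsFoldedD C D)
    (hq : ∀ i, q i → q' (i + 1)) (i j : ℤ) (hi : q i) (hj : q' j) (hij : i + 1 = j) :
    DirectSum.component R {i : ℤ // q' i} (fun i => C.cx.X i) ⟨j, hj⟩ ∘ₗ D =
      C.d i j ∘ₗ DirectSum.component R {i : ℤ // q i} (fun i => C.cx.X i) ⟨i, hi⟩ := by
  subst hij
  refine DirectSum.linearMap_ext R fun ⟨k, hk⟩ => ?_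
  rw [LinearMap.comp_assoc, hD k (k + 1) hk (hq k hk) rfl]
  refine LinearMap.ext fun x => ?_
  simp only [LinearMap.comp_apply]
  by_cases h : k = i
  · subst h
    rw [DirectSum.component.lof_self, DirectSum.component.lof_self]
  · have h' : (⟨k, hk⟩ : {i : ℤ // q i}) ≠ ⟨i, hi⟩ := fun e => h (congrArg Subtype.val e)
    have h'' : (⟨k + 1, hq k hk⟩ : {i : ℤ // q' i}) ≠ ⟨i + 1, hj⟩ := fun e => h (by
      have := congrArg Subtype.val e
      simpa using this)
    simp [DirectSum.component.of, h', h'', h]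

variable (L) in
/-- The dimension of the cohomology in degree `i`. -/
def cohDim (C : PerfCx R) (i : ℤ) : ℕ :=
  dimC L (Hgy (BTensor.map ⊤ act (C.d (i - 1) i)) (BTensor.map ⊤ act (C.d i (i + 1))))

theorem dimC_folded (C : PerfCx R) {q q' : ℤ → Prop}
    {D : (DirectSum {i : ℤ // q i} fun i => C.cx.X i) →ₗ[R]
      DirectSum {i : ℤ // q' i} fun i => C.cx.X i}
    {D' : (DirectSum {i : ℤ // q' i} fun i => C.cx.X i) →ₗ[R]
      DirectSum {i : ℤ // q i} fun i => C.cx.X i} (hD : IsFoldedD C D) (hD' : IsFoldedD C D')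
    (hq : ∀ i, q i → q' (i + 1)) (hq' : ∀ i, q' i → q (i + 1)) (hq'' : ∀ i, q i → q' (i - 1))
    (hV : FinC L (Hgy (BTensor.map ⊤ act D') (BTensor.map ⊤ act D)))
    (s : Finset {i : ℤ // q i}) (hs : ∀ i, i ∉ s → Subsingleton (C.cx.X i)) :
    dimC L (Hgy (BTensor.map ⊤ act D') (BTensor.map ⊤ act D)) =
      ∑ i ∈ s, cohDim L act C i := by
  have e1 : ∀ i : {i : ℤ // q i}, ∀ x, BTensor.map ⊤ act D (BTensor.map ⊤ act
      (DirectSum.lof R {i : ℤ // q i} (fun i => C.cx.X i) i) x) =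
      BTensor.map ⊤ act (DirectSum.lof R {i : ℤ // q' i} (fun i => C.cx.X i) ⟨i + 1, hq i i.2⟩)
        (BTensor.map ⊤ act (C.d i (i + 1)) x) := fun i x => by
    rw [BTensor.map_map, BTensor.map_map, hD i.1 (i.1 + 1) i.2 (hq i.1 i.2) rfl]
  have e2 : ∀ i : {i : ℤ // q i}, ∀ x, BTensor.map ⊤ act
      (DirectSum.lof R {i : ℤ // q i} (fun i => C.cx.X i) i)
        (BTensor.map ⊤ act (C.d (i - 1) i) x) = BTensor.map ⊤ act D' (BTensor.map ⊤ act
      (DirectSum.lof R {i : ℤ // q' i} (fun i => C.cx.X i) ⟨i - 1, hq'' i i.2⟩) x) := fun i x => by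
    rw [BTensor.map_map, BTensor.map_map, hD' (i.1 - 1) i.1 (hq'' i.1 i.2) i.2 (by ring)]
  have e3 : ∀ i : {i : ℤ // q i}, ∀ x, BTensor.map ⊤ act (C.d i (i + 1)) (BTensor.map ⊤ act
      (DirectSum.component R {i : ℤ // q i} (fun i => C.cx.X i) i) x) =
      BTensor.map ⊤ act (DirectSum.component R {i : ℤ // q' i} (fun i => C.cx.X i)
        ⟨i + 1, hq i i.2⟩) (BTensor.map ⊤ act D x) := fun i x => by
    rw [BTensor.map_map, BTensor.map_map, hD.component hq i.1 (i.1 + 1) i.2 (hq i.1 i.2) rfl]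
  have e4 : ∀ i : {i : ℤ // q i}, ∀ x, BTensor.map ⊤ act
      (DirectSum.component R {i : ℤ // q i} (fun i => C.cx.X i) i) (BTensor.map ⊤ act D' x) =
      BTensor.map ⊤ act (C.d (i - 1) i) (BTensor.map ⊤ act
      (DirectSum.component R {i : ℤ // q' i} (fun i => C.cx.X i) ⟨i - 1, hq'' i i.2⟩) x) :=
    fun i x => by
      rw [BTensor.map_map, BTensor.map_map,
        hD'.component hq' (i.1 - 1) i.1 (hq'' i.1 i.2) i.2 (by ring)]
  have hm : ∀ {M N P : Type u} [AddCommGroup M] [Module R M] [AddCommGroup N] [Module R N]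
      [AddCommGroup P] [Module R P] {f : M →ₗ[R] N} {g : N →ₗ[R] P},
      ∀ (x y : BTensor ⊤ act N) (hx hy), x = y →
      Hgy.mk (BTensor.map ⊤ act f) (BTensor.map ⊤ act g) x hx = Hgy.mk _ _ y hy := by
    rintro M N P _ _ _ _ _ _ f g x _ hx hy rfl
    rfl
  refine dimC_eq_sum s hV
    (W := fun i => Hgy (BTensor.map ⊤ act (C.d (i.1 - 1) i.1)) (BTensor.map ⊤ act (C.d i.1 (i.1 + 1))))
    (fun i => Hgy.smap (BTensor.map ⊤ act (DirectSum.lof R {i : ℤ // q i} (fun i => C.cx.X i) i))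
      (fun x hx => by rw [e1, hx, map_zero]) fun x => ⟨_, e2 i x⟩)
    (fun i => Hgy.smap (BTensor.map ⊤ act (DirectSum.component R {i : ℤ // q i}
      (fun i => C.cx.X i) i)) (fun x hx => by rw [e3, hx, map_zero]) fun x => ⟨_, e4 i x⟩) ?_ ?_ ?_
  · intro i x
    obtain ⟨y, hy, rfl⟩ := Hgy.exists_rep x
    rw [Hgy.smap_mk, Hgy.smap_mk]
    refine hm _ _ _ _ ?_
    rw [BTensor.map_map]
    have : DirectSum.component R {i : ℤ // q i} (fun i => C.cx.X i) i ∘ₗ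
        DirectSum.lof R {i : ℤ // q i} (fun i => C.cx.X i) i = LinearMap.id :=
      LinearMap.ext fun m => by simp [DirectSum.component.lof_self]
    rw [this, BTensor.map_id, LinearMap.id_apply]
  · intro i j x hij
    obtain ⟨y, hy, rfl⟩ := Hgy.exists_rep x
    rw [Hgy.smap_mk, Hgy.smap_mk]
    refine Hgy.mk_eq_zero.2 ⟨0, ?_⟩
    rw [BTensor.map_map, map_zero]
    have : DirectSum.component R {i : ℤ // q i} (fun i => C.cx.X i) j ∘ₗ
        DirectSum.lof R {i : ℤ // q i} (fun i => C.cx.X i) i = 0 :=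
      LinearMap.ext fun m => by simp [DirectSum.component.of, hij]
    rw [this, BTensor.map_zero, LinearMap.zero_apply]
  · intro v
    obtain ⟨y, hy, rfl⟩ := Hgy.exists_rep v
    simp only [Hgy.smap_mk]
    have hk : ∀ i : {i : ℤ // q i}, BTensor.map ⊤ act D (BTensor.map ⊤ act
        (DirectSum.lof R {i : ℤ // q i} (fun i => C.cx.X i) i) (BTensor.map ⊤ act
          (DirectSum.component R {i : ℤ // q i} (fun i => C.cx.X i) i) y)) = 0 := fun i => by
      rw [e1, e3, hy, map_zero, map_zero]
    refine Eq.trans (b := Hgy.mk _ _ (∑ i ∈ s, BTensor.map ⊤ act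
        (DirectSum.lof R {i : ℤ // q i} (fun i => C.cx.X i) i) (BTensor.map ⊤ act
          (DirectSum.component R {i : ℤ // q i} (fun i => C.cx.X i) i) y))
        (by rw [map_sum]; exact Finset.sum_eq_zero fun i _ => hk i)) ?_
      (hm _ _ _ _ (BTensor.sum_component (act := act) _ s hs y))
    have : ∀ t : Finset {i : ℤ // q i}, ∑ i ∈ t, Hgy.mk (BTensor.map ⊤ act D') (BTensor.map ⊤ act D) _
        (hk i) = Hgy.mk _ _ (∑ i ∈ t, BTensor.map ⊤ act
        (DirectSum.lof R {i : ℤ // q i} (fun i => C.cx.X i) i) (BTensor.map ⊤ act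
          (DirectSum.component R {i : ℤ // q i} (fun i => C.cx.X i) i) y))
        (by rw [map_sum]; exact Finset.sum_eq_zero fun i _ => hk i) := by
      classical
      intro t
      induction t using Finset.induction_on with
      | empty => exact (Hgy.mk_eq_zero.2 ⟨0, by rw [map_zero, Finset.sum_empty]⟩).symm
      | insert i t hi ih =>
        rw [Finset.sum_insert hi, ih]
        refine Eq.trans (b := Hgy.mk _ _ (_ + _) (by rw [map_add, hk, map_sum, Finset.sum_eq_zero
          fun i _ => hk i, add_zero])) rfl (hm _ _ _ _ (Finset.sum_insert hi).symm)
    exact this s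

theorem cohDim_eq_zero (C : PerfCx R) (i : ℤ) [Subsingleton (C.cx.X i)] : cohDim L act C i = 0 := by
  have : Subsingleton (BTensor ⊤ act (C.cx.X i)) := BTensor.subsingleton
  have : Subsingleton (Hgy (BTensor.map ⊤ act (C.d (i - 1) i)) (BTensor.map ⊤ act (C.d i (i + 1)))) :=
    ⟨fun x y => by
      obtain ⟨a, ha, rfl⟩ := Hgy.exists_rep x
      obtain ⟨b, hb, rfl⟩ := Hgy.exists_rep y
      exact Hgy.mk_eq_mk.2 ⟨0, Subsingleton.elim _ _⟩⟩
  exact dimC_eq_zero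

end FoldedCohomology

section GammaRank

variable {p : ℕ} [Fact p.Prime] {L : Type v} [Field L] [Algebra ℚ_[p] L] [FiniteDimensional ℚ_[p] L]
  [Algebra ℤ_[p] L] [IsScalarTower ℤ_[p] ℚ_[p] L]
  {G : Type u} [Group G] [TopologicalSpace G] [IsTopologicalGroup G] [CompactSpace G]
  {n : ℕ} (ρ : G →ₜ* GL (Fin n) (Integers p L)) (θ : G →ₜ* Multiplicative ℤ_[p])

theorem invRank_cohomology_eq {C : PerfCx (Iwasawa p G)}
    (hC : NullHtpy (actP ρ θ) (PowerSeries.X : PowerSeries L) C) (i : ℤ) :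
    invRank (Integers p L) L (Hgy (BTensor.map ⊤ (actΓ ρ θ) (C.d (i - 1) i))
      (BTensor.map ⊤ (actΓ ρ θ) (C.d i (i + 1)))) = cohDim L (actP ρ θ) C i := by
  obtain ⟨h, hh⟩ := hC
  exact invRank_hgy_eq ρ θ (C.d_comp_d (i - 2) (i - 1) i) (C.d_comp_d (i - 1) i (i + 1))
    (h (i - 1) (i - 2)) (h i (i - 1)) (h (i + 1) i)
    (hh (i - 2) (i - 1) i (by ring) (by ring)) (hh (i - 1) i (i + 1) (by ring) (by ring))

/-- If `T` is null-homotopic over `L[[T]]`, the alternating sum of the ranks of the `Γ`-invariants of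
the cohomology is the difference of the ranks of the Bockstein maps. -/
theorem rankΓ_eq {C : PerfCx (Iwasawa p G)}
    (hC : NullHtpy (actP ρ θ) (PowerSeries.X : PowerSeries L) C) :
    rankΓ ρ θ C = (bockRankEv ρ θ C : ℤ) - bockRankOd ρ θ C := by
  classical
  obtain ⟨hEv, hOd, h1, h2⟩ := hC.exists_fold
  obtain ⟨a, b, hab⟩ := C.bounded
  have hs (q : ℤ → Prop) [DecidablePred q] : ∀ i : {i : ℤ // q i}, i ∉ (Finset.Icc a b).subtype q →
      Subsingleton (C.cx.X i) := fun i hi => hab i (by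
    simp only [Finset.mem_subtype, Finset.mem_Icc, not_and, not_le] at hi
    by_contra hc
    push Not at hc
    exact absurd (hi hc.1) (not_lt.2 hc.2))
  have hE : bockRankEv ρ θ C = ∑ i ∈ (Finset.Icc a b).subtype Odd, cohDim L (actP ρ θ) C i :=
    (dimC_hgy_eq ρ θ C.dEv_comp_dOd C.dOd_comp_dEv hEv hOd h2).symm.trans
      (dimC_folded (actP ρ θ) C (isFoldedD_dOd C) (isFoldedD_dEv C) (fun i hi => hi.add_one)
        (fun i hi => hi.add_one) (fun i hi => hi.sub_odd odd_one)
        (finC_hgy ρ θ C.dOd_comp_dEv hEv hOd h2) _ (hs Odd))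
  have hO : bockRankOd ρ θ C = ∑ i ∈ (Finset.Icc a b).subtype Even, cohDim L (actP ρ θ) C i :=
    (dimC_hgy_eq ρ θ C.dOd_comp_dEv C.dEv_comp_dOd hOd hEv h1).symm.trans
      (dimC_folded (actP ρ θ) C (isFoldedD_dEv C) (isFoldedD_dOd C) (fun i hi => hi.add_one)
        (fun i hi => hi.add_one) (fun i hi => hi.sub_odd odd_one)
        (finC_hgy ρ θ C.dEv_comp_dOd hOd hEv h1) _ (hs Even))
  have hΓ : rankΓ ρ θ C = ∑ i ∈ Finset.Icc a b,
      (Int.negOnePow (i + 1) : ℤ) * (cohDim L (actP ρ θ) C i : ℤ) := by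
    unfold rankΓ
    simp only [invRank_cohomology_eq ρ θ hC]
    refine finsum_eq_sum_of_support_subset _ fun i hi => ?_
    by_contra hi'
    have : Subsingleton (C.cx.X i) := hab i (by
      simp only [Finset.coe_Icc, Set.mem_Icc, not_and, not_le] at hi'
      by_contra hc
      push Not at hc
      exact absurd (hi' hc.1) (not_lt.2 hc.2))
    exact hi (by simp only [cohDim_eq_zero, Nat.cast_zero, mul_zero])
  rw [hΓ, hE, hO, Finset.sum_subtype_eq_sum_filter (f := fun i => cohDim L (actP ρ θ) C i),
    Finset.sum_subtype_eq_sum_filter (f := fun i => cohDim L (actP ρ θ) C i),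
    ← Finset.sum_filter_add_sum_filter_not _ Odd]
  simp only [Int.not_odd_iff_even]
  push_cast
  rw [sub_eq_add_neg, ← Finset.sum_neg_distrib]
  congr 1
  · refine Finset.sum_congr rfl fun i hi => ?_
    rw [Int.negOnePow_even _ (Finset.mem_filter.1 hi).2.add_one]
    simp
  · refine Finset.sum_congr rfl fun i hi => ?_
    rw [Int.negOnePow_odd _ (Finset.mem_filter.1 hi).2.add_one]
    simp

end GammaRank

/-! ### Extending linear forms over `ℤ_p` -/

section Extension

variable {p : ℕ} [Fact p.Prime]

theorem padicInt_p_ne_zero : (p : ℤ_[p]) ≠ 0 := Nat.cast_ne_zero.2 (Fact.out : p.Prime).ne_zero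

theorem padicInt_eq_zero_of_dvd {c : ℤ_[p]} (h : ∀ m : ℕ, (p : ℤ_[p]) ^ m ∣ c) : c = 0 := by
  by_contra hc
  have h1 := (PadicInt.norm_le_pow_iff_le_valuation c hc (c.valuation + 1)).1
    ((PadicInt.norm_le_pow_iff_mem_span_pow c _).2 (Ideal.mem_span_singleton.2 (h _)))
  omega

theorem isClosed_padicInt_dvd (m : ℕ) : IsClosed {c : ℤ_[p] | (p : ℤ_[p]) ^ m ∣ c} := by
  have : {c : ℤ_[p] | (p : ℤ_[p]) ^ m ∣ c} = {c | ‖c‖ ≤ (p : ℝ) ^ (-m : ℤ)} := by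
    ext c
    rw [Set.mem_ofPred_eq, Set.mem_ofPred_eq, PadicInt.norm_le_pow_iff_mem_span_pow,
      Ideal.mem_span_singleton]
  rw [this]
  exact isClosed_le continuous_norm continuous_const

theorem isOpen_padicInt_dvd (m : ℕ) : IsOpen {c : ℤ_[p] | (p : ℤ_[p]) ^ m ∣ c} := by
  have : {c : ℤ_[p] | (p : ℤ_[p]) ^ m ∣ c} = Metric.closedBall 0 ((p : ℝ) ^ (-m : ℤ)) := by
    ext c
    rw [Set.mem_ofPred_eq, mem_closedBall_zero_iff, PadicInt.norm_le_pow_iff_mem_span_pow,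
      Ideal.mem_span_singleton]
  rw [this]
  exact IsUltrametricDist.isOpen_closedBall _
    (zpow_pos (Nat.cast_pos.2 (Fact.out : p.Prime).pos) _).ne'

variable (p) in
/-- The divisible module `ℚ_p / ℤ_p`. -/
abbrev PruferMod : Type := ℚ_[p] ⧸ LinearMap.range (Algebra.linearMap ℤ_[p] ℚ_[p])

theorem baer_pruferMod : Module.Baer ℤ_[p] (PruferMod p) := by
  intro I g
  obtain ⟨a, rfl⟩ := IsPrincipalIdealRing.principal I |>.principal
  rcases eq_or_ne a 0 with rfl | ha
  · refine ⟨0, fun x hx => ?_⟩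
    obtain rfl : x = 0 := by simpa using hx
    rw [map_zero]
    exact (map_zero g).symm
  · have hmem : a ∈ Submodule.span ℤ_[p] {a} := Submodule.mem_span_singleton_self a
    obtain ⟨q, hq⟩ := Submodule.mkQ_surjective _ (g ⟨a, hmem⟩)
    have ha' : algebraMap ℤ_[p] ℚ_[p] a ≠ 0 := by
      simpa using ha
    refine ⟨LinearMap.toSpanSingleton ℤ_[p] _ (Submodule.mkQ _ ((algebraMap ℤ_[p] ℚ_[p] a)⁻¹ * q)),
      fun x hx => ?_⟩
    obtain ⟨b, rfl⟩ := Submodule.mem_span_singleton.1 hx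
    have : (⟨b • a, hx⟩ : Submodule.span ℤ_[p] {a}) = b • ⟨a, hmem⟩ := rfl
    rw [this, map_smul g, ← hq, LinearMap.toSpanSingleton_apply, smul_eq_mul, mul_smul, ← map_smul,
      Algebra.smul_def, mul_inv_cancel_left₀ ha']

theorem exists_approx_extension {V W : Type*} [AddCommGroup V] [Module ℤ_[p] V] [AddCommGroup W]
    [Module ℤ_[p] W] (t : V →ₗ[ℤ_[p]] W) (x : V →ₗ[ℤ_[p]] ℤ_[p]) (m : ℕ)
    (h : ∀ v w, t v = (p : ℤ_[p]) ^ m • w → (p : ℤ_[p]) ^ m ∣ x v) :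
    ∃ z : W → ℤ_[p], (∀ w w', (p : ℤ_[p]) ^ m ∣ z (w + w') - (z w + z w')) ∧
      (∀ (c : ℤ_[p]) w, (p : ℤ_[p]) ^ m ∣ z (c • w) - c * z w) ∧
      ∀ v, (p : ℤ_[p]) ^ m ∣ z (t v) - x v := by
  have hp : (p : ℚ_[p]) ≠ 0 := Nat.cast_ne_zero.2 (Fact.out : p.Prime).ne_zero
  have hpm : (p : ℚ_[p]) ^ m ≠ 0 := pow_ne_zero _ hp
  let P : Submodule ℤ_[p] W := LinearMap.range (LinearMap.lsmul ℤ_[p] W ((p : ℤ_[p]) ^ m))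
  let t' : V →ₗ[ℤ_[p]] W ⧸ P := P.mkQ ∘ₗ t
  let ε : ℤ_[p] →ₗ[ℤ_[p]] PruferMod p :=
    Submodule.mkQ _ ∘ₗ LinearMap.toSpanSingleton ℤ_[p] ℚ_[p] (((p : ℚ_[p]) ^ m)⁻¹)
  have hε : ∀ c, ε c = 0 ↔ (p : ℤ_[p]) ^ m ∣ c := fun c => by
    change Submodule.mkQ _ (c • ((p : ℚ_[p]) ^ m)⁻¹) = 0 ↔ _
    rw [← LinearMap.mem_ker, Submodule.ker_mkQ, LinearMap.mem_range]
    constructor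
    · rintro ⟨d, hd⟩
      refine ⟨d, ?_⟩
      rw [Algebra.linearMap_apply, Algebra.smul_def, eq_mul_inv_iff_mul_eq₀ hpm] at hd
      apply PadicInt.ext
      rw [PadicInt.coe_mul, PadicInt.coe_pow, PadicInt.coe_natCast, mul_comm]
      exact hd.symm
    · rintro ⟨d, rfl⟩
      refine ⟨d, ?_⟩
      rw [Algebra.linearMap_apply, Algebra.smul_def, map_mul, map_pow, map_natCast, mul_comm,
        inv_mul_cancel_left₀ hpm]
  have hker : LinearMap.ker t' ≤ LinearMap.ker (ε ∘ₗ x) := fun v hv => by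
    obtain ⟨w, hw⟩ : t v ∈ P := (Submodule.Quotient.mk_eq_zero P).1 hv
    exact (hε _).2 (h v w hw.symm)
  obtain ⟨u, hu⟩ := Module.Baer.extension_property baer_pruferMod
    ((LinearMap.ker t').liftQ t' le_rfl)
    (LinearMap.ker_eq_bot.1 (Submodule.ker_liftQ_eq_bot' _ _ rfl))
    ((LinearMap.ker t').liftQ (ε ∘ₗ x) hker)
  have hz : ∀ w, ∃ c, ε c = u (P.mkQ w) := fun w => by
    obtain ⟨q, hq⟩ := Submodule.mkQ_surjective _ (u (P.mkQ w))
    have h1 : Submodule.mkQ (LinearMap.range (Algebra.linearMap ℤ_[p] ℚ_[p]))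
        ((p : ℤ_[p]) ^ m • q) = 0 := by
      rw [map_smul, hq, ← map_smul, ← map_smul]
      have : P.mkQ ((p : ℤ_[p]) ^ m • w) = 0 := (Submodule.Quotient.mk_eq_zero P).2 ⟨w, rfl⟩
      rw [this, map_zero]
    obtain ⟨c, hc⟩ := (Submodule.Quotient.mk_eq_zero _).1 h1
    refine ⟨c, hq ▸ congrArg (Submodule.mkQ _) ?_⟩
    rw [LinearMap.toSpanSingleton_apply, Algebra.smul_def]
    rw [Algebra.linearMap_apply] at hc
    rw [hc, Algebra.smul_def, map_pow, map_natCast, mul_comm, inv_mul_cancel_left₀ hpm]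
  choose z hz using hz
  refine ⟨z, fun w w' => (hε _).1 ?_, fun c w => (hε _).1 ?_, fun v => (hε _).1 ?_⟩
  · rw [map_sub, map_add, hz, hz, hz, map_add, map_add, sub_self]
  · rw [map_sub, ← smul_eq_mul, map_smul, hz, hz, map_smul, map_smul, sub_self]
  · rw [map_sub, hz, sub_eq_zero]
    exact LinearMap.congr_fun hu (Submodule.Quotient.mk v)

/-- A linear form on `V` extends along `t : V → W` if it is divisible by `p ^ m` wherever `t` is. -/
theorem exists_extension {V W : Type*} [AddCommGroup V] [Module ℤ_[p] V] [AddCommGroup W]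
    [Module ℤ_[p] W] (t : V →ₗ[ℤ_[p]] W) (x : V →ₗ[ℤ_[p]] ℤ_[p])
    (h : ∀ (m : ℕ) v w, t v = (p : ℤ_[p]) ^ m • w → (p : ℤ_[p]) ^ m ∣ x v) :
    ∃ z : W →ₗ[ℤ_[p]] ℤ_[p], ∀ v, z (t v) = x v := by
  let A : ℕ → Set (W → ℤ_[p]) := fun m =>
    {z | (∀ w w', (p : ℤ_[p]) ^ m ∣ z (w + w') - (z w + z w')) ∧
      (∀ (c : ℤ_[p]) w, (p : ℤ_[p]) ^ m ∣ z (c • w) - c * z w) ∧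
      ∀ v, (p : ℤ_[p]) ^ m ∣ z (t v) - x v}
  have hcl : ∀ m, IsClosed (A m) := fun m => by
    have : A m = (⋂ w, ⋂ w', {z | (p : ℤ_[p]) ^ m ∣ z (w + w') - (z w + z w')}) ∩
        ((⋂ (c : ℤ_[p]), ⋂ w, {z | (p : ℤ_[p]) ^ m ∣ z (c • w) - c * z w}) ∩
          ⋂ v, {z | (p : ℤ_[p]) ^ m ∣ z (t v) - x v}) := by
      ext z
      simp [A]
    rw [this]
    exact (isClosed_iInter fun w => isClosed_iInter fun w' =>
        (isClosed_padicInt_dvd m).preimage (by fun_prop)).inter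
      ((isClosed_iInter fun c => isClosed_iInter fun w =>
        (isClosed_padicInt_dvd m).preimage (by fun_prop)).inter
      (isClosed_iInter fun v => (isClosed_padicInt_dvd m).preimage (by fun_prop)))
  obtain ⟨z, hz⟩ := IsCompact.nonempty_iInter_of_sequence_nonempty_isCompact_isClosed A
    (fun m z hz => ⟨fun w w' => (pow_dvd_pow _ m.le_succ).trans (hz.1 w w'),
      fun c w => (pow_dvd_pow _ m.le_succ).trans (hz.2.1 c w),
      fun v => (pow_dvd_pow _ m.le_succ).trans (hz.2.2 v)⟩)
    (fun m => exists_approx_extension t x m (h m)) (hcl 0).isCompact hcl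
  rw [Set.mem_iInter] at hz
  exact ⟨{ toFun := z
           map_add' := fun w w' => sub_eq_zero.1 (padicInt_eq_zero_of_dvd fun m => (hz m).1 w w')
           map_smul' := fun c w => sub_eq_zero.1 (padicInt_eq_zero_of_dvd fun m => (hz m).2.1 c w) },
    fun v => sub_eq_zero.1 (padicInt_eq_zero_of_dvd fun m => (hz m).2.2 v)⟩

variable {G : Type*} [TopologicalSpace G] [CompactSpace G]

theorem ContinuousMap.exists_eq_pow_smul {f : C(G, ℤ_[p])} {m : ℕ}
    (hf : ∀ g, (p : ℤ_[p]) ^ m ∣ f g) : ∃ f' : C(G, ℤ_[p]), f = (p : ℤ_[p]) ^ m • f' := by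
  have hpm : (p : ℤ_[p]) ^ m ≠ 0 := pow_ne_zero _ padicInt_p_ne_zero
  choose f' hf' using hf
  refine ⟨⟨f', ?_⟩, ContinuousMap.ext hf'⟩
  have hpm' : ‖(p : ℤ_[p]) ^ m‖ ≠ 0 := norm_ne_zero_iff.2 hpm
  have hd : ∀ a b : ℤ_[p], dist a b =
      ‖(p : ℤ_[p]) ^ m‖⁻¹ * dist ((p : ℤ_[p]) ^ m * a) ((p : ℤ_[p]) ^ m * b) := fun a b => by
    rw [dist_eq_norm, dist_eq_norm, ← mul_sub, norm_mul, inv_mul_cancel_left₀ hpm']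
  rw [continuous_iff_continuousAt]
  intro g
  rw [ContinuousAt, tendsto_iff_dist_tendsto_zero]
  simp only [hd (f' _) (f' g), ← hf']
  have := (tendsto_iff_dist_tendsto_zero.1 (f.continuous.tendsto g)).const_mul ‖(p : ℤ_[p]) ^ m‖⁻¹
  rwa [mul_zero] at this

theorem continuous_of_linear (z : C(G, ℤ_[p]) →ₗ[ℤ_[p]] ℤ_[p]) : Continuous z := by
  refine AddMonoidHomClass.continuous_of_bound z 1 fun f => ?_
  rw [one_mul]
  by_contra hlt
  push Not at hlt
  have hz : z f ≠ 0 := norm_ne_zero_iff.1 ((norm_nonneg f).trans_lt hlt).ne'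
  have h1 : ∀ g, (p : ℤ_[p]) ^ ((z f).valuation + 1) ∣ f g := fun g => by
    have h2 : ‖f g‖ < ‖z f‖ := (f.norm_coe_le_norm g).trans_lt hlt
    rw [← Ideal.mem_span_singleton, ← PadicInt.norm_le_pow_iff_mem_span_pow,
      PadicInt.norm_le_pow_iff_norm_lt_pow_add_one]
    rw [PadicInt.norm_eq_zpow_neg_valuation hz] at h2
    convert h2 using 2
    push_cast
    ring
  obtain ⟨f', hf'⟩ := ContinuousMap.exists_eq_pow_smul h1
  have h3 : (p : ℤ_[p]) ^ ((z f).valuation + 1) ∣ z f := ⟨z f', by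
    conv_lhs => rw [hf', map_smul, smul_eq_mul]⟩
  have h4 := (PadicInt.norm_le_pow_iff_le_valuation _ hz ((z f).valuation + 1)).1
    ((PadicInt.norm_le_pow_iff_mem_span_pow _ _).2 (Ideal.mem_span_singleton.2 h3))
  omega

end Extension

/-! ### Measures and matrix coefficients -/

section MatrixCoefficients

variable {p : ℕ} [Fact p.Prime] {G : Type u} [Group G] [TopologicalSpace G] [IsTopologicalGroup G]
  [CompactSpace G] {O : Type v} [CommRing O] [Algebra ℤ_[p] O] [Module.Finite ℤ_[p] O]
  [Module.Free ℤ_[p] O] [TopologicalSpace O] [IsModuleTopology ℤ_[p] O] {n N : ℕ}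
  (ρ : G →ₜ* GL (Fin n) O) (θ : G →ₜ* Multiplicative ℤ_[p])
  (β : Module.Basis (Fin N) ℤ_[p] (Fin n → O))

/-- The coefficients of the action `y ↦ y ρ(g)` on `O^n` in a `ℤ_p`-basis. -/
def coeffFun (a b : Fin N) : C(G, ℤ_[p]) where
  toFun g := β.coord b (Matrix.vecMul (β a) (ρ g : Matrix (Fin n) (Fin n) O))
  continuous_toFun := by
    let ℓ : (Fin n → Fin n → O) →ₗ[ℤ_[p]] ℤ_[p] :=
      β.coord b ∘ₗ
        { toFun := fun X => Matrix.vecMul (β a) (Matrix.of X)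
          map_add' := fun X Y => Matrix.vecMul_add _ _ _
          map_smul' := fun c X => Matrix.vecMul_smul (β a) c (Matrix.of X) }
    have hρ : Continuous fun g => (ρ g : Matrix (Fin n) (Fin n) O) :=
      Units.continuous_val.comp ρ.continuous_toFun
    exact Continuous.comp (g := ℓ) (IsModuleTopology.continuous_of_linearMap ℓ) hρ

/-- The matrix formed by the coefficients. -/
def coeffMat (g : G) : Matrix (Fin N) (Fin N) ℤ_[p] := Matrix.of fun a b => coeffFun ρ β a b g

theorem vecMul_rho (g : G) (a : Fin N) :
    Matrix.vecMul (β a) (ρ g : Matrix (Fin n) (Fin n) O) = ∑ b, coeffFun ρ β a b g • β b :=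
  (β.sum_repr _).symm

theorem coeffMat_mul (g h : G) : coeffMat ρ β (g * h) = coeffMat ρ β g * coeffMat ρ β h := by
  ext a b
  have h1 : Matrix.vecMul (β a) (ρ (g * h) : Matrix (Fin n) (Fin n) O) =
      ∑ c, coeffFun ρ β a c g • Matrix.vecMul (β c) (ρ h : Matrix (Fin n) (Fin n) O) := by
    rw [map_mul, Units.val_mul, ← Matrix.vecMul_vecMul, vecMul_rho, Matrix.sum_vecMul]
    simp only [Matrix.smul_vecMul]
  change β.coord b (Matrix.vecMul (β a) (ρ (g * h) : Matrix (Fin n) (Fin n) O)) = _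
  rw [h1, map_sum, Matrix.mul_apply]
  simp only [map_smul, smul_eq_mul]
  rfl

theorem coeffMat_one : coeffMat ρ β (1 : G) = 1 := by
  ext a b
  change β.coord b (Matrix.vecMul (β a) (ρ 1 : Matrix (Fin n) (Fin n) O)) = _
  rw [map_one, Units.val_one, Matrix.vecMul_one, Module.Basis.coord_apply, Module.Basis.repr_self,
    Matrix.one_apply, Finsupp.single_apply]

theorem coeffMat_inv_mul (g : G) : coeffMat ρ β g⁻¹ * coeffMat ρ β g = 1 := by
  rw [← coeffMat_mul, inv_mul_cancel, coeffMat_one]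

theorem coeffMat_mul_inv (g : G) : coeffMat ρ β g * coeffMat ρ β g⁻¹ = 1 := by
  rw [← coeffMat_mul, mul_inv_cancel, coeffMat_one]

/-- The function `g ↦ φ(θ(g))`. -/
def pullθ (φ : C(ℤ_[p], ℤ_[p])) : C(G, ℤ_[p]) := φ.comp (thetaFun θ)

theorem coeff_vecMul_repΓ (μ : Iwasawa p G) (a : Fin N) (j : Fin n) (k : ℕ) :
    PowerSeries.coeff k (Matrix.vecMul (fun i => PowerSeries.C (β a i)) (repΓ ρ θ μ) j) =
      ∑ b, μ (coeffFun ρ β a b * pullθ θ (mahler k)) • β b j := by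
  refine Iwasawa.dual_ext (p := p) fun ℓ => ?_
  simp only [Matrix.vecMul, dotProduct, map_sum, PowerSeries.coeff_C_mul, repΓ_apply,
    PowerSeries.coeff_mk, map_smul, smul_eq_mul]
  have key : ∀ i, ℓ (β a i * μ.integral (repCoeff ρ θ i j k)) =
      μ (Iwasawa.compDual (ℓ.comp (LinearMap.mulLeft ℤ_[p] (β a i))) (repCoeff ρ θ i j k)) :=
    fun i => by rw [← Iwasawa.apply_integral]; rfl
  have key' : ∀ b, μ (coeffFun ρ β a b * pullθ θ (mahler k)) * ℓ (β b j) =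
      μ (ℓ (β b j) • (coeffFun ρ β a b * pullθ θ (mahler k))) :=
    fun b => by rw [map_smul, smul_eq_mul, mul_comm]
  simp only [key, key', ← map_sum]
  congr 1
  ext g
  simp only [ContinuousMap.sum_apply, ContinuousMap.smul_apply, ContinuousMap.mul_apply, smul_eq_mul]
  have h1 : ∀ i, Iwasawa.compDual (ℓ.comp (LinearMap.mulLeft ℤ_[p] (β a i))) (repCoeff ρ θ i j k) g =
      Ring.choose (θ g).toAdd k * ℓ (β a i * (ρ g : Matrix (Fin n) (Fin n) O) i j) := fun i => by
    change ℓ (β a i * (Ring.choose (θ g).toAdd k • (ρ g : Matrix (Fin n) (Fin n) O) i j)) = _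
    rw [mul_smul_comm, map_smul, smul_eq_mul]
  have h2 : ∀ b, ℓ (β b j) * (coeffFun ρ β a b g * pullθ θ (mahler k) g) =
      Ring.choose (θ g).toAdd k * ℓ (coeffFun ρ β a b g • β b j) := fun b => by
    rw [map_smul, smul_eq_mul]
    change _ * (_ * Ring.choose (θ g).toAdd k) = _
    ring
  simp only [h1, h2, ← Finset.mul_sum, ← map_sum]
  congr 2
  have h3 := congrFun (vecMul_rho ρ β g a) j
  rw [Finset.sum_apply] at h3
  exact h3

variable {ρ θ β}

theorem apply_pullθ_eq_zero {m : Fin N → Iwasawa p G} {b : Fin N}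
    (hm : ∀ k, ∑ a, m a (coeffFun ρ β a b * pullθ θ (mahler k)) = 0) (φ : C(ℤ_[p], ℤ_[p])) :
    ∑ a, m a (coeffFun ρ β a b * pullθ θ φ) = 0 := by
  let E : C(ℤ_[p], ℤ_[p]) →+ ℤ_[p] :=
    { toFun := fun φ => ∑ a, m a (coeffFun ρ β a b * pullθ θ φ)
      map_zero' := Finset.sum_eq_zero fun a _ => by
        rw [show pullθ θ (0 : C(ℤ_[p], ℤ_[p])) = 0 from rfl, mul_zero, map_zero]
      map_add' := fun φ ψ => by
        rw [← Finset.sum_add_distrib]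
        refine Finset.sum_congr rfl fun a _ => ?_
        rw [← map_add, ← mul_add]
        rfl }
  have hE : Continuous E := by
    change Continuous fun φ : C(ℤ_[p], ℤ_[p]) =>
      ∑ a, m a (coeffFun ρ β a b * φ.comp (thetaFun θ))
    exact continuous_finsetSum _ fun a _ => (map_continuous (m a)).comp
      (continuous_const.mul (ContinuousMap.continuous_precomp (thetaFun θ)))
  have h := (PadicInt.hasSum_mahler φ).map E hE
  have h0 : ∀ c k, E (PadicInt.mahlerTerm (c : ℤ_[p]) k) = 0 := fun c k => by
    have h1 : ∀ a, coeffFun ρ β a b * pullθ θ (PadicInt.mahlerTerm (c : ℤ_[p]) k) =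
        c • (coeffFun ρ β a b * pullθ θ (mahler k)) := fun a => by
      ext g
      have : pullθ θ (PadicInt.mahlerTerm (c : ℤ_[p]) k) g = pullθ θ (mahler k) g * c := by
        refine (PadicInt.mahlerTerm_apply _ _ _).trans ?_
        rw [smul_eq_mul]
        rfl
      rw [ContinuousMap.mul_apply, this, ContinuousMap.smul_apply, ContinuousMap.mul_apply,
        smul_eq_mul]
      ring
    change ∑ a, m a _ = 0
    simp only [h1, map_smul, ← Finset.smul_sum, hm, smul_zero]
  have h2 : (⇑E ∘ fun k => PadicInt.mahlerTerm (Nat.iterate (fwdDiff 1) k (⇑φ) 0 : ℤ_[p]) k) = 0 :=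
    funext fun k => h0 _ _
  rw [h2] at h
  exact h.unique hasSum_zero

theorem mulVec_mem_range {r : ℤ_[p]} {v : Fin N → ℤ_[p]} (A : Matrix (Fin N) (Fin N) ℤ_[p])
    (hv : v ∈ LinearMap.range (LinearMap.lsmul ℤ_[p] (Fin N → ℤ_[p]) r)) :
    A.mulVec v ∈ LinearMap.range (LinearMap.lsmul ℤ_[p] (Fin N → ℤ_[p]) r) := by
  obtain ⟨u, rfl⟩ := hv
  exact ⟨A.mulVec u, (Matrix.mulVec_smul _ _ _).symm⟩

theorem mem_range_lsmul_iff {r : ℤ_[p]} {v : Fin N → ℤ_[p]} :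
    v ∈ LinearMap.range (LinearMap.lsmul ℤ_[p] (Fin N → ℤ_[p]) r) ↔ ∀ a, r ∣ v a := by
  constructor
  · rintro ⟨u, rfl⟩ a
    exact ⟨u a, rfl⟩
  · intro h
    choose u hu using h
    exact ⟨u, funext fun a => (hu a).symm⟩

/-- A measure that annihilates the functions `c_{ab}(g) φ(θ(g))` annihilates modulo `p ^ m` every
function that is `H`-equivariant modulo `p ^ m`. -/
theorem dvd_sum_of_equivariant (hθ : Function.Surjective θ) {K : ℕ} {h : Fin K → G}
    (hh : ∀ x, θ x = 1 → x ∈ closure (Subgroup.closure (Set.range h) : Set G))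
    {m : Fin N → Iwasawa p G}
    (hm : ∀ b k, ∑ a, m a (coeffFun ρ β a b * pullθ θ (mahler k)) = 0) (d : ℕ)
    (f : Fin N → C(G, ℤ_[p]))
    (hf : ∀ k a g, (p : ℤ_[p]) ^ d ∣ f a (h k * g) - ∑ b, coeffFun ρ β a b (h k) * f b g) :
    (p : ℤ_[p]) ^ d ∣ ∑ a, m a (f a) := by
  classical
  let D : Submodule ℤ_[p] (Fin N → ℤ_[p]) :=
    LinearMap.range (LinearMap.lsmul ℤ_[p] (Fin N → ℤ_[p]) ((p : ℤ_[p]) ^ d))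
  have hD : ∀ {v}, v ∈ D ↔ ∀ a, (p : ℤ_[p]) ^ d ∣ v a := mem_range_lsmul_iff
  let F : G → Fin N → ℤ_[p] := fun g a => f a g
  have hFc : Continuous F := continuous_pi fun a => (f a).continuous
  let c := coeffMat ρ β
  have hcc : Continuous c := continuous_pi fun a => continuous_pi fun b => (coeffFun ρ β a b).continuous
  have hDcl : IsClosed (D : Set (Fin N → ℤ_[p])) := by
    have : (D : Set (Fin N → ℤ_[p])) = ⋂ a, {v | (p : ℤ_[p]) ^ d ∣ v a} := by
      ext v
      rw [Set.mem_iInter]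
      exact hD
    rw [this]
    exact isClosed_iInter fun a => 
      IsClosed.preimage (f := fun v : Fin N → ℤ_[p] => v a) (by fun_prop) (isClosed_padicInt_dvd d)
  have hDop : IsOpen (D : Set (Fin N → ℤ_[p])) := by
    have : (D : Set (Fin N → ℤ_[p])) = ⋂ a, {v | (p : ℤ_[p]) ^ d ∣ v a} := by
      ext v
      rw [Set.mem_iInter]
      exact hD
    rw [this]
    exact isOpen_iInter_of_finite fun a => 
      IsOpen.preimage (f := fun v : Fin N → ℤ_[p] => v a) (by fun_prop) (isOpen_padicInt_dvd d)
  let S : Subgroup G :=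
    { carrier := {x | ∀ g, F (x * g) - (c x).mulVec (F g) ∈ D}
      one_mem' := fun g => by
        rw [show c 1 = 1 from coeffMat_one ρ β, one_mul, Matrix.one_mulVec, sub_self]
        exact D.zero_mem
      mul_mem' := fun {x y} hx hy g => by
        have : F (x * y * g) - (c (x * y)).mulVec (F g) =
            (F (x * (y * g)) - (c x).mulVec (F (y * g))) +
              (c x).mulVec (F (y * g) - (c y).mulVec (F g)) := by
          rw [show c (x * y) = c x * c y from coeffMat_mul ρ β x y, Matrix.mulVec_sub,
            Matrix.mulVec_mulVec, mul_assoc, sub_add_sub_cancel]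
        rw [this]
        exact D.add_mem (hx _) (mulVec_mem_range _ (hy _))
      inv_mem' := fun {x} hx g => by
        have : F (x⁻¹ * g) - (c x⁻¹).mulVec (F g) =
            -(c x⁻¹).mulVec (F (x * (x⁻¹ * g)) - (c x).mulVec (F (x⁻¹ * g))) := by
          rw [Matrix.mulVec_sub, Matrix.mulVec_mulVec,
            show c x⁻¹ * c x = 1 from coeffMat_inv_mul ρ β x, Matrix.one_mulVec, mul_inv_cancel_left,
            neg_sub]
        rw [this]
        exact D.neg_mem (mulVec_mem_range _ (hx _)) }
  have hScl : IsClosed (S : Set G) := by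
    have : (S : Set G) = ⋂ g, {x | F (x * g) - (c x).mulVec (F g) ∈ D} := by
      ext x
      rw [Set.mem_iInter]
      rfl
    rw [this]
    exact isClosed_iInter fun g => hDcl.preimage
      ((hFc.comp (continuous_mul_const g)).sub (hcc.matrix_mulVec continuous_const))
  have hS : ∀ x, θ x = 1 → x ∈ S := fun x hx => by
    refine closure_minimal ?_ hScl (hh x hx)
    refine (Subgroup.closure_le S).2 ?_
    rintro _ ⟨k, rfl⟩ g
    exact hD.2 fun a => hf k a g
  let φ : G → Fin N → ℤ_[p] := fun g => (c g⁻¹).mulVec (F g)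
  have hφc : Continuous φ := (hcc.comp continuous_inv).matrix_mulVec hFc
  have hφ : ∀ g g', θ g = θ g' → φ g' - φ g ∈ D := fun g g' hgg => by
    have hx := hS (g' * g⁻¹) (by rw [map_mul, map_inv, hgg, mul_inv_cancel]) g
    rw [inv_mul_cancel_right] at hx
    have : φ g' - φ g = (c g'⁻¹).mulVec (F g' - (c (g' * g⁻¹)).mulVec (F g)) := by
      rw [Matrix.mulVec_sub, Matrix.mulVec_mulVec, ← show c (g'⁻¹ * (g' * g⁻¹)) = _ from
        coeffMat_mul ρ β _ _, inv_mul_cancel_left]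
    rw [this]
    exact mulVec_mem_range _ hx
  let σ : Multiplicative ℤ_[p] → G := Function.surjInv hθ
  let rep : (Fin N → ℤ_[p]) → Fin N → ℤ_[p] := fun v => (Submodule.Quotient.mk v : _ ⧸ D).out
  have hrep : ∀ {v w}, v - w ∈ D → rep v = rep w := fun {v w} hvw =>
    congrArg Quotient.out ((Submodule.Quotient.eq D).2 hvw)
  have hrep' : ∀ v, v - rep v ∈ D := fun v => (Submodule.Quotient.eq D).1
    (Quotient.out_eq (Submodule.Quotient.mk v : _ ⧸ D)).symm
  have hχ : ∀ g, rep (φ (σ (θ g))) = rep (φ g) := fun g =>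
    hrep (hφ g _ (Function.surjInv_eq hθ _).symm)
  have hθq : Topology.IsQuotientMap θ :=
    (Continuous.isClosedMap θ.continuous_toFun).isQuotientMap θ.continuous_toFun hθ
  have hψc : Continuous fun s : Multiplicative ℤ_[p] => rep (φ (σ s)) := by
    rw [hθq.continuous_iff]
    have : (fun s : Multiplicative ℤ_[p] => rep (φ (σ s))) ∘ θ = fun g => rep (φ g) := funext hχ
    rw [this]
    refine IsLocallyConstant.continuous (IsLocallyConstant.iff_exists_open _ |>.2 fun g =>
      ⟨{g' | φ g' - φ g ∈ D}, hDop.preimage (hφc.sub continuous_const), ?_, fun g' hg' => hrep hg'⟩)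
    change φ g - φ g ∈ D
    rw [sub_self]
    exact D.zero_mem
  let ψ : Fin N → C(ℤ_[p], ℤ_[p]) := fun b => ⟨fun s => rep (φ (σ (Multiplicative.ofAdd s))) b,
    (continuous_apply b).comp (hψc.comp continuous_ofAdd)⟩
  have hψ : ∀ b g, pullθ θ (ψ b) g = rep (φ g) b := fun b g => congrFun (hχ g) b
  have hdiff : ∀ a, ∃ f' : C(G, ℤ_[p]), f a - ∑ b, coeffFun ρ β a b * pullθ θ (ψ b) =
      (p : ℤ_[p]) ^ d • f' := fun a => ContinuousMap.exists_eq_pow_smul fun g => by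
    have h1 : F g - (c g).mulVec (rep (φ g)) ∈ D := by
      have : F g - (c g).mulVec (rep (φ g)) = (c g).mulVec (φ g - rep (φ g)) := by
        rw [Matrix.mulVec_sub, Matrix.mulVec_mulVec,
          show c g * c g⁻¹ = 1 from coeffMat_mul_inv ρ β g, Matrix.one_mulVec]
      rw [this]
      exact mulVec_mem_range _ (hrep' _)
    have h2 := hD.1 h1 a
    rw [ContinuousMap.sub_apply, ContinuousMap.sum_apply]
    simp only [ContinuousMap.mul_apply, hψ]
    exact h2
  choose f' hf' using hdiff
  refine ⟨∑ a, m a (f' a), ?_⟩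
  have h1 : ∀ a, m a (f a) = (p : ℤ_[p]) ^ d * m a (f' a) +
      ∑ b, m a (coeffFun ρ β a b * pullθ θ (ψ b)) := fun a => by
    rw [← smul_eq_mul, ← map_smul, ← hf', map_sub, ← map_sum, sub_add_cancel]
  simp only [h1, Finset.sum_add_distrib, ← Finset.mul_sum]
  rw [Finset.sum_comm]
  simp only [apply_pullθ_eq_zero (hm _), Finset.sum_const_zero, add_zero]

/-- A continuous linear form as a measure. -/
def Iwasawa.ofLinear (z : C(G, ℤ_[p]) →ₗ[ℤ_[p]] ℤ_[p]) : Iwasawa p G :=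
  (⟨z, continuous_of_linear z⟩ : C(G, ℤ_[p]) →L[ℤ_[p]] ℤ_[p])

theorem exists_measure_relation (hθ : Function.Surjective θ) {K : ℕ} {h : Fin K → G}
    (hh : ∀ x, θ x = 1 → x ∈ closure (Subgroup.closure (Set.range h) : Set G))
    {m : Fin N → Iwasawa p G}
    (hm : ∀ b k, ∑ a, m a (coeffFun ρ β a b * pullθ θ (mahler k)) = 0) :
    ∃ z : Fin K → Fin N → Iwasawa p G, ∀ b f,
      m b f = ∑ k, (z k b (Iwasawa.shift (h k) f) - ∑ a, coeffFun ρ β a b (h k) * z k a f) := by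
  classical
  let sh : G → C(G, ℤ_[p]) →ₗ[ℤ_[p]] C(G, ℤ_[p]) := fun g =>
    { toFun := Iwasawa.shift g
      map_add' := fun _ _ => rfl
      map_smul' := fun _ _ => rfl }
  let t : (Fin N → C(G, ℤ_[p])) →ₗ[ℤ_[p]] (Fin K → Fin N → C(G, ℤ_[p])) :=
    LinearMap.pi fun k => LinearMap.pi fun a => sh (h k) ∘ₗ LinearMap.proj a -
      ∑ b, coeffFun ρ β a b (h k) • LinearMap.proj b
  let x : (Fin N → C(G, ℤ_[p])) →ₗ[ℤ_[p]] ℤ_[p] :=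
    { toFun := fun f => ∑ a, m a (f a)
      map_add' := fun f f' => by
        rw [← Finset.sum_add_distrib]
        exact Finset.sum_congr rfl fun a _ => map_add (m a) (f a) (f' a)
      map_smul' := fun c f => by
        rw [RingHom.id_apply, Finset.smul_sum]
        exact Finset.sum_congr rfl fun a _ => map_smul (m a) c (f a) }
  have ht : ∀ f k a, t f k a = Iwasawa.shift (h k) (f a) -
      ∑ b, coeffFun ρ β a b (h k) • f b := fun f k a => by
    change sh (h k) (f a) - (∑ b, coeffFun ρ β a b (h k) • LinearMap.proj b :
      (Fin N → C(G, ℤ_[p])) →ₗ[ℤ_[p]] C(G, ℤ_[p])) f = _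
    rw [LinearMap.sum_apply]
    rfl
  obtain ⟨z, hz⟩ := exists_extension t x fun d f w hfw =>
    dvd_sum_of_equivariant hθ hh hm d f fun k a g => by
      have h1 := congrArg (fun u => u g) (congrFun (congrFun hfw k) a)
      refine ⟨w k a g, ?_⟩
      simp only [ht] at h1
      rw [ContinuousMap.sub_apply, ContinuousMap.sum_apply] at h1
      exact h1
  refine ⟨fun k a => Iwasawa.ofLinear (z ∘ₗ LinearMap.single ℤ_[p] _ k ∘ₗ
    LinearMap.single ℤ_[p] (fun _ => C(G, ℤ_[p])) a), fun b f => ?_⟩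
  have h1 : m b f = x (Pi.single b f) := by
    change _ = ∑ a, m a ((Pi.single b f : Fin N → C(G, ℤ_[p])) a)
    rw [Finset.sum_eq_single b (fun a _ hab => by rw [Pi.single_eq_of_ne hab, map_zero])
      (fun hb => absurd (Finset.mem_univ b) hb), Pi.single_eq_same]
  have h2 : ∀ w : Fin K → Fin N → C(G, ℤ_[p]), z w = ∑ k, ∑ a, z (Pi.single k (Pi.single a (w k a))) := by
    intro w
    simp only [← map_sum]
    congr 1
    ext1 k
    ext1 a
    rw [Finset.sum_apply, Finset.sum_eq_single k, Finset.sum_apply]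
    · rw [Finset.sum_apply, Finset.sum_eq_single a]
      · simp
      · intro a' _ h'
        simp [h'.symm]
      · simp
    · intro k' _ h'
      rw [Finset.sum_apply]
      simp [h'.symm]
    · simp
  rw [h1, ← hz, h2]
  refine Finset.sum_congr rfl fun k _ => ?_
  have h3 : ∀ a, t (Pi.single b f) k a = (if a = b then Iwasawa.shift (h k) f else 0) -
      coeffFun ρ β a b (h k) • f := fun a => by
    rw [ht, Finset.sum_eq_single b (fun c _ hcb => by rw [Pi.single_eq_of_ne hcb, smul_zero])
      (fun hb => absurd (Finset.mem_univ b) hb), Pi.single_eq_same]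
    congr 1
    split_ifs with hab
    · subst hab
      rw [Pi.single_eq_same]
    · rw [Pi.single_eq_of_ne hab]
      rfl
  let ζ : Fin N → C(G, ℤ_[p]) →ₗ[ℤ_[p]] ℤ_[p] := fun a => z ∘ₗ LinearMap.single ℤ_[p] _ k ∘ₗ
    LinearMap.single ℤ_[p] (fun _ => C(G, ℤ_[p])) a
  change ∑ a, ζ a (t (Pi.single b f) k a) = ζ b (Iwasawa.shift (h k) f) -
    ∑ a, coeffFun ρ β a b (h k) * ζ a f
  simp only [h3, map_sub, map_smul, smul_eq_mul, Finset.sum_sub_distrib]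
  congr 1
  rw [Finset.sum_eq_single b (fun c _ hcb => by rw [if_neg hcb, map_zero])
    (fun hb => absurd (Finset.mem_univ b) hb), if_pos rfl]

theorem dvd_of_sum_choose {d K : ℕ} {v : ℕ → ℤ_[p]}
    (h : ∀ s : ℤ_[p], (p : ℤ_[p]) ^ d ∣ ∑ k ∈ Finset.range K, v k * mahler k s) :
    ∀ k < K, (p : ℤ_[p]) ^ d ∣ v k := by
  intro k
  induction k using Nat.strong_induction_on with
  | _ k ih =>
    intro hk
    have h1 := h (k : ℤ_[p])
    rw [← Finset.add_sum_erase _ _ (Finset.mem_range.2 hk)] at h1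
    rw [mahler_natCast_eq, Nat.choose_self, Nat.cast_one, mul_one] at h1
    refine (dvd_add_left (Finset.dvd_sum fun j hj => ?_)).1 h1
    rw [Finset.mem_erase, Finset.mem_range] at hj
    rcases lt_or_gt_of_ne hj.1 with hlt | hgt
    · exact (ih j hlt hj.2).mul_right _
    · rw [mahler_natCast_eq, Nat.choose_eq_zero_of_lt hgt, Nat.cast_zero, mul_zero]
      exact dvd_zero _

variable (ρ θ β) in
theorem exists_measure (hθ : Function.Surjective θ) (F : Fin N → ℕ → ℤ_[p]) :
    ∃ m : Fin N → Iwasawa p G, ∀ b k, ∑ a, m a (coeffFun ρ β a b * pullθ θ (mahler k)) = F b k := by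
  classical
  let w : Fin N × ℕ → Fin N → C(G, ℤ_[p]) := fun x a => coeffFun ρ β a x.1 * pullθ θ (mahler x.2)
  let t : (Fin N × ℕ →₀ ℤ_[p]) →ₗ[ℤ_[p]] Fin N → C(G, ℤ_[p]) := Finsupp.linearCombination ℤ_[p] w
  let x : (Fin N × ℕ →₀ ℤ_[p]) →ₗ[ℤ_[p]] ℤ_[p] :=
    Finsupp.linearCombination ℤ_[p] fun x => F x.1 x.2
  obtain ⟨z, hz⟩ := exists_extension t x fun d v f hvf => by
    obtain ⟨K, hK⟩ : ∃ K, ∀ x ∈ v.support, x.2 < K := by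
      obtain ⟨K, hK⟩ := (v.support.image Prod.snd).exists_nat_subset_range
      exact ⟨K, fun x hx => Finset.mem_range.1 (hK (Finset.mem_image_of_mem _ hx))⟩
    have hsub : v.support ⊆ Finset.univ ×ˢ Finset.range K := fun x hx =>
      Finset.mem_product.2 ⟨Finset.mem_univ _, Finset.mem_range.2 (hK x hx)⟩
    have key : ∀ b k, (p : ℤ_[p]) ^ d ∣ v (b, k) := fun b k => by
      by_cases hk : k < K
      · refine dvd_of_sum_choose (v := fun k => v (b, k)) (fun s => ?_) k hk
        obtain ⟨g, hg⟩ := hθ (Multiplicative.ofAdd s)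
        let u : Fin N → ℤ_[p] := fun b => ∑ k ∈ Finset.range K, v (b, k) * mahler k s
        have h1 : (coeffMat ρ β g).mulVec u ∈
            LinearMap.range (LinearMap.lsmul ℤ_[p] (Fin N → ℤ_[p]) ((p : ℤ_[p]) ^ d)) := by
          refine mem_range_lsmul_iff.2 fun a => ⟨f a g, ?_⟩
          have h2 := congrArg (fun q => q g) (congrFun hvf a)
          refine Eq.trans ?_ h2
          have h3 : t v = ∑ x ∈ Finset.univ ×ˢ Finset.range K, v x • w x :=
            Finsupp.sum_of_support_subset v hsub _ fun x _ => zero_smul _ _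
          simp only [h3, Finset.sum_apply, Pi.smul_apply, ContinuousMap.sum_apply,
            ContinuousMap.smul_apply, smul_eq_mul]
          rw [Finset.sum_product]
          change ∑ b, coeffFun ρ β a b g * u b = _
          refine Finset.sum_congr rfl fun b _ => ?_
          change coeffFun ρ β a b g * ∑ k ∈ Finset.range K, v (b, k) * mahler k s = _
          rw [Finset.mul_sum]
          refine Finset.sum_congr rfl fun k _ => ?_
          have h4 : pullθ θ (mahler k) g = mahler k s := by
            change mahler k (θ g).toAdd = _
            rw [hg, toAdd_ofAdd]
          change _ = v (b, k) * (coeffFun ρ β a b g * pullθ θ (mahler k) g)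
          rw [h4]
          ring
        have h5 := mulVec_mem_range (coeffMat ρ β g⁻¹) h1
        rw [Matrix.mulVec_mulVec, coeffMat_inv_mul, Matrix.one_mulVec] at h5
        exact mem_range_lsmul_iff.1 h5 b
      · have : v (b, k) = 0 := by
          by_contra h
          exact hk (hK (b, k) (Finsupp.mem_support_iff.2 h))
        rw [this]
        exact dvd_zero _
    exact Finset.dvd_sum fun x _ => (key x.1 x.2).mul_right _
  refine ⟨fun a => Iwasawa.ofLinear (z ∘ₗ LinearMap.single ℤ_[p] (fun _ => C(G, ℤ_[p])) a),
    fun b k => ?_⟩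
  have h1 := hz (Finsupp.single (b, k) 1)
  simp only [t, x, Finsupp.linearCombination_single, one_smul] at h1
  rw [← h1, ← LinearMap.sum_single_apply (fun _ : Fin N => C(G, ℤ_[p])) (w (b, k)), map_sum]
  rfl

end MatrixCoefficients

/-! ### Comparison of coinvariants for `H` with modules over `O[[T]]` -/

section Coinvariants

variable {p : ℕ} [Fact p.Prime] {L : Type v} [Field L] [Algebra ℚ_[p] L] [FiniteDimensional ℚ_[p] L]
  [Algebra ℤ_[p] L] [IsScalarTower ℤ_[p] ℚ_[p] L]
  {G : Type u} [Group G] [TopologicalSpace G] [IsTopologicalGroup G] [CompactSpace G]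
  (H : ClosedSubgroup G) [H.toSubgroup.Normal]
  (e : (G ⧸ H.toSubgroup) ≃ₜ* Multiplicative ℤ_[p])
  {n : ℕ} (ρ : G →ₜ* GL (Fin n) (Integers p L)) (θ : G →ₜ* Multiplicative ℤ_[p])

theorem actO_apply (r : Iwasawa p G) (y : Fin n → Integers p L) :
    actO ρ θ (MulOpposite.op r) y = Matrix.vecMul y (repO ρ θ r) := rfl

theorem actI_apply (r : Iwasawa p G) (y : Fin n → PowerSeries (Integers p L)) :
    actI ρ θ (MulOpposite.op r) y = Matrix.vecMul y (repΓ ρ θ r) := rfl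

theorem repO_dirac (g : G) :
    repO ρ θ (Iwasawa.dirac g) = (ρ g : Matrix (Fin n) (Fin n) (Integers p L)) := by
  ext i j
  change PowerSeries.constantCoeff (repΓ ρ θ (Iwasawa.dirac g) i j) = _
  rw [repΓ_dirac, ← PowerSeries.coeff_zero_eq_constantCoeff_apply, PowerSeries.coeff_mk,
    Ring.choose_zero_right, one_smul]

variable (L) in
/-- The power series `(1 + T)^{θ(g)}`. -/
def gammaPow (g : G) : PowerSeries (Integers p L) :=
  PowerSeries.mk fun k => algebraMap ℤ_[p] (Integers p L) (Ring.choose (θ g).toAdd k)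

theorem repΓ_dirac_eq (g : G) : repΓ ρ θ (Iwasawa.dirac g) = gammaPow L θ g •
    (PowerSeries.C (R := Integers p L)).mapMatrix (ρ g : Matrix (Fin n) (Fin n) (Integers p L)) := by
  ext i j k
  rw [repΓ_dirac, PowerSeries.coeff_mk, Matrix.smul_apply, RingHom.mapMatrix_apply, Matrix.map_apply,
    smul_eq_mul, PowerSeries.coeff_mul_C, gammaPow, PowerSeries.coeff_mk, Algebra.smul_def]

theorem vecMap_C_vecMul (y : Fin n → Integers p L) (X : Matrix (Fin n) (Fin n) (Integers p L)) :
    vecMap (PowerSeries.C (R := Integers p L)) n (Matrix.vecMul y X) =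
      Matrix.vecMul (vecMap (PowerSeries.C (R := Integers p L)) n y)
        ((PowerSeries.C (R := Integers p L)).mapMatrix X) := by
  ext1 j
  simp [vecMap, Matrix.vecMul, dotProduct]

/-- The map `O^n ⊗_{Λ(H)} M → O[[T]]^n ⊗_{Λ(G)} M`. -/
def toΓ (M : Type*) [AddCommGroup M] [Module (Iwasawa p G) M] :
    BTensor (Iwasawa.ofSubgroup H).range (actO ρ (thetaOf H e)) M
      →ₛₗ[PowerSeries.C (R := Integers p L)] BTensor ⊤ (actI ρ (thetaOf H e)) M :=
  BTensor.lift ((BTensor.tmulHom ⊤ (actI ρ (thetaOf H e)) M).comp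
      (vecMap (PowerSeries.C (R := Integers p L)) n).toAddMonoidHom)
    (by
      rintro _ ⟨μ, rfl⟩ y m
      refine Eq.trans ?_ (BTensor.act_tmul ⊤ (actI ρ (thetaOf H e)) (Subring.mem_top _) _ m)
      rw [actO_apply, actI_apply]
      change BTensor.tmul ⊤ _ (vecMap (PowerSeries.C (R := Integers p L)) n (Matrix.vecMul y _)) m = _
      rw [vecMap_C_vecMul]
      congr 2
      ext1 i j
      exact (repΓ_ofSubgroup H e ρ μ i j).symm)
    (fun c y m => by
      change BTensor.tmul ⊤ _ (vecMap (PowerSeries.C (R := Integers p L)) n (c • y)) m = _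
      rw [map_smulₛₗ, BTensor.smul_tmul]
      rfl)

variable {M N : Type*} [AddCommGroup M] [Module (Iwasawa p G) M] [AddCommGroup N]
  [Module (Iwasawa p G) N]

theorem toΓ_tmul (y : Fin n → Integers p L) (m : M) :
    toΓ H e ρ M (BTensor.tmul _ _ y m) = BTensor.tmul ⊤ (actI ρ (thetaOf H e))
      (vecMap (PowerSeries.C (R := Integers p L)) n y) m := rfl

theorem map_toΓ (f : M →ₗ[Iwasawa p G] N)
    (x : BTensor (Iwasawa.ofSubgroup H).range (actO ρ (thetaOf H e)) M) :
    BTensor.map ⊤ (actI ρ (thetaOf H e)) f (toΓ H e ρ M x) =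
      toΓ H e ρ N (BTensor.map _ (actO ρ (thetaOf H e)) f x) :=
  LinearMap.congr_fun (f := (BTensor.map ⊤ (actI ρ (thetaOf H e)) f).comp (toΓ H e ρ M))
    (g := (toΓ H e ρ N).comp (BTensor.map _ (actO ρ (thetaOf H e)) f))
    (BTensor.hom_ext' fun _ _ => rfl) x

theorem toΓ_gAct (g : G) (x : BTensor (Iwasawa.ofSubgroup H).range (actO ρ (thetaOf H e)) M) :
    toΓ H e ρ M (gAct ρ (thetaOf H e) H M g x) = gammaPow L (thetaOf H e) g • toΓ H e ρ M x := by
  induction x using BTensor.induction_on with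
  | zero => rw [map_zero, map_zero, smul_zero]
  | add a b ha hb => rw [map_add, map_add, ha, hb, map_add, smul_add]
  | tmul y m =>
    change BTensor.tmul ⊤ (actI ρ (thetaOf H e)) (vecMap (PowerSeries.C (R := Integers p L)) n
      (actO ρ (thetaOf H e) (MulOpposite.op (Iwasawa.dirac g⁻¹)) y))
        ((Iwasawa.dirac g : Iwasawa p G) • m) = _
    rw [← BTensor.act_tmul ⊤ (actI ρ (thetaOf H e)) (Subring.mem_top _), actI_apply, actO_apply,
      repΓ_dirac_eq, repO_dirac, Matrix.vecMul_smul, ← vecMap_C_vecMul, Matrix.vecMul_vecMul,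
      ← Units.val_mul, ← map_mul, inv_mul_cancel, map_one, Units.val_one, Matrix.vecMul_one,
      BTensor.smul_tmul]
    rfl

theorem exists_scalar (θ : G →ₜ* Multiplicative ℤ_[p]) (c : ℤ_[p]) :
    ∃ r ∈ (Iwasawa.ofSubgroup (p := p) H).range,
    (∀ (μ : Iwasawa p G) f, (r * μ) f = c * μ f) ∧ ∀ y, actO ρ θ (MulOpposite.op r) y = c • y := by
  let κ : Iwasawa p H.toSubgroup := Iwasawa.ofLinear
    { toFun := fun f => c * f 1
      map_add' := fun f f' => mul_add c (f 1) (f' 1)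
      map_smul' := fun d f => mul_left_comm c d (f 1) }
  have h1 : ∀ f, Iwasawa.ofSubgroup H κ f = c * f 1 := fun f => rfl
  refine ⟨_, ⟨κ, rfl⟩, fun μ f => ?_, fun y => ?_⟩
  · rw [Iwasawa.mul_apply, h1, Iwasawa.conv_apply]
    congr 2
    ext h
    simp [Iwasawa.shift]
  · have : repO ρ θ (Iwasawa.ofSubgroup H κ) = c • (1 : Matrix (Fin n) (Fin n) (Integers p L)) := by
      ext1 i j
      change PowerSeries.constantCoeff (repΓ ρ θ _ i j) = _
      rw [repΓ_apply, ← PowerSeries.coeff_zero_eq_constantCoeff_apply, PowerSeries.coeff_mk]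
      refine Iwasawa.dual_ext (p := p) fun ℓ => ?_
      rw [Iwasawa.apply_integral, h1, Matrix.smul_apply, map_smul, smul_eq_mul]
      congr 1
      change ℓ (Ring.choose (θ 1).toAdd 0 • (ρ 1 : Matrix (Fin n) (Fin n) (Integers p L)) i j) = _
      rw [Ring.choose_zero_right, one_smul, map_one, Units.val_one]
    rw [actO_apply, this, Matrix.vecMul_smul, Matrix.vecMul_one]

theorem dirac_mem_range {h : G} (hh : h ∈ H.toSubgroup) :
    (Iwasawa.dirac h : Iwasawa p G) ∈ (Iwasawa.ofSubgroup (p := p) H).range :=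
  ⟨Iwasawa.dirac ⟨h, hh⟩, rfl⟩

section Ring

variable {N' : ℕ} (β : Module.Basis (Fin N') ℤ_[p] (Fin n → Integers p L))

theorem exists_sum_basis (x : BTensor (Iwasawa.ofSubgroup H).range (actO ρ θ) M) :
    ∃ m : Fin N' → M, x = ∑ a, BTensor.tmul _ _ (β a) (m a) := by
  induction x using BTensor.induction_on with
  | zero => exact ⟨0, (Finset.sum_eq_zero fun a _ => BTensor.tmul_zero _ _ _).symm⟩
  | add a b ha hb =>
    obtain ⟨m, rfl⟩ := ha
    obtain ⟨m', rfl⟩ := hb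
    exact ⟨m + m', by simp only [← Finset.sum_add_distrib, ← BTensor.tmul_add, Pi.add_apply]⟩
  | tmul y m =>
    choose r hr hr' hr'' using fun c => exists_scalar H ρ θ c
    refine ⟨fun a => r (β.repr y a) • m, ?_⟩
    conv_lhs => rw [← β.sum_repr y, BTensor.tmul_sum_left]
    refine Finset.sum_congr rfl fun a _ => ?_
    rw [← BTensor.act_tmul _ _ (hr _), hr'']

theorem coord_toΓ_sum (m : Fin N' → Iwasawa p G) (j : Fin n) (k : ℕ) :
    PowerSeries.coeff k (BTensor.coord (actI ρ (thetaOf H e)) LinearMap.id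
      (toΓ H e ρ _ (∑ a, BTensor.tmul _ _ (β a) (m a))) j) =
    ∑ b, (∑ a, m a (coeffFun ρ β a b * pullθ (thetaOf H e) (mahler k))) • β b j := by
  rw [map_sum, map_sum, Finset.sum_apply, map_sum]
  simp only [Finset.sum_smul]
  rw [Finset.sum_comm]
  refine Finset.sum_congr rfl fun a _ => ?_
  rw [toΓ_tmul, BTensor.coord_tmul]
  exact coeff_vecMul_repΓ ρ (thetaOf H e) β (m a) a j k

theorem coord_id_injective :
    Function.Injective (BTensor.coord (M := Iwasawa p G) (actI ρ θ) LinearMap.id) := by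
  have h : ∀ x, BTensor.tmul ⊤ (actI ρ θ) (BTensor.coord (M := Iwasawa p G) (actI ρ θ)
      LinearMap.id x) (1 : Iwasawa p G) = x := fun x => by
    have := BTensor.sum_coord (act := actI ρ θ) (k := 1) (m := fun _ => (1 : Iwasawa p G))
      (ℓ := fun _ => LinearMap.id) (by simp) x
    simpa using this
  exact fun x y hxy => by rw [← h x, ← h y, hxy]

theorem toΓ_ring_injective {K : ℕ} {h : Fin K → G} (hH : ∀ k, h k ∈ H.toSubgroup)
    (hh : ∀ x ∈ H.toSubgroup, x ∈ closure (Subgroup.closure (Set.range h) : Set G)) :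
    Function.Injective (toΓ H e ρ (Iwasawa p G)) := by
  let β := Module.finBasis ℤ_[p] (Fin n → Integers p L)
  rw [injective_iff_map_eq_zero]
  intro x hx
  obtain ⟨m, rfl⟩ := exists_sum_basis H ρ (thetaOf H e) β x
  have hm : ∀ b k, ∑ a, m a (coeffFun ρ β a b * pullθ (thetaOf H e) (mahler k)) = 0 := fun b k => by
    have h1 : ∑ b, (∑ a, m a (coeffFun ρ β a b * pullθ (thetaOf H e) (mahler k))) • β b = 0 := by
      ext1 j
      rw [Finset.sum_apply]
      refine Eq.trans (coord_toΓ_sum H e ρ β m j k).symm ?_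
      rw [hx, map_zero]
      exact map_zero _
    exact Fintype.linearIndependent_iff.1 β.linearIndependent _ h1 b
  obtain ⟨z, hz⟩ := exists_measure_relation (thetaOf_surjective H e)
    (fun x hx => hh x (mem_of_thetaOf H e hx)) hm
  choose r hr hr' hr'' using fun c => exists_scalar (L := L) H ρ (thetaOf H e) c
  have hm' : ∀ b, m b = ∑ k, ((Iwasawa.dirac (h k) : Iwasawa p G) • z k b -
      ∑ a, r (coeffFun ρ β a b (h k)) • z k a) := fun b => by
    ext f
    have hev : ∀ {ι : Type} (s : Finset ι) (ν : ι → Iwasawa p G), (∑ i ∈ s, ν i) f = ∑ i ∈ s, ν i f :=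
      fun s ν => map_sum (AddMonoidHom.mk' (fun ν : Iwasawa p G => ν f) fun _ _ => rfl) ν s
    have hsub : ∀ ν ν' : Iwasawa p G, (ν - ν') f = ν f - ν' f := fun _ _ => rfl
    rw [hz, hev]
    refine Finset.sum_congr rfl fun k _ => ?_
    rw [hsub, hev]
    congr 1
    exact Finset.sum_congr rfl fun a _ => (hr' _ _ _).symm
  have h2 : ∀ b, BTensor.tmul (Iwasawa.ofSubgroup (p := p) H).range (actO ρ (thetaOf H e)) (β b) (m b) =
      ∑ k, (∑ c, BTensor.tmul _ _ (coeffFun ρ β b c (h k) • β c) (z k b) -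
        ∑ a, BTensor.tmul _ _ (coeffFun ρ β a b (h k) • β b) (z k a)) := fun b => by
    conv_lhs => rw [hm', BTensor.tmul_sum_right]
    refine Finset.sum_congr rfl fun k _ => ?_
    have hs : ∀ u v : Iwasawa p G, BTensor.tmul (Iwasawa.ofSubgroup (p := p) H).range
        (actO ρ (thetaOf H e)) (β b) (u - v) = BTensor.tmul _ _ (β b) u - BTensor.tmul _ _ (β b) v :=
      fun u v => map_sub (BTensor.tmulHom _ (actO ρ (thetaOf H e)) _ (β b)) u v
    rw [hs, BTensor.tmul_sum_right, ← BTensor.act_tmul _ _ (dirac_mem_range H (hH k)), actO_apply,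
      repO_dirac, vecMul_rho, BTensor.tmul_sum_left]
    congr 1
    refine Finset.sum_congr rfl fun a _ => ?_
    rw [← BTensor.act_tmul _ _ (hr _), hr'']
  simp only [h2]
  rw [Finset.sum_comm]
  refine Finset.sum_eq_zero fun k _ => ?_
  rw [Finset.sum_sub_distrib, sub_eq_zero]
  exact Finset.sum_comm

theorem toΓ_ring_surjective : Function.Surjective (toΓ H e ρ (Iwasawa p G)) := by
  let β := Module.finBasis ℤ_[p] (Fin n → Integers p L)
  intro w
  let F := BTensor.coord (actI ρ (thetaOf H e)) LinearMap.id w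
  obtain ⟨m, hm⟩ := exists_measure ρ (thetaOf H e) β (thetaOf_surjective H e)
    fun b k => β.repr (fun j => PowerSeries.coeff k (F j)) b
  refine ⟨∑ a, BTensor.tmul _ _ (β a) (m a), coord_id_injective ρ (thetaOf H e) ?_⟩
  ext j k
  rw [coord_toΓ_sum]
  simp only [hm]
  have := congrFun (β.sum_repr fun j => PowerSeries.coeff k (F j)) j
  rw [Finset.sum_apply] at this
  exact this

end Ring

variable [Module.Finite (Iwasawa p G) M] [Module.Projective (Iwasawa p G) M]

theorem BTensor.sum_map_dualBasis {R : Type*} [Ring R] {B : Type*} [Ring B] {Y : Type*} [AddCommGroup Y]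
    [Module B Y] (R₀ : Subring R) (act : Rᵐᵒᵖ →+* Module.End B Y) {M : Type*} [AddCommGroup M]
    [Module R M] {k : ℕ} {m : Fin k → M} {ℓ : Fin k → M →ₗ[R] R} (h : ∀ x, ∑ i, ℓ i x • m i = x)
    (x : BTensor R₀ act M) : ∑ i, BTensor.map R₀ act (LinearMap.toSpanSingleton R M (m i))
      (BTensor.map R₀ act (ℓ i) x) = x := by
  induction x using BTensor.induction_on with
  | zero => simp
  | add a b ha hb => simp only [_root_.map_add, Finset.sum_add_distrib, ha, hb]
  | tmul y z =>
    simp only [BTensor.map_tmul, LinearMap.toSpanSingleton_apply]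
    rw [← BTensor.tmul_sum_right, h]

theorem toΓ_bijective {K : ℕ} {h : Fin K → G} (hH : ∀ k, h k ∈ H.toSubgroup)
    (hh : ∀ x ∈ H.toSubgroup, x ∈ closure (Subgroup.closure (Set.range h) : Set G)) :
    Function.Bijective (toΓ H e ρ M) := by
  obtain ⟨k, m, ℓ, hmℓ⟩ := exists_dualBasis (Iwasawa p G) M
  constructor
  · rw [injective_iff_map_eq_zero]
    intro x hx
    rw [← BTensor.sum_map_dualBasis _ _ hmℓ x]
    refine Finset.sum_eq_zero fun i _ => ?_
    have : BTensor.map _ (actO ρ (thetaOf H e)) (ℓ i) x = 0 :=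
      toΓ_ring_injective H e ρ hH hh (by rw [← map_toΓ, hx, map_zero, map_zero])
    rw [this, map_zero]
  · intro w
    choose x hx using fun i => toΓ_ring_surjective H e ρ (BTensor.map ⊤ (actI ρ (thetaOf H e)) (ℓ i) w)
    refine ⟨∑ i, BTensor.map _ _ (LinearMap.toSpanSingleton _ M (m i)) (x i), ?_⟩
    rw [map_sum, ← BTensor.sum_map_dualBasis ⊤ (actI ρ (thetaOf H e)) hmℓ w]
    refine Finset.sum_congr rfl fun i _ => ?_
    rw [← map_toΓ, hx]

end Coinvariants

section RankComparison

variable {p : ℕ} [Fact p.Prime] {L : Type v} [Field L] [Algebra ℚ_[p] L] [FiniteDimensional ℚ_[p] L]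
  [Algebra ℤ_[p] L] [IsScalarTower ℤ_[p] ℚ_[p] L]
  {G : Type u} [Group G] [TopologicalSpace G] [IsTopologicalGroup G] [CompactSpace G]
  (H : ClosedSubgroup G) [H.toSubgroup.Normal]
  (e : (G ⧸ H.toSubgroup) ≃ₜ* Multiplicative ℤ_[p])
  {n : ℕ} (ρ : G →ₜ* GL (Fin n) (Integers p L))

theorem gammaPow_of_one {θ : G →ₜ* Multiplicative ℤ_[p]} {g : G}
    (hg : θ g = Multiplicative.ofAdd 1) : gammaPow L θ g = 1 + PowerSeries.X := by
  ext k
  rw [gammaPow, PowerSeries.coeff_mk, hg, toAdd_ofAdd]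
  have h1 : Ring.choose (1 : ℤ_[p]) k = ((Nat.choose 1 k : ℕ) : ℤ_[p]) := by
    have := Ring.choose_natCast (R := ℤ_[p]) 1 k
    rwa [Nat.cast_one] at this
  rw [h1, map_natCast]
  rcases k with _ | _ | k
  · simp
  · simp [PowerSeries.coeff_one]
  · rw [Nat.choose_eq_zero_of_lt (by omega)]
    simp [PowerSeries.coeff_one, PowerSeries.coeff_X]

theorem exists_gammaPow_eq (θ : G →ₜ* Multiplicative ℤ_[p]) (g : G) :
    ∃ v, gammaPow L θ g = 1 + v * PowerSeries.X := by
  obtain ⟨v, hv⟩ : PowerSeries.X ∣ gammaPow L θ g - 1 := by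
    rw [PowerSeries.X_dvd_iff, map_sub, map_one, ← PowerSeries.coeff_zero_eq_constantCoeff_apply,
      gammaPow, PowerSeries.coeff_mk, Ring.choose_zero_right, map_one, sub_self]
  exact ⟨v, by rw [mul_comm, ← hv, add_sub_cancel]⟩

theorem finrank_fixed_eq {O : Type*} [CommRing O] [Algebra O L] {X : Type*} [AddCommGroup X]
    [Module O X] {Y : Type*} [AddCommGroup Y] [Module (PowerSeries O) Y]
    (E : X →ₛₗ[PowerSeries.C (R := O)] Y) (hE : Function.Bijective E) {ι : Type*}
    (α : ι → X →ₗ[O] X) (u : ι → PowerSeries O) (hα : ∀ g c, E (α g c) = u g • E c)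
    (hu : ∀ g, ∃ v, u g = 1 + v * PowerSeries.X) (hu' : ∃ g, u g = 1 + PowerSeries.X) :
    Module.finrank L (L ⊗[O] (⨅ g, LinearMap.ker (α g - LinearMap.id) : Submodule O X)) =
      invRank O L Y := by
  have hmem : ∀ c, c ∈ (⨅ g, LinearMap.ker (α g - LinearMap.id) : Submodule O X) ↔
      (PowerSeries.X : PowerSeries O) • E c = 0 := fun c => by
    have h1 : c ∈ (⨅ g, LinearMap.ker (α g - LinearMap.id) : Submodule O X) ↔
        ∀ g, u g • E c = E c := by
      rw [Submodule.mem_iInf]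
      refine forall_congr' fun g => ?_
      rw [LinearMap.mem_ker, LinearMap.sub_apply, LinearMap.id_apply, sub_eq_zero, ← hE.1.eq_iff, hα]
    rw [h1]
    constructor
    · intro h2
      obtain ⟨g, hg⟩ := hu'
      have h3 := h2 g
      rwa [hg, add_smul, one_smul, add_eq_left] at h3
    · intro h2 g
      obtain ⟨v, hv⟩ := hu g
      rw [hv, add_smul, one_smul, mul_smul, h2, smul_zero, add_zero]
  let _ : Module O (Submodule.torsionBy (PowerSeries O) Y PowerSeries.X) :=
    Module.compHom _ (PowerSeries.C (R := O))
  let f : (⨅ g, LinearMap.ker (α g - LinearMap.id) : Submodule O X) →ₗ[O]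
      Submodule.torsionBy (PowerSeries O) Y PowerSeries.X :=
    { toFun := fun c => ⟨E c.1, (Submodule.mem_torsionBy_iff _ _).2 ((hmem c.1).1 c.2)⟩
      map_add' := fun c d => Subtype.ext (map_add E c.1 d.1)
      map_smul' := fun r c => Subtype.ext (map_smulₛₗ E r c.1) }
  have hf : Function.Bijective f :=
    ⟨fun c d hcd => Subtype.ext (hE.1 (congrArg Subtype.val hcd)), fun y => by
      obtain ⟨c, hc⟩ := hE.2 y.1
      exact ⟨⟨c, (hmem c).2 (hc ▸ (Submodule.mem_torsionBy_iff _ _).1 y.2)⟩, Subtype.ext hc⟩⟩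
  exact (TensorProduct.AlgebraTensorModule.congr (LinearEquiv.refl L L)
    (LinearEquiv.ofBijective f hf)).finrank_eq

theorem finrank_hyperInv_eq {K : ℕ} {h : Fin K → G} (hH : ∀ k, h k ∈ H.toSubgroup)
    (hh : ∀ x ∈ H.toSubgroup, x ∈ closure (Subgroup.closure (Set.range h) : Set G))
    (A : PerfCx (Iwasawa p G)) (i : ℤ) :
    Module.finrank L (L ⊗[Integers p L] hyperInv ρ (thetaOf H e) H A i) =
      invRank (Integers p L) L (Hgy (BTensor.map ⊤ (actΓ ρ (thetaOf H e)) (A.d (-i - 1) (-i)))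
        (BTensor.map ⊤ (actΓ ρ (thetaOf H e)) (A.d (-i) (-i + 1)))) := by
  set θ := thetaOf H e with hθ
  have hb := fun j => toΓ_bijective H e ρ (M := A.cx.X j) hH hh
  let E : hyperH ρ θ H A i →ₛₗ[PowerSeries.C (R := Integers p L)]
      Hgy (BTensor.map ⊤ (actI ρ θ) (A.d (-i - 1) (-i)))
        (BTensor.map ⊤ (actI ρ θ) (A.d (-i) (-i + 1))) :=
    Hgy.smap (toΓ H e ρ (A.cx.X (-i))) (fun x hx => by rw [map_toΓ, hx, map_zero])
      fun x => ⟨toΓ H e ρ _ x, (map_toΓ H e ρ (A.d (-i - 1) (-i)) x).symm⟩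
  have hEmk : ∀ x hx, E (Hgy.mk _ _ x hx) = Hgy.mk _ _ (toΓ H e ρ (A.cx.X (-i)) x)
      ((map_toΓ H e ρ (A.d (-i) (-i + 1)) x).trans (by rw [hx, map_zero])) := fun x hx => rfl
  have hEinj : Function.Injective E := by
    rw [injective_iff_map_eq_zero]
    intro c hc
    obtain ⟨x, hx, rfl⟩ := Hgy.exists_rep c
    rw [hEmk] at hc
    obtain ⟨u, hu⟩ := Hgy.mk_eq_zero.1 hc
    obtain ⟨v, rfl⟩ := (hb _).2 u
    exact Hgy.mk_eq_zero.2 ⟨v, (hb _).1 ((map_toΓ H e ρ (A.d (-i - 1) (-i)) v).symm.trans hu)⟩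
  have hEsurj : Function.Surjective E := fun c => by
    obtain ⟨y, hy, rfl⟩ := Hgy.exists_rep c
    obtain ⟨x, rfl⟩ := (hb _).2 y
    have hx : BTensor.map _ (actO ρ θ) (A.d (-i) (-i + 1)) x = 0 := (hb _).1 (by
      rw [map_zero]
      exact (map_toΓ H e ρ (A.d (-i) (-i + 1)) x).symm.trans hy)
    exact ⟨Hgy.mk _ _ x hx, rfl⟩
  have hact : ∀ g c, E (hyperAct ρ θ H A i g c) = gammaPow L θ g • E c := fun g c => by
    obtain ⟨x, hx, rfl⟩ := Hgy.exists_rep c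
    refine Eq.trans ?_ (Hgy.smul_mk _ _ _).symm
    have hg : BTensor.map _ (actO ρ θ) (A.d (-i) (-i + 1)) (gAct ρ θ H _ g x) = 0 := by
      rw [← gAct_map, hx, map_zero]
    refine Eq.trans (hEmk _ hg) (Hgy.mk_eq_mk.2 ⟨0, ?_⟩)
    exact (map_zero _).trans (sub_eq_zero.2 (toΓ_gAct H e ρ g x)).symm
  exact finrank_fixed_eq E ⟨hEinj, hEsurj⟩ (hyperAct ρ θ H A i) (gammaPow L θ) hact
    (exists_gammaPow_eq θ) ((thetaOf_surjective H e (Multiplicative.ofAdd 1)).imp fun g hg =>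
      gammaPow_of_one hg)

theorem rankG_eq_rankΓ {K : ℕ} {h : Fin K → G} (hH : ∀ k, h k ∈ H.toSubgroup)
    (hh : ∀ x ∈ H.toSubgroup, x ∈ closure (Subgroup.closure (Set.range h) : Set G))
    (A : PerfCx (Iwasawa p G)) : rankG ρ (thetaOf H e) H A = rankΓ ρ (thetaOf H e) A := by
  let f : ℤ → ℤ := fun i => (Int.negOnePow (i + 1) : ℤ) * (invRank (Integers p L) L
    (Hgy (BTensor.map ⊤ (actΓ ρ (thetaOf H e)) (A.d (i - 1) i))
      (BTensor.map ⊤ (actΓ ρ (thetaOf H e)) (A.d i (i + 1)))) : ℤ)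
  refine (finsum_congr fun i => ?_ : _ = ∑ᶠ i, f (Equiv.neg ℤ i)).trans
    (finsum_comp_equiv (Equiv.neg ℤ) (f := f))
  rw [finrank_hyperInv_eq H e ρ hH hh A, Int.negOnePow_add, ← Int.negOnePow_neg,
    ← Int.negOnePow_add]
  rfl

end RankComparison

/-! ### Closed subgroups of compact `p`-adic Lie groups are topologically finitely generated -/

section Generation

open Topology Set

theorem exists_finite_generators {G : Type*} [Group G] [TopologicalSpace G] [IsTopologicalGroup G]
    [CompactSpace G] (p : ℕ) (U : ℕ → Subgroup G) (hU : ∀ j, IsOpen (U j : Set G))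
    (hbasis : ∀ V ∈ 𝓝 (1 : G), ∃ j, ∀ i, j ≤ i → (U i : Set G) ⊆ V) {F : Type*} [Finite F]
    (c : ℕ → G → F)
    (hc : ∀ j, ∀ x ∈ U j, ∀ y ∈ U j, c j x = c j y → x⁻¹ * y ∈ U (j + 1))
    (hpow : ∀ j, ∀ x ∈ U j, x ^ p ∈ U (j + 1) ∧ c (j + 1) (x ^ p) = c j x)
    (H : Subgroup G) (hH : IsClosed (H : Set G)) :
    ∃ (K : ℕ) (h : Fin K → G), (∀ k, h k ∈ H) ∧
      ∀ x ∈ H, x ∈ closure (Subgroup.closure (Set.range h) : Set G) := by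
  classical
  let V : ℕ →o Set F :=
    ⟨fun j => c j '' {x | x ∈ H ∧ x ∈ U j}, monotone_nat_of_le_succ fun j => by
      rintro _ ⟨x, ⟨hx, hxU⟩, rfl⟩
      exact ⟨x ^ p, ⟨H.pow_mem hx p, (hpow j x hxU).1⟩, (hpow j x hxU).2⟩⟩
  obtain ⟨j₀, hj₀⟩ := WellFoundedGT.monotone_chain_condition V
  have hlift : ∀ v : V j₀, ∃ x, (x ∈ H ∧ x ∈ U j₀) ∧ c j₀ x = v := fun v => v.2
  choose l hl hlv using hlift
  obtain ⟨t, htH, ht⟩ := hH.isCompact.elim_nhds_subcover (fun x => {y | x⁻¹ * y ∈ U j₀})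
    fun x _ => ((hU j₀).preimage (continuous_const_mul x⁻¹)).mem_nhds (by
      change x⁻¹ * x ∈ U j₀
      rw [inv_mul_cancel]
      exact (U j₀).one_mem)
  have hfin : (Set.range l ∪ (t : Set G)).Finite := (Set.finite_range l).union t.finite_toSet
  obtain ⟨K, h, hh⟩ : ∃ (K : ℕ) (h : Fin K → G), Set.range h = Set.range l ∪ (t : Set G) := by
    obtain ⟨K, h, -, hh⟩ := hfin.fin_param
    exact ⟨K, h, hh⟩
  have hrange : ∀ x ∈ Set.range l ∪ (t : Set G), x ∈ H := by
    rintro x (⟨v, rfl⟩ | hx)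
    · exact (hl v).1
    · exact htH x hx
  refine ⟨K, h, fun k => hrange _ (hh ▸ Set.mem_range_self k), ?_⟩
  rw [hh]
  let C := Subgroup.closure (Set.range l ∪ (t : Set G))
  have hCH : C ≤ H := (Subgroup.closure_le H).2 hrange
  have hpow' : ∀ v k, l v ^ p ^ k ∈ U (j₀ + k) ∧ c (j₀ + k) (l v ^ p ^ k) = v := fun v k => by
    induction k with
    | zero => simpa using ⟨(hl v).2, hlv v⟩
    | succ k ih =>
      obtain ⟨h1, h2⟩ := hpow _ _ ih.1
      rw [pow_succ, pow_mul]
      exact ⟨h1, h2.trans ih.2⟩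
  have happrox : ∀ k, ∀ x ∈ H, x ∈ U j₀ → ∃ y ∈ C, y⁻¹ * x ∈ U (j₀ + k) := fun k x hxH hxU => by
    induction k with
    | zero => exact ⟨1, C.one_mem, by simpa using hxU⟩
    | succ k ih =>
      obtain ⟨y, hy, hyx⟩ := ih
      have h1 : c (j₀ + k) (y⁻¹ * x) ∈ V (j₀ + k) :=
        ⟨_, ⟨H.mul_mem (H.inv_mem (hCH hy)) hxH, hyx⟩, rfl⟩
      rw [← hj₀ (j₀ + k) (Nat.le_add_right _ _)] at h1
      obtain ⟨h2, h3⟩ := hpow' ⟨_, h1⟩ k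
      refine ⟨y * l ⟨_, h1⟩ ^ p ^ k, C.mul_mem hy (C.pow_mem (Subgroup.subset_closure
        (Or.inl (Set.mem_range_self _))) _), ?_⟩
      rw [mul_inv_rev, mul_assoc]
      exact hc _ _ h2 _ hyx h3
  intro x hx
  obtain ⟨s, hs, hsx⟩ : ∃ s ∈ t, s⁻¹ * x ∈ U j₀ := by
    have := ht hx
    simpa using this
  rw [mem_closure_iff_nhds]
  intro W hW
  have hW' : (fun w => x * w⁻¹) ⁻¹' W ∈ 𝓝 (1 : G) := by
    refine ContinuousAt.preimage_mem_nhds (by fun_prop) ?_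
    simpa using hW
  obtain ⟨j, hj⟩ := hbasis _ hW'
  obtain ⟨y, hy, hyx⟩ := happrox j (s⁻¹ * x) (H.mul_mem (H.inv_mem (htH s hs)) hx) hsx
  refine ⟨s * y, ?_, C.mul_mem (Subgroup.subset_closure (Or.inr hs)) hy⟩
  have := hj (j₀ + j) (Nat.le_add_left _ _) hyx
  have e : x * (y⁻¹ * (s⁻¹ * x))⁻¹ = s * y := by group
  rwa [Set.mem_preimage, e] at this

end Generation

section Chart

open Topology Set
open scoped Manifold ContDiff

variable (p : ℕ) [Fact p.Prime] {E : Type*} [NormedAddCommGroup E] [NormedSpace ℚ_[p] E]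
  [FiniteDimensional ℚ_[p] E] (G : Type*) [Group G] [TopologicalSpace G] [IsTopologicalGroup G]
  [ChartedSpace E G] [LieGroup 𝓘(ℚ_[p], E) ω G]

include E in
theorem exists_mul_estimate {ε : ℝ} (hε : 0 < ε) :
    ∃ (d : ℕ) (S : Set G) (ψ : G → Fin d → ℚ_[p]), IsOpen S ∧ 1 ∈ S ∧ ψ 1 = 0 ∧ ContinuousOn ψ S ∧
      (∀ V ∈ 𝓝 (1 : G), ∃ r > 0, ∀ g ∈ S, ‖ψ g‖ ≤ r → g ∈ V) ∧
      ∃ r > 0, ∀ g ∈ S, ∀ h ∈ S, ‖ψ g‖ ≤ r → ‖ψ h‖ ≤ r →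
        g * h ∈ S ∧ ‖ψ (g * h) - ψ g - ψ h‖ ≤ ε * ‖ψ h‖ := by
  let φ := chartAt E (1 : G)
  let a := φ 1
  have h1S : (1 : G) ∈ φ.source := mem_chart_source E 1
  have haT : a ∈ φ.target := φ.map_source h1S
  have hφ1 : φ.symm a = 1 := φ.left_inv h1S
  let m : E × E → E := fun x => φ (φ.symm x.1 * φ.symm x.2)
  have hm : AnalyticAt ℚ_[p] m (a, a) := by
    have h1 : ContMDiffAt (𝓘(ℚ_[p], E).prod 𝓘(ℚ_[p], E)) 𝓘(ℚ_[p], E) ω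
        (fun x : G × G => x.1 * x.2) (1, 1) := (contMDiff_mul 𝓘(ℚ_[p], E) ω).contMDiffAt
    have h2 := (contMDiffAt_iff.1 h1).2
    have : CompleteSpace E := FiniteDimensional.complete ℚ_[p] E
    simp only [mul_one, mfld_simps] at h2
    rw [Prod.map_id, Set.range_id] at h2
    have h3 : ContDiffAt ℚ_[p] ω m (a, a) := contDiffWithinAt_univ.1 h2
    exact h3.analyticAt
  obtain ⟨D, hD⟩ : ∃ D, HasStrictFDerivAt m D (a, a) := ⟨_, hm.hasStrictFDerivAt⟩
  have hma : ∀ᶠ y in 𝓝 a, m (a, y) = y := by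
    filter_upwards [φ.open_target.mem_nhds haT] with y hy
    change φ (φ.symm a * φ.symm y) = y
    rw [hφ1, one_mul, φ.right_inv hy]
  have hDinr : D.comp (ContinuousLinearMap.inr ℚ_[p] E E) = ContinuousLinearMap.id ℚ_[p] E := by
    have h1 : HasFDerivAt (fun y => m (a, y)) (D.comp (ContinuousLinearMap.inr ℚ_[p] E E)) a :=
      hD.hasFDerivAt.comp a (hasFDerivAt_prodMk_right a a)
    have h2 : HasFDerivAt (fun y => m (a, y)) (ContinuousLinearMap.id ℚ_[p] E) a :=
      (hasFDerivAt_id a).congr_of_eventuallyEq hma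
    exact h1.unique h2
  let d := Module.finrank ℚ_[p] E
  let lam : E ≃L[ℚ_[p]] (Fin d → ℚ_[p]) := ContinuousLinearEquiv.ofFinrankEq (by simp [d])
  let A := ‖(lam : E →L[ℚ_[p]] (Fin d → ℚ_[p]))‖ + 1
  let B := ‖(lam.symm : (Fin d → ℚ_[p]) →L[ℚ_[p]] E)‖ + 1
  have hA : 0 < A := by positivity
  have hB : 0 < B := by positivity
  have hlamA : ∀ v, ‖lam v‖ ≤ A * ‖v‖ := fun v =>
    ((lam : E →L[ℚ_[p]] (Fin d → ℚ_[p])).le_opNorm v).trans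
      (mul_le_mul_of_nonneg_right (le_add_of_nonneg_right zero_le_one) (norm_nonneg v))
  have hlamB : ∀ v, ‖v‖ ≤ B * ‖lam v‖ := fun v => by
    have := ((lam.symm : (Fin d → ℚ_[p]) →L[ℚ_[p]] E).le_opNorm (lam v)).trans
      (mul_le_mul_of_nonneg_right (le_add_of_nonneg_right zero_le_one) (norm_nonneg (lam v)))
    simpa using this
  have hsmall : ∀ δ > 0, ∀ v, ‖lam v‖ ≤ δ / (2 * B) → ‖v‖ < δ := fun δ hδ v hv => by
    refine (hlamB v).trans_lt ((mul_le_mul_of_nonneg_left hv hB.le).trans_lt ?_)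
    rw [show B * (δ / (2 * B)) = δ / 2 by field_simp]
    exact half_lt_self hδ
  have hest : ∀ᶠ z : E × E in 𝓝 (a, a), z.1 ∈ φ.target ∧ z.2 ∈ φ.target ∧
      φ.symm z.1 * φ.symm z.2 ∈ φ.source ∧
      ‖m z - z.1 - (z.2 - a)‖ ≤ ε / (A * B) * ‖z.2 - a‖ := by
    have h1 := hD.isLittleO.bound (show 0 < ε / (A * B) by positivity)
    have h2 : Filter.Tendsto (fun z : E × E => (z, (z.1, a))) (𝓝 (a, a)) (𝓝 ((a, a), (a, a))) := by
      have : Continuous fun z : E × E => (z, (z.1, a)) := by fun_prop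
      exact this.tendsto (a, a)
    have h3 : ∀ᶠ z : E × E in 𝓝 (a, a), z.1 ∈ φ.target :=
      continuous_fst.continuousAt.eventually_mem (φ.open_target.mem_nhds haT)
    have h4 : ∀ᶠ z : E × E in 𝓝 (a, a), z.2 ∈ φ.target :=
      continuous_snd.continuousAt.eventually_mem (φ.open_target.mem_nhds haT)
    have hc : ContinuousAt φ.symm a := φ.continuousAt_symm haT
    have h5 : ∀ᶠ z : E × E in 𝓝 (a, a), φ.symm z.1 * φ.symm z.2 ∈ φ.source := by
      have hc' : ContinuousAt (fun z : E × E => φ.symm z.1 * φ.symm z.2) (a, a) :=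
        (ContinuousAt.comp (f := Prod.fst) hc continuousAt_fst).mul
          (ContinuousAt.comp (f := Prod.snd) hc continuousAt_snd)
      refine hc'.eventually_mem (φ.open_source.mem_nhds ?_)
      rw [hφ1, mul_one]
      exact h1S
    filter_upwards [h2.eventually h1, h3, h4, h5] with z hz hz1 hz2 hz3
    refine ⟨hz1, hz2, hz3, ?_⟩
    have e1 : m (z.1, a) = z.1 := by
      change φ (φ.symm z.1 * φ.symm a) = z.1
      rw [hφ1, mul_one, φ.right_inv hz1]
    have e2 : z - (z.1, a) = ContinuousLinearMap.inr ℚ_[p] E E (z.2 - a) := by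
      ext <;> simp
    have e3 : D (z - (z.1, a)) = z.2 - a := by
      rw [e2, ← ContinuousLinearMap.comp_apply, hDinr, ContinuousLinearMap.id_apply]
    have e4 : ‖z - (z.1, a)‖ = ‖z.2 - a‖ := by
      rw [e2]
      simp [Prod.norm_def]
    simp only [e1, e3, e4] at hz
    exact hz
  obtain ⟨δ, hδ, hball⟩ := Metric.eventually_nhds_iff_ball.1 hest
  refine ⟨d, φ.source, fun g => lam (φ g - a), φ.open_source, h1S, ?_, ?_, fun V hV => ?_,
    δ / (2 * B), by positivity, fun g hg h hh hgr hhr => ?_⟩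
  · change lam (φ 1 - φ 1) = 0
    rw [sub_self, map_zero]
  · exact lam.continuous.comp_continuousOn (φ.continuousOn.sub continuousOn_const)
  · have h1 : φ.symm ⁻¹' V ∈ 𝓝 a := by
      refine (φ.continuousAt_symm haT).preimage_mem_nhds ?_
      rwa [hφ1]
    obtain ⟨r, hr, hrV⟩ := Metric.mem_nhds_iff.1 h1
    refine ⟨r / (2 * B), by positivity, fun g hg hgr => ?_⟩
    have h2 : φ g ∈ Metric.ball a r := by
      rw [mem_ball_iff_norm]
      exact hsmall r hr _ hgr
    have h3 := hrV h2
    rwa [Set.mem_preimage, φ.left_inv hg] at h3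
  · have h1 : (φ g, φ h) ∈ Metric.ball (a, a) δ := by
      rw [mem_ball_iff_norm, Prod.norm_def, max_lt_iff]
      exact ⟨hsmall δ hδ _ hgr, hsmall δ hδ _ hhr⟩
    obtain ⟨-, -, h2, h3⟩ := hball _ h1
    simp only [m, φ.left_inv hg, φ.left_inv hh] at h2 h3
    refine ⟨h2, ?_⟩
    have e : lam (φ (g * h) - a) - lam (φ g - a) - lam (φ h - a) =
        lam (φ (g * h) - φ g - (φ h - a)) := by
      rw [← map_sub, ← map_sub]
      congr 1
      abel
    rw [e]
    refine (hlamA _).trans ((mul_le_mul_of_nonneg_left h3 hA.le).trans ?_)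
    calc A * (ε / (A * B) * ‖φ h - a‖) ≤ A * (ε / (A * B) * (B * ‖lam (φ h - a)‖)) := by
          gcongr
          exact hlamB _
      _ = ε * ‖lam (φ h - a)‖ := by field_simp

/-- The residue class modulo `p` of a `p`-adic integer. -/
def padicResidue (x : ℚ_[p]) : ZMod p :=
  if h : ‖x‖ ≤ 1 then PadicInt.toZMod (⟨x, h⟩ : ℤ_[p]) else 0

variable {p} in
theorem padicResidue_eq_iff {x y : ℚ_[p]} (hx : ‖x‖ ≤ 1) (hy : ‖y‖ ≤ 1) :
    padicResidue p x = padicResidue p y ↔ ‖x - y‖ ≤ (p : ℝ)⁻¹ := by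
  have key : ∀ a b : ℤ_[p], PadicInt.toZMod a = PadicInt.toZMod b ↔
      ‖(a : ℚ_[p]) - b‖ ≤ (p : ℝ)⁻¹ := fun a b => by
    rw [← sub_eq_zero, ← map_sub, ← RingHom.mem_ker, PadicInt.ker_toZMod,
      IsLocalRing.mem_maximalIdeal, PadicInt.mem_nonunits, PadicInt.norm_def, PadicInt.coe_sub]
    have h := Padic.norm_le_pow_iff_norm_lt_pow_add_one ((a : ℚ_[p]) - (b : ℚ_[p])) (-1)
    rw [zpow_neg_one, neg_add_cancel, zpow_zero] at h
    exact h.symm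
  have h1 : padicResidue p x = PadicInt.toZMod (⟨x, hx⟩ : ℤ_[p]) := dif_pos hx
  have h2 : padicResidue p y = PadicInt.toZMod (⟨y, hy⟩ : ℤ_[p]) := dif_pos hy
  rw [h1, h2]
  exact key ⟨x, hx⟩ ⟨y, hy⟩

theorem norm_le_of_le_max {V : Type*} [SeminormedAddCommGroup V] {v : V} {ε s : ℝ} (hε : ε < 1)
    (hs : 0 ≤ s) (h : ‖v‖ ≤ max (ε * ‖v‖) s) : ‖v‖ ≤ s := by
  rcases le_max_iff.1 h with h | h
  · have := norm_nonneg v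
    nlinarith
  · exact h

include p E in
/-- A closed subgroup of a compact `p`-adic Lie group is topologically finitely generated. -/
theorem exists_finite_generators_of_lieGroup [CompactSpace G] (H : Subgroup G)
    (hH : IsClosed (H : Set G)) : ∃ (K : ℕ) (h : Fin K → G), (∀ k, h k ∈ H) ∧
      ∀ x ∈ H, x ∈ closure (Subgroup.closure (Set.range h) : Set G) := by
  have hp1 : (1 : ℝ) < p := by exact_mod_cast (Fact.out : p.Prime).one_lt
  let q : ℝ := (p : ℝ)⁻¹
  have hq0 : 0 < q := inv_pos.2 (zero_lt_one.trans hp1)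
  have hq1 : q < 1 := inv_lt_one_of_one_lt₀ hp1
  have hε1 : q ^ 2 < 1 := pow_lt_one₀ hq0.le hq1 two_ne_zero
  obtain ⟨d, S, ψ, hSo, h1S, hψ1, hψc, hbas, r₀, hr₀, hmul⟩ :=
    exists_mul_estimate p (E := E) G (ε := q ^ 2) (by positivity)
  have hopen : ∀ r, 0 < r → IsOpen {g | g ∈ S ∧ ‖ψ g‖ ≤ r} := fun r hr => by
    have h1 : IsOpen (Metric.closedBall (0 : Fin d → ℚ_[p]) r) :=
      IsUltrametricDist.isOpen_closedBall _ hr.ne'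
    have h2 := hψc.isOpen_inter_preimage hSo h1
    convert h2 using 1
    ext g
    simp
  have hnhds : ∀ r, 0 < r → {g | g ∈ S ∧ ‖ψ g‖ ≤ r} ∈ 𝓝 (1 : G) := fun r hr =>
    (hopen r hr).mem_nhds ⟨h1S, by rw [hψ1, norm_zero]; exact hr.le⟩
  have hW : (fun g : G => g⁻¹) ⁻¹' {g | g ∈ S ∧ ‖ψ g‖ ≤ r₀} ∈ 𝓝 (1 : G) := by
    refine continuous_inv.continuousAt.preimage_mem_nhds ?_
    rw [inv_one]
    exact hnhds r₀ hr₀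
  obtain ⟨r₁, hr₁, hinv⟩ := hbas _ hW
  obtain ⟨j₁, hj₁⟩ := exists_pow_lt_of_lt_one (lt_min hr₀ hr₁) hq1
  have hR : ∀ j, q ^ (j + j₁) ≤ r₀ ∧ q ^ (j + j₁) ≤ r₁ := fun j =>
    le_min_iff.1 ((pow_le_pow_of_le_one hq0.le hq1.le (Nat.le_add_left _ _)).trans hj₁.le)
  have hinv' : ∀ (j : ℕ) (g : G), g ∈ S → ‖ψ g‖ ≤ q ^ (j + j₁) →
      g⁻¹ ∈ S ∧ ‖ψ g⁻¹‖ ≤ q ^ (j + j₁) := fun j g hg hgj => by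
    obtain ⟨h1, h2⟩ : g⁻¹ ∈ S ∧ ‖ψ g⁻¹‖ ≤ r₀ := hinv g hg (hgj.trans (hR j).2)
    refine ⟨h1, ?_⟩
    have h3 := (hmul g hg _ h1 (hgj.trans (hR j).1) h2).2
    rw [mul_inv_cancel, hψ1] at h3
    refine (norm_le_of_le_max hε1 (norm_nonneg (ψ g)) ?_).trans hgj
    have e : ψ g⁻¹ = -((0 : Fin d → ℚ_[p]) - ψ g - ψ g⁻¹) + -ψ g := by abel
    calc ‖ψ g⁻¹‖ = ‖-((0 : Fin d → ℚ_[p]) - ψ g - ψ g⁻¹) + -ψ g‖ := congrArg _ e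
      _ ≤ max ‖-((0 : Fin d → ℚ_[p]) - ψ g - ψ g⁻¹)‖ ‖-ψ g‖ := IsUltrametricDist.norm_add_le_max _ _
      _ ≤ max (q ^ 2 * ‖ψ g⁻¹‖) ‖ψ g‖ := by
        rw [norm_neg, norm_neg]
        exact max_le_max h3 le_rfl
  have hmul' : ∀ (s : ℝ) (g h : G), s ≤ r₀ → g ∈ S → h ∈ S → ‖ψ g‖ ≤ s → ‖ψ h‖ ≤ s →
      g * h ∈ S ∧ ‖ψ (g * h)‖ ≤ s ∧ ‖ψ (g * h) - ψ g - ψ h‖ ≤ q ^ 2 * ‖ψ h‖ :=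
    fun s g h hs hg hh hgs hhs => by
      obtain ⟨h1, h2⟩ := hmul g hg h hh (hgs.trans hs) (hhs.trans hs)
      refine ⟨h1, ?_, h2⟩
      have e : ψ (g * h) = (ψ (g * h) - ψ g - ψ h) + (ψ g + ψ h) := by abel
      rw [e]
      refine (IsUltrametricDist.norm_add_le_max _ _).trans (max_le ?_ ((IsUltrametricDist.norm_add_le_max _ _).trans (max_le hgs hhs)))
      exact h2.trans ((mul_le_of_le_one_left (norm_nonneg _) hε1.le).trans hhs)
  let U : ℕ → Subgroup G := fun j =>
    { carrier := {g | g ∈ S ∧ ‖ψ g‖ ≤ q ^ (j + j₁)}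
      one_mem' := ⟨h1S, by rw [hψ1, norm_zero]; positivity⟩
      mul_mem' := fun {g h} hg hh =>
        ⟨(hmul' _ g h (hR j).1 hg.1 hh.1 hg.2 hh.2).1, (hmul' _ g h (hR j).1 hg.1 hh.1 hg.2 hh.2).2.1⟩
      inv_mem' := fun {g} hg => hinv' j g hg.1 hg.2 }
  have hp0 : (p : ℚ_[p]) ≠ 0 := Nat.cast_ne_zero.2 (Fact.out : p.Prime).ne_zero
  have hnorm : ∀ (x : ℚ_[p]) (k : ℕ), ‖x / (p : ℚ_[p]) ^ k‖ = ‖x‖ / q ^ k := fun x k => by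
    rw [norm_div, norm_pow, Padic.norm_p]
  have hle1 : ∀ (j : ℕ) (g : G), g ∈ U j → ∀ i, ‖ψ g i / (p : ℚ_[p]) ^ (j + j₁)‖ ≤ 1 :=
    fun j g hg i => by
      rw [hnorm, div_le_one (by positivity)]
      exact (norm_le_pi_norm _ i).trans hg.2
  refine exists_finite_generators p U (fun j => hopen _ (by positivity)) (fun V hV => ?_)
    (F := Fin d → ZMod p) (fun j g i => padicResidue p (ψ g i / (p : ℚ_[p]) ^ (j + j₁))) ?_ ?_ H hH
  · obtain ⟨r, hr, hrV⟩ := hbas V hV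
    obtain ⟨j, hj⟩ := exists_pow_lt_of_lt_one hr hq1
    exact ⟨j, fun i hi g hg => hrV g hg.1 (hg.2.trans
      ((pow_le_pow_of_le_one hq0.le hq1.le (hi.trans (Nat.le_add_right _ _))).trans hj.le))⟩
  · intro j x hx y hy hxy
    have hw : x⁻¹ * y ∈ U j := (U j).mul_mem ((U j).inv_mem hx) hy
    refine ⟨hw.1, ?_⟩
    have h1 : ‖ψ y - ψ x‖ ≤ q ^ (j + 1 + j₁) := by
      refine (pi_norm_le_iff_of_nonneg (by positivity)).2 fun i => ?_
      have h2 := (padicResidue_eq_iff (hle1 j y hy i) (hle1 j x hx i)).1 (congrFun hxy i).symm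
      rw [← sub_div, hnorm, div_le_iff₀ (by positivity)] at h2
      refine h2.trans (le_of_eq ?_)
      change q * q ^ (j + j₁) = _
      ring
    have h3 := (hmul' _ x (x⁻¹ * y) (hR j).1 hx.1 hw.1 hx.2 hw.2).2.2
    rw [mul_inv_cancel_left] at h3
    refine norm_le_of_le_max hε1 (by positivity) ?_ (v := ψ (x⁻¹ * y))
    have e : ψ (x⁻¹ * y) = -(ψ y - ψ x - ψ (x⁻¹ * y)) + (ψ y - ψ x) := by abel
    calc ‖ψ (x⁻¹ * y)‖ = ‖-(ψ y - ψ x - ψ (x⁻¹ * y)) + (ψ y - ψ x)‖ := congrArg _ e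
      _ ≤ max ‖-(ψ y - ψ x - ψ (x⁻¹ * y))‖ ‖ψ y - ψ x‖ := IsUltrametricDist.norm_add_le_max _ _
      _ ≤ max (q ^ 2 * ‖ψ (x⁻¹ * y)‖) (q ^ (j + 1 + j₁)) := by
        rw [norm_neg]
        exact max_le_max h3 h1
  · intro j x hx
    have hk : ∀ k : ℕ, ‖ψ (x ^ k) - (k : ℚ_[p]) • ψ x‖ ≤ q ^ 2 * ‖ψ x‖ := fun k => by
      induction k with
      | zero =>
        rw [pow_zero, hψ1, Nat.cast_zero, zero_smul, sub_zero, norm_zero]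
        positivity
      | succ k ih =>
        have hxk : x ^ k ∈ U j := (U j).pow_mem hx k
        have h1 := (hmul' _ (x ^ k) x (hR j).1 hxk.1 hx.1 hxk.2 hx.2).2.2
        have e : ψ (x ^ (k + 1)) - ((k + 1 : ℕ) : ℚ_[p]) • ψ x =
            (ψ (x ^ k * x) - ψ (x ^ k) - ψ x) + (ψ (x ^ k) - (k : ℚ_[p]) • ψ x) := by
          rw [pow_succ, Nat.cast_succ, add_smul, one_smul]
          abel
        rw [e]
        exact (IsUltrametricDist.norm_add_le_max _ _).trans (max_le h1 ih)
    have hxp : x ^ p ∈ U j := (U j).pow_mem hx p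
    have h2 : ‖ψ (x ^ p) - (p : ℚ_[p]) • ψ x‖ ≤ q ^ 2 * q ^ (j + j₁) :=
      (hk p).trans (mul_le_mul_of_nonneg_left hx.2 (by positivity))
    have hxp' : x ^ p ∈ U (j + 1) := by
      refine ⟨hxp.1, ?_⟩
      have e : ψ (x ^ p) = (ψ (x ^ p) - (p : ℚ_[p]) • ψ x) + (p : ℚ_[p]) • ψ x := by abel
      rw [e]
      refine (IsUltrametricDist.norm_add_le_max _ _).trans (max_le (h2.trans ?_) ?_)
      · rw [← pow_add]
        exact pow_le_pow_of_le_one hq0.le hq1.le (by omega)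
      · rw [norm_smul, Padic.norm_p]
        refine (mul_le_mul_of_nonneg_left hx.2 hq0.le).trans (le_of_eq ?_)
        ring
    refine ⟨hxp', funext fun i => ?_⟩
    rw [padicResidue_eq_iff (hle1 _ _ hxp' i) (hle1 _ _ hx i)]
    have e : ψ (x ^ p) i / (p : ℚ_[p]) ^ (j + 1 + j₁) - ψ x i / (p : ℚ_[p]) ^ (j + j₁) =
        (ψ (x ^ p) - (p : ℚ_[p]) • ψ x) i / (p : ℚ_[p]) ^ (j + 1 + j₁) := by
      rw [Pi.sub_apply, Pi.smul_apply, smul_eq_mul, sub_div]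
      congr 1
      rw [show j + 1 + j₁ = (j + j₁) + 1 by ring, pow_succ']
      field_simp
    rw [e, hnorm, div_le_iff₀ (by positivity)]
    refine (norm_le_pi_norm _ i).trans (h2.trans (le_of_eq ?_))
    change q ^ 2 * q ^ (j + j₁) = q * q ^ (j + 1 + j₁)
    ring

end Chart

/-! ### Leading coefficients -/

section LeadingCoefficient

variable (L : Type v) [Field L]

/-- The leading coefficient of a Laurent series, as a homomorphism. -/
def leadingCoeffHom : LaurentSeries L →* L where
  toFun := HahnSeries.leadingCoeff
  map_one' := HahnSeries.leadingCoeff_one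
  map_mul' := fun x y => HahnSeries.leadingCoeff_mul x y

variable {L}

theorem neg_one_zpow_sub (a b : ℕ) : (-1 : L) ^ ((a : ℤ) - b) = (-1) ^ (a + b) := by
  rw [zpow_sub₀ (by simp), zpow_natCast, zpow_natCast, pow_add, div_eq_mul_inv, ← inv_pow, inv_neg,
    inv_one]

end LeadingCoefficient

end LeadingTerm

end

open LeadingTerm
open scoped Manifold ContDiff

theorem mainTheorem7 (p : ℕ) [Fact p.Prime]
    {E : Type*} [NormedAddCommGroup E] [NormedSpace ℚ_[p] E] [FiniteDimensional ℚ_[p] E]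
    {G : Type*} [Group G] [TopologicalSpace G] [IsTopologicalGroup G] [CompactSpace G] [T2Space G]
    [ChartedSpace E G] [LieGroup 𝓘(ℚ_[p], E) ω G]
    (H : ClosedSubgroup G) [H.toSubgroup.Normal]
    (e : (G ⧸ H.toSubgroup) ≃ₜ* Multiplicative ℤ_[p])
    {L : Type*} [Field L] [Algebra ℚ_[p] L] [FiniteDimensional ℚ_[p] L]
    [Algebra ℤ_[p] L] [IsScalarTower ℤ_[p] ℚ_[p] L]
    {n : ℕ} (ρ : G →ₜ* GL (Fin n) (Integers p L))
    (A : PerfCx (Iwasawa p G)) (hS : SigmaLoc (oreSetStar p H) A)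
    (hss : SemisimpleAt ρ (thetaOf H e) A) :
    rankG ρ (thetaOf H e) H A = rankΓ ρ (thetaOf H e) A ∧
    ∃ ρS : Loc (Iwasawa p G) (oreSetStar p H) →+* Matrix (Fin n) (Fin n) (QGamma p L),
      (∀ x, ρS (toLoc (oreSetStar p H) x) =
        (algebraMap (PowerSeries (Integers p L)) (QGamma p L)).mapMatrix
          (repΓ ρ (thetaOf H e) x)) ∧
      ∃ ch : K1Loc (SigmaGen A) →* K1 (Loc (Iwasawa p G) (oreSetStar p H)),
        (∀ C hC a, IsCharElement (oreSetStar p H) C a (ch (K1Loc.mk C hC a))) ∧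
        ∃ lt : K1Loc (SigmaGen A) →* Lˣ,
          (∀ C hC a, IsLeadingTerm ρ (thetaOf H e) H C a (lt (K1Loc.mk C hC a) : L)) ∧
          (∀ a : A.Triv,
            (toLaurent p L (rhoStar ρS (ch (K1Loc.mk A SigmaGen.base a)))).order =
              rankΓ ρ (thetaOf H e) A) ∧
          ∀ x, (lt x : L) = (toLaurent p L (rhoStar ρS (ch x))).leadingCoeff := by
  obtain ⟨K, h, hH, hh⟩ := exists_finite_generators_of_lieGroup p (E := E) G H.toSubgroup H.isClosed'
  have hrank : ∀ C, rankG ρ (thetaOf H e) H C = rankΓ ρ (thetaOf H e) C :=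
    rankG_eq_rankΓ H e ρ hH hh
  have hnull : ∀ C, SigmaGen A C → rankΓ ρ (thetaOf H e) C =
      (bockRankEv ρ (thetaOf H e) C : ℤ) - bockRankOd ρ (thetaOf H e) C := fun C hC =>
    rankΓ_eq ρ (thetaOf H e) ((hss.nullHtpy ρ (thetaOf H e)).of_sigmaGen (fun b => mul_comm _ _) hC)
  obtain ⟨ρS, hρS⟩ := exists_rhoS H e ρ
  obtain ⟨ch, hch⟩ := exists_charHom (oreSetStar p H) A hS
  refine ⟨hrank A, ρS, hρS, ch, hch, (Units.map (leadingCoeffHom L)).comp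
    ((Units.map (toLaurent p L).toMonoidHom).comp ((rhoStar ρS).comp ch)), fun C hC a => ?_, fun a => ?_,
    fun x => rfl⟩
  · obtain ⟨s⟩ := hss.exists_contraction ρ (thetaOf H e) hC
    obtain ⟨sK, hF⟩ := exists_contraction_laurent ρ (thetaOf H e) ρS hρS a (hch C hC a)
    obtain ⟨-, jEv, jOd, h1, h2, t, ht⟩ := exists_leadingTerm ρ (thetaOf H e) s a sK _ hF
    refine ⟨jEv, jOd, h1, h2, s, t, ?_⟩
    rw [hrank, hnull C hC, neg_one_zpow_sub]
    exact ht
  · obtain ⟨s⟩ := hss.exists_contraction ρ (thetaOf H e) SigmaGen.base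
    obtain ⟨sK, hF⟩ := exists_contraction_laurent ρ (thetaOf H e) ρS hρS a (hch A SigmaGen.base a)
    rw [hnull A SigmaGen.base]
    exact (exists_leadingTerm ρ (thetaOf H e) s a sK _ hF).1
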